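/- **Setting.** Let $d,H\ge 1$ be integers and $\varepsilon,\delta\in(0,1)$. Consider an episodic MDP with state space $\mathcal X$, action space $\mathcal A$ (measurable spaces of arbitrary size), layers $h=1,\dots,H$, random initial state $x_1$ with a fixed law, deterministic transitions $x_{h+1}=f_h(x_h,a_h)$ and random rewards $r_h\in[0,1]$ whose law depends only on $(h,x_h,a_h)$; all data are measurable. $\Pi$ is the set of deterministic (possibly nonstationary) policies, $V_1^\pi(x)=\mathbb E^\pi[\sum_{h=1}^H r_h\mid x_1=x]$ and $V_1^\star(x)=\sup_{\pi\in\Pi}V_1^\pi(x)$. Let $\phi_h:\mathcal X\times\mathcal A\to\mathbb R^d$ be known features. Assume: * *(bounded features)* $\|\phi_h(x,a)\|\le 1$ for all $h,x,a$; * *(linear rewards)* for each $h$ there is $w_h^\star\in\mathbb R^d$ with $\|w_h^\star\|\le\sqrt d$ and $\mathbb E[r_h\mid x_h=x,a_h=a]=\phi_h(x,a)^\top w^\star_h$ for all $x,a$; * *(linear Bellman completeness)* with $\mathcal B_h=\{\theta\in\mathbb R^d:|\phi_h(x,a)^\top\theta|\le1\ \forall x,a\}$, for each $h<H$ there is $\mathcal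 T_h:\mathcal B_{h+1}\to\mathcal B_h$ with $\phi_h(x,a)^\top\mathcal T_h\theta=\max_{a'}\phi_{h+1}(f_h(x,a),a')^\top\theta$ for all $x,a$ and $\theta\in\mathcal B_{h+1}$; * *(argmax oracle)* for given $h,x,\theta$ an oracle returns a maximizer over $a\in\mathcal A$ of $\phi_h(x,a)^\top\theta$, by a fixed measurable tie-breaking rule. In particular these maxima are attained. The learner interacts with the MDP only by playing episodes with policies $x\mapsto\arg\max_a\phi_h(x,a)^\top\theta_h$ (stored through $\theta_{1:H}$) and observing them, evaluating features, and calling the argmax oracle. Every sample below is a fresh independent episode. **Subroutines.** *$\mathrm{FQI}(h,w_{1:h},\Psi_{1:h-1},n)$.* Put $\hat\theta_h=w_h$. For $\ell=h-1,\dots,1$: for every $\pi\in\Psi_\ell$ play $n$ episodes; from each, record $\phi=\phi_\ell(x_\ell,a_\ell)$ and the target $y=\phi_\ell(x_\ell,a_\ell)^\top w_\ell+\max_a\phi_{\ell+1}(x_{\ell+1},a)^\top\hat\theta_{\ell+1}$; set $\hat\theta_\ell=(\sum\phi\phi^\top)^\dagger\sum\phi\,y$. Return the greedy policy with parameters $\hat\theta_{1:h}$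 (and $0$ after layer $h$). Write $\mathrm{FQI}_h(\theta)$ for the call with $w_h=\theta$, $w_\ell=0$ for $\ell<h$, and $n=n_{\rm fqi}$. *$\mathrm{SubspaceCover}(h,\Psi_{1:h-1})$.* Start with $\mathcal S=\{0\}$, $\Psi=\emptyset$. Repeat for at most $d+1$ rounds: if $\mathcal S=\mathbb R^d$, return $(\mathcal S,\Psi)$; otherwise take an orthonormal basis of $\mathcal S^\perp$ (by Gram–Schmidt) and go through its elements $\theta$ in order. Compute $\pi^-=\mathrm{FQI}_h(-\theta)$ and $\pi^+=\mathrm{FQI}_h(\theta)$, play $n_{\rm test}$ episodes with each, and let $n^\mp$ be the number of those with $\phi_h(x_h,a_h)\notin\mathcal S$. Let $\pi=\pi^+$ if $n^+\ge n^-$ and $\pi=\pi^-$ otherwise. If $\max(n^+,n^-)>n_{\rm test}\,\varepsilon/(4Hd)$, then add $\pi$ to $\Psi$, add to $\mathcal S$ the direction $v$ found below, and begin the next round; if this happens for no $\theta$, return $(\mathcal S,\Psi)$. To find $v$, let $Q$ be the law of the first nonzero value among $n_{\rm reject}$ independent copies of $\mathrm{proj}_{\mathcal S^\perp}\phi_h(x_h,a_h)$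 under $\pi$ (and $0$ if there is none). Draw $n_{\rm samp}$ candidates from $Q$; for each of them count in how many of $m_{\rm boost}$ independent trials it lies in the span of $n_{\rm samp}$ fresh draws from $Q$; $v$ is a candidate with the highest count. *$\mathrm{Spanner}(h,\Psi_{1:h-1})$.* Let $\mathrm{LinOpt}(\theta)=\mathrm{FQI}_h(\theta)$ and let $\mathrm{Vec}(\pi)$ be the average of $\phi_h(x_h,a_h)$ over $n_{\rm vec}$ episodes of $\pi$. Let $W=(w_1,\dots,w_d)$ be the identity matrix. For column $i$ let $\theta_i=(\det(e_j,W_{-i}))_{j}$, where $\det(w,W_{-i})$ is the determinant of $W$ with column $i$ replaced by $w$; let $z_i^\pm=\mathrm{LinOpt}(\pm\theta_i/\|\theta_i\|)$ and $w_i^\pm=\mathrm{Vec}(z_i^\pm)$. First loop: for $i=1,\dots,d$ replace $(w_i,\pi_i)$ by $(w_i^++\varepsilon_{\rm rob}\theta_i/\|\theta_i\|,z_i^+)$ if $\theta_i^\top w_i^+\ge-\theta_i^\top w_i^-$ and by $(w_i^--\varepsilon_{\rm rob}\theta_i/\|\theta_i\|,z_i^-)$ otherwise. Second loop: in each pass go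 through $i=1,\dots,d$; at the first $i$ for which $\theta_i^\top w_i^++\varepsilon_{\rm rob}\|\theta_i\|\ge2|\det(w_i,W_{-i})|$, or else $-\theta_i^\top w_i^-+\varepsilon_{\rm rob}\|\theta_i\|\ge2|\det(w_i,W_{-i})|$, make the corresponding one of the above two replacements and start a new pass. When a pass makes no replacement, return $\{\pi_1,\dots,\pi_d\}$. If this has not happened within $N_{\rm iter}$ passes, the whole procedure stops and has failed. *$\mathrm{ComputeSpanner}(\varepsilon,\delta)$.* For $h=1,\dots,H$ compute $(\mathcal S_h,\Psi_h)=\mathrm{SubspaceCover}(h,\Psi_{1:h-1})$ and $\Gamma_h=\mathrm{Spanner}(h,\Psi_{1:h-1})$, with the parameters, for a constant $c_1$, $$\varepsilon_{\rm rob}=4\varepsilon,\quad N_{\rm iter}=d+\Big\lceil\tfrac d2\log_2\tfrac{100d}{\varepsilon_{\rm rob}^2}\Big\rceil,\quad \delta'=\frac{\delta}{8Hd^2N_{\rm iter}},\quad n_{\rm vec}=\Big\lceil\frac{c_1H^4d^2}{\varepsilon^{2}}\log\tfrac1{\delta'}\Big\rceil,$$ $$n_{\rm test}=\Big\lceil\frac{128H^2d^2\log(4/\delta')}{\varepsilon^2}\Big\rceil,\quad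 n_{\rm samp}=\lceil512d^2\log(256d/\delta')\rceil,\quad m_{\rm boost}=\lceil2048d^2\log(4/\delta')\rceil,$$ $$n_{\rm reject}=\Big\lceil\frac{8Hd\log((n_{\rm samp}+n_{\rm samp}^2m_{\rm boost})/\delta')}{\varepsilon}\Big\rceil,\quad n_{\rm span}=\Big\lceil\frac{16Hd\sqrt{\log(4d)\,n_{\rm samp}}+32Hd\log(4d)+8Hd\,n_{\rm samp}}{\varepsilon}\Big\rceil,$$ $$n_{\rm cover}=n_{\rm fqi}=\lceil\log_2(H^2d/\delta')\rceil\,n_{\rm span}.$$ *$\mathrm{PolicyOpt}(\Psi_{1:H},\Gamma_{1:H},n,\lambda)$.* For every layer $\ell$ play $n$ episodes with each policy of $\Gamma_\ell$ and set $\hat w_\ell=(\lambda I+\sum\phi\phi^\top)^{-1}\sum\phi\,r$, summing over the observed pairs $\phi=\phi_\ell(x_\ell,a_\ell)$, $r=r_\ell$. Return $\mathrm{FQI}(H,\hat w_{1:H},\Psi_{1:H-1},n)$. **Theorem.** Let $L=\max\{1,\log(dH/(\delta\varepsilon))\}$ and $\varepsilon'=\varepsilon/(c_0d^2H^2L)$.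 Run $\mathrm{ComputeSpanner}(\varepsilon',\delta/4)$, then $\mathrm{PolicyOpt}(\Psi_{1:H},\Gamma_{1:H},n,1)$ with $n=\max\{n_{\rm cover},\lceil c_2d^4H^2L^2/\varepsilon^2\rceil\}$, where $n_{\rm cover}$ is the one of the call $\mathrm{ComputeSpanner}(\varepsilon',\delta/4)$. There is a universal constant $C>0$ such that for all $c_0,c_1,c_2\ge C$ there is a number $K$, depending only on $c_0,c_1,c_2$, such that in every setting as above: 1. With probability at least $1-\delta$ the procedure does not fail and its output policy $\hat\pi$ satisfies $$\mathbb E\big[V_1^\star(x_1)-V_1^{\hat\pi}(x_1)\big]\le\varepsilon ,$$ where the expectation is over a fresh initial state $x_1$. 2. In every run, the number of episodes, the number of calls to the argmax oracle (those made while playing greedy policies included) and the number of all other steps have sum at most $K\big(dH\,\varepsilon^{-1}(1+\log(1/\delta))\big)^K$. Here steps are environment steps, feature evaluations ($d$ steps each) and exact real arithmetic ($O(d^3)$ for an inverse, pseudo-inverse or determinant of a $d\times d$ matrix). The argmax oracle is the only access to the action set, and the bound does not depend on $|\mathcal A|$. -/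

import Mathlib

open MeasureTheory

universe u v w

noncomputable section

namespace LBC

/-! ## The environment -/

/-- Euclidean space `ℝᵈ`. -/
abbrev Vec (d : ℕ) := EuclideanSpace ℝ (Fin d)

/-- A (possibly nonstationary) deterministic policy; layers are numbered from `0`. -/
abbrev Policy (X : Type u) (A : Type v) := ℕ → X → A

/-- A Markov decision process with deterministic transitions, random initial state and random
rewards. At layer `h` the action `a` leads from `x` to the single state `next h x a`, and the random
reward of layer `h` is `reward h x a ξ` with a fresh noise variable `ξ ∼ noise`. Since the noise
space is arbitrary, every measurable family of reward laws on `[0,1]` arises in this way (take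
uniform noise on `[0,1]` and the quantile functions). -/
structure MDP (X : Type u) (A : Type v) (Ξ : Type w) [MeasurableSpace X] [MeasurableSpace Ξ] where
  /-- law of the initial state -/
  start : Measure X
  /-- transition map of layer `h` -/
  next : ℕ → X → A → X
  /-- law of the reward noise -/
  noise : Measure Ξ
  /-- random reward of layer `h` -/
  reward : ℕ → X → A → Ξ → ℝ
  start_prob : IsProbabilityMeasure start
  noise_prob : IsProbabilityMeasure noise

attribute [instance] MDP.start_prob MDP.noise_prob

section Environment

variable {X : Type u} {A : Type v} {Ξ : Type w} [MeasurableSpace X] [MeasurableSpace Ξ]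

/-- The state of layer `h` reached from the initial state `x` under the policy `π`. -/
def MDP.state (M : MDP X A Ξ) (π : Policy X A) (x : X) : ℕ → X
  | 0 => x
  | h + 1 => M.next h (M.state π x h) (π h (M.state π x h))

/-- `E[r_h | x_h = x, a_h = a]`. -/
def MDP.meanReward (M : MDP X A Ξ) (h : ℕ) (x : X) (a : A) : ℝ :=
  ∫ ξ, M.reward h x a ξ ∂M.noise

/-- `V₁^π(x)`: the expected sum of the rewards of the `H` layers `0, …, H-1` from the initial
state `x` under `π` (the trajectory of states and actions is determined by `x` and `π`). -/
def MDP.value (M : MDP X A Ξ) (H : ℕ) (π : Policy X A) (x : X) : ℝ :=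
  ∑ h ∈ Finset.range H, M.meanReward h (M.state π x h) (π h (M.state π x h))

/-- `V₁^⋆(x)`: the supremum of `V₁^π(x)` over all deterministic policies `π`. -/
def MDP.optValue (M : MDP X A Ξ) (H : ℕ) (x : X) : ℝ :=
  ⨆ π : Policy X A, M.value H π x

/-- The set of `θ ∈ ℝᵈ` with `|⟨φ_h(x,a), θ⟩| ≤ 1` for all `(x,a)`. -/
def bellmanBall {d : ℕ} (φ : ℕ → X → A → Vec d) (h : ℕ) : Set (Vec d) :=
  {θ | ∀ x a, |inner ℝ (φ h x a) θ| ≤ 1}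

/-- Linear Bellman completeness with respect to `φ`: for every layer `h` that is followed by a
further layer, there is a map `T` from the ball of layer `h+1` to the ball of layer `h` with
`⟨φ_h(x,a), Tθ⟩ = max_{a'} ⟨φ_{h+1}(x',a'), θ⟩`, where `x'` is the successor of `(x,a)`.
(The last layer is followed by the zero feature, for which the condition holds with `T = 0`.) -/
def MDP.LinearBellmanComplete (M : MDP X A Ξ) {d : ℕ} (φ : ℕ → X → A → Vec d) (H : ℕ) : Prop :=
  ∀ h, h + 1 < H → ∃ T : Vec d → Vec d, ∀ θ ∈ bellmanBall φ (h + 1),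
    T θ ∈ bellmanBall φ h ∧
      ∀ x a, inner ℝ (φ h x a) (T θ) = ⨆ a' : A, inner ℝ (φ (h + 1) (M.next h x a) a') θ

/-- Measurability of the data of the MDP, of the features and of the argmax rule. -/
structure MDP.IsMeasurable [MeasurableSpace A] (M : MDP X A Ξ) {d : ℕ} (φ : ℕ → X → A → Vec d)
    (amax : ℕ → X → Vec d → A) (H : ℕ) : Prop where
  next : ∀ h < H, Measurable fun p : X × A => M.next h p.1 p.2
  reward : ∀ h < H, Measurable fun p : (X × A) × Ξ => M.reward h p.1.1 p.1.2 p.2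
  feature : ∀ h < H, Measurable fun p : X × A => φ h p.1 p.2
  argmax : ∀ h < H, Measurable fun p : X × Vec d => amax h p.1 p.2

/-- `amax h x θ` is a maximizer of `a ↦ ⟨φ_h(x,a), θ⟩` (a fixed tie-breaking rule). -/
def IsArgmaxOracle {d : ℕ} (φ : ℕ → X → A → Vec d) (amax : ℕ → X → Vec d → A) (H : ℕ) : Prop :=
  ∀ h < H, ∀ x θ a, (inner ℝ (φ h x a) θ : ℝ) ≤ inner ℝ (φ h x (amax h x θ)) θ

/-- Mean rewards are linear in the features, with parameters of norm at most `√d`. -/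
def MDP.LinearReward (M : MDP X A Ξ) {d : ℕ} (φ : ℕ → X → A → Vec d) (H : ℕ) : Prop :=
  ∀ h < H, ∃ ws : Vec d, ‖ws‖ ≤ √d ∧ ∀ x a, M.meanReward h x a = inner ℝ ws (φ h x a)

/-- The randomness of one episode: initial state and reward noise of every layer. -/
abbrev Episode (X : Type u) (Ξ : Type w) := X × (ℕ → Ξ)

/-- Law of one episode: the initial state and the noise variables are independent. -/
def MDP.episodeLaw (M : MDP X A Ξ) : Measure (Episode X Ξ) :=
  M.start.prod (Measure.infinitePi fun _ : ℕ => M.noise)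

instance (M : MDP X A Ξ) : IsProbabilityMeasure M.episodeLaw := by
  unfold MDP.episodeLaw; infer_instance

/-- Law of the randomness of an unlimited sequence of independent episodes. -/
def MDP.law (M : MDP X A Ξ) : Measure (ℕ → Episode X Ξ) :=
  Measure.infinitePi fun _ : ℕ => M.episodeLaw

end Environment

/-! ## Learning programs and their cost -/

/-- The parameters `θ_h` of a policy `x ↦ argmax_a ⟨φ_h(x,a), θ_h⟩`. This is how programs store
policies. -/
abbrev Param (d : ℕ) := ℕ → Vec d

/-- The greedy policy with parameters `θ`. -/
def greedy {X : Type u} {A : Type v} {d : ℕ} (amax : ℕ → X → Vec d → A) (θ : Param d) :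
    Policy X A := fun h x => amax h x (θ h)

/-- Interactive programs. A program has no access to the MDP except through the commands
* `episode θ h k`: play a new episode up to layer `h` with the greedy policy with parameters `θ`,
  and observe `x_h, a_h, r_h, x_{h+1}`;
* `feature h x a k`: evaluate `φ_h(x,a)`;
* `argmax h x θ k`: call the action oracle for `argmax_a ⟨φ_h(x,a), θ⟩`;
* `tick c k`: spend `c` steps on exact real arithmetic. -/
inductive Prog (X : Type u) (A : Type v) (d : ℕ) (α : Type) : Type (max u v)
  | done (a : α) : Prog X A d α
  | episode (θ : Param d) (h : ℕ) (k : X → A → ℝ → X → Prog X A d α) : Prog X A d α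
  | feature (h : ℕ) (x : X) (a : A) (k : Vec d → Prog X A d α) : Prog X A d α
  | argmax (h : ℕ) (x : X) (θ : Vec d) (k : A → Prog X A d α) : Prog X A d α
  | tick (c : ℕ) (k : Prog X A d α) : Prog X A d α

/-- Cost of a run: number of episodes, number of calls to the argmax oracle (those made while
playing greedy policies included), and number of all further steps (environment steps, feature
evaluations at `d` steps each, arithmetic). -/
@[ext]
structure Cost where
  episodes : ℕ
  oracleCalls : ℕ
  steps : ℕ

/-- Componentwise sum of costs. -/
def Cost.plus (c c' : Cost) : Cost :=
  ⟨c.episodes + c'.episodes, c.oracleCalls + c'.oracleCalls, c.steps + c'.steps⟩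

/-- Sequential composition. -/
def Prog.bind {X : Type u} {A : Type v} {d : ℕ} {α β : Type} :
    Prog X A d α → (α → Prog X A d β) → Prog X A d β
  | .done a, f => f a
  | .episode θ h k, f => .episode θ h fun x a r x' => (k x a r x').bind f
  | .feature h x a k, f => .feature h x a fun y => (k y).bind f
  | .argmax h x θ k, f => .argmax h x θ fun a => (k a).bind f
  | .tick c k, f => .tick c (k.bind f)

instance {X : Type u} {A : Type v} {d : ℕ} : Monad (Prog X A d) where
  pure := .done
  bind := Prog.bind

/-- Run a program in an environment; `ω k` is the randomness of the `k`-th episode not yet used.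
Returns the output and the cost. -/
def Prog.run {X : Type u} {A : Type v} {Ξ : Type w} [MeasurableSpace X] [MeasurableSpace Ξ] {d : ℕ}
    {α : Type} (M : MDP X A Ξ) (φ : ℕ → X → A → Vec d) (amax : ℕ → X → Vec d → A) :
    Prog X A d α → (ℕ → Episode X Ξ) → α × Cost
  | .done a, _ => (a, ⟨0, 0, 0⟩)
  | .episode θ h k, ω =>
      let x := M.state (greedy amax θ) (ω 0).1 h
      let a := greedy amax θ h x
      let res := (k x a (M.reward h x a ((ω 0).2 h)) (M.next h x a)).run M φ amax
        fun n => ω (n + 1)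
      (res.1, Cost.plus ⟨1, h + 1, h + 1⟩ res.2)
  | .feature h x a k, ω =>
      let res := (k (φ h x a)).run M φ amax ω
      (res.1, Cost.plus ⟨0, 0, d⟩ res.2)
  | .argmax h x θ k, ω =>
      let res := (k (amax h x θ)).run M φ amax ω
      (res.1, Cost.plus ⟨0, 1, 0⟩ res.2)
  | .tick c k, ω =>
      let res := k.run M φ amax ω
      (res.1, Cost.plus ⟨0, 0, c⟩ res.2)

section Programs

variable {X : Type u} {A : Type v} {d : ℕ}

/-- Return `a`, a quantity that takes `c` arithmetic steps. -/
def compute {α : Type} (c : ℕ) (a : α) : Prog X A d α := .tick c (.done a)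

/-- Run `p` independently `n` times and collect the outputs. -/
def repeatProg {α : Type} (p : Prog X A d α) : ℕ → Prog X A d (List α)
  | 0 => pure []
  | n + 1 => do
      let a ← p
      let l ← repeatProg p n
      pure (a :: l)

/-- Run `f b` for all `b` in a list, in this order, and collect the outputs. -/
def forProg {α β : Type} (f : β → Prog X A d α) : List β → Prog X A d (List α)
  | [] => pure []
  | b :: l => do
      let a ← f b
      let l' ← forProg f l
      pure (a :: l')

/-- Sample `φ_h(x_h, a_h)` under a policy. -/
def drawFeature (π : Param d) (h : ℕ) : Prog X A d (Vec d) :=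
  .episode π h fun x a _ _ => .feature h x a .done

/-- Sample `(φ_h(x_h, a_h), r_h)` under a policy. -/
def drawReward (π : Param d) (h : ℕ) : Prog X A d (Vec d × ℝ) :=
  .episode π h fun x a r _ => .feature h x a fun y => .done (y, r)

/-- Sample `φ_h(x_h, a_h)` and `⟨φ_h(x_h, a_h), w⟩ + max_a ⟨φ_{h+1}(x_{h+1}, a), θ⟩`. -/
def drawTarget (π : Param d) (h : ℕ) (w θ : Vec d) : Prog X A d (Vec d × ℝ) :=
  .episode π h fun x a _ x' => .feature h x a fun y =>
    .argmax (h + 1) x' θ fun a' => .feature (h + 1) x' a' fun y' =>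
      compute (4 * d) (y, inner ℝ y w + inner ℝ y' θ)

/-! ### Linear algebra

Arithmetic is exact, one step per operation up to an absolute constant factor. Determinant, inverse
and pseudo-inverse of a `d × d` matrix are charged `d ^ 3` steps (Gaussian elimination). -/

/-- `∑ y yᵀ` over a data set of pairs `(y, t)`. -/
def gram (D : List (Vec d × ℝ)) : Matrix (Fin d) (Fin d) ℝ :=
  (D.map fun p => Matrix.vecMulVec p.1.ofLp p.1.ofLp).sum

/-- `∑ t y` over a data set of pairs `(y, t)`. -/
def moment (D : List (Vec d × ℝ)) : Vec d :=
  (D.map fun p => p.2 • p.1).sum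

open Classical in
/-- Moore-Penrose inverse of a symmetric real matrix: invert the nonzero eigenvalues. -/
def pinv (S : Matrix (Fin d) (Fin d) ℝ) : Matrix (Fin d) (Fin d) ℝ :=
  if hS : S.IsHermitian then hS.cfc fun t => t⁻¹ else 0

/-- Minimum-norm least squares `Σ† b`. -/
def leastSquares (D : List (Vec d × ℝ)) : Vec d :=
  WithLp.toLp 2 ((pinv (gram D)).mulVec (moment D).ofLp)

/-- Ridge regression `(λ I + Σ)⁻¹ b`. -/
def ridge (lam : ℝ) (D : List (Vec d × ℝ)) : Vec d :=
  WithLp.toLp 2 (((lam • (1 : Matrix (Fin d) (Fin d) ℝ) + gram D)⁻¹).mulVec (moment D).ofLp)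

/-- The residual of `y` after subtracting its components along the vectors of `Q`: for an
orthonormal list `Q`, the orthogonal projection of `y` to the complement of the span of `Q`. -/
def resid (Q : List (Vec d)) (y : Vec d) : Vec d :=
  y - (Q.map fun q => (inner ℝ q y : ℝ) • q).sum

open Classical in
/-- One step of Gram-Schmidt: append the normalized residual of `y` if it is nonzero. -/
def gsStep (Q : List (Vec d)) (y : Vec d) : List (Vec d) :=
  if resid Q y = 0 then Q else Q ++ [‖resid Q y‖⁻¹ • resid Q y]

/-- An orthonormal basis of the orthogonal complement of the span of an orthonormal list `Q`,
by Gram-Schmidt on the standard basis vectors. -/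
def complBasis (Q : List (Vec d)) : List (Vec d) :=
  (((List.finRange d).map fun j => EuclideanSpace.single j (1 : ℝ)).foldl gsStep Q).drop Q.length

/-- The vector `(det(e_j, W_{-i}))_j`, where `W` is the matrix with columns `W 0, …, W (d-1)` and
`W_{-i}` is `W` without its `i`-th column. (Moving column `i` of `W` to the front gives the
sign.) -/
def cofactor (W : Fin d → Vec d) (i : Fin d) : Vec d :=
  WithLp.toLp 2 fun j => (-1) ^ (i : ℕ) *
    Matrix.det (Matrix.of fun r c => Function.update W i (EuclideanSpace.single j (1 : ℝ)) c r)

/-! ### Fitted Q-iteration -/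

/-- The regressions of layers `h-1, …, 0`, given the parameters of the layers from `h` on. -/
def fqiLoop (ws : Param d) (Ψ : ℕ → List (Param d)) (n : ℕ) : ℕ → Param d → Prog X A d (Param d)
  | 0, θ => pure θ
  | h + 1, θ => do
      let D ← forProg (fun π => repeatProg (drawTarget π h (ws h) (θ (h + 1))) n) (Ψ h)
      let θh ← compute (D.flatten.length * d ^ 2 + 2 * d ^ 3) (leastSquares D.flatten)
      fqiLoop ws Ψ n h (Function.update θ h θh)

/-- Fitted Q-iteration up to layer `h` for the rewards `⟨φ_l(x,a), ws l⟩`, `l ≤ h`, with `n`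
episodes for every policy in `Ψ l`, `l < h`. -/
def fqi (h : ℕ) (ws : Param d) (Ψ : ℕ → List (Param d)) (n : ℕ) : Prog X A d (Param d) :=
  fqiLoop ws Ψ n h (Function.update 0 h (ws h))

/-- Rewards that vanish except in layer `h`, where they are `⟨φ_h(x,a), θ⟩`. -/
def rewardAt (h : ℕ) (θ : Vec d) : Param d := Function.update 0 h θ

/-! ### Parameters of the exploration phase -/

/-- Sample sizes and tolerances of the exploration phase. -/
structure Sizes where
  /-- accuracy `ε` of the exploration phase -/
  eps : ℝ
  /-- accuracy of the spanner computation -/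
  epsRob : ℝ
  nIter : ℕ
  nVec : ℕ
  nTest : ℕ
  nSamp : ℕ
  mBoost : ℕ
  nReject : ℕ
  nSpan : ℕ
  /-- `n_cover = n_fqi` -/
  nCover : ℕ

/-- The sample sizes for accuracy `ε` and confidence `δ`. -/
def sizes (c₁ : ℝ) (d H : ℕ) (ε δ : ℝ) : Sizes :=
  let epsRob : ℝ := 4 * ε
  let nIter : ℕ := d + ⌈(d : ℝ) / 2 * Real.logb 2 (100 * d / epsRob ^ 2)⌉₊
  let δ' : ℝ := δ / (8 * H * d ^ 2 * nIter)
  let nSamp : ℕ := ⌈512 * (d : ℝ) ^ 2 * Real.log (256 * d / δ')⌉₊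
  let mBoost : ℕ := ⌈2048 * (d : ℝ) ^ 2 * Real.log (4 / δ')⌉₊
  let nSpan : ℕ := ⌈16 * H * d * √(Real.log (4 * d) * nSamp) / ε
    + 32 * H * d * Real.log (4 * d) / ε + 8 * H * d * nSamp / ε⌉₊
  { eps := ε
    epsRob := epsRob
    nIter := nIter
    nVec := ⌈c₁ * (H : ℝ) ^ 4 * (d : ℝ) ^ 2 / ε ^ 2 * Real.log (1 / δ')⌉₊
    nTest := ⌈128 * (H : ℝ) ^ 2 * (d : ℝ) ^ 2 * Real.log (4 / δ') / ε ^ 2⌉₊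
    nSamp := nSamp
    mBoost := mBoost
    nReject := ⌈8 * H * d * Real.log ((nSamp + (nSamp : ℝ) ^ 2 * mBoost) / δ') / ε⌉₊
    nSpan := nSpan
    nCover := ⌈Real.logb 2 ((H : ℝ) ^ 2 * d / δ')⌉₊ * nSpan }

/-! ### Subspace cover -/

open Classical in
/-- Rejection sampling with budget `K` from the law of the component of `φ_h(x_h, a_h)` orthogonal
to the span of `Q`, conditioned on being nonzero. -/
def rejection (π : Param d) (h : ℕ) (Q : List (Vec d)) : ℕ → Prog X A d (Vec d)
  | 0 => pure 0
  | K + 1 => do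
      let y ← drawFeature π h
      let r ← compute (4 * (Q.length + 1) * d) (resid Q y)
      if r ≠ 0 then pure r else rejection π h Q K

open Classical in
/-- Does `y` lie in the span of the list `W`? -/
def spanTest (y : Vec d) (W : List (Vec d)) : Bool := decide (y ∈ Submodule.span ℝ {z | z ∈ W})

/-- Draw `n` candidates; for each of them count how often it lies in the span of `n` fresh samples,
in `m` trials; return the (first) candidate with the highest count. A span test takes
`(n + 1) d²` steps. -/
def computeOutlierDirection (draw : Prog X A d (Vec d)) (n m : ℕ) : Prog X A d (Vec d) := do
  let U ← repeatProg draw n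
  let S ← forProg (fun y => do
    let hits ← repeatProg (do
      let W ← repeatProg draw n
      compute ((n + 1) * d ^ 2) (spanTest y W)) m
    compute m (y, hits.count true)) U
  compute n (((S.argmax Prod.snd).map Prod.fst).getD 0)

open Classical in
/-- Is `φ_h(x_h, a_h)`, sampled under `π`, outside of the span of `Q`? -/
def outlierTest (π : Param d) (h : ℕ) (Q : List (Vec d)) : Prog X A d Bool := do
  let y ← drawFeature π h
  compute (4 * (Q.length + 1) * d) (decide (resid Q y ≠ 0))

/-- Go through the directions `θ` in a list, until one of the two policies that are computed for the
rewards `∓⟨φ_h, θ⟩` leaves the span of `Q` often enough; then return this policy and a new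
direction. -/
def searchDirections (H : ℕ) (s : Sizes) (h : ℕ) (Ψ : ℕ → List (Param d)) (Q : List (Vec d)) :
    List (Vec d) → Prog X A d (Option (Param d × Vec d))
  | [] => pure none
  | θ :: rest => do
      let πm ← fqi h (rewardAt h (-θ)) Ψ s.nCover
      let πp ← fqi h (rewardAt h θ) Ψ s.nCover
      let out ← repeatProg (do
        let bm ← outlierTest πm h Q
        let bp ← outlierTest πp h Q
        pure (bm, bp)) s.nTest
      let km ← compute s.nTest ((out.map Prod.fst).count true)
      let kp ← compute s.nTest ((out.map Prod.snd).count true)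
      let π : Param d := if km ≤ kp then πp else πm
      if (s.nTest : ℝ) * (s.eps / (4 * H * d)) < (max km kp : ℕ) then do
        let y ← computeOutlierDirection (rejection π h Q s.nReject) s.nSamp s.mBoost
        pure (some (π, y))
      else searchDirections H s h Ψ Q rest

/-- The outer loop of the subspace cover, with a bound on the number of rounds. The subspace is
stored through an orthonormal basis `Q`. -/
def subspaceLoop (H : ℕ) (s : Sizes) (h : ℕ) (Ψ : ℕ → List (Param d)) :
    ℕ → List (Vec d) → List (Param d) → Prog X A d (List (Vec d) × List (Param d))
  | 0, Q, Ψh => pure (Q, Ψh)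
  | t + 1, Q, Ψh => do
      let B ← compute (4 * (d + 1) ^ 3) (complBasis Q)
      match ← searchDirections H s h Ψ Q B with
      | none => pure (Q, Ψh)
      | some (π, y) => do
          let Q' ← compute (4 * (d + 1) ^ 2) (gsStep Q y)
          subspaceLoop H s h Ψ t Q' (Ψh ++ [π])

/-- Subspace and cover policies of layer `h`. (If the subspace is all of `ℝᵈ`, the list of
directions is empty and the loop returns.) -/
def subspaceCover (H : ℕ) (s : Sizes) (h : ℕ) (Ψ : ℕ → List (Param d)) :
    Prog X A d (List (Vec d) × List (Param d)) :=
  subspaceLoop H s h Ψ (d + 1) [] []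

/-! ### Robust spanner -/

/-- Monte Carlo estimate of `E^π[φ_h(x_h, a_h)]` from `n` episodes. -/
def vecEval (h : ℕ) (n : ℕ) (π : Param d) : Prog X A d (Vec d) := do
  let l ← repeatProg (drawFeature π h) n
  compute ((n + 1) * d) ((n : ℝ)⁻¹ • l.sum)

/-- Columns `w_i` and policies `z_i` maintained by the spanner computation. -/
structure SpanState (d : ℕ) where
  W : Fin d → Vec d
  z : Fin d → Param d

/-- Replace the `i`-th column and the `i`-th policy. -/
def SpanState.set (st : SpanState d) (i : Fin d) (y : Vec d) (π : Param d) : SpanState d :=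
  ⟨Function.update st.W i y, Function.update st.z i π⟩

/-- The two optimizers and estimates for column `i`, and `θ_i`: returns
`(θ_i, z⁺, w⁺, z⁻, w⁻)`. -/
def spanQuery (linOpt : Vec d → Prog X A d (Param d)) (vec : Param d → Prog X A d (Vec d))
    (st : SpanState d) (i : Fin d) :
    Prog X A d (Vec d × Param d × Vec d × Param d × Vec d) := do
  let θ ← compute (d ^ 4) (cofactor st.W i)
  let zp ← linOpt (‖θ‖⁻¹ • θ)
  let wp ← vec zp
  let zm ← linOpt (-(‖θ‖⁻¹ • θ))
  let wm ← vec zm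
  pure (θ, zp, wp, zm, wm)

/-- First loop: initialize the columns one after the other. -/
def spanInit (linOpt : Vec d → Prog X A d (Param d)) (vec : Param d → Prog X A d (Vec d)) (ε : ℝ) :
    List (Fin d) → SpanState d → Prog X A d (SpanState d)
  | [], st => pure st
  | i :: rest, st => do
      let (θ, zp, wp, zm, wm) ← spanQuery linOpt vec st i
      let st' ← compute (20 * d)
        (if -(inner ℝ θ wm : ℝ) ≤ inner ℝ θ wp then st.set i (wp + (ε * ‖θ‖⁻¹) • θ) zp
          else st.set i (wm - (ε * ‖θ‖⁻¹) • θ) zm)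
      spanInit linOpt vec ε rest st'

/-- One pass of the second loop over the columns: returns the updated state at the first column that
can be improved by the factor `C`, and `none` if there is none. Here `det(w_i, W_{-i})` is
`⟨θ_i, w_i⟩`. -/
def spanPass (linOpt : Vec d → Prog X A d (Param d)) (vec : Param d → Prog X A d (Vec d))
    (C ε : ℝ) (st : SpanState d) : List (Fin d) → Prog X A d (Option (SpanState d))
  | [] => pure none
  | i :: rest => do
      let (θ, zp, wp, zm, wm) ← spanQuery linOpt vec st i
      let next ← compute (20 * d)
        (if C * |(inner ℝ θ (st.W i) : ℝ)| ≤ inner ℝ θ wp + ε * ‖θ‖ then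
          some (st.set i (wp + (ε * ‖θ‖⁻¹) • θ) zp)
        else if C * |(inner ℝ θ (st.W i) : ℝ)| ≤ -(inner ℝ θ wm) + ε * ‖θ‖ then
          some (st.set i (wm - (ε * ‖θ‖⁻¹) • θ) zm)
        else none)
      match next with
      | some st' => pure (some st')
      | none => spanPass linOpt vec C ε st rest

/-- Second loop: repeat passes until no column is updated. The result is `none` if this does not
happen within the given number of passes. -/
def spanLoop (linOpt : Vec d → Prog X A d (Param d)) (vec : Param d → Prog X A d (Vec d))
    (C ε : ℝ) : ℕ → SpanState d → Prog X A d (Option (Fin d → Param d))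
  | 0, _ => pure none
  | N + 1, st => do
      match ← spanPass linOpt vec C ε st (List.finRange d) with
      | none => pure (some st.z)
      | some st' => spanLoop linOpt vec C ε N st'

/-- Approximate barycentric spanner from an approximate linear optimization routine `linOpt` and an
estimation routine `vec`; `none` if the second loop takes more than `N` passes. -/
def robustSpanner (linOpt : Vec d → Prog X A d (Param d)) (vec : Param d → Prog X A d (Vec d))
    (C ε : ℝ) (N : ℕ) : Prog X A d (Option (Fin d → Param d)) := do
  let st ← spanInit linOpt vec ε (List.finRange d)
    ⟨fun i => EuclideanSpace.single i (1 : ℝ), fun _ => 0⟩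
  spanLoop linOpt vec C ε N st

/-! ### The two phases -/

/-- Output of the exploration phase: for every layer an orthonormal basis of the subspace, the cover
policies and the spanner policies. -/
structure Exploration (d : ℕ) where
  S : ℕ → List (Vec d)
  Ψ : ℕ → List (Param d)
  Γ : ℕ → Fin d → Param d

/-- The first `h` rounds (layers `0, …, h-1`) of the exploration phase. The result is `none` if some
spanner computation does not terminate in time. -/
def exploreUpTo (H : ℕ) (s : Sizes) : ℕ → Prog X A d (Option (Exploration d))
  | 0 => pure (some ⟨fun _ => [], fun _ => [], fun _ _ => 0⟩)
  | h + 1 => do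
      match ← exploreUpTo H s h with
      | none => pure none
      | some E => do
          let (Q, Ψh) ← subspaceCover H s h E.Ψ
          let Γh ← robustSpanner (fun θ => fqi h (rewardAt h θ) E.Ψ s.nCover) (vecEval h s.nVec)
            2 s.epsRob s.nIter
          match Γh with
          | none => pure none
          | some Γh => pure (some ⟨Function.update E.S h Q, Function.update E.Ψ h Ψh,
              Function.update E.Γ h Γh⟩)

/-- Exploration phase with accuracy `ε` and confidence `δ`. -/
def computeSpanner (c₁ : ℝ) (H : ℕ) (ε δ : ℝ) : Prog X A d (Option (Exploration d)) :=
  exploreUpTo H (sizes c₁ d H ε δ) H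

/-- Policy optimization phase: estimate the reward parameters of all layers by ridge regression on
`n` episodes for every spanner policy, then call fitted Q-iteration with the estimated rewards. -/
def policyOpt (H : ℕ) (Ψ : ℕ → List (Param d)) (Γ : ℕ → Fin d → Param d) (n : ℕ) (lam : ℝ) :
    Prog X A d (Param d) := do
  let ws ← forProg (fun h => do
    let D ← forProg (fun i => repeatProg (drawReward (Γ h i) h) n) (List.finRange d)
    compute (D.flatten.length * d ^ 2 + 2 * d ^ 3) (ridge lam D.flatten)) (List.range H)
  fqi (H - 1) (fun h => ws.getD h 0) Ψ n

/-- `L = max {1, log (dH/(δε))}`. -/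
def logFactor (d H : ℕ) (ε δ : ℝ) : ℝ := max 1 (Real.log (d * H / (δ * ε)))

/-- The whole procedure: exploration with accuracy `ε' = ε/(c₀ d² H² L)` and confidence `δ/4`, then
policy optimization with `n = max {n_cover, c₂ d⁴ H² L² / ε²}` and ridge parameter `1`. -/
def procedure (c₀ c₁ c₂ : ℝ) (H : ℕ) (ε δ : ℝ) : Prog X A d (Option (Param d)) := do
  let L := logFactor d H ε δ
  let ε' := ε / (c₀ * (d : ℝ) ^ 2 * (H : ℝ) ^ 2 * L)
  match ← computeSpanner c₁ H ε' (δ / 4) with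
  | none => pure none
  | some E => do
      let n := max (sizes c₁ d H ε' (δ / 4)).nCover ⌈c₂ * ((d : ℝ) ^ 4 * (H : ℝ) ^ 2 * L ^ 2 / ε ^ 2)⌉₊
      let θ ← policyOpt H E.Ψ E.Γ n 1
      pure (some θ)

end Programs

end LBC

end

/-!
The transitions are deterministic, so the trajectory of a policy is a function of the initial state,
and the only other randomness is that of the rewards. In particular the regression targets of fitted
Q-iteration are noiseless: by linear Bellman completeness they are linear in the feature, and least
squares recovers the Bellman backup exactly on the span of the observed features
(`LayerCover.sat_fqi`). Hence nothing is lost from layer to layer. If every layer `l` has a subspace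
`S l` inside the span of the data, then from each initial state whose trajectories, under all greedy
policies, stay in these subspaces, the computed policy is exactly optimal (`IsBackup.optimal`). What
remains is to make the subspaces so large that the other initial states are rare.

*Covering.* Let a policy leave the current subspace of layer `h` with probability `p`. One of `n`
samples of the normalized deviation is missed by the span of `n` fresh samples with probability at
most `d / (n + 1)`, since the dimension grows at most `d` times (`lintegral_miss_le`); boosting
selects a vector that is missed with probability at most `3/8` (`sat_computeOutlierDirection`).
Rejection sampling transfers this to the features themselves (`miss_compare`): if `n` is large
compared with `1/p`, then `n` features contain the new direction in their span, modulo the earlier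
ones, with probability `1/2`, and repetition makes this probability close to `1`
(`Covers.sat_targetData`). If no further direction is found, then the optimizers of the basis vectors
of the complement, and of their negatives, leave the subspace rarely. But where any policy leaves it,
one of these optimizers does (`start_escape_le`), and so the exceptional initial states have
probability at most `5/8 ε'` over all layers, where `ε'` is the accuracy of the exploration.

*Spanners.* On the remaining initial states fitted Q-iteration is an exact linear optimization over
the mean features of all policies, so its error is at most `5/4 ε'` on average. Maximizing
determinants with tilted columns gives an approximate spanner: every replacement in the second loop
doubles the determinant, while Hadamard's inequality bounds it, and with the tilt the first loop
makes it at least `(5/2 ε') ^ d` (`sat_robustSpanner`). Ridge regression on data of the spanner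
policies estimates the mean reward of each of them at the rate `1 / √n`, with noise weights that may
depend on all features at once (`lintegral_exp_drawsL`, `sat_ridgeProg`), and therefore the mean
reward of every policy. Optimizing the estimated rewards, again exactly outside of the exceptional
initial states, loses at most `ε` on average (`suboptimality_le`, `suboptimality_bound`).

*Bookkeeping.* `E.Sat p b P` says that the output of the program `p` violates `P` with probability at
most `b`, and these bounds add up along the structure of a program. This rests on the Markov property
(`lintegral_dist_bind`): the episodes that a program has not used are independent of its output, and
all programs depend measurably on their data. The cost is bounded in the same way, through a worst
case predicate `Bounded p B P` that ignores the environment altogether. If `N` bounds all sample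
sizes, then the whole procedure costs at most `N ^ 18` (`bounded_procedure`), and the sample sizes are
polynomial in `d H (1/ε) (1 + log (1/δ))` (`sizes_atMost`, `procedure_cost_le`).
-/

noncomputable section

namespace LBC

open ENNReal (ofReal)
open Real (exp log logb)

/-! ### Measurability on lists and options -/

section ListMeasurable

variable {α β γ J : Type*} [MeasurableSpace α] [MeasurableSpace β] [MeasurableSpace γ]
  [MeasurableSpace J]

/-- The σ-algebra on lists: the disjoint union of the product σ-algebras on tuples. -/
instance instMeasurableSpaceList : MeasurableSpace (List α) :=
  MeasurableSpace.comap (List.equivSigmaTuple (α := α)) Sigma.instMeasurableSpace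

/-- The σ-algebra on options: the disjoint union of `α` and a point. -/
instance instMeasurableSpaceOption : MeasurableSpace (Option α) :=
  MeasurableSpace.map some inferInstance

theorem measurableEmbedding_ofFn (n : ℕ) :
    MeasurableEmbedding (List.ofFn : (Fin n → α) → List α) where
  injective := List.ofFn_injective
  measurable := by
    refine Measurable.of_comap_le ?_
    have h : Measurable (fun v : Fin n → α => List.equivSigmaTuple (List.ofFn v)) := by
      have : (fun v : Fin n → α => List.equivSigmaTuple (List.ofFn v)) =
          Sigma.mk (β := fun n => Fin n → α) n := by
        funext v
        exact List.equivSigmaTuple.right_inv ⟨n, v⟩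
      rw [this]
      intro s hs
      exact (MeasurableSpace.measurableSet_iInf.1 hs n)
    have h2 := h.comap_le
    rw [instMeasurableSpaceList, MeasurableSpace.comap_comp]
    exact h2
  measurableSet_image' := by
    intro s hs
    refine ⟨Sigma.mk (β := fun n => Fin n → α) n '' s, ?_, ?_⟩
    · refine MeasurableSpace.measurableSet_iInf.2 fun m => ?_
      change MeasurableSet (Sigma.mk m ⁻¹' (Sigma.mk (β := fun n => Fin n → α) n '' s))
      by_cases h : n = m
      · subst h
        rw [Set.preimage_image_eq _ sigma_mk_injective]
        exact hs
      · rw [Set.preimage_image_sigmaMk_of_ne (Ne.symm h)]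
        exact MeasurableSet.empty
    · ext l
      constructor
      · rintro ⟨v, hv, he⟩
        refine ⟨v, hv, ?_⟩
        have := congrArg List.equivSigmaTuple.symm he
        rw [Equiv.symm_apply_apply] at this
        exact this
      · rintro ⟨v, hv, rfl⟩
        exact ⟨v, hv, (List.equivSigmaTuple.right_inv ⟨n, v⟩).symm⟩

theorem measurableEmbedding_some : MeasurableEmbedding (some : α → Option α) where
  injective := Option.some_injective α
  measurable := fun _ hs => hs
  measurableSet_image' := by
    intro s hs
    change MeasurableSet (some ⁻¹' (some '' s))
    rwa [Set.preimage_image_eq _ (Option.some_injective α)]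

theorem measurableSet_none : MeasurableSet ({none} : Set (Option α)) := by
  change MeasurableSet (some ⁻¹' {none})
  have : (some ⁻¹' {none} : Set α) = ∅ := by ext; simp
  rw [this]; exact MeasurableSet.empty

/-- A function of a list and a parameter is measurable if it is so on tuples of every length. -/
theorem measurable_list_of_tuple {F : List α × J → β}
    (h : ∀ n, Measurable fun p : (Fin n → α) × J => F (List.ofFn p.1, p.2)) : Measurable F := by
  intro S hS
  have : F ⁻¹' S = ⋃ n : ℕ, (Prod.map (List.ofFn : (Fin n → α) → List α) (id : J → J)) ''
      ((fun p : (Fin n → α) × J => F (List.ofFn p.1, p.2)) ⁻¹' S) := by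
    ext ⟨l, j⟩
    simp only [Set.mem_preimage, Set.mem_iUnion, Set.mem_image]
    constructor
    · intro hl
      refine ⟨l.length, (l.get, j), ?_, ?_⟩
      · simpa using hl
      · simp
    · rintro ⟨n, p, hp, he⟩
      rw [← he]; exact hp
  rw [this]
  exact MeasurableSet.iUnion fun n =>
    ((measurableEmbedding_ofFn n).prodMap MeasurableEmbedding.id).measurableSet_image.2 (h n hS)

/-- Measurability of a function of a list and a parameter, by recursion on the list. -/
theorem measurable_list_of_cons {F : List α × J → β} (h0 : Measurable fun j => F ([], j))
    (hs : ∀ n, (Measurable fun p : (Fin n → α) × J => F (List.ofFn p.1, p.2)) →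
      Measurable fun p : α × (Fin n → α) × J => F (p.1 :: List.ofFn p.2.1, p.2.2)) :
    Measurable F := by
  refine measurable_list_of_tuple fun n => ?_
  induction n with
  | zero => simpa [Function.comp_def] using h0.comp (measurable_snd (α := Fin 0 → α))
  | succ n ih =>
    have h2 := hs n ih
    have h3 : Measurable fun p : (Fin (n + 1) → α) × J =>
        (p.1 0, (fun i : Fin n => p.1 i.succ), p.2) := by fun_prop
    have h4 := h2.comp h3
    simpa [Function.comp_def, List.ofFn_succ] using h4

@[fun_prop]
theorem measurable_some : Measurable (some : α → Option α) := fun _ hs => hs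

/-- A function of an option and a parameter is measurable if both its branches are. -/
theorem measurable_option_of_cases {F : Option α × J → β}
    (h1 : Measurable fun p : α × J => F (some p.1, p.2)) (h0 : Measurable fun j => F (none, j)) :
    Measurable F := by
  intro S hS
  have : F ⁻¹' S = ((Prod.map (some : α → Option α) (id : J → J)) ''
      ((fun p : α × J => F (some p.1, p.2)) ⁻¹' S)) ∪
        ({none} ×ˢ ((fun j => F (none, j)) ⁻¹' S)) := by
    ext ⟨o, j⟩
    cases o <;> simp
  rw [this]
  exact ((measurableEmbedding_some.prodMap MeasurableEmbedding.id).measurableSet_image.2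
    (h1 hS)).union (measurableSet_none.prod (h0 hS))

theorem measurable_list_cons' : Measurable fun p : List α × α => p.2 :: p.1 := by
  refine measurable_list_of_tuple fun n => ?_
  have h : Measurable fun p : (Fin n → α) × α => (Fin.cons p.2 p.1 : Fin (n + 1) → α) := by
    refine measurable_pi_iff.2 fun i => ?_
    refine Fin.cases ?_ (fun i => ?_) i
    · simpa using measurable_snd
    · simp only [Fin.cons_succ]; fun_prop
  have h2 := (measurableEmbedding_ofFn (α := α) (n + 1)).measurable.comp h
  simpa [Function.comp_def, List.ofFn_succ] using h2

@[fun_prop]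
theorem _root_.Measurable.list_cons {f : J → α} {g : J → List α} (hf : Measurable f)
    (hg : Measurable g) : Measurable fun j => f j :: g j :=
  measurable_list_cons'.comp (hg.prodMk hf)

@[fun_prop]
theorem measurable_ofFn (n : ℕ) : Measurable (List.ofFn : (Fin n → α) → List α) :=
  (measurableEmbedding_ofFn n).measurable

@[fun_prop]
theorem _root_.Measurable.list_ofFn {n : ℕ} {f : J → Fin n → α} (hf : Measurable f) :
    Measurable fun j => List.ofFn (f j) := (measurable_ofFn n).comp hf

/-- Folding a list with a measurable step is measurable. -/
theorem measurable_foldl {f : J → γ → α → γ}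
    (hf : Measurable fun p : J × γ × α => f p.1 p.2.1 p.2.2) :
    Measurable fun p : List α × γ × J => p.1.foldl (f p.2.2) p.2.1 := by
  refine measurable_list_of_cons (by simpa using measurable_fst) fun n ih => ?_
  simp only [List.foldl_cons]
  exact ih.comp (g := fun p : (Fin n → α) × γ × J => List.foldl (f p.2.2) p.2.1 (List.ofFn p.1))
    (f := fun p : α × (Fin n → α) × γ × J => (p.2.1, f p.2.2.2 p.2.2.1 p.1, p.2.2.2))
    (by
      refine (by fun_prop : Measurable fun p : α × (Fin n → α) × γ × J => p.2.1).prodMk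
        (Measurable.prodMk ?_ (by fun_prop))
      exact hf.comp (f := fun p : α × (Fin n → α) × γ × J => (p.2.2.2, p.2.2.1, p.1))
        (by fun_prop))

/-- Folding a list from the right with a measurable step is measurable. -/
theorem measurable_foldr {f : J → α → γ → γ}
    (hf : Measurable fun p : J × α × γ => f p.1 p.2.1 p.2.2) :
    Measurable fun p : List α × γ × J => p.1.foldr (f p.2.2) p.2.1 := by
  refine measurable_list_of_cons (by simpa using measurable_fst) fun n ih => ?_
  simp only [List.foldr_cons]
  have h1 : Measurable fun p : α × (Fin n → α) × γ × J =>
      List.foldr (f p.2.2.2) p.2.2.1 (List.ofFn p.2.1) := ih.comp measurable_snd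
  exact hf.comp (f := fun p : α × (Fin n → α) × γ × J =>
    (p.2.2.2, p.1, List.foldr (f p.2.2.2) p.2.2.1 (List.ofFn p.2.1)))
    ((by fun_prop : Measurable fun p : α × (Fin n → α) × γ × J => p.2.2.2).prodMk
      (Measurable.prodMk (by fun_prop) h1))

theorem _root_.Measurable.list_foldl {f : J → γ → α → γ} {l : J → List α} {g : J → γ}
    (hf : Measurable fun p : J × γ × α => f p.1 p.2.1 p.2.2) (hl : Measurable l)
    (hg : Measurable g) : Measurable fun j => (l j).foldl (f j) (g j) :=
  (measurable_foldl hf).comp (hl.prodMk (hg.prodMk measurable_id))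

theorem _root_.Measurable.list_foldr {f : J → α → γ → γ} {l : J → List α} {g : J → γ}
    (hf : Measurable fun p : J × α × γ => f p.1 p.2.1 p.2.2) (hl : Measurable l)
    (hg : Measurable g) : Measurable fun j => (l j).foldr (f j) (g j) :=
  (measurable_foldr hf).comp (hl.prodMk (hg.prodMk measurable_id))

theorem _root_.Measurable.list_map {f : J → α → β} {l : J → List α}
    (hf : Measurable fun p : J × α => f p.1 p.2) (hl : Measurable l) :
    Measurable fun j => (l j).map (f j) := by
  have h := Measurable.list_foldr (γ := List β) (f := fun j a l => f j a :: l) (g := fun _ => [])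
    (by
      refine Measurable.list_cons ?_ (by fun_prop)
      exact hf.comp (f := fun p : J × α × List β => (p.1, p.2.1)) (by fun_prop)) hl (by fun_prop)
  convert h using 2 with j
  exact List.map_eq_foldr

@[fun_prop]
theorem _root_.Measurable.list_map_const {f : α → β} {l : J → List α} (hf : Measurable f)
    (hl : Measurable l) : Measurable fun j => (l j).map f :=
  Measurable.list_map (f := fun _ => f) (by fun_prop) hl

@[fun_prop]
theorem _root_.Measurable.list_append {f g : J → List α} (hf : Measurable f)
    (hg : Measurable g) : Measurable fun j => f j ++ g j := by
  have h := Measurable.list_foldr (γ := List α) (J := J) (f := fun _ a l => a :: l) (g := g)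
    (by fun_prop) hf hg
  simpa [List.foldr_cons_eq_append] using h

@[fun_prop]
theorem _root_.Measurable.list_flatten {f : J → List (List α)} (hf : Measurable f) :
    Measurable fun j => (f j).flatten := by
  have h := Measurable.list_foldr (γ := List α) (J := J) (f := fun _ (a l : List α) => a ++ l)
    (g := fun _ => []) (by fun_prop) hf (by fun_prop)
  convert h using 2 with j
  induction f j with
  | nil => rfl
  | cons a l ih => simp [ih]

@[fun_prop]
theorem _root_.Measurable.list_sum [AddMonoid α] [MeasurableAdd₂ α] {f : J → List α}
    (hf : Measurable f) : Measurable fun j => (f j).sum := by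
  have h := Measurable.list_foldr (γ := α) (J := J) (f := fun _ (a b : α) => a + b)
    (g := fun _ => 0) (by fun_prop) hf (by fun_prop)
  exact h

@[fun_prop]
theorem _root_.Measurable.list_length {f : J → List α} (hf : Measurable f) :
    Measurable fun j => (f j).length := by
  have h := Measurable.list_foldr (γ := ℕ) (J := J) (f := fun _ (_ : α) b => b + 1)
    (g := fun _ => 0) (by fun_prop) hf (by fun_prop)
  convert h using 2 with j
  induction f j with
  | nil => rfl
  | cons a l ih => rw [List.length_cons, ih, List.foldr_cons]

theorem measurable_list_tail : Measurable (List.tail : List α → List α) := by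
  have : Measurable fun p : List α × Unit => p.1.tail := by
    refine measurable_list_of_cons (by simp) fun n _ => ?_
    simp only [List.tail_cons]; fun_prop
  exact this.comp (measurable_id.prodMk (measurable_const (a := ())))

@[fun_prop]
theorem _root_.Measurable.list_drop {f : J → List α} (n : ℕ) (hf : Measurable f) :
    Measurable fun j => (f j).drop n := by
  induction n with
  | zero => simpa using hf
  | succ n ih =>
    have : (fun j => (f j).drop (n + 1)) = fun j => ((f j).drop n).tail := by
      funext j; simp
    rw [this]; exact measurable_list_tail.comp ih

@[fun_prop]
theorem _root_.Measurable.list_head? {f : J → List α} (hf : Measurable f) :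
    Measurable fun j => (f j).head? := by
  have : Measurable fun p : List α × Unit => p.1.head? := by
    refine measurable_list_of_cons (by simp) fun n _ => ?_
    simp only [List.head?_cons]; fun_prop
  exact this.comp (hf.prodMk (measurable_const (a := ())))

@[fun_prop]
theorem _root_.Measurable.option_getD {f : J → Option α} {a : J → α} (hf : Measurable f)
    (ha : Measurable a) : Measurable fun j => (f j).getD (a j) := by
  have : Measurable fun p : Option α × J => p.1.getD (a p.2) :=
    measurable_option_of_cases (by simpa using measurable_fst) (by simpa using ha)
  exact this.comp (hf.prodMk measurable_id)

@[fun_prop]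
theorem _root_.Measurable.option_map {f : α → β} {g : J → Option α} (hf : Measurable f)
    (hg : Measurable g) : Measurable fun j => (g j).map f := by
  have : Measurable fun p : Option α × J => p.1.map f :=
    measurable_option_of_cases (by simp only [Option.map_some]; fun_prop) (by simp)
  exact this.comp (hg.prodMk measurable_id)

@[fun_prop]
theorem _root_.Measurable.list_getD {f : J → List α} (n : ℕ) (a : α) (hf : Measurable f) :
    Measurable fun j => (f j).getD n a := by
  have : (fun j => (f j).getD n a) = fun j => (((f j).drop n).head?).getD a := by
    funext j; simp [List.getD_eq_getElem?_getD]
  rw [this]; fun_prop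

theorem _root_.Measurable.list_argmax [LinearOrder β] [TopologicalSpace β] [OrderTopology β]
    [SecondCountableTopology β] [OpensMeasurableSpace β] {f : α → β} (hf : Measurable f)
    {l : J → List α} (hl : Measurable l) : Measurable fun j => (l j).argmax f := by
  have h := Measurable.list_foldl (γ := Option α) (J := J)
    (f := fun _ => List.argAux fun b c => f c < f b) (g := fun _ => none) (l := l) ?_ hl
    measurable_const
  · exact h
  · have : Measurable fun p : Option α × α => List.argAux (fun b c => f c < f b) p.1 p.2 := by
      refine measurable_option_of_cases ?_ (by simp only [List.argAux]; fun_prop)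
      simp only [List.argAux]
      exact Measurable.ite (measurableSet_lt (hf.comp measurable_fst) (hf.comp measurable_snd))
        (by fun_prop) (by fun_prop)
    exact this.comp (by fun_prop : Measurable fun p : J × Option α × α => (p.2.1, p.2.2))

@[fun_prop]
theorem _root_.Measurable.list_count_true {f : J → List Bool} (hf : Measurable f) :
    Measurable fun j => (f j).count true := by
  have h := Measurable.list_foldr (γ := ℕ) (J := J)
    (f := fun _ (b : Bool) n => n + (if b = true then 1 else 0))
    (g := fun _ => 0) (Measurable.add (by fun_prop) ((measurable_of_countable
      fun b : Bool => if b = true then 1 else 0).comp (by fun_prop :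
        Measurable fun p : J × Bool × ℕ => p.2.1))) hf (by fun_prop)
  convert h using 2 with j
  induction f j with
  | nil => rfl
  | cons a l ih => cases a <;> simp [ih]

end ListMeasurable

instance instMeasurableSpaceSpanState (d : ℕ) : MeasurableSpace (SpanState d) :=
  MeasurableSpace.comap (fun st => (st.W, st.z)) inferInstance

instance instMeasurableSpaceExploration (d : ℕ) : MeasurableSpace (Exploration d) :=
  MeasurableSpace.comap (fun E => (E.S, E.Ψ, E.Γ)) inferInstance

section

variable {J : Type*} [MeasurableSpace J] {d : ℕ}

@[fun_prop]
theorem measurable_spanState_W : Measurable (SpanState.W : SpanState d → _) :=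
  (measurable_fst.comp (comap_measurable (fun st : SpanState d => (st.W, st.z))) : _)

@[fun_prop]
theorem measurable_spanState_z : Measurable (SpanState.z : SpanState d → _) :=
  (measurable_snd.comp (comap_measurable (fun st : SpanState d => (st.W, st.z))) : _)

@[fun_prop]
theorem measurable_exploration_S : Measurable (Exploration.S : Exploration d → _) :=
  (measurable_fst.comp (comap_measurable (fun E : Exploration d => (E.S, E.Ψ, E.Γ))) : _)

@[fun_prop]
theorem measurable_exploration_Ψ : Measurable (Exploration.Ψ : Exploration d → _) :=
  ((measurable_fst.comp measurable_snd).comp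
    (comap_measurable (fun E : Exploration d => (E.S, E.Ψ, E.Γ))) : _)

@[fun_prop]
theorem measurable_exploration_Γ : Measurable (Exploration.Γ : Exploration d → _) :=
  ((measurable_snd.comp measurable_snd).comp
    (comap_measurable (fun E : Exploration d => (E.S, E.Ψ, E.Γ))) : _)

@[fun_prop]
theorem _root_.Measurable.spanState_mk {W : J → Fin d → Vec d} {z : J → Fin d → Param d}
    (hW : Measurable W) (hz : Measurable z) : Measurable fun j => SpanState.mk (W j) (z j) := by
  rw [measurable_comap_iff]; exact hW.prodMk hz

@[fun_prop]
theorem _root_.Measurable.exploration_mk {S : J → ℕ → List (Vec d)} {Ψ : J → ℕ → List (Param d)}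
    {Γ : J → ℕ → Fin d → Param d} (hS : Measurable S) (hΨ : Measurable Ψ) (hΓ : Measurable Γ) :
    Measurable fun j => Exploration.mk (S j) (Ψ j) (Γ j) := by
  rw [measurable_comap_iff]; exact hS.prodMk (hΨ.prodMk hΓ)

/-- Joint measurability of `Function.update` at a fixed argument. -/
theorem _root_.Measurable.function_update {ι : Type*} [DecidableEq ι] {β : Type*}
    [MeasurableSpace β] {f : J → ι → β} {a : J → β} (i : ι) (hf : Measurable f)
    (ha : Measurable a) : Measurable fun j => Function.update (f j) i (a j) := by
  refine measurable_pi_iff.2 fun k => ?_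
  by_cases h : k = i
  · subst h; simpa using ha
  · simp only [Function.update_of_ne h]; fun_prop

end

/-! ### Semantics of programs -/

/-- An environment together with the standing assumptions: features, argmax rule and horizon,
measurability, bounded features, bounded and linear rewards, linear Bellman completeness. -/
structure Setting (X : Type u) (A : Type v) (Ξ : Type w) [MeasurableSpace X] [MeasurableSpace A]
    [MeasurableSpace Ξ] (d : ℕ) where
  M : MDP X A Ξ
  φ : ℕ → X → A → Vec d
  amax : ℕ → X → Vec d → A
  H : ℕ
  d_pos : 1 ≤ d
  H_pos : 1 ≤ H
  meas : M.IsMeasurable φ amax H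
  oracle : IsArgmaxOracle φ amax H
  complete : M.LinearBellmanComplete φ H
  feature_le : ∀ h < H, ∀ x a, ‖φ h x a‖ ≤ 1
  reward_mem : ∀ h < H, ∀ x a ξ, M.reward h x a ξ ∈ Set.Icc (0 : ℝ) 1
  linear : M.LinearReward φ H

section Shift

variable {X : Type u} {Ξ : Type w} {A : Type v} [MeasurableSpace X] [MeasurableSpace Ξ]

/-- Put one episode in front of a sequence of episodes. -/
def consEpisode (q : Episode X Ξ × (ℕ → Episode X Ξ)) : ℕ → Episode X Ξ :=
  fun n => Nat.casesOn n q.1 q.2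

theorem measurable_consEpisode : Measurable (consEpisode (X := X) (Ξ := Ξ)) := by
  refine measurable_pi_iff.2 fun n => ?_
  cases n with
  | zero => exact measurable_fst
  | succ n => exact (measurable_pi_apply n).comp measurable_snd

/-- The first episode is independent of the sequence of the later ones, which has the same law as
the whole sequence. -/
theorem law_cons (M : MDP X A Ξ) :
    (M.episodeLaw.prod M.law).map consEpisode = M.law := by
  classical
  refine Measure.eq_infinitePi _ fun s t ht => ?_
  have : IsProbabilityMeasure M.law := by unfold MDP.law; infer_instance
  rw [Measure.map_apply measurable_consEpisode
    (MeasurableSet.pi s.countable_toSet fun i _ => ht i)]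
  have hpre : consEpisode ⁻¹' (Set.pi (s : Set ℕ) t) =
      (if 0 ∈ s then t 0 else Set.univ) ×ˢ
        Set.pi ((s.preimage Nat.succ (Nat.succ_injective.injOn) : Finset ℕ) : Set ℕ)
          (fun n => t (n + 1)) := by
    ext ⟨e, ω⟩
    simp only [Set.mem_preimage, Set.mem_pi, Set.mem_prod, Finset.mem_coe, Finset.mem_preimage]
    constructor
    · intro h
      refine ⟨?_, fun i hi => h (i + 1) hi⟩
      split_ifs with h0
      · exact h 0 h0
      · trivial
    · rintro ⟨h0, h1⟩ i hi
      cases i with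
      | zero => rw [if_pos hi] at h0; exact h0
      | succ n => exact h1 n hi
  rw [hpre, Measure.prod_prod]
  have h2 : M.law (Set.pi ((s.preimage Nat.succ (Nat.succ_injective.injOn) : Finset ℕ) : Set ℕ)
      (fun n => t (n + 1))) = ∏ n ∈ s.preimage Nat.succ (Nat.succ_injective.injOn),
        M.episodeLaw (t (n + 1)) := by
    unfold MDP.law
    exact Measure.infinitePi_pi _ fun i _ => ht (i + 1)
  rw [h2]
  have h3 := Finset.prod_preimage' Nat.succ s Nat.succ_injective.injOn
    (fun i => M.episodeLaw (t i))
  simp only [Nat.succ_eq_add_one] at h3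
  rw [h3, ← Finset.prod_filter_mul_prod_filter_not s (fun x => x ∈ Set.range Nat.succ), mul_comm]
  congr 1
  have h4 : (s.filter fun x => ¬ x ∈ Set.range Nat.succ) = if 0 ∈ s then {0} else ∅ := by
    ext i
    cases i with
    | zero => by_cases h : 0 ∈ s <;> simp [h]
    | succ n => by_cases h : 0 ∈ s <;> simp [h]
  rw [h4]
  split_ifs <;> simp

end Shift

variable {X : Type u} {A : Type v} {Ξ : Type w} [MeasurableSpace X] [MeasurableSpace A]
  [MeasurableSpace Ξ] {d : ℕ}

namespace Setting

variable (E : Setting X A Ξ d)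

/-- Law of the randomness of all episodes. -/
def law : Measure (ℕ → Episode X Ξ) := E.M.law

instance : IsProbabilityMeasure E.law := by unfold law MDP.law; infer_instance

/-- Output of a program and the randomness that it leaves for later programs. -/
def eval {α : Type} : Prog X A d α → (ℕ → Episode X Ξ) → α × (ℕ → Episode X Ξ)
  | .done a, ω => (a, ω)
  | .episode θ h k, ω =>
      let x := E.M.state (greedy E.amax θ) (ω 0).1 h
      let a := greedy E.amax θ h x
      eval (k x a (E.M.reward h x a ((ω 0).2 h)) (E.M.next h x a)) fun n => ω (n + 1)
  | .feature h x a k, ω => eval (k (E.φ h x a)) ω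
  | .argmax h x θ k, ω => eval (k (E.amax h x θ)) ω
  | .tick _ k, ω => eval k ω

theorem run_fst {α : Type} (p : Prog X A d α) (ω : ℕ → Episode X Ξ) :
    (p.run E.M E.φ E.amax ω).1 = (E.eval p ω).1 := by
  induction p generalizing ω with
  | done a => rfl
  | episode θ h k ih => exact ih _ _ _ _ _
  | feature h x a k ih => exact ih _ _
  | argmax h x θ k ih => exact ih _ _
  | tick c k ih => exact ih _

theorem eval_bind {α β : Type} (p : Prog X A d α) (f : α → Prog X A d β)
    (ω : ℕ → Episode X Ξ) :
    E.eval (p.bind f) ω = E.eval (f (E.eval p ω).1) (E.eval p ω).2 := by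
  induction p generalizing ω with
  | done a => rfl
  | episode θ h k ih => exact ih _ _ _ _ _
  | feature h x a k ih => exact ih _ _
  | argmax h x θ k ih => exact ih _ _
  | tick c k ih => exact ih _

/-- A family of programs is measurable if output and remaining randomness depend measurably on the
index and on the randomness. -/
def MeasFam {ι : Type*} [MeasurableSpace ι] {α : Type} [MeasurableSpace α]
    (p : ι → Prog X A d α) : Prop :=
  Measurable fun q : ι × (ℕ → Episode X Ξ) => E.eval (p q.1) q.2

/-- A single measurable program. -/
def MeasProg {α : Type} [MeasurableSpace α] (p : Prog X A d α) : Prop := Measurable (E.eval p)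

/-- Law of the output of a program. -/
def dist {α : Type} [MeasurableSpace α] (p : Prog X A d α) : Measure α :=
  E.law.map fun ω => (E.eval p ω).1

section Rules

variable {ι κ : Type*} [MeasurableSpace ι] [MeasurableSpace κ] {α β : Type} [MeasurableSpace α]
  [MeasurableSpace β]

variable {E}

theorem MeasFam.comp {p : ι → Prog X A d α} (hp : E.MeasFam p) {g : κ → ι} (hg : Measurable g) :
    E.MeasFam fun j => p (g j) :=
  Measurable.comp (g := fun q : ι × (ℕ → Episode X Ξ) => E.eval (p q.1) q.2) hp
    ((hg.comp measurable_fst).prodMk measurable_snd)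

theorem MeasFam.prog {p : ι → Prog X A d α} (hp : E.MeasFam p) (i : ι) : E.MeasProg (p i) :=
  Measurable.comp (g := fun q : ι × (ℕ → Episode X Ξ) => E.eval (p q.1) q.2) hp
    measurable_prodMk_left

theorem MeasProg.fam {p : Prog X A d α} (hp : E.MeasProg p) : E.MeasFam fun _ : ι => p :=
  Measurable.comp (g := E.eval p) hp measurable_snd

theorem MeasFam.done {f : ι → α} (hf : Measurable f) :
    E.MeasFam fun i => (Prog.done (f i) : Prog X A d α) :=
  (hf.comp measurable_fst).prodMk measurable_snd

theorem MeasFam.bind {p : ι → Prog X A d α} {f : ι → α → Prog X A d β} (hp : E.MeasFam p)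
    (hf : E.MeasFam fun q : ι × α => f q.1 q.2) : E.MeasFam fun i => (p i).bind (f i) := by
  have h := Measurable.comp (g := fun q : (ι × α) × (ℕ → Episode X Ξ) => E.eval (f q.1.1 q.1.2) q.2)
    hf (f := fun q : ι × (ℕ → Episode X Ξ) => ((q.1, (E.eval (p q.1) q.2).1),
      (E.eval (p q.1) q.2).2))
    ((measurable_fst.prodMk (Measurable.fst hp)).prodMk (Measurable.snd hp))
  unfold MeasFam
  simp only [eval_bind]
  exact h

theorem MeasFam.feature {h : ℕ} (hh : h < E.H) {x : ι → X} {a : ι → A} {k : ι → Vec d → Prog X A d α}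
    (hx : Measurable x) (ha : Measurable a) (hk : E.MeasFam fun q : ι × Vec d => k q.1 q.2) :
    E.MeasFam fun i => Prog.feature h (x i) (a i) (k i) := by
  have h1 := (E.meas.feature h hh).comp (hx.prodMk ha)
  exact Measurable.comp (g := fun q : (ι × Vec d) × (ℕ → Episode X Ξ) => E.eval (k q.1.1 q.1.2) q.2)
    hk ((measurable_fst.prodMk (h1.comp measurable_fst)).prodMk measurable_snd)

theorem MeasFam.argmax {h : ℕ} (hh : h < E.H) {x : ι → X} {θ : ι → Vec d}
    {k : ι → A → Prog X A d α} (hx : Measurable x) (hθ : Measurable θ)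
    (hk : E.MeasFam fun q : ι × A => k q.1 q.2) :
    E.MeasFam fun i => Prog.argmax h (x i) (θ i) (k i) := by
  have h1 := (E.meas.argmax h hh).comp (hx.prodMk hθ)
  exact Measurable.comp (g := fun q : (ι × A) × (ℕ → Episode X Ξ) => E.eval (k q.1.1 q.1.2) q.2)
    hk ((measurable_fst.prodMk (h1.comp measurable_fst)).prodMk measurable_snd)

theorem MeasFam.compute {c : ι → ℕ} {f : ι → α} (hf : Measurable f) :
    E.MeasFam fun i => (LBC.compute (c i) (f i) : Prog X A d α) :=
  MeasFam.done (E := E) hf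

end Rules

/-- The state of layer `h` depends measurably on policy parameters and initial state. -/
theorem measurable_state {h : ℕ} (hh : h < E.H) :
    Measurable fun q : Param d × X => E.M.state (greedy E.amax q.1) q.2 h := by
  induction h with
  | zero => exact measurable_snd
  | succ h ih =>
    have h1 := ih (by omega)
    have h2 := (E.meas.argmax h (by omega)).comp (h1.prodMk
      ((measurable_pi_apply h).comp measurable_fst))
    exact (E.meas.next h (by omega)).comp (h1.prodMk h2)

/-- So does the action of layer `h`. -/
theorem measurable_action {h : ℕ} (hh : h < E.H) :
    Measurable fun q : Param d × X => greedy E.amax q.1 h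
      (E.M.state (greedy E.amax q.1) q.2 h) :=
  (E.meas.argmax h hh).comp ((E.measurable_state hh).prodMk
      ((measurable_pi_apply h).comp measurable_fst))

section Rules

variable {ι κ : Type*} [MeasurableSpace ι] [MeasurableSpace κ] {α β : Type} [MeasurableSpace α]
  [MeasurableSpace β]

variable {E}

theorem MeasFam.episode {h : ℕ} (hh : h < E.H) {θ : ι → Param d}
    {k : ι → X → A → ℝ → X → Prog X A d α} (hθ : Measurable θ)
    (hk : E.MeasFam fun q : ι × X × A × ℝ × X => k q.1 q.2.1 q.2.2.1 q.2.2.2.1 q.2.2.2.2) :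
    E.MeasFam fun i => Prog.episode (θ i) h (k i) := by
  have h0 : Measurable fun q : ι × (ℕ → Episode X Ξ) => (θ q.1, (q.2 0).1) := by fun_prop
  have h1 := (E.measurable_state hh).comp h0
  have h2 := (E.measurable_action hh).comp h0
  have h3 := (E.meas.next h hh).comp (h1.prodMk h2)
  have h4 := (E.meas.reward h hh).comp ((h1.prodMk h2).prodMk
    (by fun_prop : Measurable fun q : ι × (ℕ → Episode X Ξ) => (q.2 0).2 h))
  exact Measurable.comp (g := fun q : (ι × X × A × ℝ × X) × (ℕ → Episode X Ξ) =>
      E.eval (k q.1.1 q.1.2.1 q.1.2.2.1 q.1.2.2.2.1 q.1.2.2.2.2) q.2) hk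
    ((measurable_fst.prodMk (h1.prodMk (h2.prodMk (h4.prodMk h3)))).prodMk (by fun_prop))

theorem MeasFam.repeatProg {p : ι → Prog X A d α} (hp : E.MeasFam p) (n : ℕ) :
    E.MeasFam fun i => LBC.repeatProg (p i) n := by
  induction n with
  | zero => exact MeasFam.done measurable_const
  | succ n ih =>
    refine MeasFam.bind hp ?_
    refine MeasFam.bind (ih.comp measurable_fst) ?_
    exact MeasFam.done (by fun_prop)

theorem MeasFam.forProg {κ : Type} [MeasurableSpace κ] {f : ι → κ → Prog X A d α} {l : ι → List κ}
    (hf : E.MeasFam fun q : ι × κ => f q.1 q.2) (hl : Measurable l) :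
    E.MeasFam fun i => LBC.forProg (f i) (l i) := by
  have h : Measurable fun p : List κ × (ι × (ℕ → Episode X Ξ)) =>
      E.eval (LBC.forProg (f p.2.1) p.1) p.2.2 := by
    refine measurable_list_of_cons ?_ fun n ih => ?_
    · exact MeasFam.done (E := E) (f := fun _ : ι => ([] : List α)) measurable_const
    · have hrec : E.MeasFam fun q : (Fin n → κ) × ι => LBC.forProg (f q.2) (List.ofFn q.1) :=
        ih.comp (by fun_prop : Measurable fun p : ((Fin n → κ) × ι) × (ℕ → Episode X Ξ) =>
          (p.1.1, p.1.2, p.2))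
      have h2 : E.MeasFam fun q : κ × (Fin n → κ) × ι =>
          LBC.forProg (f q.2.2) (q.1 :: List.ofFn q.2.1) := by
        refine MeasFam.bind (hf.comp (g := fun q : κ × (Fin n → κ) × ι => (q.2.2, q.1))
          (by fun_prop)) ?_
        refine MeasFam.bind (hrec.comp
          (g := fun q : (κ × (Fin n → κ) × ι) × α => (q.1.2.1, q.1.2.2)) (by fun_prop)) ?_
        exact MeasFam.done (by fun_prop)
      exact Measurable.comp (g := fun q : (κ × (Fin n → κ) × ι) × (ℕ → Episode X Ξ) =>
        E.eval (LBC.forProg (f q.1.2.2) (q.1.1 :: List.ofFn q.1.2.1)) q.2) h2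
        (by fun_prop : Measurable fun p : κ × (Fin n → κ) × ι × (ℕ → Episode X Ξ) =>
          ((p.1, p.2.1, p.2.2.1), p.2.2.2))
  exact h.comp (f := fun q : ι × (ℕ → Episode X Ξ) => (l q.1, q.1, q.2)) (by fun_prop)

theorem MeasFam.ite {c : ι → Prop} [DecidablePred c] {p q : ι → Prog X A d α}
    (hc : MeasurableSet {i | c i}) (hp : E.MeasFam p) (hq : E.MeasFam q) :
    E.MeasFam fun i => if c i then p i else q i := by
  have h : (fun r : ι × (ℕ → Episode X Ξ) => E.eval (if c r.1 then p r.1 else q r.1) r.2) =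
      fun r => if c r.1 then E.eval (p r.1) r.2 else E.eval (q r.1) r.2 := by
    funext r; split_ifs <;> rfl
  unfold MeasFam
  rw [h]
  exact Measurable.ite (measurable_fst hc) hp hq

theorem MeasFam.option {o : ι → Option κ} {p : ι → κ → Prog X A d α} {q : ι → Prog X A d α}
    (ho : Measurable o) (hp : E.MeasFam fun r : ι × κ => p r.1 r.2) (hq : E.MeasFam q) :
    E.MeasFam fun i => (Option.elim (o i) (q i) (p i) : Prog X A d α) := by
  have h : Measurable fun r : Option κ × (ι × (ℕ → Episode X Ξ)) =>
      E.eval (Option.elim r.1 (q r.2.1) (p r.2.1)) r.2.2 :=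
    measurable_option_of_cases (Measurable.comp
      (g := fun q : (ι × κ) × (ℕ → Episode X Ξ) => E.eval (p q.1.1 q.1.2) q.2) hp (by fun_prop :
      Measurable fun r : κ × (ι × (ℕ → Episode X Ξ)) => ((r.2.1, r.1), r.2.2))) hq
  exact h.comp (f := fun r : ι × (ℕ → Episode X Ξ) => (o r.1, r.1, r.2)) (by fun_prop)

theorem MeasProg.dist_apply {p : Prog X A d α} (hp : E.MeasProg p) {B : Set α}
    (hB : MeasurableSet B) : E.dist p B = E.law {ω | (E.eval p ω).1 ∈ B} :=
  Measure.map_apply (Measurable.fst hp) hB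

theorem MeasProg.isProb {p : Prog X A d α} (hp : E.MeasProg p) :
    IsProbabilityMeasure (E.dist p) :=
  Measure.isProbabilityMeasure_map (Measurable.fst hp).aemeasurable

theorem MeasFam.measurable_dist {p : ι → Prog X A d α} (hp : E.MeasFam p) :
    Measurable fun i => E.dist (p i) := by
  refine Measure.measurable_of_measurable_coe _ fun B hB => ?_
  simp only [(hp.prog _).dist_apply hB]
  exact measurable_measure_prodMk_left (ν := E.law) ((Measurable.fst hp) hB)

theorem eval_consEpisode_measurable {θ : Param d} {h : ℕ} {k : X → A → ℝ → X → Prog X A d α}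
    (hp : E.MeasProg (Prog.episode θ h k)) :
    Measurable fun q : Episode X Ξ × (ℕ → Episode X Ξ) =>
      E.eval (Prog.episode θ h k) (consEpisode q) :=
  Measurable.comp hp measurable_consEpisode

theorem lintegral_law_cons {G : (ℕ → Episode X Ξ) → ENNReal} (hG : Measurable G) :
    ∫⁻ ω, G ω ∂E.law = ∫⁻ e, ∫⁻ ω, G (consEpisode (e, ω)) ∂E.law ∂E.M.episodeLaw := by
  have h : (E.M.episodeLaw.prod E.law).map consEpisode = E.law := law_cons E.M
  conv_lhs => rw [← h]
  rw [lintegral_map hG measurable_consEpisode, lintegral_prod]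
  exact (hG.comp measurable_consEpisode).aemeasurable

/-- Strong Markov property: the randomness that a program leaves is independent of its output and
has the law of fresh randomness. -/
theorem law_map_eval {p : Prog X A d α} (hp : E.MeasProg p) :
    E.law.map (E.eval p) = (E.dist p).prod E.law := by
  induction p with
  | done a =>
    have h1 : E.eval (Prog.done a : Prog X A d α) = fun ω => (a, ω) := rfl
    have h2 : E.dist (Prog.done a : Prog X A d α) = Measure.dirac a := by
      unfold dist; simp [h1]
    rw [h2, Measure.dirac_prod, h1]
  | episode θ h k ih =>
    have hq := eval_consEpisode_measurable hp
    have := hp.isProb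
    ext S hS
    rw [Measure.map_apply hp hS, Measure.prod_apply hS]
    have hm := measurable_measure_prodMk_left (ν := E.law) hS
    unfold dist
    rw [lintegral_map hm (Measurable.fst hp), ← lintegral_indicator_one (hp hS),
      lintegral_law_cons (measurable_one.indicator (hp hS)),
      lintegral_law_cons (G := fun ω => E.law (Prod.mk (E.eval (Prog.episode θ h k) ω).1 ⁻¹' S))
        (hm.comp (Measurable.fst hp))]
    refine lintegral_congr fun e => ?_
    have he : E.MeasProg (k (E.M.state (greedy E.amax θ) e.1 h)
        (greedy E.amax θ h (E.M.state (greedy E.amax θ) e.1 h))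
        (E.M.reward h (E.M.state (greedy E.amax θ) e.1 h)
          (greedy E.amax θ h (E.M.state (greedy E.amax θ) e.1 h)) (e.2 h))
        (E.M.next h (E.M.state (greedy E.amax θ) e.1 h)
          (greedy E.amax θ h (E.M.state (greedy E.amax θ) e.1 h)))) :=
      hq.comp (measurable_prodMk_left (x := e))
    have h2 := congrArg (fun m => m S) (ih _ _ _ _ he)
    have := he.isProb
    rw [Measure.map_apply he hS, Measure.prod_apply hS] at h2
    unfold dist at h2
    rw [lintegral_map hm (Measurable.fst he), ← lintegral_indicator_one (he hS)] at h2
    exact h2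
  | feature h x a k ih => exact ih _ hp
  | argmax h x θ k ih => exact ih _ hp
  | tick c k ih => exact ih hp

theorem dist_bind {p : Prog X A d α} {f : α → Prog X A d β} (hp : E.MeasProg p)
    (hf : E.MeasFam f) : E.dist (p.bind f) = (E.dist p).bind fun a => E.dist (f a) := by
  have := hp.isProb
  have h1 : E.dist (p.bind f) = ((E.dist p).prod E.law).map fun q => (E.eval (f q.1) q.2).1 := by
    rw [← law_map_eval hp, Measure.map_map (Measurable.fst hf) hp]
    unfold dist
    simp only [eval_bind]
    rfl
  rw [h1]
  ext B hB
  rw [Measure.map_apply (Measurable.fst hf) hB, Measure.prod_apply ((Measurable.fst hf) hB),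
    Measure.bind_apply hB hf.measurable_dist.aemeasurable]
  refine lintegral_congr fun a => ?_
  rw [(hf.prog a).dist_apply hB]
  rfl

theorem lintegral_dist_bind {p : Prog X A d α} {f : α → Prog X A d β} (hp : E.MeasProg p)
    (hf : E.MeasFam f) {G : β → ENNReal} (hG : Measurable G) :
    ∫⁻ b, G b ∂E.dist (p.bind f) = ∫⁻ a, ∫⁻ b, G b ∂E.dist (f a) ∂E.dist p := by
  rw [dist_bind hp hf, Measure.lintegral_bind hf.measurable_dist.aemeasurable hG.aemeasurable]

theorem dist_done (a : α) : E.dist (Prog.done a : Prog X A d α) = Measure.dirac a := by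
  unfold dist eval; simp

theorem dist_compute (c : ℕ) (a : α) : E.dist (LBC.compute c a : Prog X A d α) = Measure.dirac a :=
  dist_done a

variable (E)

/-- Up to probability `b`, the output of `p` satisfies `P`. No measurability of `P` is required:
the probability of the complement is understood as an inner measure, which is what composes well
under sequential composition. -/
def Sat (p : Prog X A d α) (b : ENNReal) (P : α → Prop) : Prop :=
  ∀ B : Set α, MeasurableSet B → (∀ a ∈ B, ¬ P a) → E.dist p B ≤ b

variable {E}

theorem Sat.mono {p : Prog X A d α} {b b' : ENNReal} {P Q : α → Prop} (h : E.Sat p b P)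
    (hb : b ≤ b') (hPQ : ∀ a, P a → Q a) : E.Sat p b' Q :=
  fun B hB hd => (h B hB fun a ha hPa => hd a ha (hPQ a hPa)).trans hb

theorem Sat.bind {p : Prog X A d α} {f : α → Prog X A d β} {b c : ENNReal} {P : α → Prop}
    {Q : β → Prop} (hp : E.MeasProg p) (hf : E.MeasFam f) (h : E.Sat p b P)
    (h' : ∀ a, P a → E.Sat (f a) c Q) : E.Sat (p.bind f) (b + c) Q := by
  intro B hB hd
  have := hp.isProb
  have hm : Measurable fun a => E.dist (f a) B := (Measure.measurable_coe hB).comp hf.measurable_dist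
  rw [dist_bind hp hf, Measure.bind_apply hB hf.measurable_dist.aemeasurable]
  have hS : MeasurableSet {a | c < E.dist (f a) B} := measurableSet_lt measurable_const hm
  have h1 : E.dist p {a | c < E.dist (f a) B} ≤ b :=
    h _ hS fun a ha hP => (not_le.2 ha) (h' a hP B hB hd)
  calc ∫⁻ a, E.dist (f a) B ∂E.dist p
      ≤ ∫⁻ a, ({a | c < E.dist (f a) B}.indicator 1 a + c) ∂E.dist p := by
        refine lintegral_mono fun a => ?_
        by_cases ha : c < E.dist (f a) B
        · have := (hf.prog a).isProb
          rw [Set.indicator_of_mem (by exact ha)]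
          exact prob_le_one.trans (le_self_add)
        · exact (not_lt.1 ha).trans le_add_self
    _ = E.dist p {a | c < E.dist (f a) B} + c := by
        rw [lintegral_add_right _ measurable_const, lintegral_indicator_one hS]
        simp
    _ ≤ b + c := by gcongr

theorem Sat.of_forall {p : Prog X A d α} {P : α → Prop} (hp : E.MeasProg p)
    (h : ∀ ω, P (E.eval p ω).1) : E.Sat p 0 P := by
  intro B hB hd
  rw [hp.dist_apply hB]
  have : {ω | (E.eval p ω).1 ∈ B} = ∅ := by
    ext ω; simpa using fun hω => hd _ hω (h ω)
  simp [this]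

theorem Sat.done {a : α} {P : α → Prop} (h : P a) : E.Sat (Prog.done a : Prog X A d α) 0 P :=
  Sat.of_forall (MeasFam.prog (ι := Unit) (MeasFam.done measurable_const) ()) fun _ => h

theorem Sat.pure {a : α} {b : ENNReal} {P : α → Prop} (h : P a) :
    E.Sat (Prog.done a : Prog X A d α) b P := (Sat.done h).mono zero_le fun _ h => h

theorem Sat.compute {c : ℕ} {a : α} {P : α → Prop} (h : P a) :
    E.Sat (LBC.compute c a : Prog X A d α) 0 P := Sat.done h

theorem Sat.compute_bind {c : ℕ} {a : α} {f : α → Prog X A d β} {b : ENNReal} {P : β → Prop}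
    (h : E.Sat (f a) b P) : E.Sat ((LBC.compute c a).bind f) b P := h

theorem Sat.of_dist_le {p : Prog X A d α} {b : ENNReal} {P : α → Prop}
    (h : E.dist p {a | ¬ P a} ≤ b) : E.Sat p b P :=
  fun _ _ hd => (measure_mono hd).trans h

theorem Sat.and {p : Prog X A d α} {b c : ENNReal} {P Q : α → Prop} (h : E.Sat p b P)
    (h' : E.Sat p c Q) (hQ : MeasurableSet {a | Q a}) : E.Sat p (b + c) fun a => P a ∧ Q a := by
  intro B hB hd
  have h1 : B ⊆ (B ∩ {a | Q a}) ∪ {a | Q a}ᶜ := by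
    intro a ha
    by_cases hq : Q a
    · exact Or.inl ⟨ha, hq⟩
    · exact Or.inr hq
  refine (measure_mono h1).trans ((measure_union_le _ _).trans ?_)
  exact add_le_add (h _ (hB.inter hQ) fun a ha hP => hd a ha.1 ⟨hP, ha.2⟩)
    (h' _ hQ.compl fun a ha => ha)

theorem Sat.forProg {κ : Type} {f : κ → Prog X A d α} {b : ENNReal} {P : κ → α → Prop} {l : List κ}
    (hf : ∀ k ∈ l, E.MeasProg (f k)) (h : ∀ k ∈ l, E.Sat (f k) b (P k)) :
    E.Sat (LBC.forProg f l) (l.length * b) (List.Forall₂ P l) := by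
  induction l with
  | nil => exact (Sat.done List.Forall₂.nil).mono (by simp) fun _ h => h
  | cons k l ih =>
    have hfl : E.MeasFam fun _ : Unit => LBC.forProg f l := by
      clear ih h
      induction l with
      | nil => exact MeasFam.done measurable_const
      | cons k' l ih' =>
        refine MeasFam.bind (MeasProg.fam (hf _ (by simp))) ?_
        refine MeasFam.bind (MeasFam.comp (ih' fun a ha => hf a (by
          simp only [List.mem_cons] at ha ⊢; tauto)) (g := fun _ => ()) measurable_const) ?_
        exact MeasFam.done (by fun_prop)
    have h2 : E.Sat (LBC.forProg f l) (l.length * b) (List.Forall₂ P l) :=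
      ih (fun a ha => hf a (by simp [ha])) (fun a ha => h a (by simp [ha]))
    have h3 : E.Sat (LBC.forProg f (k :: l)) (b + (l.length * b + 0))
        (List.Forall₂ P (k :: l)) := by
      refine Sat.bind (hf k (by simp)) ?_ (h k (by simp)) fun a ha => ?_
      · exact MeasFam.bind (MeasFam.comp hfl (g := fun _ => ()) measurable_const)
          (MeasFam.done (by fun_prop))
      · refine Sat.bind (hfl.prog ()) (MeasFam.done (by fun_prop)) h2 fun l' hl' => ?_
        exact Sat.done (List.Forall₂.cons ha hl')
    refine h3.mono ?_ fun _ h => h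
    rw [List.length_cons]; push_cast; rw [add_mul, one_mul, add_zero, add_comm]

end Rules

end Setting

/-! ### Gram-Schmidt lists -/

section GramSchmidt

variable {d : ℕ} {J : Type*} [MeasurableSpace J]

/-- Linear span of the elements of a list. -/
def lspan (Q : List (Vec d)) : Submodule ℝ (Vec d) := Submodule.span ℝ {z | z ∈ Q}

theorem mem_lspan {Q : List (Vec d)} {q : Vec d} (h : q ∈ Q) : q ∈ lspan Q :=
  Submodule.subset_span h

@[simp] theorem lspan_nil : lspan ([] : List (Vec d)) = ⊥ := by simp [lspan]

theorem lspan_cons (y : Vec d) (Q : List (Vec d)) :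
    lspan (y :: Q) = Submodule.span ℝ {y} ⊔ lspan Q := by
  unfold lspan; rw [← Submodule.span_union]; congr 1; ext; simp

theorem lspan_append (P Q : List (Vec d)) : lspan (P ++ Q) = lspan P ⊔ lspan Q := by
  unfold lspan; rw [← Submodule.span_union]; congr 1; ext; simp

/-- Orthonormal lists. -/
def ONList (Q : List (Vec d)) : Prop :=
  (∀ q ∈ Q, ‖q‖ = 1) ∧ Q.Pairwise fun p q => inner ℝ p q = 0

theorem inner_projSum_eq_zero {Q : List (Vec d)} {v y : Vec d} (h : ∀ q ∈ Q, inner ℝ v q = 0) :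
    inner ℝ v (Q.map fun q => (inner ℝ q y : ℝ) • q).sum = 0 := by
  induction Q with
  | nil => simp
  | cons a Q ih =>
    simp only [List.map_cons, List.sum_cons, inner_add_right, inner_smul_right]
    rw [ih fun q hq => h q (by simp [hq]), h a (by simp)]; simp

theorem inner_projSum {Q : List (Vec d)} (hQ : ONList Q) {p y : Vec d} (hp : p ∈ Q) :
    inner ℝ p (Q.map fun q => (inner ℝ q y : ℝ) • q).sum = inner ℝ p y := by
  induction Q with
  | nil => simp at hp
  | cons a Q ih =>
    have hQ' : ONList Q := ⟨fun q hq => hQ.1 q (by simp [hq]), (List.pairwise_cons.1 hQ.2).2⟩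
    have ha := (List.pairwise_cons.1 hQ.2).1
    simp only [List.map_cons, List.sum_cons, inner_add_right, inner_smul_right]
    rcases List.mem_cons.1 hp with rfl | hp
    · rw [inner_projSum_eq_zero ha, real_inner_self_eq_norm_sq, hQ.1 p (by simp)]; simp
    · rw [ih hQ' hp, real_inner_comm a p, ha p hp]; simp

theorem projSum_mem (Q : List (Vec d)) (y : Vec d) :
    (Q.map fun q => (inner ℝ q y : ℝ) • q).sum ∈ lspan Q := by
  refine list_sum_mem fun z hz => ?_
  obtain ⟨q, hq, rfl⟩ := List.mem_map.1 hz
  exact Submodule.smul_mem _ _ (mem_lspan hq)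

theorem inner_resid {Q : List (Vec d)} (hQ : ONList Q) {p : Vec d} (hp : p ∈ Q) (y : Vec d) :
    inner ℝ p (resid Q y) = 0 := by
  unfold resid; rw [inner_sub_right, inner_projSum hQ hp, sub_self]

theorem inner_resid_of_mem {Q : List (Vec d)} (hQ : ONList Q) {z : Vec d} (hz : z ∈ lspan Q)
    (y : Vec d) : inner ℝ z (resid Q y) = 0 := by
  unfold lspan at hz
  induction hz using Submodule.span_induction with
  | mem x hx => exact inner_resid hQ hx y
  | zero => simp
  | add a b _ _ ha hb => rw [inner_add_left, ha, hb, add_zero]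
  | smul c a _ ha => rw [real_inner_smul_left, ha, mul_zero]

theorem resid_eq_zero_iff {Q : List (Vec d)} (hQ : ONList Q) (y : Vec d) :
    resid Q y = 0 ↔ y ∈ lspan Q := by
  constructor
  · intro h
    rw [sub_eq_zero.1 h]; exact projSum_mem Q y
  · intro h
    have h1 : resid Q y ∈ lspan Q := Submodule.sub_mem _ h (projSum_mem Q y)
    exact inner_self_eq_zero.1 (inner_resid_of_mem hQ h1 y)

theorem span_resid (Q : List (Vec d)) (y : Vec d) (U : Submodule ℝ (Vec d)) (hU : lspan Q ≤ U) :
    U ⊔ Submodule.span ℝ {resid Q y} = U ⊔ Submodule.span ℝ {y} := by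
  have hs := hU (projSum_mem Q y)
  apply le_antisymm
  · refine sup_le le_sup_left ((Submodule.span_singleton_le_iff_mem _ _).2 ?_)
    exact Submodule.sub_mem _ ((le_sup_right : _ ≤ U ⊔ Submodule.span ℝ {y})
      (Submodule.mem_span_singleton_self y)) ((le_sup_left : U ≤ _) hs)
  · refine sup_le le_sup_left ((Submodule.span_singleton_le_iff_mem _ _).2 ?_)
    have : y = resid Q y + (Q.map fun q => (inner ℝ q y : ℝ) • q).sum := by unfold resid; abel
    have h2 : resid Q y + (Q.map fun q => (inner ℝ q y : ℝ) • q).sum ∈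
        U ⊔ Submodule.span ℝ {resid Q y} := Submodule.add_mem _
      ((le_sup_right : _ ≤ U ⊔ Submodule.span ℝ {resid Q y})
        (Submodule.mem_span_singleton_self _)) ((le_sup_left : U ≤ _) hs)
    rwa [← this] at h2

theorem gsStep_of_mem {Q : List (Vec d)} (hQ : ONList Q) {y : Vec d} (hy : y ∈ lspan Q) :
    gsStep Q y = Q := by
  unfold gsStep; rw [if_pos ((resid_eq_zero_iff hQ y).2 hy)]

theorem gsStep_of_notMem {Q : List (Vec d)} (hQ : ONList Q) {y : Vec d} (hy : y ∉ lspan Q) :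
    gsStep Q y = Q ++ [‖resid Q y‖⁻¹ • resid Q y] := by
  unfold gsStep; rw [if_neg (mt (resid_eq_zero_iff hQ y).1 hy)]

theorem onList_gsStep {Q : List (Vec d)} (hQ : ONList Q) (y : Vec d) : ONList (gsStep Q y) := by
  unfold gsStep
  split_ifs with h
  · exact hQ
  · constructor
    · intro q hq
      rcases List.mem_append.1 hq with hq | hq
      · exact hQ.1 q hq
      · rw [List.mem_singleton.1 hq, norm_smul, norm_inv, norm_norm,
          inv_mul_cancel₀ (norm_ne_zero_iff.2 h)]
    · rw [List.pairwise_append]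
      refine ⟨hQ.2, List.pairwise_singleton _ _, fun a ha b hb => ?_⟩
      rw [List.mem_singleton.1 hb, inner_smul_right, inner_resid hQ ha, mul_zero]

theorem lspan_gsStep {Q : List (Vec d)} (hQ : ONList Q) (y : Vec d) :
    lspan (gsStep Q y) = lspan Q ⊔ Submodule.span ℝ {y} := by
  by_cases hy : y ∈ lspan Q
  · rw [gsStep_of_mem hQ hy, sup_eq_left.2 ((Submodule.span_singleton_le_iff_mem _ _).2 hy)]
  · rw [gsStep_of_notMem hQ hy, lspan_append, lspan_cons, lspan_nil, sup_bot_eq,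
      ← span_resid Q y _ le_rfl]
    congr 1
    refine Submodule.span_singleton_smul_eq (IsUnit.mk0 _ ?_) _
    exact inv_ne_zero (norm_ne_zero_iff.2 (mt (resid_eq_zero_iff hQ y).1 hy))

theorem prefix_gsStep (Q : List (Vec d)) (y : Vec d) : Q <+: gsStep Q y := by
  unfold gsStep; split_ifs
  · exact List.prefix_rfl
  · exact List.prefix_append _ _

theorem length_gsStep_le (Q : List (Vec d)) (y : Vec d) : (gsStep Q y).length ≤ Q.length + 1 := by
  unfold gsStep; split_ifs <;> simp

theorem foldl_gsStep {Q : List (Vec d)} (hQ : ONList Q) (l : List (Vec d)) :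
    ONList (l.foldl gsStep Q) ∧ lspan (l.foldl gsStep Q) = lspan Q ⊔ lspan l := by
  induction l generalizing Q with
  | nil => simp [hQ]
  | cons a l ih =>
    have h := ih (onList_gsStep hQ a)
    refine ⟨h.1, ?_⟩
    rw [List.foldl_cons, h.2, lspan_gsStep hQ, lspan_cons, sup_assoc]

theorem prefix_foldl_gsStep (Q l : List (Vec d)) : Q <+: l.foldl gsStep Q := by
  induction l generalizing Q with
  | nil => exact List.prefix_rfl
  | cons a l ih => exact (prefix_gsStep Q a).trans (ih _)

theorem length_foldl_gsStep_le (Q l : List (Vec d)) :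
    (l.foldl gsStep Q).length ≤ Q.length + l.length := by
  induction l generalizing Q with
  | nil => simp
  | cons a l ih =>
    have := ih (gsStep Q a)
    have := length_gsStep_le Q a
    simp only [List.foldl_cons, List.length_cons]; omega

theorem onList_nil : ONList ([] : List (Vec d)) := ⟨by simp, List.Pairwise.nil⟩

theorem mem_lspan_iff_resid (W : List (Vec d)) (y : Vec d) :
    y ∈ lspan W ↔ resid (W.foldl gsStep []) y = 0 := by
  have h := foldl_gsStep onList_nil W
  rw [resid_eq_zero_iff h.1, h.2]; simp

theorem length_complBasis_le (Q : List (Vec d)) : (complBasis Q).length ≤ d := by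
  unfold complBasis
  have := length_foldl_gsStep_le Q
    ((List.finRange d).map fun j => EuclideanSpace.single j (1 : ℝ))
  rw [List.length_drop]
  simp only [List.length_map, List.length_finRange] at this
  omega

theorem append_complBasis (Q : List (Vec d)) : Q ++ complBasis Q =
    ((List.finRange d).map fun j => EuclideanSpace.single j (1 : ℝ)).foldl gsStep Q := by
  obtain ⟨t, ht⟩ := prefix_foldl_gsStep Q
    ((List.finRange d).map fun j => EuclideanSpace.single j (1 : ℝ))
  unfold complBasis
  rw [← ht]; simp

theorem lspan_standard :
    lspan ((List.finRange d).map fun j => EuclideanSpace.single j (1 : ℝ)) = ⊤ := by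
  have h := (EuclideanSpace.basisFun (Fin d) ℝ).toBasis.span_eq
  rw [← h]; unfold lspan; congr 1
  ext z; simp

theorem onList_append_complBasis {Q : List (Vec d)} (hQ : ONList Q) :
    ONList (Q ++ complBasis Q) := by
  rw [append_complBasis]; exact (foldl_gsStep hQ _).1

theorem lspan_append_complBasis {Q : List (Vec d)} (hQ : ONList Q) :
    lspan (Q ++ complBasis Q) = ⊤ := by
  rw [append_complBasis, (foldl_gsStep hQ _).2, lspan_standard]; simp

theorem inner_complBasis {Q : List (Vec d)} (hQ : ONList Q) {b y : Vec d} (hb : b ∈ complBasis Q)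
    (hy : y ∈ lspan Q) : inner ℝ y b = 0 := by
  have h := (List.pairwise_append.1 (onList_append_complBasis hQ).2).2.2
  unfold lspan at hy
  induction hy using Submodule.span_induction with
  | mem x hx => exact h x hx b hb
  | zero => simp
  | add a b _ _ ha hb => rw [inner_add_left, ha, hb, add_zero]
  | smul c a _ ha => rw [real_inner_smul_left, ha, mul_zero]

theorem exists_complBasis {Q : List (Vec d)} (hQ : ONList Q) {y : Vec d} (hy : y ∉ lspan Q) :
    ∃ b ∈ complBasis Q, inner ℝ y b ≠ 0 := by
  by_contra! h
  have h1 : resid Q y ≠ 0 := mt (resid_eq_zero_iff hQ y).1 hy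
  apply h1
  have h2 : resid Q y ∈ lspan (Q ++ complBasis Q) := by
    rw [lspan_append_complBasis hQ]; trivial
  have h3 : ∀ z ∈ lspan (Q ++ complBasis Q), inner ℝ z (resid Q y) = 0 := by
    intro z hz
    rw [lspan_append] at hz
    obtain ⟨p, hp, q, hq, rfl⟩ := Submodule.mem_sup.1 hz
    rw [inner_add_left, inner_resid_of_mem hQ hp, zero_add]
    unfold lspan at hq
    induction hq using Submodule.span_induction with
    | mem x hx =>
      unfold resid
      rw [inner_sub_right, real_inner_comm, h x hx, real_inner_comm,
        inner_complBasis hQ hx (projSum_mem Q y), sub_zero]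
    | zero => simp
    | add a b ha' hb' ha hb =>
      rw [inner_add_left, ha (Submodule.add_mem _ (by exact Submodule.mem_sup_left hp)
        (by exact Submodule.mem_sup_right ha')), hb (Submodule.add_mem _
          (by exact Submodule.mem_sup_left hp) (by exact Submodule.mem_sup_right hb')), add_zero]
    | smul c a ha' ha =>
      rw [real_inner_smul_left, ha (Submodule.add_mem _ (by exact Submodule.mem_sup_left hp)
        (by exact Submodule.mem_sup_right ha')), mul_zero]
  exact inner_self_eq_zero.1 (h3 _ h2)

theorem ONList.orthonormal {Q : List (Vec d)} (hQ : ONList Q) :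
    Orthonormal ℝ fun i : Fin Q.length => Q.get i := by
  refine ⟨fun i => hQ.1 _ (List.get_mem _ _), fun i j hij => ?_⟩
  have hp := List.pairwise_iff_getElem.1 hQ.2
  rcases lt_or_gt_of_ne (fun h => hij (Fin.ext h) : (i : ℕ) ≠ j) with h | h
  · exact hp i j i.2 j.2 h
  · change inner ℝ (Q.get i) (Q.get j) = 0
    rw [real_inner_comm]; exact hp j i j.2 i.2 h

theorem ONList.length_le {Q : List (Vec d)} (hQ : ONList Q) : Q.length ≤ d := by
  simpa using hQ.orthonormal.linearIndependent.fintype_card_le_finrank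

@[fun_prop]
theorem _root_.Measurable.resid {Q : J → List (Vec d)} {y : J → Vec d} (hQ : Measurable Q)
    (hy : Measurable y) : Measurable fun j => resid (Q j) (y j) := by
  unfold LBC.resid
  refine hy.sub (Measurable.list_sum (Measurable.list_map ?_ hQ))
  fun_prop

@[fun_prop]
theorem _root_.Measurable.gsStep {Q : J → List (Vec d)} {y : J → Vec d} (hQ : Measurable Q)
    (hy : Measurable y) : Measurable fun j => gsStep (Q j) (y j) := by
  unfold LBC.gsStep
  refine Measurable.ite ?_ hQ (by fun_prop)
  exact (hQ.resid hy) (measurableSet_singleton 0)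

@[fun_prop]
theorem _root_.Measurable.complBasis {Q : J → List (Vec d)} (hQ : Measurable Q) :
    Measurable fun j => complBasis (Q j) := by
  have h : (fun j => LBC.complBasis (Q j)) = fun j => (((List.finRange d).map fun j =>
      EuclideanSpace.single j (1 : ℝ)).foldl gsStep (Q j)).drop (Q j).length := rfl
  rw [h]
  have h1 : Measurable fun j => (((List.finRange d).map fun j =>
      EuclideanSpace.single j (1 : ℝ)).foldl gsStep (Q j)) :=
    Measurable.list_foldl (f := fun _ => gsStep) (by fun_prop) measurable_const hQ
  have h2 : Measurable fun p : List (Vec d) × ℕ => p.1.drop p.2 :=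
    measurable_from_prod_countable_left fun n => by exact Measurable.list_drop n measurable_id
  exact h2.comp (h1.prodMk (by fun_prop))

theorem measurableSet_mem_lspan {y : J → Vec d} {W : J → List (Vec d)} (hy : Measurable y)
    (hW : Measurable W) : MeasurableSet {j | y j ∈ lspan (W j)} := by
  simp only [mem_lspan_iff_resid]
  have h1 : Measurable fun j => (W j).foldl gsStep [] :=
    Measurable.list_foldl (f := fun _ => gsStep) (by fun_prop) hW measurable_const
  exact (h1.resid hy) (measurableSet_singleton 0)

theorem spanTest_eq_true {y : Vec d} {W : List (Vec d)} : spanTest y W = true ↔ y ∈ lspan W := by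
  unfold spanTest lspan; simp

theorem measurable_bool_of_true {f : J → Bool} (h : MeasurableSet {j | f j = true}) :
    Measurable f := by
  refine measurable_to_countable' fun b => ?_
  cases b
  · convert h.compl using 1; ext; simp
  · exact h

theorem _root_.Measurable.spanTest {y : J → Vec d} {W : J → List (Vec d)} (hy : Measurable y)
    (hW : Measurable W) : Measurable fun j => spanTest (y j) (W j) := by
  refine measurable_bool_of_true ?_
  simp only [spanTest_eq_true]
  exact measurableSet_mem_lspan hy hW

end GramSchmidt

/-! ### Determinants, pseudo-inverses and ridge regression -/

section Determinant

variable {d : ℕ} {J : Type*} [MeasurableSpace J]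

/-- Determinant of the matrix with the given columns. -/
def cdet (W : Fin d → Vec d) : ℝ := (EuclideanSpace.basisFun (Fin d) ℝ).toBasis.det W

theorem cdet_eq (W : Fin d → Vec d) : cdet W = Matrix.det (Matrix.of fun r c => W c r) := by
  unfold cdet
  rw [Module.Basis.det_apply]
  congr 1

/-- Pairing with the cofactor vector replaces a column, up to sign. -/
theorem inner_cofactor (W : Fin d → Vec d) (i : Fin d) (y : Vec d) :
    inner ℝ (cofactor W i) y = (-1) ^ (i : ℕ) * cdet (Function.update W i y) := by
  have h1 : cdet (Function.update W i y) =
      ∑ j, y j * cdet (Function.update W i (EuclideanSpace.single j (1 : ℝ))) := by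
    let L := ((EuclideanSpace.basisFun (Fin d) ℝ).toBasis.det).toMultilinearMap.toLinearMap W i
    have hL : ∀ z, L z = cdet (Function.update W i z) := fun z => rfl
    rw [← hL]
    have hy : y = ∑ j, y j • EuclideanSpace.single j (1 : ℝ) := by
      have := (EuclideanSpace.basisFun (Fin d) ℝ).sum_repr y
      simpa using this.symm
    conv_lhs => rw [hy]
    rw [map_sum]
    refine Finset.sum_congr rfl fun j _ => ?_
    rw [map_smul, hL, smul_eq_mul]
  rw [h1, PiLp.inner_apply, Finset.mul_sum]
  refine Finset.sum_congr rfl fun j _ => ?_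
  simp only [cofactor, cdet_eq]
  simp
  ring

theorem abs_inner_cofactor (W : Fin d → Vec d) (i : Fin d) (y : Vec d) :
    |(inner ℝ (cofactor W i) y : ℝ)| = |cdet (Function.update W i y)| := by
  rw [inner_cofactor, abs_mul]; simp

/-- Hadamard's inequality. -/
theorem abs_cdet_le (W : Fin d → Vec d) : |cdet W| ≤ ∏ i, ‖W i‖ := by
  have : Fact (Module.finrank ℝ (Vec d) = d) := ⟨by simp⟩
  let o : Orientation ℝ (Vec d) (Fin d) :=
    (EuclideanSpace.basisFun (Fin d) ℝ).toBasis.orientation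
  have := o.abs_volumeForm_apply_le W
  rwa [o.volumeForm_robust' (EuclideanSpace.basisFun (Fin d) ℝ)] at this

/-- Cramer's rule. -/
theorem cramer_sum (W : Fin d → Vec d) (y : Vec d) :
    cdet W • y = ∑ i, cdet (Function.update W i y) • W i := by
  have h := Matrix.mulVec_cramer (Matrix.of fun r c => W c r) y.ofLp
  ext r
  have h2 := congrFun h r
  simp only [Matrix.mulVec, dotProduct, Matrix.cramer_apply, Pi.smul_apply, smul_eq_mul] at h2
  rw [← cdet_eq] at h2
  have e : ((∑ i, cdet (Function.update W i y) • W i : Vec d)) r =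
      ∑ i, cdet (Function.update W i y) * W i r := by simp
  rw [e]
  simp only [PiLp.smul_apply, smul_eq_mul]
  rw [← h2]
  refine Finset.sum_congr rfl fun i _ => ?_
  rw [mul_comm, cdet_eq]
  congr 2
  ext a b
  by_cases hb : b = i
  · subst hb; simp
  · simp [hb]

theorem measurable_cdet : Measurable (cdet : (Fin d → Vec d) → ℝ) := by
  have : (cdet : (Fin d → Vec d) → ℝ) = fun W => Matrix.det (Matrix.of fun r c => W c r) :=
    funext cdet_eq
  rw [this]
  simp only [Matrix.det_apply, Matrix.of_apply]
  fun_prop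

@[fun_prop]
theorem _root_.Measurable.cofactor {W : J → Fin d → Vec d} (i : Fin d) (hW : Measurable W) :
    Measurable fun j => cofactor (W j) i := by
  have h : ∀ j, LBC.cofactor (W j) i = WithLp.toLp 2 fun k => (-1) ^ (i : ℕ) *
      cdet (Function.update (W j) i (EuclideanSpace.single k (1 : ℝ))) := by
    intro j; simp only [LBC.cofactor, cdet_eq]
  simp only [h]
  have h2 : ∀ k, Measurable fun j => cdet (Function.update (W j) i (EuclideanSpace.single k (1 : ℝ))) :=
    fun k => measurable_cdet.comp (hW.function_update i measurable_const)
  fun_prop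

end Determinant

section MatrixMeas

variable {d : ℕ} {J : Type*} [MeasurableSpace J]

theorem measurable_det_entries {F : J → Matrix (Fin d) (Fin d) ℝ}
    (hF : ∀ i k, Measurable fun j => F j i k) : Measurable fun j => (F j).det := by
  simp only [Matrix.det_apply]
  fun_prop

theorem measurable_inv_entries {F : J → Matrix (Fin d) (Fin d) ℝ}
    (hF : ∀ i k, Measurable fun j => F j i k) (i k : Fin d) :
    Measurable fun j => (F j)⁻¹ i k := by
  simp only [Matrix.inv_def, Matrix.smul_apply, Matrix.adjugate_apply, Ring.inverse_eq_inv',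
    smul_eq_mul]
  refine (measurable_det_entries hF).inv.mul (measurable_det_entries fun a b => ?_)
  simp only [Matrix.updateRow_apply]
  split_ifs <;> fun_prop

theorem measurable_mul_entries {F G : J → Matrix (Fin d) (Fin d) ℝ}
    (hF : ∀ i k, Measurable fun j => F j i k) (hG : ∀ i k, Measurable fun j => G j i k)
    (i k : Fin d) : Measurable fun j => (F j * G j) i k := by
  simp only [Matrix.mul_apply]
  fun_prop

theorem measurable_mulVec_entries {F : J → Matrix (Fin d) (Fin d) ℝ} {b : J → Vec d}
    (hF : ∀ i k, Measurable fun j => F j i k) (hb : Measurable b) :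
    Measurable fun j => (WithLp.toLp 2 ((F j).mulVec (b j).ofLp) : Vec d) := by
  have h : ∀ i, Measurable fun j => (F j).mulVec (b j).ofLp i := by
    intro i
    simp only [Matrix.mulVec, dotProduct]
    fun_prop
  have : Measurable fun j => (F j).mulVec (b j).ofLp := measurable_pi_iff.2 h
  fun_prop

end MatrixMeas

section Gram

variable {d : ℕ} {J : Type*} [MeasurableSpace J]

theorem gram_nil : gram ([] : List (Vec d × ℝ)) = 0 := by simp [gram]

theorem gram_cons (p : Vec d × ℝ) (D : List (Vec d × ℝ)) :
    gram (p :: D) = Matrix.vecMulVec p.1.ofLp p.1.ofLp + gram D := by simp [gram]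

theorem gram_apply (D : List (Vec d × ℝ)) (i j : Fin d) :
    gram D i j = (D.map fun p => p.1 i * p.1 j).sum := by
  induction D with
  | nil => simp [gram_nil]
  | cons p D ih => rw [gram_cons, Matrix.add_apply, ih]; simp [Matrix.vecMulVec_apply]

theorem measurable_gram_entries {D : J → List (Vec d × ℝ)} (hD : Measurable D) (i k : Fin d) :
    Measurable fun j => gram (D j) i k := by
  simp only [gram_apply]
  exact Measurable.list_sum (Measurable.list_map_const (by fun_prop) hD)

theorem measurable_moment {D : J → List (Vec d × ℝ)} (hD : Measurable D) :
    Measurable fun j => moment (D j) := by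
  unfold moment
  exact Measurable.list_sum (Measurable.list_map_const (by fun_prop) hD)

/-- The Gram matrix acts as `x ↦ ∑ ⟨y, x⟩ y`. -/
theorem gram_mulVec (D : List (Vec d × ℝ)) (x : Vec d) :
    (WithLp.toLp 2 ((gram D).mulVec x.ofLp) : Vec d) =
      (D.map fun p => (inner ℝ p.1 x : ℝ) • p.1).sum := by
  induction D with
  | nil => simp [gram_nil]
  | cons p D ih =>
    rw [gram_cons, Matrix.add_mulVec, WithLp.toLp_add, ih, List.map_cons, List.sum_cons]
    congr 1
    ext i
    simp only [Matrix.mulVec, dotProduct, Matrix.vecMulVec_apply, PiLp.smul_apply, smul_eq_mul,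
      PiLp.inner_apply, Finset.sum_mul]
    refine Finset.sum_congr rfl fun j _ => ?_
    simp; ring

theorem inner_list_sum (x : Vec d) (l : List (Vec d)) :
    (inner ℝ x l.sum : ℝ) = (l.map fun y => (inner ℝ x y : ℝ)).sum := by
  induction l with
  | nil => simp
  | cons a l ih => simp [inner_add_right, ih]

theorem gram_isHermitian (D : List (Vec d × ℝ)) : (gram D).IsHermitian := by
  ext i j
  simp only [Matrix.conjTranspose_apply, gram_apply, star_trivial]
  congr 2; funext p; ring

variable {S : Matrix (Fin d) (Fin d) ℝ}

theorem hermCfc_mul (hS : S.IsHermitian) (f g : ℝ → ℝ) :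
    hS.cfc f * hS.cfc g = hS.cfc fun t => f t * g t := by
  unfold Matrix.IsHermitian.cfc
  rw [← map_mul, Matrix.diagonal_mul_diagonal]
  congr 2

theorem hermCfc_id (hS : S.IsHermitian) : (hS.cfc fun t => t) = S := by
  conv_rhs => rw [hS.spectral_theorem]
  rfl

theorem hermCfc_const (hS : S.IsHermitian) (c : ℝ) :
    (hS.cfc fun _ => c) = c • (1 : Matrix (Fin d) (Fin d) ℝ) := by
  unfold Matrix.IsHermitian.cfc
  have : Matrix.diagonal ((RCLike.ofReal : ℝ → ℝ) ∘ (fun _ => c) ∘ hS.eigenvalues) =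
      c • (1 : Matrix (Fin d) (Fin d) ℝ) := by
    ext i j; simp [Matrix.diagonal_apply, Matrix.one_apply]
  rw [this, map_smul, map_one]

theorem hermCfc_add (hS : S.IsHermitian) (f g : ℝ → ℝ) :
    hS.cfc f + hS.cfc g = hS.cfc fun t => f t + g t := by
  unfold Matrix.IsHermitian.cfc
  rw [← map_add, Matrix.diagonal_add]
  congr 2

theorem hermCfc_tendsto (hS : S.IsHermitian) {f : ℕ → ℝ → ℝ} {g : ℝ → ℝ}
    (h : ∀ t, Filter.Tendsto (fun n => f n t) Filter.atTop (nhds (g t))) :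
    Filter.Tendsto (fun n => hS.cfc (f n)) Filter.atTop (nhds (hS.cfc g)) := by
  unfold Matrix.IsHermitian.cfc
  simp only [Unitary.conjStarAlgAut_apply]
  refine Filter.Tendsto.mul (Filter.Tendsto.mul tendsto_const_nhds ?_) tendsto_const_nhds
  refine tendsto_pi_nhds.2 fun i => tendsto_pi_nhds.2 fun j => ?_
  by_cases hij : i = j
  · subst hij; simpa using h _
  · simp [Matrix.diagonal_apply_ne _ hij]

theorem mul_pinv_mul (hS : S.IsHermitian) : S * pinv S * S = S := by
  have h : pinv S = hS.cfc fun t => t⁻¹ := by unfold pinv; rw [dif_pos hS]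
  rw [h]
  calc S * (hS.cfc fun t => t⁻¹) * S
      = (hS.cfc fun t => t) * (hS.cfc fun t => t⁻¹) * (hS.cfc fun t => t) := by rw [hermCfc_id]
    _ = hS.cfc fun t => t * t⁻¹ * t := by rw [hermCfc_mul, hermCfc_mul]
    _ = S := by
      conv_rhs => rw [← hermCfc_id hS]
      congr 1; funext t
      by_cases ht : t = 0 <;> simp [ht]

/-- The pseudo-inverse is a limit of regularized inverses, hence measurable. -/
theorem tendsto_pinv (hS : S.IsHermitian) :
    Filter.Tendsto (fun n : ℕ => (S * S + ((1 : ℝ) / (n + 1)) • 1)⁻¹ * S) Filter.atTop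
      (nhds (pinv S)) := by
  have h : pinv S = hS.cfc fun t => t⁻¹ := by unfold pinv; rw [dif_pos hS]
  rw [h]
  have h1 : ∀ n : ℕ, (S * S + ((1 : ℝ) / (n + 1)) • 1)⁻¹ * S =
      hS.cfc fun t => (t * t + 1 / (n + 1))⁻¹ * t := by
    intro n
    have hpos : (0 : ℝ) < 1 / (n + 1) := by positivity
    have h2 : S * S + ((1 : ℝ) / (n + 1)) • 1 = hS.cfc fun t => t * t + 1 / (n + 1) := by
      rw [← hermCfc_add, hermCfc_const, ← hermCfc_mul, hermCfc_id]
    have h3 : (hS.cfc fun t => (t * t + 1 / ((n : ℝ) + 1))⁻¹) *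
        (hS.cfc fun t => t * t + 1 / ((n : ℝ) + 1)) = 1 := by
      rw [hermCfc_mul]
      have : (fun t : ℝ => (t * t + 1 / ((n : ℝ) + 1))⁻¹ * (t * t + 1 / ((n : ℝ) + 1))) =
          fun _ => 1 := by
        funext t; exact inv_mul_cancel₀ (by nlinarith [mul_self_nonneg t])
      rw [this, hermCfc_const, one_smul]
    rw [h2, Matrix.inv_eq_left_inv h3]
    rw [← hermCfc_mul hS (fun t => (t * t + 1 / ((n : ℝ) + 1))⁻¹) (fun t => t), hermCfc_id]
  simp only [h1]
  refine hermCfc_tendsto hS fun t => ?_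
  by_cases ht : t = 0
  · simp [ht]
  · have h0 := tendsto_one_div_add_atTop_nhds_zero_nat (𝕜 := ℝ)
    have h4 : Filter.Tendsto (fun n : ℕ => (t * t + 1 / ((n : ℝ) + 1))⁻¹ * t) Filter.atTop
        (nhds ((t * t + 0)⁻¹ * t)) :=
      ((tendsto_const_nhds.add h0).inv₀ (by simpa using ht)).mul tendsto_const_nhds
    convert h4 using 2
    field_simp; simp

theorem measurable_leastSquares {D : J → List (Vec d × ℝ)} (hD : Measurable D) :
    Measurable fun j => leastSquares (D j) := by
  have hG := measurable_gram_entries hD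
  refine measurable_of_tendsto_metrizable (f := fun (n : ℕ) j => (WithLp.toLp 2
    (((gram (D j) * gram (D j) + ((1 : ℝ) / (n + 1)) • 1)⁻¹ * gram (D j)).mulVec
      (moment (D j)).ofLp) : Vec d)) (fun n => ?_) ?_
  · refine measurable_mulVec_entries (measurable_mul_entries (measurable_inv_entries
      fun i k => ?_) hG) (measurable_moment hD)
    simp only [Matrix.add_apply, Matrix.smul_apply]
    exact (measurable_mul_entries hG hG i k).add_const _
  · rw [tendsto_pi_nhds]
    intro j
    have h := tendsto_pinv (gram_isHermitian (D j))
    unfold leastSquares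
    have hc : Continuous fun A : Matrix (Fin d) (Fin d) ℝ =>
        (WithLp.toLp 2 (A.mulVec (moment (D j)).ofLp) : Vec d) := by fun_prop
    exact (hc.tendsto _).comp h

/-- If the targets are an exactly linear function of the features, least squares recovers this
function on the span of the features. -/
theorem inner_leastSquares {D : List (Vec d × ℝ)} {θ : Vec d}
    (hD : ∀ p ∈ D, p.2 = inner ℝ p.1 θ) {y : Vec d} (hy : y ∈ lspan (D.map Prod.fst)) :
    (inner ℝ y (leastSquares D) : ℝ) = inner ℝ y θ := by
  have hmom : (moment D).ofLp = (gram D).mulVec θ.ofLp := by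
    have h1 := gram_mulVec D θ
    have h2 : moment D = (D.map fun p => (inner ℝ p.1 θ : ℝ) • p.1).sum := by
      unfold moment; congr 1
      exact List.map_congr_left fun p hp => by rw [hD p hp]
    rw [h2, ← h1]
  have hG := mul_pinv_mul (gram_isHermitian D)
  have hker : (WithLp.toLp 2 ((gram D).mulVec (leastSquares D - θ).ofLp) : Vec d) = 0 := by
    have : (gram D).mulVec (leastSquares D - θ).ofLp = 0 := by
      rw [WithLp.ofLp_sub, Matrix.mulVec_sub]
      unfold leastSquares
      simp only [hmom, Matrix.mulVec_mulVec, ← mul_assoc, hG, sub_self]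
    rw [this]; rfl
  rw [gram_mulVec] at hker
  have h3 : (D.map fun p => (inner ℝ p.1 (leastSquares D - θ) : ℝ) ^ 2).sum = 0 := by
    have := congrArg (fun z => (inner ℝ (leastSquares D - θ) z : ℝ)) hker
    simp only [inner_list_sum, List.map_map, inner_zero_right] at this
    rw [← this]; congr 1
    refine List.map_congr_left fun p _ => ?_
    simp only [Function.comp, inner_smul_right]
    rw [real_inner_comm p.1]; ring
  have h4 : ∀ p ∈ D, (inner ℝ p.1 (leastSquares D - θ) : ℝ) = 0 := by
    intro p hp
    have h5 : ∀ l : List ℝ, (∀ x ∈ l, 0 ≤ x) → l.sum = 0 → ∀ x ∈ l, x = 0 := by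
      intro l hl hs x hx
      exact le_antisymm (hs ▸ List.single_le_sum hl x hx) (hl x hx)
    have := h5 _ (by
      intro x hx; obtain ⟨q, _, rfl⟩ := List.mem_map.1 hx; positivity) h3 _
      (List.mem_map_of_mem hp)
    simpa using this
  have h6 : (inner ℝ y (leastSquares D - θ) : ℝ) = 0 := by
    unfold lspan at hy
    induction hy using Submodule.span_induction with
    | mem x hx =>
      obtain ⟨p, hp, rfl⟩ := List.mem_map.1 hx
      exact h4 p hp
    | zero => simp
    | add a b _ _ ha hb => rw [inner_add_left, ha, hb, add_zero]
    | smul c a _ ha => rw [real_inner_smul_left, ha, mul_zero]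
  rw [inner_sub_right] at h6; linarith

/-- The solution `a` of `a + ∑ ⟨y, a⟩ y = b`. -/
def ridgeDir (ys : List (Vec d)) (b : Vec d) : Vec d :=
  WithLp.toLp 2 ((((1 : ℝ) • (1 : Matrix (Fin d) (Fin d) ℝ) +
    gram (ys.map fun y => (y, (0 : ℝ))))⁻¹).mulVec b.ofLp)

theorem gram_map_fst (D : List (Vec d × ℝ)) :
    gram ((D.map Prod.fst).map fun y => (y, (0 : ℝ))) = gram D := by
  ext i j; simp only [gram_apply, List.map_map]; rfl

theorem ridge_eq_ridgeDir (D : List (Vec d × ℝ)) :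
    ridge 1 D = ridgeDir (D.map Prod.fst) (moment D) := by
  unfold ridge ridgeDir; rw [gram_map_fst]

theorem ridgeDir_spec (ys : List (Vec d)) (b : Vec d) :
    ridgeDir ys b + (ys.map fun y => (inner ℝ y (ridgeDir ys b) : ℝ) • y).sum = b := by
  set A := ((1 : ℝ) • (1 : Matrix (Fin d) (Fin d) ℝ) + gram (ys.map fun y => (y, (0 : ℝ))))
    with hA
  have hact : ∀ x : Vec d, (WithLp.toLp 2 (A.mulVec x.ofLp) : Vec d) =
      x + (ys.map fun y => (inner ℝ y x : ℝ) • y).sum := by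
    intro x
    rw [hA, Matrix.add_mulVec, WithLp.toLp_add, gram_mulVec, List.map_map]
    simp; rfl
  have hinj : Function.Injective A.mulVec := by
    rw [← Matrix.coe_mulVecLin, ← LinearMap.ker_eq_bot, LinearMap.ker_eq_bot']
    intro x hx
    have h := hact (WithLp.toLp 2 x)
    rw [Matrix.mulVecLin_apply] at hx
    rw [hx] at h
    have h2 := congrArg (fun z => (inner ℝ (WithLp.toLp 2 x : Vec d) z : ℝ)) h
    simp only [inner_add_right, inner_list_sum, List.map_map] at h2
    have h3 : 0 ≤ ((ys.map ((fun y => (inner ℝ (WithLp.toLp 2 x : Vec d) y : ℝ)) ∘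
        fun y => (inner ℝ y (WithLp.toLp 2 x : Vec d) : ℝ) • y))).sum := by
      refine List.sum_nonneg fun z hz => ?_
      obtain ⟨y, _, rfl⟩ := List.mem_map.1 hz
      simp only [Function.comp, inner_smul_right]
      rw [real_inner_comm y]; exact mul_self_nonneg _
    have h4 : (inner ℝ (WithLp.toLp 2 x : Vec d) (WithLp.toLp 2 x : Vec d) : ℝ) = 0 := by
      have h5 := real_inner_self_nonneg (x := (WithLp.toLp 2 x : Vec d))
      have h6 : (inner ℝ (WithLp.toLp 2 x : Vec d) (WithLp.toLp 2 (0 : Fin d → ℝ) : Vec d) : ℝ)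
        = 0 := by simp
      rw [h6] at h2; linarith
    have h7 := inner_self_eq_zero.1 h4
    simpa using congrArg WithLp.ofLp h7
  have hu : IsUnit A := Matrix.mulVec_injective_iff_isUnit.1 hinj
  rw [← hact]
  unfold ridgeDir
  rw [← hA]
  simp only [Matrix.mulVec_mulVec]
  rw [Matrix.mul_nonsing_inv _ ((Matrix.isUnit_iff_isUnit_det _).1 hu), Matrix.one_mulVec]

theorem measurable_ridgeDir {ys : J → List (Vec d)} {b : J → Vec d} (hy : Measurable ys)
    (hb : Measurable b) : Measurable fun j => ridgeDir (ys j) (b j) := by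
  unfold ridgeDir
  refine measurable_mulVec_entries (measurable_inv_entries fun i k => ?_) hb
  simp only [Matrix.add_apply, Matrix.smul_apply]
  exact measurable_const.add (measurable_gram_entries (Measurable.list_map_const
    (f := fun y : Vec d => (y, (0 : ℝ))) (by fun_prop) hy) i k)

theorem measurable_ridge {D : J → List (Vec d × ℝ)} (hD : Measurable D) :
    Measurable fun j => ridge 1 (D j) := by
  simp only [ridge_eq_ridgeDir]
  exact measurable_ridgeDir (Measurable.list_map_const measurable_fst hD) (measurable_moment hD)

/-- Energy identity for `ridgeDir`. -/
theorem ridgeDir_energy (ys : List (Vec d)) (b : Vec d) :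
    ‖ridgeDir ys b‖ ^ 2 + (ys.map fun y => (inner ℝ (ridgeDir ys b) y : ℝ) ^ 2).sum =
      inner ℝ (ridgeDir ys b) b := by
  have h := congrArg (fun z => (inner ℝ (ridgeDir ys b) z : ℝ)) (ridgeDir_spec ys b)
  rw [← h, inner_add_right, real_inner_self_eq_norm_sq, inner_list_sum, List.map_map]
  congr 2
  refine List.map_congr_left fun y _ => ?_
  simp only [Function.comp, inner_smul_right]
  rw [real_inner_comm]; ring

/-- Error of ridge regression in direction `b`: a linear function of the noise plus the bias. -/
theorem inner_ridge_sub (D : List (Vec d × ℝ)) (ws b : Vec d) :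
    (inner ℝ b (ridge 1 D - ws) : ℝ) =
      (D.map fun p => (inner ℝ (ridgeDir (D.map Prod.fst) b) p.1 : ℝ) *
        (p.2 - inner ℝ ws p.1)).sum - inner ℝ (ridgeDir (D.map Prod.fst) b) ws := by
  rw [ridge_eq_ridgeDir]
  set ys := D.map Prod.fst with hys
  set a := ridgeDir ys b with ha
  set r := ridgeDir ys (moment D) with hr
  have hb : b = a + (ys.map fun y => (inner ℝ y a : ℝ) • y).sum := (ridgeDir_spec ys b).symm
  have hm : moment D = r + (ys.map fun y => (inner ℝ y r : ℝ) • y).sum :=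
    (ridgeDir_spec ys _).symm
  have h1 : ∀ z : Vec d, (inner ℝ b z : ℝ) =
      inner ℝ a z + (D.map fun p => (inner ℝ a p.1 : ℝ) * inner ℝ p.1 z).sum := by
    intro z
    conv_lhs => rw [hb]
    rw [inner_add_left, real_inner_comm _ (List.sum _), inner_list_sum, List.map_map, hys,
      List.map_map]
    congr 2
    refine List.map_congr_left fun p _ => ?_
    simp only [Function.comp, inner_smul_right]
    rw [real_inner_comm p.1 z, real_inner_comm p.1 a]
  have h2 : (inner ℝ a (moment D) : ℝ) = (D.map fun p => (inner ℝ a p.1 : ℝ) * p.2).sum := by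
    unfold moment
    rw [inner_list_sum, List.map_map]
    congr 1
    refine List.map_congr_left fun p _ => ?_
    simp only [Function.comp, inner_smul_right]; ring
  have h3 : (inner ℝ b r : ℝ) = inner ℝ a (moment D) := by
    rw [h1, hm, inner_add_right, inner_list_sum, List.map_map, hys, List.map_map]
    congr 2
    refine List.map_congr_left fun p _ => ?_
    simp only [Function.comp, inner_smul_right]; ring
  rw [inner_sub_right, h3, h2, h1 ws]
  have h4 : (D.map fun p => (inner ℝ a p.1 : ℝ) * (p.2 - inner ℝ ws p.1)).sum =
      (D.map fun p => (inner ℝ a p.1 : ℝ) * p.2).sum -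
        (D.map fun p => (inner ℝ a p.1 : ℝ) * inner ℝ p.1 ws).sum := by
    clear_value a
    clear hb hm h1 h2 h3 hr hys ha r
    induction D with
    | nil => simp
    | cons p D ih =>
      simp only [List.map_cons, List.sum_cons, ih]
      rw [real_inner_comm p.1 ws]; ring
  rw [h4]; ring

end Gram

/-! ### Measurability of the programs -/

namespace Setting

variable {X : Type u} {A : Type v} {Ξ : Type w} [MeasurableSpace X] [MeasurableSpace A]
  [MeasurableSpace Ξ] {d : ℕ} {E : Setting X A Ξ d} {ι : Type*} [MeasurableSpace ι]

theorem MeasFam.matchOption {α β : Type} [MeasurableSpace α] [MeasurableSpace β]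
    {p : ι → Prog X A d (Option α)} {f : ι → Option α → Prog X A d β}
    (hp : E.MeasFam p) (h0 : E.MeasFam fun i => f i none)
    (h1 : E.MeasFam fun q : ι × α => f q.1 (some q.2)) : E.MeasFam fun i => (p i).bind (f i) := by
  refine MeasFam.bind hp ?_
  have h := MeasFam.option (E := E) (ι := ι × Option α) (o := fun q => q.2)
    (p := fun q a => f q.1 (some a)) (q := fun q => f q.1 none) measurable_snd
    (h1.comp (by fun_prop : Measurable fun r : (ι × Option α) × α => (r.1.1, r.2)))
    (h0.comp measurable_fst)
  convert h using 2 with q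
  rcases q with ⟨i, _ | x⟩ <;> rfl

theorem MeasFam.of_option {α β : Type} [MeasurableSpace α] [MeasurableSpace β]
    {f : Option α → Prog X A d β} (h0 : E.MeasProg (f none))
    (h1 : E.MeasFam fun a : α => f (some a)) : E.MeasFam f := by
  have h := MeasFam.matchOption (E := E) (p := fun o : Option α => (Prog.done o : Prog X A d _))
    (f := fun _ => f) (MeasFam.done measurable_id) (MeasProg.fam h0) (h1.comp measurable_snd)
  exact h

theorem measFam_drawFeature {h : ℕ} (hh : h < E.H) :
    E.MeasFam fun π : Param d => (drawFeature π h : Prog X A d (Vec d)) := by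
  refine MeasFam.episode hh measurable_id ?_
  refine MeasFam.feature hh (by fun_prop) (by fun_prop) ?_
  exact MeasFam.done measurable_snd

theorem measFam_drawReward {h : ℕ} (hh : h < E.H) :
    E.MeasFam fun π : Param d => (drawReward π h : Prog X A d (Vec d × ℝ)) := by
  refine MeasFam.episode hh measurable_id ?_
  refine MeasFam.feature hh (by fun_prop) (by fun_prop) ?_
  exact MeasFam.done (by fun_prop)

theorem measFam_drawTarget {h : ℕ} (hh : h + 1 < E.H) :
    E.MeasFam fun q : Param d × Vec d × Vec d =>
      (drawTarget q.1 h q.2.1 q.2.2 : Prog X A d (Vec d × ℝ)) := by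
  refine MeasFam.episode (by omega) measurable_fst ?_
  refine MeasFam.feature (by omega) (by fun_prop) (by fun_prop) ?_
  refine MeasFam.argmax hh (by fun_prop) (by fun_prop) ?_
  refine MeasFam.feature hh (by fun_prop) (by fun_prop) ?_
  exact MeasFam.compute (by fun_prop)

theorem measFam_fqiLoop {n h : ℕ} (hh : h < E.H) :
    E.MeasFam fun q : Param d × (ℕ → List (Param d)) × Param d =>
      (fqiLoop q.1 q.2.1 n h q.2.2 : Prog X A d (Param d)) := by
  induction h with
  | zero => exact MeasFam.done (by fun_prop)
  | succ h ih =>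
    refine MeasFam.bind (MeasFam.forProg (MeasFam.repeatProg ((measFam_drawTarget hh).comp
      (by fun_prop : Measurable fun r : (Param d × (ℕ → List (Param d)) × Param d) × Param d =>
        (r.2, r.1.1 h, r.1.2.2 (h + 1)))) n) (by fun_prop)) ?_
    refine MeasFam.bind (MeasFam.compute (measurable_leastSquares (by fun_prop))) ?_
    refine (ih (by omega)).comp (g := fun r : ((Param d × (ℕ → List (Param d)) × Param d) ×
      List (List (Vec d × ℝ))) × Vec d => (r.1.1.1, r.1.1.2.1,
        Function.update r.1.1.2.2 h r.2)) ?_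
    exact Measurable.prodMk (by fun_prop) (Measurable.prodMk (by fun_prop)
      (Measurable.function_update h (by fun_prop) (by fun_prop)))

theorem measFam_fqi {n h : ℕ} (hh : h < E.H) :
    E.MeasFam fun q : Param d × (ℕ → List (Param d)) =>
      (fqi h q.1 q.2 n : Prog X A d (Param d)) :=
  (measFam_fqiLoop hh).comp (g := fun q : Param d × (ℕ → List (Param d)) =>
      (q.1, q.2, Function.update 0 h (q.1 h))) (Measurable.prodMk (by fun_prop)
      (Measurable.prodMk (by fun_prop)
      (Measurable.function_update h measurable_const (by fun_prop))))

theorem measFam_fqi_rewardAt {n h : ℕ} (hh : h < E.H) :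
    E.MeasFam fun q : Vec d × (ℕ → List (Param d)) =>
      (fqi h (rewardAt h q.1) q.2 n : Prog X A d (Param d)) :=
  (measFam_fqi hh).comp (g := fun q : Vec d × (ℕ → List (Param d)) => (rewardAt h q.1, q.2))
    (Measurable.prodMk (Measurable.function_update h measurable_const (by fun_prop)) (by fun_prop))

theorem measFam_rejection {h : ℕ} (hh : h < E.H) (K : ℕ) :
    E.MeasFam fun q : Param d × List (Vec d) =>
      (rejection q.1 h q.2 K : Prog X A d (Vec d)) := by
  induction K with
  | zero => exact MeasFam.done measurable_const
  | succ K ih =>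
    refine MeasFam.bind ((measFam_drawFeature hh).comp measurable_fst) ?_
    refine MeasFam.bind (MeasFam.compute (by fun_prop)) ?_
    refine MeasFam.ite ?_ (MeasFam.done (by fun_prop))
      (ih.comp (by fun_prop : Measurable fun r : ((Param d × List (Vec d)) × Vec d) × Vec d =>
        r.1.1))
    exact (measurable_snd (measurableSet_singleton (0 : Vec d))).compl

theorem measFam_computeOutlierDirection {draw : ι → Prog X A d (Vec d)} (hd : E.MeasFam draw)
    (n m : ℕ) : E.MeasFam fun i => computeOutlierDirection (draw i) n m := by
  refine MeasFam.bind (hd.repeatProg n) ?_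
  refine MeasFam.bind (MeasFam.forProg (κ := Vec d) ?_ (by fun_prop)) ?_
  · refine MeasFam.bind (MeasFam.repeatProg (MeasFam.bind ((hd.repeatProg n).comp
      (by fun_prop : Measurable fun q : (ι × List (Vec d)) × Vec d => q.1.1)) ?_) m) ?_
    · exact MeasFam.compute (Measurable.spanTest (by fun_prop) (by fun_prop))
    · exact MeasFam.compute (by fun_prop)
  · exact MeasFam.compute (Measurable.option_getD (Measurable.option_map (by fun_prop)
      (Measurable.list_argmax (by fun_prop) (by fun_prop))) measurable_const)

theorem measFam_outlierTest {h : ℕ} (hh : h < E.H) :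
    E.MeasFam fun q : Param d × List (Vec d) =>
      (outlierTest q.1 h q.2 : Prog X A d Bool) := by
  refine MeasFam.bind ((measFam_drawFeature hh).comp measurable_fst) ?_
  refine MeasFam.compute (measurable_bool_of_true ?_)
  simp only [ne_eq, decide_eq_true_eq]
  have h1 : Measurable fun q : (Param d × List (Vec d)) × Vec d => resid q.1.2 q.2 := by fun_prop
  exact (h1 (measurableSet_singleton (0 : Vec d))).compl

/-- The outcomes of `n` outlier tests of a pair of policies. -/
def pairTest (h : ℕ) (Q : List (Vec d)) (n : ℕ) (πm πp : Param d) :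
    Prog X A d (List (Bool × Bool)) :=
  LBC.repeatProg ((outlierTest πm h Q).bind fun bm =>
    (outlierTest πp h Q).bind fun bp => Prog.done (bm, bp)) n

open Classical in
/-- The part of the search for an outlier direction that follows the tests of a pair of policies;
`c` is the search over the remaining directions. -/
def pairChoice (H : ℕ) (s : Sizes) (h : ℕ) (Q : List (Vec d))
    (c : Prog X A d (Option (Param d × Vec d))) (πm πp : Param d) (out : List (Bool × Bool)) :
    Prog X A d (Option (Param d × Vec d)) :=
  (LBC.compute s.nTest ((out.map Prod.fst).count true)).bind fun km =>
  (LBC.compute s.nTest ((out.map Prod.snd).count true)).bind fun kp =>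
    if (s.nTest : ℝ) * (s.eps / (4 * H * d)) < (max km kp : ℕ) then
      (computeOutlierDirection (LBC.rejection (if km ≤ kp then πp else πm) h Q s.nReject)
        s.nSamp s.mBoost).bind fun y => Prog.done (some (if km ≤ kp then πp else πm, y))
    else c

theorem searchDirections_cons (H : ℕ) (s : Sizes) (h : ℕ) (Ψ : ℕ → List (Param d))
    (Q : List (Vec d)) (θ : Vec d) (B : List (Vec d)) :
    (searchDirections H s h Ψ Q (θ :: B) : Prog X A d (Option (Param d × Vec d))) =
      (fqi h (rewardAt h (-θ)) Ψ s.nCover).bind fun πm =>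
        (fqi h (rewardAt h θ) Ψ s.nCover).bind fun πp =>
          (pairTest h Q s.nTest πm πp).bind
            (pairChoice H s h Q (searchDirections H s h Ψ Q B) πm πp) := rfl

theorem measFam_pairTest {h : ℕ} (hh : h < E.H) (n : ℕ) :
    E.MeasFam fun q : List (Vec d) × Param d × Param d =>
      (pairTest h q.1 n q.2.1 q.2.2 : Prog X A d (List (Bool × Bool))) := by
  have h0 := measFam_outlierTest (E := E) (h := h) hh
  have h1 := h0.comp (κ := List (Vec d) × Param d × Param d) (g := fun q => (q.2.1, q.1))
    (by fun_prop)
  have h2 := h0.comp (κ := (List (Vec d) × Param d × Param d) × Bool)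
    (g := fun q => (q.1.2.2, q.1.1)) (by fun_prop)
  have h3 : E.MeasFam fun q : ((List (Vec d) × Param d × Param d) × Bool) × Bool =>
      (Prog.done (q.1.2, q.2) : Prog X A d (Bool × Bool)) := MeasFam.done (by fun_prop)
  exact MeasFam.repeatProg (MeasFam.bind h1 (MeasFam.bind h2 h3)) n

theorem measFam_pairChoice {s : Sizes} {h : ℕ} (hh : h < E.H)
    {c : ι → Prog X A d (Option (Param d × Vec d))} (hc : E.MeasFam c) :
    E.MeasFam fun q : (ι × List (Vec d) × Param d × Param d) × List (Bool × Bool) =>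
      pairChoice E.H s h q.1.2.1 (c q.1.1) q.1.2.2.1 q.1.2.2.2 q.2 := by
  refine MeasFam.bind (MeasFam.compute (by fun_prop)) ?_
  refine MeasFam.bind (MeasFam.compute (by fun_prop)) ?_
  have hπ : Measurable fun q : (((ι × List (Vec d) × Param d × Param d) × List (Bool × Bool)) × ℕ)
      × ℕ => (if q.1.2 ≤ q.2 then q.1.1.1.2.2.2 else q.1.1.1.2.2.1 : Param d) :=
    Measurable.ite (measurableSet_le (by fun_prop) (by fun_prop)) (by fun_prop) (by fun_prop)
  refine MeasFam.ite ?_ ?_ ?_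
  · refine measurableSet_lt measurable_const ?_
    exact (measurable_of_countable (fun k : ℕ => (k : ℝ))).comp
      (Measurable.max (by fun_prop) (by fun_prop))
  · refine MeasFam.bind (measFam_computeOutlierDirection ((measFam_rejection hh
      s.nReject).comp (hπ.prodMk (by fun_prop : Measurable fun q : (((ι × List (Vec d) × Param d ×
        Param d) × List (Bool × Bool)) × ℕ) × ℕ => q.1.1.1.2.1))) _ _) ?_
    exact MeasFam.done (measurable_some.comp ((hπ.comp measurable_fst).prodMk measurable_snd))
  · exact hc.comp (by fun_prop)

theorem measFam_searchDirections {s : Sizes} {h : ℕ} (hh : h < E.H) :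
    E.MeasFam fun q : List (Vec d) × (ℕ → List (Param d)) × List (Vec d) =>
      (searchDirections E.H s h q.2.1 q.2.2 q.1 : Prog X A d (Option (Param d × Vec d))) := by
  have key : Measurable fun q : List (Vec d) × (((ℕ → List (Param d)) × List (Vec d)) ×
      (ℕ → Episode X Ξ)) => E.eval (searchDirections E.H s h q.2.1.1 q.2.1.2 q.1) q.2.2 := by
    refine measurable_list_of_cons ?_ fun n ih => ?_
    · exact MeasFam.done (E := E) (ι := (ℕ → List (Param d)) × List (Vec d))
        (f := fun _ => (none : Option (Param d × Vec d))) measurable_const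
    · have hrec : E.MeasFam fun q : (Fin n → Vec d) × ((ℕ → List (Param d)) × List (Vec d)) =>
          (searchDirections E.H s h q.2.1 q.2.2 (List.ofFn q.1) :
            Prog X A d (Option (Param d × Vec d))) :=
        ih.comp (by fun_prop : Measurable fun p : ((Fin n → Vec d) × ((ℕ → List (Param d)) ×
          List (Vec d))) × (ℕ → Episode X Ξ) => (p.1.1, p.1.2, p.2))
      have h2 : E.MeasFam fun q : Vec d × (Fin n → Vec d) × ((ℕ → List (Param d)) ×
          List (Vec d)) => (searchDirections E.H s h q.2.2.1 q.2.2.2 (q.1 :: List.ofFn q.2.1) :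
            Prog X A d (Option (Param d × Vec d))) := by
        simp only [searchDirections_cons]
        have f0 := measFam_fqi_rewardAt (E := E) (n := s.nCover) (h := h) hh
        have f1 := f0.comp (κ := Vec d × (Fin n → Vec d) × ((ℕ → List (Param d)) ×
          List (Vec d))) (g := fun q => (-q.1, q.2.2.1)) (by fun_prop)
        have f2 := f0.comp (κ := (Vec d × (Fin n → Vec d) × ((ℕ → List (Param d)) ×
          List (Vec d))) × Param d) (g := fun q => (q.1.1, q.1.2.2.1)) (by fun_prop)
        have f3 := (measFam_pairTest (E := E) hh s.nTest).comp
          (κ := ((Vec d × (Fin n → Vec d) × ((ℕ → List (Param d)) ×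
            List (Vec d))) × Param d) × Param d) (g := fun q => (q.1.1.2.2.2, q.1.2, q.2))
          (by fun_prop)
        have f4 := (measFam_pairChoice (s := s) hh hrec).comp
          (κ := (((Vec d × (Fin n → Vec d) × ((ℕ → List (Param d)) ×
            List (Vec d))) × Param d) × Param d) × List (Bool × Bool))
          (g := fun q => ((q.1.1.1.2, q.1.1.1.2.2.2, q.1.1.2, q.1.2), q.2)) (by fun_prop)
        exact MeasFam.bind f1 (MeasFam.bind f2 (MeasFam.bind f3 f4))
      exact Measurable.comp (g := fun q : (Vec d × (Fin n → Vec d) × ((ℕ → List (Param d)) ×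
          List (Vec d))) × (ℕ → Episode X Ξ) =>
        E.eval (searchDirections E.H s h q.1.2.2.1 q.1.2.2.2 (q.1.1 :: List.ofFn q.1.2.1)) q.2) h2
        (by fun_prop : Measurable fun p : Vec d × (Fin n → Vec d) × (((ℕ → List (Param d)) ×
          List (Vec d)) × (ℕ → Episode X Ξ)) => ((p.1, p.2.1, p.2.2.1), p.2.2.2))
  exact key.comp (f := fun q : (List (Vec d) × (ℕ → List (Param d)) × List (Vec d)) ×
    (ℕ → Episode X Ξ) => (q.1.1, q.1.2, q.2)) (by fun_prop)

theorem measFam_subspaceLoop {s : Sizes} {h : ℕ} (hh : h < E.H) (t : ℕ) :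
    E.MeasFam fun q : (ℕ → List (Param d)) × List (Vec d) × List (Param d) =>
      (subspaceLoop E.H s h q.1 t q.2.1 q.2.2 :
        Prog X A d (List (Vec d) × List (Param d))) := by
  induction t with
  | zero => exact MeasFam.done (by fun_prop)
  | succ t ih =>
    refine MeasFam.bind (MeasFam.compute (by fun_prop)) ?_
    refine MeasFam.matchOption ((measFam_searchDirections hh).comp
      (by fun_prop : Measurable fun q : ((ℕ → List (Param d)) × List (Vec d) × List (Param d)) ×
        List (Vec d) => (q.2, q.1.1, q.1.2.1))) (MeasFam.done (by fun_prop)) ?_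
    refine MeasFam.bind (MeasFam.compute (by fun_prop)) ?_
    exact ih.comp (by fun_prop : Measurable fun q : ((((ℕ → List (Param d)) × List (Vec d) ×
      List (Param d)) × List (Vec d)) × (Param d × Vec d)) × List (Vec d) =>
        (q.1.1.1.1, q.2, q.1.1.1.2.2 ++ [q.1.2.1]))

theorem measFam_subspaceCover {s : Sizes} {h : ℕ} (hh : h < E.H) :
    E.MeasFam fun Ψ : ℕ → List (Param d) =>
      (subspaceCover E.H s h Ψ : Prog X A d (List (Vec d) × List (Param d))) :=
  (measFam_subspaceLoop hh (d + 1)).comp (g := fun Ψ : ℕ → List (Param d) => (Ψ, [], []))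
    (by fun_prop)

theorem measFam_vecEval {h : ℕ} (hh : h < E.H) (n : ℕ) :
    E.MeasFam fun π : Param d => (vecEval h n π : Prog X A d (Vec d)) := by
  refine MeasFam.bind ((measFam_drawFeature hh).repeatProg n) ?_
  exact MeasFam.compute (by fun_prop)

@[fun_prop]
theorem _root_.Measurable.spanState_set {st : ι → SpanState d} {y : ι → Vec d} {π : ι → Param d}
    (i : Fin d) (hst : Measurable st) (hy : Measurable y) (hπ : Measurable π) :
    Measurable fun j => (st j).set i (y j) (π j) := by
  unfold SpanState.set
  exact Measurable.spanState_mk (Measurable.function_update i (by fun_prop) hy)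
    (Measurable.function_update i (by fun_prop) hπ)

section Spanner

variable {linOpt : ι → Vec d → Prog X A d (Param d)} {vec : Param d → Prog X A d (Vec d)}

theorem measFam_spanQuery (hl : E.MeasFam fun q : ι × Vec d => linOpt q.1 q.2)
    (hv : E.MeasFam vec) (i : Fin d) :
    E.MeasFam fun q : ι × SpanState d => spanQuery (linOpt q.1) vec q.2 i := by
  refine MeasFam.bind (MeasFam.compute (by fun_prop)) ?_
  refine MeasFam.bind (hl.comp (by fun_prop : Measurable fun q : (ι × SpanState d) × Vec d =>
    (q.1.1, ‖q.2‖⁻¹ • q.2))) ?_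
  refine MeasFam.bind (hv.comp measurable_snd) ?_
  refine MeasFam.bind (hl.comp (by fun_prop : Measurable fun q :
    (((ι × SpanState d) × Vec d) × Param d) × Vec d =>
    (q.1.1.1.1, -(‖q.1.1.2‖⁻¹ • q.1.1.2)))) ?_
  refine MeasFam.bind (hv.comp measurable_snd) ?_
  exact MeasFam.done (by fun_prop)

theorem measFam_spanInit (hl : E.MeasFam fun q : ι × Vec d => linOpt q.1 q.2)
    (hv : E.MeasFam vec) (ε : ℝ) (l : List (Fin d)) :
    E.MeasFam fun q : ι × SpanState d => spanInit (linOpt q.1) vec ε l q.2 := by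
  induction l with
  | nil => exact MeasFam.done measurable_snd
  | cons i l ih =>
    refine MeasFam.bind (measFam_spanQuery hl hv i) ?_
    refine MeasFam.bind (MeasFam.compute ?_) (ih.comp (by fun_prop : Measurable fun q :
      ((ι × SpanState d) × (Vec d × Param d × Vec d × Param d × Vec d)) × SpanState d =>
        (q.1.1.1, q.2)))
    exact Measurable.ite (measurableSet_le (by fun_prop) (by fun_prop)) (by fun_prop)
      (by fun_prop)

theorem measFam_spanPass (hl : E.MeasFam fun q : ι × Vec d => linOpt q.1 q.2)
    (hv : E.MeasFam vec) (C ε : ℝ) (l : List (Fin d)) :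
    E.MeasFam fun q : ι × SpanState d => spanPass (linOpt q.1) vec C ε q.2 l := by
  induction l with
  | nil => exact MeasFam.done measurable_const
  | cons i l ih =>
    refine MeasFam.bind (measFam_spanQuery hl hv i) ?_
    refine MeasFam.matchOption (MeasFam.compute ?_) (ih.comp (by fun_prop : Measurable fun q :
      ((ι × SpanState d) × (Vec d × Param d × Vec d × Param d × Vec d)) => q.1))
      (MeasFam.done (by fun_prop))
    have hW : ∀ i, Measurable fun q : ((ι × SpanState d) × (Vec d × Param d × Vec d × Param d ×
      Vec d)) => q.1.2.W i := fun i =>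
        (measurable_pi_apply i).comp (measurable_spanState_W.comp (by fun_prop))
    refine Measurable.ite (measurableSet_le ?_ (by fun_prop)) (by fun_prop)
      (Measurable.ite (measurableSet_le ?_ (by fun_prop)) (by fun_prop) measurable_const)
    all_goals
      have h1 : Measurable fun q : ((ι × SpanState d) × (Vec d × Param d × Vec d × Param d ×
        Vec d)) => (inner ℝ q.2.1 (q.1.2.W i) : ℝ) := Measurable.inner (by fun_prop) (hW i)
      exact measurable_const.mul (continuous_abs.measurable.comp h1)

theorem measFam_spanLoop (hl : E.MeasFam fun q : ι × Vec d => linOpt q.1 q.2)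
    (hv : E.MeasFam vec) (C ε : ℝ) (N : ℕ) :
    E.MeasFam fun q : ι × SpanState d => spanLoop (linOpt q.1) vec C ε N q.2 := by
  induction N with
  | zero => exact MeasFam.done measurable_const
  | succ N ih =>
    refine MeasFam.matchOption (measFam_spanPass hl hv C ε _) (MeasFam.done (by fun_prop)) ?_
    exact ih.comp (by fun_prop : Measurable fun q : (ι × SpanState d) × SpanState d =>
      (q.1.1, q.2))

theorem measFam_robustSpanner (hl : E.MeasFam fun q : ι × Vec d => linOpt q.1 q.2)
    (hv : E.MeasFam vec) (C ε : ℝ) (N : ℕ) :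
    E.MeasFam fun i => robustSpanner (linOpt i) vec C ε N := by
  refine MeasFam.bind ((measFam_spanInit hl hv ε (List.finRange d)).comp
    (g := fun i => (i, _)) (measurable_id.prodMk measurable_const)) ?_
  exact measFam_spanLoop hl hv C ε N

end Spanner

/-- Add the results of layer `h` to those of the earlier layers. -/
def recordLayer (h : ℕ) (R : Exploration d) (r : List (Vec d) × List (Param d)) :
    Option (Fin d → Param d) → Prog X A d (Option (Exploration d))
  | none => Prog.done none
  | some Γ => Prog.done (some ⟨Function.update R.S h r.1, Function.update R.Ψ h r.2,
      Function.update R.Γ h Γ⟩)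

/-- The round of layer `h` in the exploration phase. -/
def exploreLayer (H : ℕ) (s : Sizes) (h : ℕ) :
    Option (Exploration d) → Prog X A d (Option (Exploration d))
  | none => Prog.done none
  | some R => (subspaceCover H s h R.Ψ).bind fun r =>
      (robustSpanner (fun θ => fqi h (rewardAt h θ) R.Ψ s.nCover) (vecEval h s.nVec) 2 s.epsRob
        s.nIter).bind (recordLayer h R r)

theorem exploreUpTo_succ (H : ℕ) (s : Sizes) (h : ℕ) :
    (exploreUpTo H s (h + 1) : Prog X A d (Option (Exploration d))) =
      (exploreUpTo H s h).bind (exploreLayer H s h) := by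
  change Prog.bind _ _ = _
  congr 1

theorem measFam_recordLayer (h : ℕ) {R : ι → Exploration d} {r : ι → List (Vec d) × List (Param d)}
    {o : ι → Option (Fin d → Param d)} (hR : Measurable R) (hr : Measurable r) (ho : Measurable o) :
    E.MeasFam fun i => (recordLayer h (R i) (r i) (o i) : Prog X A d (Option (Exploration d))) := by
  have h1 : E.MeasFam fun q : ι × (Fin d → Param d) => (Prog.done (some
      ⟨Function.update (R q.1).S h (r q.1).1, Function.update (R q.1).Ψ h (r q.1).2,
        Function.update (R q.1).Γ h q.2⟩) : Prog X A d (Option (Exploration d))) := by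
    refine MeasFam.done (measurable_some.comp (Measurable.exploration_mk ?_ ?_ ?_))
    · exact Measurable.function_update h (by fun_prop) (by fun_prop)
    · exact Measurable.function_update h (by fun_prop) (by fun_prop)
    · exact Measurable.function_update h (by fun_prop) (by fun_prop)
  exact MeasFam.matchOption (f := fun i => recordLayer h (R i) (r i)) (MeasFam.done ho)
    (MeasFam.done measurable_const) h1

theorem measFam_layerSpanner {s : Sizes} {h : ℕ} (hh : h < E.H) :
    E.MeasFam fun Ψ : ℕ → List (Param d) =>
      (robustSpanner (fun θ => fqi h (rewardAt h θ) Ψ s.nCover) (vecEval h s.nVec) 2 s.epsRob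
        s.nIter : Prog X A d (Option (Fin d → Param d))) :=
  measFam_robustSpanner
    (linOpt := fun (Ψ : ℕ → List (Param d)) θ => fqi h (rewardAt h θ) Ψ s.nCover)
    ((measFam_fqi_rewardAt hh).comp (by fun_prop : Measurable fun q :
      (ℕ → List (Param d)) × Vec d => (q.2, q.1)))
    (measFam_vecEval hh s.nVec) 2 s.epsRob s.nIter

theorem measFam_exploreLayer {s : Sizes} {h : ℕ} (hh : h < E.H) :
    E.MeasFam fun o => (exploreLayer E.H s h o : Prog X A d (Option (Exploration d))) := by
  refine MeasFam.of_option (MeasFam.prog (ι := Unit) (MeasFam.done measurable_const) ()) ?_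
  refine MeasFam.bind (f := fun R r => (robustSpanner (fun θ => fqi h (rewardAt h θ) R.Ψ s.nCover)
    (vecEval h s.nVec) 2 s.epsRob s.nIter).bind (recordLayer h R r)) ((measFam_subspaceCover hh).comp
    (g := fun R : Exploration d => R.Ψ) (by fun_prop)) ?_
  refine MeasFam.bind (f := fun q => recordLayer h q.1 q.2) ((measFam_layerSpanner hh).comp
    (g := fun q : Exploration d × List (Vec d) × List (Param d) => q.1.Ψ) (by fun_prop)) ?_
  exact measFam_recordLayer h (by fun_prop) (by fun_prop) (by fun_prop)

theorem measProg_exploreUpTo (s : Sizes) {h : ℕ} (hh : h ≤ E.H) :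
    E.MeasProg (exploreUpTo E.H s h : Prog X A d (Option (Exploration d))) := by
  induction h with
  | zero => exact MeasFam.prog (ι := Unit) (MeasFam.done measurable_const) ()
  | succ h ih =>
    rw [exploreUpTo_succ]
    exact MeasFam.prog (ι := Unit) (MeasFam.bind (f := fun _ => exploreLayer E.H s h)
      (MeasProg.fam (ih (by omega))) ((measFam_exploreLayer (by omega)).comp measurable_snd)) ()

theorem measFam_rewardData {h : ℕ} (hh : h < E.H) (n : ℕ) :
    E.MeasFam fun z : Fin d → Param d => (forProg
      (fun i => repeatProg (drawReward (z i) h) n) (List.finRange d) :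
        Prog X A d (List (List (Vec d × ℝ)))) := by
  refine MeasFam.forProg (MeasFam.repeatProg ?_ n) measurable_const
  have : Measurable fun q : (Fin d → Param d) × Fin d => q.1 q.2 :=
    measurable_from_prod_countable_left fun i => by fun_prop
  exact (measFam_drawReward hh).comp this

/-- The regression of one layer in the policy optimization phase. -/
def ridgeProg (Γ : ℕ → Fin d → Param d) (n : ℕ) (h : ℕ) : Prog X A d (Vec d) := do
  let D ← forProg (fun i => repeatProg (drawReward (Γ h i) h) n) (List.finRange d)
  compute (D.flatten.length * d ^ 2 + 2 * d ^ 3) (ridge 1 D.flatten)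

theorem measFam_ridgeProg {h : ℕ} (hh : h < E.H) (n : ℕ) :
    E.MeasFam fun Γ : ℕ → Fin d → Param d => (ridgeProg Γ n h : Prog X A d (Vec d)) := by
  refine MeasFam.bind ((measFam_rewardData hh n).comp (measurable_pi_apply h)) ?_
  exact MeasFam.compute (measurable_ridge (by fun_prop))

theorem policyOpt_eq (H : ℕ) (Ψ : ℕ → List (Param d)) (Γ : ℕ → Fin d → Param d) (n : ℕ) :
    (policyOpt H Ψ Γ n 1 : Prog X A d (Param d)) =
      (forProg (ridgeProg Γ n) (List.range H)).bind fun ws =>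
        fqi (H - 1) (fun h => ws.getD h 0) Ψ n := rfl

theorem measFam_ridgeProgs (n : ℕ) (l : List ℕ) (hl : ∀ h ∈ l, h < E.H) :
    E.MeasFam fun Γ : ℕ → Fin d → Param d =>
      (forProg (ridgeProg Γ n) l : Prog X A d (List (Vec d))) := by
  induction l with
  | nil => exact MeasFam.done measurable_const
  | cons h l ih =>
    refine MeasFam.bind (measFam_ridgeProg (hl h (by simp)) n) ?_
    refine MeasFam.bind ((ih fun k hk => hl k (by simp [hk])).comp measurable_fst) ?_
    exact MeasFam.done (by fun_prop)

theorem measFam_policyOpt (n : ℕ) :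
    E.MeasFam fun q : (ℕ → List (Param d)) × (ℕ → Fin d → Param d) =>
      (policyOpt E.H q.1 q.2 n 1 : Prog X A d (Param d)) := by
  simp only [policyOpt_eq]
  refine MeasFam.bind ((measFam_ridgeProgs n (List.range E.H) (by simp)).comp measurable_snd) ?_
  have hH := E.H_pos
  refine (measFam_fqi (n := n) (by omega)).comp (g := fun q : ((ℕ → List (Param d)) ×
    (ℕ → Fin d → Param d)) × List (Vec d) => (fun h => q.2.getD h 0, q.1.1)) ?_
  fun_prop

theorem measProg_procedure (c₀ c₁ c₂ ε δ : ℝ) :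
    E.MeasProg (procedure c₀ c₁ c₂ E.H ε δ : Prog X A d (Option (Param d))) := by
  suffices h : E.MeasFam fun _ : Unit =>
      (procedure c₀ c₁ c₂ E.H ε δ : Prog X A d (Option (Param d))) from h.prog ()
  refine MeasFam.matchOption (MeasProg.fam (measProg_exploreUpTo _ le_rfl))
    (MeasFam.done measurable_const) ?_
  refine MeasFam.bind ((measFam_policyOpt _).comp (by fun_prop : Measurable fun q :
    Unit × Exploration d => (q.2.Ψ, q.2.Γ))) ?_
  exact MeasFam.done (by fun_prop)

end Setting

/-! ### Lists of independent draws -/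

section Draws

variable {α β V : Type*} [MeasurableSpace α] [MeasurableSpace β] [MeasurableSpace V]

/-- Law of a list of independent draws from the measures in a list. -/
def drawsL : List (Measure α) → Measure (List α)
  | [] => Measure.dirac []
  | ν :: l => (ν.prod (drawsL l)).map fun q => q.1 :: q.2

/-- Law of a list of `n` independent draws from `ν`. -/
def draws (ν : Measure α) (n : ℕ) : Measure (List α) := drawsL (List.replicate n ν)

/-- All measures in the list are probability measures. -/
def AllProb (l : List (Measure α)) : Prop := ∀ ν ∈ l, IsProbabilityMeasure ν

theorem allProb_replicate (ν : Measure α) [h : IsProbabilityMeasure ν] (n : ℕ) :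
    AllProb (List.replicate n ν) := fun μ hμ => by
  rw [(List.mem_replicate.1 hμ).2]; exact h

theorem isProb_drawsL {l : List (Measure α)} (hl : AllProb l) :
    IsProbabilityMeasure (drawsL l) := by
  induction l with
  | nil => unfold drawsL; infer_instance
  | cons ν l ih =>
    have := ih fun μ hμ => hl μ (by simp [hμ])
    have := hl ν (by simp)
    exact Measure.isProbabilityMeasure_map (by fun_prop)

instance (ν : Measure α) [IsProbabilityMeasure ν] (n : ℕ) : IsProbabilityMeasure (draws ν n) :=
  isProb_drawsL (allProb_replicate ν n)

theorem lintegral_drawsL_cons {ν : Measure α} {l : List (Measure α)} (hl : AllProb l)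
    {G : List α → ENNReal} (hG : Measurable G) :
    ∫⁻ D, G D ∂drawsL (ν :: l) = ∫⁻ a, ∫⁻ D, G (a :: D) ∂drawsL l ∂ν := by
  have := isProb_drawsL hl
  change ∫⁻ D, G D ∂((ν.prod (drawsL l)).map fun q => q.1 :: q.2) = _
  rw [lintegral_map hG (by fun_prop), lintegral_prod _ (by fun_prop)]

theorem lintegral_draws_zero {ν : Measure α} {G : List α → ENNReal} (hG : Measurable G) :
    ∫⁻ D, G D ∂draws ν 0 = G [] := by
  unfold draws; simp only [List.replicate_zero, drawsL]; rw [lintegral_dirac' _ hG]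

theorem lintegral_draws_succ {ν : Measure α} [IsProbabilityMeasure ν] {n : ℕ}
    {G : List α → ENNReal} (hG : Measurable G) :
    ∫⁻ D, G D ∂draws ν (n + 1) = ∫⁻ a, ∫⁻ D, G (a :: D) ∂draws ν n ∂ν := by
  unfold draws
  rw [List.replicate_succ, lintegral_drawsL_cons (allProb_replicate ν n) hG]

theorem draws_succ_apply {ν : Measure α} [IsProbabilityMeasure ν] {n : ℕ} {B : Set (List α)}
    (hB : MeasurableSet B) : draws ν (n + 1) B = ∫⁻ a, draws ν n {D | a :: D ∈ B} ∂ν := by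
  rw [← lintegral_indicator_one hB, lintegral_draws_succ (measurable_one.indicator hB)]
  refine lintegral_congr fun a => ?_
  rw [← lintegral_indicator_one]
  · rfl
  · exact (by fun_prop : Measurable fun D : List α => a :: D) hB

theorem measurable_draws_cons {ν : Measure α} [IsProbabilityMeasure ν] {n : ℕ} {B : Set (List α)}
    (hB : MeasurableSet B) : Measurable fun a => draws ν n {D | a :: D ∈ B} :=
  measurable_measure_prodMk_left (ν := draws ν n)
    ((by fun_prop : Measurable fun q : α × List α => q.1 :: q.2) hB)

theorem drawsL_map {l : List (Measure α)} (hl : AllProb l) {f : α → β} (hf : Measurable f) :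
    (drawsL l).map (List.map f) = drawsL (l.map fun ν => ν.map f) := by
  induction l with
  | nil =>
    simp only [drawsL, List.map_nil]
    rw [Measure.map_dirac' (by fun_prop)]; rfl
  | cons ν l ih =>
    have h1 : AllProb l := fun μ hμ => hl μ (by simp [hμ])
    have := isProb_drawsL h1
    have := hl ν (by simp)
    rw [List.map_cons]
    unfold drawsL
    rw [← ih h1, Measure.map_map (by fun_prop) (by fun_prop),
      Measure.map_prod_map _ _ hf (by fun_prop), Measure.map_map (by fun_prop) (by fun_prop)]
    rfl

theorem draws_map {ν : Measure α} [IsProbabilityMeasure ν] {f : α → β} (hf : Measurable f)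
    (n : ℕ) : (draws ν n).map (List.map f) = draws (ν.map f) n := by
  unfold draws; rw [drawsL_map (allProb_replicate ν n) hf, List.map_replicate]

theorem lintegral_drawsL_append {l l' : List (Measure α)} (hl : AllProb l) (hl' : AllProb l')
    {G : List α → ENNReal} (hG : Measurable G) :
    ∫⁻ D, G D ∂drawsL (l ++ l') = ∫⁻ D, ∫⁻ D', G (D ++ D') ∂drawsL l' ∂drawsL l := by
  have h' := isProb_drawsL hl'
  induction l generalizing G with
  | nil =>
    simp only [List.nil_append, drawsL]
    rw [lintegral_dirac']
    · rfl
    · exact Measurable.lintegral_prod_right' (ν := drawsL l')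
        (f := fun q : List α × List α => G (q.1 ++ q.2)) (by fun_prop)
  | cons ν l ih =>
    have h1 : AllProb l := fun μ hμ => hl μ (by simp [hμ])
    rw [List.cons_append, lintegral_drawsL_cons (fun μ hμ => (List.mem_append.1 hμ).elim
      (h1 μ) (hl' μ)) hG, lintegral_drawsL_cons h1]
    · refine lintegral_congr fun a => ?_
      rw [ih h1 (by fun_prop)]
      rfl
    · exact Measurable.lintegral_prod_right' (ν := drawsL l')
        (f := fun q : List α × List α => G (q.1 ++ q.2)) (by fun_prop)

/-- Flattening independent lists of independent draws. -/
theorem drawsL_flatten {κ : Type*} {ν : κ → Measure α} (hν : ∀ k, IsProbabilityMeasure (ν k))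
    (n : ℕ) (l : List κ) :
    (drawsL (l.map fun k => draws (ν k) n)).map List.flatten =
      drawsL (l.flatMap fun k => List.replicate n (ν k)) := by
  refine Measure.ext_of_lintegral _ fun G hG => ?_
  rw [lintegral_map hG (by fun_prop)]
  induction l generalizing G with
  | nil => simp only [List.map_nil, drawsL, List.flatMap_nil]; rw [lintegral_dirac' _ (by fun_prop),
      lintegral_dirac' _ hG]; rfl
  | cons k l ih =>
    have h1 : AllProb (l.map fun k => draws (ν k) n) := by
      intro μ hμ; obtain ⟨k, _, rfl⟩ := List.mem_map.1 hμ
      have := hν k; infer_instance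
    have h2 : AllProb (l.flatMap fun k => List.replicate n (ν k)) := by
      intro μ hμ; obtain ⟨k, _, hk⟩ := List.mem_flatMap.1 hμ
      rw [(List.mem_replicate.1 hk).2]; exact hν k
    have := hν k
    rw [List.map_cons, lintegral_drawsL_cons h1 (by fun_prop), List.flatMap_cons,
      lintegral_drawsL_append (allProb_replicate (ν k) n) h2 hG]
    refine lintegral_congr fun D => ?_
    simp only [List.flatten_cons]
    exact ih (G := fun D' => G (D ++ D')) (by fun_prop)

theorem drawsL_length {l : List (Measure α)} (hl : AllProb l) :
    ∀ᵐ D ∂drawsL l, D.length = l.length := by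
  induction l with
  | nil => simp only [drawsL]; rw [ae_dirac_iff]; rfl
           exact (by fun_prop : Measurable fun D : List α => D.length) (measurableSet_singleton 0)
  | cons ν l ih =>
    have h1 : AllProb l := fun μ hμ => hl μ (by simp [hμ])
    have := isProb_drawsL h1
    have := hl ν (by simp)
    unfold drawsL
    rw [ae_map_iff (by fun_prop)]
    · have := Measure.quasiMeasurePreserving_snd (μ := ν) (ν := drawsL l)
      filter_upwards [this.ae (ih h1)] with q hq
      simp [hq]
    · exact (by fun_prop : Measurable fun D : List α => D.length) (measurableSet_singleton _)

/-- The second coordinate is subgaussian with variance proxy `1/4`, conditionally on the first. -/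
def CondSubG (ν : Measure (V × ℝ)) : Prop :=
  ∀ (F : V → ENNReal) (g : V → ℝ), Measurable F → Measurable g →
    ∫⁻ p, F p.1 * ofReal (exp (g p.1 * p.2 - g p.1 ^ 2 / 8)) ∂ν ≤ ∫⁻ p, F p.1 ∂ν

/-- Exponential supermartingale bound: independent conditionally subgaussian noise variables may be
weighted by coefficients that depend on all features at once. -/
theorem lintegral_exp_drawsL {l : List (Measure (V × ℝ))} (hl : AllProb l)
    (hsg : ∀ ν ∈ l, CondSubG ν) {F : List V → ENNReal} {g : List V × V → ℝ} (hF : Measurable F)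
    (hg : Measurable g) :
    ∫⁻ D, F (D.map Prod.fst) * ofReal (exp ((D.map fun p =>
      g (D.map Prod.fst, p.1) * p.2 - g (D.map Prod.fst, p.1) ^ 2 / 8).sum)) ∂drawsL l ≤
      ∫⁻ D, F (D.map Prod.fst) ∂drawsL l := by
  have hmeas : ∀ (F : List V → ENNReal) (g : List V × V → ℝ), Measurable F → Measurable g →
      Measurable fun D : List (V × ℝ) => F (D.map Prod.fst) * ofReal (exp ((D.map
        fun p => g (D.map Prod.fst, p.1) * p.2 - g (D.map Prod.fst, p.1) ^ 2 / 8).sum)) := by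
    intro F g hF hg
    refine (by fun_prop : Measurable fun D : List (V × ℝ) => F (D.map Prod.fst)).mul ?_
    refine ENNReal.measurable_ofReal.comp (Real.measurable_exp.comp ?_)
    refine Measurable.list_sum (Measurable.list_map ?_ measurable_id)
    have h1 : Measurable fun q : List (V × ℝ) × V × ℝ => g (q.1.map Prod.fst, q.2.1) := by fun_prop
    exact (h1.mul (by fun_prop)).sub ((h1.pow_const 2).div_const 8)
  induction l generalizing F g with
  | nil =>
    simp only [drawsL]
    rw [lintegral_dirac' _ (hmeas F g hF hg), lintegral_dirac' _ (by fun_prop)]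
    simp
  | cons ν l ih =>
    have h1 : AllProb l := fun μ hμ => hl μ (by simp [hμ])
    have := isProb_drawsL h1
    have := hl ν (by simp)
    rw [lintegral_drawsL_cons h1 (hmeas F g hF hg), lintegral_drawsL_cons h1 (by fun_prop)]
    have hm2 := (hmeas F g hF hg).comp (by fun_prop : Measurable fun q : (V × ℝ) × List (V × ℝ) =>
      q.1 :: q.2)
    -- integrate out the first noise variable before the others: given all features, its
    -- coefficient is fixed
    refine (le_of_eq (lintegral_lintegral_swap (f := fun p D => ((fun D : List (V × ℝ) =>
      F (D.map Prod.fst) * ofReal (exp ((D.map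
        fun p => g (D.map Prod.fst, p.1) * p.2 - g (D.map Prod.fst, p.1) ^ 2 / 8).sum))) ∘
          fun q : (V × ℝ) × List (V × ℝ) => q.1 :: q.2) (p, D)) hm2.aemeasurable)).trans ?_
    calc _ ≤ ∫⁻ D, ∫⁻ p, F (p.1 :: D.map Prod.fst) * ofReal (exp ((D.map fun r =>
          g (p.1 :: D.map Prod.fst, r.1) * r.2 - g (p.1 :: D.map Prod.fst, r.1) ^ 2 / 8).sum))
            ∂ν ∂drawsL l := by
          refine lintegral_mono fun D => ?_
          refine le_trans (le_of_eq ?_) (hsg ν (by simp)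
            (fun y => F (y :: D.map Prod.fst) * ofReal (exp ((D.map fun r =>
              g (y :: D.map Prod.fst, r.1) * r.2 - g (y :: D.map Prod.fst, r.1) ^ 2 / 8).sum)))
            (fun y => g (y :: D.map Prod.fst, y)) ?_ (by fun_prop))
          · refine lintegral_congr fun p => ?_
            simp only [Function.comp, List.map_cons, List.sum_cons]
            rw [mul_assoc, ← ENNReal.ofReal_mul (Real.exp_pos _).le, ← Real.exp_add]
            congr 3; ring
          · refine Measurable.mul (by fun_prop) ?_
            refine ENNReal.measurable_ofReal.comp (Real.measurable_exp.comp ?_)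
            refine Measurable.list_sum (Measurable.list_map ?_ measurable_const)
            have h1 : Measurable fun q : V × V × ℝ => g (q.1 :: D.map Prod.fst, q.2.1) := by
              fun_prop
            exact (h1.mul (by fun_prop)).sub ((h1.pow_const 2).div_const 8)
      _ = ∫⁻ p, ∫⁻ D, F (p.1 :: D.map Prod.fst) * ofReal (exp ((D.map fun r =>
          g (p.1 :: D.map Prod.fst, r.1) * r.2 - g (p.1 :: D.map Prod.fst, r.1) ^ 2 / 8).sum))
            ∂drawsL l ∂ν := by
          rw [lintegral_lintegral_swap]
          refine Measurable.aemeasurable (Measurable.mul (by fun_prop) ?_)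
          refine ENNReal.measurable_ofReal.comp (Real.measurable_exp.comp ?_)
          refine Measurable.list_sum (Measurable.list_map (f := fun (q : List (V × ℝ) × V × ℝ)
            (r : V × ℝ) => g (q.2.1 :: q.1.map Prod.fst, r.1) * r.2 -
              g (q.2.1 :: q.1.map Prod.fst, r.1) ^ 2 / 8) ?_ measurable_fst)
          have h1 : Measurable fun q : (List (V × ℝ) × V × ℝ) × V × ℝ =>
            g (q.1.2.1 :: q.1.1.map Prod.fst, q.2.1) := by fun_prop
          exact (h1.mul (by fun_prop)).sub ((h1.pow_const 2).div_const 8)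
      _ ≤ _ := by
          refine lintegral_mono fun p => ?_
          exact ih h1 (fun μ hμ => hsg μ (by simp [hμ])) (F := fun ys => F (p.1 :: ys))
            (g := fun q => g (p.1 :: q.1, q.2)) (by fun_prop) (by fun_prop)

/-- Chernoff bound for weighted sums of conditionally subgaussian noise. -/
theorem drawsL_tail {l : List (Measure (V × ℝ))} (hl : AllProb l)
    (hsg : ∀ ν ∈ l, CondSubG ν) {g : List V × V → ℝ} (hg : Measurable g) {b t : ℝ} (hb : 0 < b)
    (ht : 0 ≤ t) (hgb : ∀ ys : List V, ys.length = l.length →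
      (ys.map fun y => g (ys, y) ^ 2).sum ≤ b) :
    drawsL l {D | t < (D.map fun p => g (D.map Prod.fst, p.1) * p.2).sum} ≤
      ofReal (exp (-(2 * t ^ 2 / b))) := by
  have := isProb_drawsL hl
  -- the optimal exponential tilt
  set s := 4 * t / b with hs
  have h := lintegral_exp_drawsL hl hsg (F := fun _ => 1) (g := fun q => s * g q) measurable_const
    (by fun_prop)
  simp only [one_mul, lintegral_one, measure_univ] at h
  set G : List (V × ℝ) → ENNReal := fun D => ofReal (exp ((D.map fun p =>
      s * g (D.map Prod.fst, p.1) * p.2 - (s * g (D.map Prod.fst, p.1)) ^ 2 / 8).sum)) with hG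
  have hGm : Measurable G := by
    refine ENNReal.measurable_ofReal.comp (Real.measurable_exp.comp ?_)
    refine Measurable.list_sum (Measurable.list_map ?_ measurable_id)
    have h1 : Measurable fun q : List (V × ℝ) × V × ℝ => s * g (q.1.map Prod.fst, q.2.1) := by
      fun_prop
    exact (h1.mul (by fun_prop)).sub ((h1.pow_const 2).div_const 8)
  have hsum : ∀ D : List (V × ℝ), ∀ ys : List V, (D.map fun p =>
      s * g (ys, p.1) * p.2 - (s * g (ys, p.1)) ^ 2 / 8).sum =
      s * (D.map fun p => g (ys, p.1) * p.2).sum -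
        s ^ 2 / 8 * ((D.map Prod.fst).map fun y => g (ys, y) ^ 2).sum := by
    intro D ys
    induction D with
    | nil => simp
    | cons p D ih => simp only [List.map_cons, List.sum_cons, ih]; ring
  have hexp : s * t - s ^ 2 / 8 * b = 2 * t ^ 2 / b := by
    rw [hs]; field_simp; ring
  have hle : drawsL l {D | t < (D.map fun p => g (D.map Prod.fst, p.1) * p.2).sum} ≤
      drawsL l {D | ofReal (exp (2 * t ^ 2 / b)) ≤ G D} := by
    refine measure_mono_ae ?_
    filter_upwards [drawsL_length hl] with D hD hlt
    change ofReal _ ≤ ofReal _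
    refine ENNReal.ofReal_le_ofReal (Real.exp_le_exp.2 ?_)
    rw [hsum, ← hexp]
    have h1 := hgb (D.map Prod.fst) (by simpa using hD)
    have h2 : 0 ≤ s := by positivity
    have h3 : t < (D.map fun p => g (D.map Prod.fst, p.1) * p.2).sum := hlt
    have := mul_le_mul_of_nonneg_left h3.le h2
    have := mul_le_mul_of_nonneg_left h1 (by positivity : 0 ≤ s ^ 2 / 8)
    linarith
  refine hle.trans ?_
  have h2 := mul_meas_ge_le_lintegral (μ := drawsL l) hGm
    (ofReal (exp (2 * t ^ 2 / b)))
  have h3 := h2.trans h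
  rw [Real.exp_neg, ENNReal.ofReal_inv_of_pos (Real.exp_pos _)]
  rw [mul_comm] at h3
  rw [← one_div]
  exact ENNReal.le_div_iff_mul_le (Or.inl (by simpa using Real.exp_pos _))
    (Or.inl ENNReal.ofReal_ne_top) |>.2 h3

/-- Hoeffding's lemma, for a bounded function of an independent noise variable. -/
theorem condSubG_of_prod {μ : Measure α} {ρ : Measure β} [IsProbabilityMeasure μ]
    [IsProbabilityMeasure ρ] {Y : α → V} {R : α × β → ℝ} {m : α → ℝ} (hY : Measurable Y)
    (hR : Measurable R) (hm : Measurable m) (h01 : ∀ q, R q ∈ Set.Icc (0 : ℝ) 1)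
    (hmean : ∀ a, ∫ b, R (a, b) ∂ρ = m a) :
    CondSubG ((μ.prod ρ).map fun q => (Y q.1, R q - m q.1)) := by
  intro F g hF hg
  have hmeas : Measurable fun q : α × β => (Y q.1, R q - m q.1) := by fun_prop
  rw [lintegral_map (by fun_prop) hmeas, lintegral_map (by fun_prop) hmeas,
    lintegral_prod _ (by fun_prop), lintegral_prod _ (by fun_prop)]
  refine lintegral_mono fun a => ?_
  simp only
  rw [lintegral_const_mul _ (by fun_prop)]
  simp only [lintegral_const, measure_univ, mul_one]
  refine mul_le_of_le_one_right' ?_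
  have hsub := ProbabilityTheory.hasSubgaussianMGF_of_mem_Icc (μ := ρ) (X := fun b => R (a, b))
    (a := 0) (b := 1) (by fun_prop) (Filter.Eventually.of_forall fun b => h01 (a, b))
  have hle := hsub.mgf_le (g (Y a))
  have hint := hsub.integrable_exp_mul (g (Y a))
  rw [hmean] at hle hint
  unfold ProbabilityTheory.mgf at hle
  have hexp : ∀ b, exp (g (Y a) * (R (a, b) - m a) - g (Y a) ^ 2 / 8) =
      exp (-(g (Y a) ^ 2 / 8)) * exp (g (Y a) * (R (a, b) - m a)) := by
    intro b; rw [← Real.exp_add]; congr 1; ring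
  simp only [hexp]
  rw [← ofReal_integral_eq_lintegral_ofReal (hint.const_mul _)
    (Filter.Eventually.of_forall fun b => by positivity), integral_const_mul, ENNReal.ofReal_le_one]
  calc _ ≤ exp (-(g (Y a) ^ 2 / 8)) * exp (g (Y a) ^ 2 / 8) := by
        refine mul_le_mul_of_nonneg_left (hle.trans (Real.exp_le_exp.2 (le_of_eq ?_)))
          (Real.exp_pos _).le
        simp; ring
    _ = 1 := by rw [← Real.exp_add]; simp

/-- Hoeffding's inequality for functions with values in `[0,1]`. -/
theorem hoeffding_upper {ν : Measure α} [IsProbabilityMeasure ν] {f : α → ℝ} (hf : Measurable f)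
    (h01 : ∀ a, f a ∈ Set.Icc (0 : ℝ) 1) {n : ℕ} (hn : 0 < n) {t : ℝ} (ht : 0 ≤ t) :
    draws ν n {D | n * t < (D.map f).sum - n * ∫ a, f a ∂ν} ≤
      ofReal (exp (-(2 * n * t ^ 2))) := by
  set m := ∫ a, f a ∂ν with hmdef
  have hc : CondSubG (ν.map fun a => ((), f a - m)) := by
    have h := condSubG_of_prod (V := Unit) (μ := Measure.dirac ()) (ρ := ν) (Y := fun _ => ())
      (R := fun q => f q.2) (m := fun _ => m) (by fun_prop) (by fun_prop) (by fun_prop)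
      (fun q => h01 q.2) (fun _ => rfl)
    rw [Measure.dirac_prod, Measure.map_map (by fun_prop) (by fun_prop)] at h
    exact h
  have hm : Measurable fun a => ((), f a - m) := by fun_prop
  have hpr : IsProbabilityMeasure (ν.map fun a => ((), f a - m)) :=
    Measure.isProbabilityMeasure_map hm.aemeasurable
  have h := drawsL_tail (l := List.replicate n (ν.map fun a => ((), f a - m)))
    (allProb_replicate _ n) (fun μ hμ => by rw [(List.mem_replicate.1 hμ).2]; exact hc)
    (g := fun _ => 1) measurable_const (b := n) (t := n * t) (by positivity) (by positivity)
    (fun ys hys => by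
      rw [List.length_replicate] at hys
      rw [← hys]; simp)
  have h2 := draws_map (ν := ν) hm n
  rw [← draws, ← h2, Measure.map_apply (by fun_prop) (measurableSet_lt (by fun_prop) (by
    fun_prop))] at h
  have he : (2 * (n * t) ^ 2 / n : ℝ) = 2 * n * t ^ 2 := by field_simp
  rw [he] at h
  refine le_trans (measure_mono_ae ?_) h
  filter_upwards [drawsL_length (allProb_replicate ν n)] with D hD hlt
  rw [List.length_replicate] at hD
  have h3 : n * t < (D.map f).sum - n * m := hlt
  change n * t < _
  rw [List.map_map]
  convert h3 using 1
  rw [← hD]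
  clear hlt h3 hD h h2 he
  induction D with
  | nil => simp
  | cons a D ih =>
    simp only [List.map_cons, List.sum_cons, ih, List.length_cons]
    push_cast; simp; ring

theorem hoeffding_lower {ν : Measure α} [IsProbabilityMeasure ν] {f : α → ℝ} (hf : Measurable f)
    (h01 : ∀ a, f a ∈ Set.Icc (0 : ℝ) 1) {n : ℕ} (hn : 0 < n) {t : ℝ} (ht : 0 ≤ t) :
    draws ν n {D | n * t < n * ∫ a, f a ∂ν - (D.map f).sum} ≤
      ofReal (exp (-(2 * n * t ^ 2))) := by
  have h := hoeffding_upper (ν := ν) (f := fun a => 1 - f a) (by fun_prop)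
    (fun a => ⟨by linarith [(h01 a).2], by linarith [(h01 a).1]⟩) hn ht
  have hint : Integrable f ν := Integrable.of_bound (C := 1) (by fun_prop)
    (Filter.Eventually.of_forall fun a => by
      rw [Real.norm_eq_abs, abs_le]; constructor <;> linarith [(h01 a).1, (h01 a).2])
  rw [integral_sub (integrable_const _) hint] at h
  refine le_trans (measure_mono_ae ?_) h
  filter_upwards [drawsL_length (allProb_replicate ν n)] with D hD hlt
  rw [List.length_replicate] at hD
  have h3 : n * t < n * ∫ a, f a ∂ν - (D.map f).sum := hlt
  change n * t < _
  have h4 : (D.map fun a => 1 - f a).sum = D.length - (D.map f).sum := by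
    clear hlt h3 hD
    induction D with
    | nil => simp
    | cons a D ih =>
      simp only [List.map_cons, List.sum_cons, ih, List.length_cons]
      push_cast; ring
  rw [h4, hD]
  simp
  linarith

end Draws

/-! ### Spans of independent samples -/

section Spans

variable {d : ℕ}

theorem exists_lspan (U : Submodule ℝ (Vec d)) : ∃ Q : List (Vec d), lspan Q = U := by
  obtain ⟨S, hS⟩ := IsNoetherian.noetherian U
  refine ⟨S.toList, ?_⟩
  rw [← hS]; unfold lspan; congr 1; ext; simp

/-- The probability that `v` is outside of the span of `U` and `n` samples from `ν`. -/
def miss (ν : Measure (Vec d)) (n : ℕ) (U : Submodule ℝ (Vec d)) (v : Vec d) : ENNReal :=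
  draws ν n {l | v ∉ U ⊔ lspan l}

theorem measurableSet_notMem_sup (U : Submodule ℝ (Vec d)) (v : Vec d) :
    MeasurableSet {l | v ∉ U ⊔ lspan l} := by
  obtain ⟨Q, rfl⟩ := exists_lspan U
  simp only [← lspan_append]
  exact (measurableSet_mem_lspan measurable_const (by fun_prop)).compl

variable {ν : Measure (Vec d)} [IsProbabilityMeasure ν]

theorem miss_le_one (n : ℕ) (U : Submodule ℝ (Vec d)) (v : Vec d) : miss ν n U v ≤ 1 :=
  prob_le_one

theorem miss_of_mem {n : ℕ} {U : Submodule ℝ (Vec d)} {v : Vec d} (h : v ∈ U) :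
    miss ν n U v = 0 := by
  unfold miss
  have : {l : List (Vec d) | v ∉ U ⊔ lspan l} = ∅ := by
    ext l; simpa using Submodule.mem_sup_left h
  rw [this, measure_empty]

theorem miss_zero (U : Submodule ℝ (Vec d)) {v : Vec d} (h : v ∉ U) : miss ν 0 U v = 1 := by
  unfold miss draws
  simp only [List.replicate_zero, drawsL]
  rw [Measure.dirac_apply' _ (measurableSet_notMem_sup U v)]
  simp [h]

theorem miss_anti {U U' : Submodule ℝ (Vec d)} (h : U ≤ U') (n : ℕ) (v : Vec d) :
    miss ν n U' v ≤ miss ν n U v :=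
  measure_mono fun _ hl hm => hl (sup_le_sup_right h _ hm)

theorem sup_lspan_cons (U : Submodule ℝ (Vec d)) (y : Vec d) (l : List (Vec d)) :
    U ⊔ lspan (y :: l) = (U ⊔ Submodule.span ℝ {y}) ⊔ lspan l := by
  rw [lspan_cons, sup_assoc]

theorem miss_succ (n : ℕ) (U : Submodule ℝ (Vec d)) (v : Vec d) :
    miss ν (n + 1) U v = ∫⁻ y, miss ν n (U ⊔ Submodule.span ℝ {y}) v ∂ν := by
  unfold miss
  rw [draws_succ_apply (measurableSet_notMem_sup U v)]
  simp only [Set.mem_ofPred_eq, sup_lspan_cons]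

theorem measurable_miss_sup (n : ℕ) (U : Submodule ℝ (Vec d)) (v : Vec d) :
    Measurable fun y => miss ν n (U ⊔ Submodule.span ℝ {y}) v := by
  have h := measurable_draws_cons (ν := ν) (n := n) (measurableSet_notMem_sup U v)
  unfold miss
  simpa only [Set.mem_ofPred_eq, sup_lspan_cons] using h

theorem measurable_miss (n : ℕ) (U : Submodule ℝ (Vec d)) : Measurable fun v => miss ν n U v := by
  obtain ⟨Q, rfl⟩ := exists_lspan U
  unfold miss
  simp only [← lspan_append]
  refine measurable_measure_prodMk_left (ν := draws ν n) (s := {q : Vec d × List (Vec d) |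
    q.1 ∉ lspan (Q ++ q.2)}) ?_
  exact (measurableSet_mem_lspan (by fun_prop) (by fun_prop)).compl

/-- The second batch is only needed if the first one fails, and then the span it has to extend
is at least `U`. -/
theorem miss_add_le (n m : ℕ) (U : Submodule ℝ (Vec d)) (v : Vec d) :
    miss ν (n + m) U v ≤ miss ν n U v * miss ν m U v := by
  induction n generalizing U with
  | zero =>
    by_cases h : v ∈ U
    · rw [miss_of_mem h]; exact zero_le
    · rw [miss_zero U h, one_mul, zero_add]
  | succ n ih =>
    rw [Nat.succ_add, miss_succ, miss_succ, ← lintegral_mul_const _ (measurable_miss_sup n U v)]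
    refine lintegral_mono fun y => (ih _).trans ?_
    gcongr
    exact miss_anti le_sup_left m v

theorem miss_mono_left {n m : ℕ} (h : n ≤ m) (U : Submodule ℝ (Vec d)) (v : Vec d) :
    miss ν m U v ≤ miss ν n U v := by
  obtain ⟨k, rfl⟩ := Nat.exists_eq_add_of_le h
  exact (miss_add_le n k U v).trans (mul_le_of_le_one_right' (miss_le_one k U v))

theorem miss_mul_le (R n : ℕ) (U : Submodule ℝ (Vec d)) (v : Vec d) :
    miss ν (R * n) U v ≤ miss ν n U v ^ R := by
  induction R with
  | zero => simpa using miss_le_one _ U v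
  | succ R ih =>
    rw [Nat.succ_mul, pow_succ]
    exact (miss_add_le _ _ U v).trans (by gcongr)

/-- The dimension of the span of a list, through the length of an orthonormal basis. -/
def gdim (l : List (Vec d)) : ℕ := (l.foldl gsStep []).length

theorem finrank_lspan_of_onList {Q : List (Vec d)} (hQ : ONList Q) :
    Module.finrank ℝ (lspan Q) = Q.length := by
  have h2 := finrank_span_eq_card hQ.orthonormal.linearIndependent
  have h3 : Set.range (fun i : Fin Q.length => Q.get i) = {z | z ∈ Q} := by
    ext z; simp [List.mem_iff_get]
  rw [h3, Fintype.card_fin] at h2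
  exact h2

theorem gdim_eq_finrank (l : List (Vec d)) : gdim l = Module.finrank ℝ (lspan l) := by
  have h := foldl_gsStep onList_nil l
  unfold gdim
  rw [← finrank_lspan_of_onList h.1, h.2, lspan_nil, bot_sup_eq]

theorem gdim_le (l : List (Vec d)) : gdim l ≤ d := (foldl_gsStep onList_nil l).1.length_le

open Classical in
theorem gdim_cons (a : Vec d) (l : List (Vec d)) :
    gdim (a :: l) = gdim l + if a ∉ lspan l then 1 else 0 := by
  have h1 : gdim (a :: l) = gdim (l ++ [a]) := by
    rw [gdim_eq_finrank, gdim_eq_finrank]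
    have : lspan (a :: l) = lspan (l ++ [a]) := by
      rw [lspan_append, lspan_cons, lspan_cons, lspan_nil, sup_bot_eq, sup_comm]
    rw [this]
  rw [h1]
  unfold gdim
  have h := foldl_gsStep onList_nil l
  rw [lspan_nil, bot_sup_eq] at h
  rw [List.foldl_append]
  simp only [List.foldl_cons, List.foldl_nil]
  by_cases hm : a ∈ lspan l
  · rw [gsStep_of_mem h.1 (by rwa [h.2])]; simp [hm]
  · rw [gsStep_of_notMem h.1 (by rwa [h.2])]; simp [hm]

theorem measurable_gdim : Measurable fun l : List (Vec d) => (gdim l : ENNReal) := by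
  refine (measurable_of_countable (fun k : ℕ => (k : ENNReal))).comp ?_
  unfold gdim
  exact Measurable.list_length (Measurable.list_foldl (f := fun _ => gsStep) (by fun_prop)
    measurable_id measurable_const)

/-- A fresh sample is outside of the span of `n` earlier ones with probability at most `d/(n+1)`:
these probabilities decrease with `n` and sum up to an expected dimension. -/
theorem lintegral_miss_le (n : ℕ) : ∫⁻ y, miss ν n ⊥ y ∂ν ≤ d / (n + 1) := by
  classical
  -- the expected gain in dimension from the `(n + 1)`-st sample
  set e : ℕ → ENNReal := fun n => ∫⁻ y, miss ν n ⊥ y ∂ν with he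
  have hstep : ∀ n, ∫⁻ l, (gdim l : ENNReal) ∂draws ν (n + 1) =
      ∫⁻ l, (gdim l : ENNReal) ∂draws ν n + e n := by
    intro n
    rw [lintegral_draws_succ measurable_gdim]
    have h1 : ∀ a, ∫⁻ l, (gdim (a :: l) : ENNReal) ∂draws ν n =
        ∫⁻ l, (gdim l : ENNReal) ∂draws ν n + miss ν n ⊥ a := by
      intro a
      unfold miss
      rw [← lintegral_indicator_one (measurableSet_notMem_sup ⊥ a),
        ← lintegral_add_left measurable_gdim]
      refine lintegral_congr fun l => ?_
      rw [gdim_cons]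
      by_cases h : a ∈ lspan l
      · simp [h]
      · simp [h]
    simp only [h1]
    rw [lintegral_add_left measurable_const]
    simp [he]
  have hsum : ∀ n, ∑ k ∈ Finset.range n, e k ≤ ∫⁻ l, (gdim l : ENNReal) ∂draws ν n := by
    intro n
    induction n with
    | zero => simp
    | succ n ih => rw [Finset.sum_range_succ, hstep]; gcongr
  have hd : ∫⁻ l, (gdim l : ENNReal) ∂draws ν (n + 1) ≤ d := by
    calc _ ≤ ∫⁻ _, (d : ENNReal) ∂draws ν (n + 1) :=
          lintegral_mono fun l => Nat.cast_le.2 (gdim_le l)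
      _ = d := by simp
  have hge : ((n : ENNReal) + 1) * e n ≤ ∑ k ∈ Finset.range (n + 1), e k := by
    calc ((n : ENNReal) + 1) * e n = ∑ k ∈ Finset.range (n + 1), e n := by simp
      _ ≤ _ := Finset.sum_le_sum fun k hk => lintegral_mono fun y =>
          miss_mono_left (Nat.lt_succ_iff.1 (Finset.mem_range.1 hk)) _ _
  rw [ENNReal.le_div_iff_mul_le (Or.inl (by simp)) (Or.inl (by finiteness)), mul_comm]
  exact hge.trans ((hsum _).trans hd)

theorem measurableSet_resid_eq (Q : List (Vec d)) : MeasurableSet {y : Vec d | resid Q y = 0} :=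
  (by fun_prop : Measurable fun y : Vec d => resid Q y) (measurableSet_singleton 0)

/-- Comparison of sampling from `ν` with sampling from a law `ρ` that dominates the law of the
nonzero residuals: `n` samples from `ν` contain `m` nonzero residuals up to the probability
`2 ^ m (1 - p / 2) ^ n`. -/
theorem miss_compare {ρ : Measure (Vec d)} [IsProbabilityMeasure ρ] {Q : List (Vec d)}
    (hρ : ∀ G : Vec d → ENNReal, Measurable G → (∀ r, G r ≤ G 0) →
      ∫⁻ y in {y | resid Q y ≠ 0}, G (resid Q y) ∂ν ≤
        ν {y | resid Q y ≠ 0} * ∫⁻ r, G r ∂ρ)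
    (n m : ℕ) {U : Submodule ℝ (Vec d)} (hU : lspan Q ≤ U) (v : Vec d) :
    miss ν n U v ≤ 2 ^ m * (ν {y | resid Q y = 0} + ν {y | resid Q y ≠ 0} / 2) ^ n +
      miss ρ m U v := by
  set p := ν {y | resid Q y ≠ 0} with hp
  set q := ν {y | resid Q y = 0} with hq
  have hS := measurableSet_resid_eq Q
  have hqp : q + p = 1 := by
    have h1 := measure_add_measure_compl (μ := ν) hS
    rw [measure_univ] at h1
    exact h1
  induction n generalizing m U with
  | zero =>
    by_cases h : v ∈ U
    · rw [miss_of_mem h]; exact zero_le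
    · rw [miss_zero U h, pow_zero, mul_one]
      exact (one_le_pow₀ (by norm_num)).trans le_self_add
  | succ n ih =>
    rcases m with _ | m
    · by_cases h : v ∈ U
      · rw [miss_of_mem h]; exact zero_le
      · rw [miss_zero U h]; exact (miss_le_one _ U v).trans le_add_self
    -- split according to whether the residual of the first sample vanishes
    · set M := q + p / 2 with hM
      rw [miss_succ, ← lintegral_add_compl _ hS]
      have h1 : ∫⁻ y in {y | resid Q y = 0}, miss ν n (U ⊔ Submodule.span ℝ {y}) v ∂ν ≤
          (2 ^ (m + 1) * M ^ n + miss ρ (m + 1) U v) * q := by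
        calc _ ≤ ∫⁻ _ in {y | resid Q y = 0}, (2 ^ (m + 1) * M ^ n + miss ρ (m + 1) U v) ∂ν :=
              lintegral_mono fun y => (miss_anti le_sup_left n v).trans (ih (m + 1) hU)
          _ = _ := by rw [setLIntegral_const]
      have h2 : ∫⁻ y in {y | resid Q y = 0}ᶜ, miss ν n (U ⊔ Submodule.span ℝ {y}) v ∂ν ≤
          2 ^ m * M ^ n * p + p * miss ρ (m + 1) U v := by
        calc _ ≤ ∫⁻ y in {y | resid Q y ≠ 0}, (2 ^ m * M ^ n +
                miss ρ m (U ⊔ Submodule.span ℝ {resid Q y}) v) ∂ν := by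
              refine lintegral_mono fun y => ?_
              -- a sample and its residual generate the same subspace modulo `U`
              rw [span_resid Q y U hU]
              exact ih m (hU.trans le_sup_left)
          _ = 2 ^ m * M ^ n * p + ∫⁻ y in {y | resid Q y ≠ 0},
                miss ρ m (U ⊔ Submodule.span ℝ {resid Q y}) v ∂ν := by
              rw [lintegral_add_left measurable_const, setLIntegral_const]
          _ ≤ _ := by
              gcongr
              rw [miss_succ (ν := ρ)]
              refine hρ _ (measurable_miss_sup m U v) fun r => miss_anti ?_ m v
              simp
      refine (add_le_add h1 h2).trans (le_of_eq ?_)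
      have hMM : (2 : ENNReal) ^ (m + 1) * M ^ (n + 1) =
          2 ^ (m + 1) * M ^ n * q + 2 ^ m * M ^ n * p := by
        have h2p : (2 : ENNReal) * (p / 2) = p :=
          ENNReal.mul_div_cancel (by norm_num) (by norm_num)
        calc (2 : ENNReal) ^ (m + 1) * M ^ (n + 1)
            = 2 ^ (m + 1) * M ^ n * q + 2 ^ m * M ^ n * (2 * (p / 2)) := by
              conv_lhs => rw [pow_succ M, hM]
              ring
          _ = _ := by rw [h2p]
      have hms : miss ρ (m + 1) U v = miss ρ (m + 1) U v * q + p * miss ρ (m + 1) U v := by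
        conv_lhs => rw [← mul_one (miss ρ (m + 1) U v), ← hqp]
        ring
      rw [hMM]
      conv_rhs => rw [hms]
      ring

end Spans

section ListEvents

variable {α J : Type*} [MeasurableSpace α] [MeasurableSpace J]

theorem measurableSet_forall_mem {B : Set α} (hB : MeasurableSet B) :
    MeasurableSet {l : List α | ∀ a ∈ l, a ∈ B} := by
  classical
  have h : Measurable fun l : List α => l.foldr (fun a b => decide (a ∈ B) && b) true := by
    refine Measurable.list_foldr (J := List α) (l := id) (f := fun _ a b => decide (a ∈ B) && b)
      ?_ measurable_id measurable_const
    refine measurable_bool_of_true ?_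
    simp only [Bool.and_eq_true, decide_eq_true_eq]
    exact ((by fun_prop : Measurable fun p : List α × α × Bool => p.2.1) hB).inter
      ((by fun_prop : Measurable fun p : List α × α × Bool => p.2.2) (measurableSet_singleton true))
  convert h (measurableSet_singleton true) using 1
  ext l
  induction l with
  | nil => simp
  | cons a l ih =>
    simp only [Set.mem_ofPred_eq, Set.mem_preimage, Set.mem_singleton_iff] at ih ⊢
    simp [ih]

theorem draws_forall_mem (ν : Measure α) [IsProbabilityMeasure ν] {B : Set α}
    (hB : MeasurableSet B) (n : ℕ) : draws ν n {l | ∀ a ∈ l, a ∈ B} = ν B ^ n := by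
  induction n with
  | zero =>
    unfold draws
    simp only [List.replicate_zero, drawsL]
    rw [Measure.dirac_apply' _ (measurableSet_forall_mem hB)]
    simp
  | succ n ih =>
    rw [draws_succ_apply (measurableSet_forall_mem hB)]
    have h : ∀ a, draws ν n {D | a :: D ∈ {l : List α | ∀ a ∈ l, a ∈ B}} =
        B.indicator (fun _ => ν B ^ n) a := by
      intro a
      by_cases ha : a ∈ B
      · rw [Set.indicator_of_mem ha, ← ih]
        simp [ha]
      · rw [Set.indicator_of_notMem ha]
        simp [ha]
    simp only [h]
    rw [lintegral_indicator_const hB, pow_succ]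

end ListEvents

/-! ### Laws of the sampling routines -/

namespace Setting

variable {X : Type u} {A : Type v} {Ξ : Type w} [MeasurableSpace X] [MeasurableSpace A]
  [MeasurableSpace Ξ] {d : ℕ} {E : Setting X A Ξ d} {α β : Type} [MeasurableSpace α]
  [MeasurableSpace β]

theorem lintegral_dist_done {a : α} {G : α → ENNReal} (hG : Measurable G) :
    ∫⁻ b, G b ∂E.dist (Prog.done a : Prog X A d α) = G a := by
  rw [dist_done, lintegral_dirac' _ hG]

theorem lintegral_dist_cons {p : Prog X A d α} {q : α → Prog X A d (List α)} (hp : E.MeasProg p)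
    (hq : E.MeasFam q) {G : List α → ENNReal} (hG : Measurable G) :
    ∫⁻ l, G l ∂E.dist (p.bind fun a => (q a).bind fun l => Prog.done (a :: l)) =
      ∫⁻ a, ∫⁻ l, G (a :: l) ∂E.dist (q a) ∂E.dist p := by
  rw [lintegral_dist_bind hp (MeasFam.bind hq (MeasFam.done (by fun_prop))) hG]
  refine lintegral_congr fun a => ?_
  rw [lintegral_dist_bind (hq.prog a) (MeasFam.done (by fun_prop)) hG]
  refine lintegral_congr fun l => ?_
  rw [lintegral_dist_done hG]

theorem dist_repeatProg {p : Prog X A d α} (hp : E.MeasProg p) (n : ℕ) :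
    E.dist (repeatProg p n) = draws (E.dist p) n := by
  have := hp.isProb
  refine Measure.ext_of_lintegral _ fun G hG => ?_
  induction n generalizing G with
  | zero => rw [lintegral_draws_zero hG]; exact lintegral_dist_done hG
  | succ n ih =>
    rw [lintegral_draws_succ hG]
    refine (lintegral_dist_cons hp (q := fun _ => repeatProg p n) ?_ hG).trans ?_
    · exact MeasFam.repeatProg (MeasProg.fam hp) n
    · exact lintegral_congr fun a => ih _ (by fun_prop)

theorem dist_forProg {κ : Type} {f : κ → Prog X A d α} (l : List κ)
    (hf : ∀ k, E.MeasProg (f k)) :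
    E.dist (forProg f l) = drawsL (l.map fun k => E.dist (f k)) := by
  have hfl : ∀ l, E.MeasFam fun _ : α => forProg f l := by
    intro l
    induction l with
    | nil => exact MeasFam.done measurable_const
    | cons k l ih =>
      exact MeasFam.bind (MeasProg.fam (hf k)) (MeasFam.bind (ih.comp measurable_fst)
        (MeasFam.done (by fun_prop)))
  have hprob : ∀ l : List κ, AllProb (l.map fun k => E.dist (f k)) := by
    intro l μ hμ
    obtain ⟨k, _, rfl⟩ := List.mem_map.1 hμ
    exact (hf k).isProb
  refine Measure.ext_of_lintegral _ fun G hG => ?_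
  induction l generalizing G with
  | nil => simp only [List.map_nil, drawsL]; rw [lintegral_dirac' _ hG]; exact lintegral_dist_done hG
  | cons k l ih =>
    rw [List.map_cons, lintegral_drawsL_cons (hprob l) hG]
    refine (lintegral_dist_cons (hf k) (q := fun _ => forProg f l) (hfl l) hG).trans ?_
    exact lintegral_congr fun a => ih _ (by fun_prop)

theorem Sat.repeatProg {p : Prog X A d α} {b : ENNReal} {P : α → Prop} (hp : E.MeasProg p)
    (h : E.Sat p b P) (n : ℕ) :
    E.Sat (LBC.repeatProg p n) (n * b) fun l => l.length = n ∧ ∀ a ∈ l, P a := by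
  induction n with
  | zero => exact (Sat.done (by simp)).mono (by simp) fun _ h => h
  | succ n ih =>
    have h3 : E.Sat (LBC.repeatProg p (n + 1)) (b + (n * b + 0))
        fun l => l.length = n + 1 ∧ ∀ a ∈ l, P a := by
      refine Sat.bind hp ?_ h fun a ha => ?_
      · exact MeasFam.bind (MeasFam.repeatProg (MeasProg.fam hp) n) (MeasFam.done (by fun_prop))
      · refine Sat.bind ((MeasFam.repeatProg (ι := Unit) (MeasProg.fam hp) n).prog ())
          (MeasFam.done (by fun_prop)) ih fun l hl => ?_
        exact Sat.done ⟨by simp [hl.1], by simpa using ⟨ha, hl.2⟩⟩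
    refine h3.mono (le_of_eq ?_) fun _ h => h
    push_cast; ring

/-- Concentration of the number of successes in independent runs. -/
theorem sat_count {p : Prog X A d α} (hp : E.MeasProg p) {f : α → Bool} (hf : Measurable f)
    {n : ℕ} (hn : 0 < n) {t : ℝ} (ht : 0 ≤ t) :
    E.Sat (repeatProg p n) (2 * ofReal (exp (-(2 * n * t ^ 2)))) fun l =>
      |(((l.map f).count true : ℕ) : ℝ) - n * (E.dist p {a | f a = true}).toReal| ≤ n * t := by
  have := hp.isProb
  refine Sat.of_dist_le ?_
  rw [dist_repeatProg hp]
  set g : α → ℝ := fun a => if f a = true then 1 else 0 with hg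
  have hS : MeasurableSet {a | f a = true} := hf (measurableSet_singleton true)
  have hgm : Measurable g := Measurable.ite hS measurable_const measurable_const
  have hg01 : ∀ a, g a ∈ Set.Icc (0 : ℝ) 1 := fun a => by
    simp only [hg]; split_ifs <;> simp
  have hmean : ∫ a, g a ∂E.dist p = (E.dist p {a | f a = true}).toReal := by
    have : g = {a | f a = true}.indicator fun _ => 1 := by
      funext a; simp only [hg, Set.indicator_apply, Set.mem_ofPred_eq]
    rw [this, integral_indicator_const _ hS]
    simp [Measure.real]
  have hcount : ∀ l : List α, (((l.map f).count true : ℕ) : ℝ) = (l.map g).sum := by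
    intro l
    induction l with
    | nil => simp
    | cons a l ih =>
      rw [List.map_cons, List.map_cons, List.sum_cons, ← ih, List.count_cons]
      simp only [hg]
      cases f a <;> simp; ring
  have h1 := hoeffding_upper (ν := E.dist p) hgm hg01 hn ht
  have h2 := hoeffding_lower (ν := E.dist p) hgm hg01 hn ht
  rw [hmean] at h1 h2
  rw [two_mul]
  refine (measure_mono ?_).trans ((measure_union_le _ _).trans (add_le_add h1 h2))
  intro l hl
  have hl' : ¬ |(((l.map f).count true : ℕ) : ℝ) - n * (E.dist p {a | f a = true}).toReal| ≤ n * t :=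
    hl
  rw [hcount, not_le, lt_abs] at hl'
  rcases hl' with h | h
  · exact Or.inl h
  · right; change n * t < _; linarith

variable (E)

/-- The feature of layer `h` on the trajectory from `x` of the greedy policy with parameters `π`. -/
def feat (π : Param d) (h : ℕ) (x : X) : Vec d :=
  E.φ h (E.M.state (greedy E.amax π) x h) (greedy E.amax π h (E.M.state (greedy E.amax π) x h))

/-- Law of the feature of layer `h` under the greedy policy with parameters `π`. -/
def featLaw (π : Param d) (h : ℕ) : Measure (Vec d) := E.M.start.map (E.feat π h)

theorem measurable_feat₂ {h : ℕ} (hh : h < E.H) :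
    Measurable fun q : Param d × X => E.feat q.1 h q.2 :=
  (E.meas.feature h hh).comp ((E.measurable_state hh).prodMk (E.measurable_action hh))

theorem measurable_feat {h : ℕ} (hh : h < E.H) (π : Param d) : Measurable (E.feat π h) :=
  (E.measurable_feat₂ hh).comp measurable_prodMk_left

theorem isProb_featLaw {h : ℕ} (hh : h < E.H) (π : Param d) :
    IsProbabilityMeasure (E.featLaw π h) :=
  Measure.isProbabilityMeasure_map (E.measurable_feat hh π).aemeasurable

theorem norm_feat_le {h : ℕ} (hh : h < E.H) (π : Param d) (x : X) : ‖E.feat π h x‖ ≤ 1 :=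
  E.feature_le h hh _ _

variable {E}

theorem law_map_zero : E.law.map (fun ω => ω 0) = E.M.episodeLaw :=
  Measure.infinitePi_map_eval (μ := fun _ : ℕ => E.M.episodeLaw) 0

theorem law_map_start : E.law.map (fun ω => (ω 0).1) = E.M.start := by
  have h : (fun ω : ℕ → Episode X Ξ => (ω 0).1) = Prod.fst ∘ fun ω => ω 0 := rfl
  rw [h, ← Measure.map_map measurable_fst (measurable_pi_apply 0), law_map_zero]
  unfold MDP.episodeLaw
  rw [Measure.map_fst_prod]; simp

theorem law_map_start_noise (h : ℕ) :
    E.law.map (fun ω => ((ω 0).1, (ω 0).2 h)) = E.M.start.prod E.M.noise := by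
  have h1 := Measure.map_map (μ := E.law) (g := Prod.map (id : X → X) fun ξ : ℕ → Ξ => ξ h)
    (f := fun ω : ℕ → Episode X Ξ => ω 0) (by fun_prop) (measurable_pi_apply 0)
  refine h1.symm.trans ?_
  rw [law_map_zero]
  unfold MDP.episodeLaw
  rw [← Measure.map_prod_map _ _ measurable_id (measurable_pi_apply h), Measure.map_id,
    Measure.infinitePi_map_eval]

theorem dist_drawFeature {h : ℕ} (hh : h < E.H) (π : Param d) :
    E.dist (drawFeature π h : Prog X A d (Vec d)) = E.featLaw π h := by
  unfold featLaw
  rw [← law_map_start, Measure.map_map (E.measurable_feat hh π) (by fun_prop)]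
  rfl

theorem map_dist_drawTarget {h : ℕ} (hh : h + 1 < E.H) (π : Param d) (w θ : Vec d) :
    (E.dist (drawTarget π h w θ : Prog X A d (Vec d × ℝ))).map Prod.fst = E.featLaw π h := by
  unfold featLaw
  rw [← law_map_start, Measure.map_map (E.measurable_feat (by omega) π) (by fun_prop)]
  have hm : E.MeasProg (drawTarget π h w θ : Prog X A d (Vec d × ℝ)) :=
    (measFam_drawTarget hh).prog (π, w, θ)
  exact Measure.map_map measurable_fst (Measurable.fst hm)

theorem dist_drawReward {h : ℕ} (hh : h < E.H) (π : Param d) :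
    E.dist (drawReward π h : Prog X A d (Vec d × ℝ)) =
      (E.M.start.prod E.M.noise).map fun q => (E.feat π h q.1,
        E.M.reward h (E.M.state (greedy E.amax π) q.1 h)
          (greedy E.amax π h (E.M.state (greedy E.amax π) q.1 h)) q.2) := by
  rw [← law_map_start_noise h, Measure.map_map]
  · rfl
  · have h1 : Measurable fun q : X × Ξ => (π, q.1) := by fun_prop
    have h2 := (E.meas.reward h hh).comp ((((E.measurable_state hh).comp h1).prodMk
      ((E.measurable_action hh).comp h1)).prodMk (measurable_snd : Measurable fun q : X × Ξ => q.2))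
    exact ((E.measurable_feat hh π).comp measurable_fst).prodMk h2
  · fun_prop

/-! ### Rejection sampling and outlier directions -/

theorem measProg_rejection {h : ℕ} (hh : h < E.H) (π : Param d) (Q : List (Vec d)) (K : ℕ) :
    E.MeasProg (rejection π h Q K : Prog X A d (Vec d)) := (measFam_rejection hh K).prog (π, Q)

/-- Recursion over the first draw: it is returned if its residual is nonzero, and otherwise the
sampling goes on. -/
theorem lintegral_rejection_succ {h : ℕ} (hh : h < E.H) (π : Param d) (Q : List (Vec d)) (K : ℕ)
    {G : Vec d → ENNReal} (hG : Measurable G) :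
    ∫⁻ r, G r ∂E.dist (rejection π h Q (K + 1) : Prog X A d (Vec d)) =
      ∫⁻ y in {y | resid Q y ≠ 0}, G (resid Q y) ∂E.featLaw π h +
        E.featLaw π h {y | resid Q y = 0} *
          ∫⁻ r, G r ∂E.dist (rejection π h Q K : Prog X A d (Vec d)) := by
  classical
  have h1 : E.MeasProg (drawFeature π h : Prog X A d (Vec d)) := (measFam_drawFeature hh).prog π
  have h2 : E.MeasFam fun r : Vec d => (if r ≠ 0 then pure r else rejection π h Q K :
      Prog X A d (Vec d)) := by
    refine MeasFam.ite ?_ (MeasFam.done measurable_id) (MeasProg.fam (measProg_rejection hh π Q K))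
    exact (measurableSet_singleton (0 : Vec d)).compl
  have h3 : E.MeasFam fun y : Vec d => ((compute (4 * (Q.length + 1) * d) (resid Q y)).bind
      fun r => if r ≠ 0 then pure r else rejection π h Q K : Prog X A d (Vec d)) :=
    MeasFam.bind (MeasFam.compute (by fun_prop)) (h2.comp measurable_snd)
  refine (lintegral_dist_bind h1 h3 hG).trans ?_
  rw [dist_drawFeature hh, ← lintegral_add_compl _ (measurableSet_resid_eq Q).compl, compl_compl]
  congr 1
  · refine setLIntegral_congr_fun (measurableSet_resid_eq Q).compl fun y hy => ?_
    change ∫⁻ r, G r ∂E.dist (if resid Q y ≠ 0 then Prog.done (resid Q y) else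
      rejection π h Q K : Prog X A d (Vec d)) = _
    rw [if_pos (by exact hy), lintegral_dist_done hG]
  · rw [mul_comm (E.featLaw π h _), ← setLIntegral_const]
    refine setLIntegral_congr_fun (measurableSet_resid_eq Q) fun y hy => ?_
    change ∫⁻ r, G r ∂E.dist (if resid Q y ≠ 0 then Prog.done (resid Q y) else
      rejection π h Q K : Prog X A d (Vec d)) = _
    rw [if_neg (by simpa using hy)]

theorem featLaw_resid_add {h : ℕ} (hh : h < E.H) (π : Param d) (Q : List (Vec d)) :
    E.featLaw π h {y | resid Q y = 0} + E.featLaw π h {y | resid Q y ≠ 0} = 1 := by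
  have := E.isProb_featLaw hh π
  have h1 := measure_add_measure_compl (μ := E.featLaw π h) (measurableSet_resid_eq Q)
  rw [measure_univ] at h1
  exact h1

/-- The law of rejection sampling dominates the law of the nonzero residuals. -/
theorem rejection_dominates {h : ℕ} (hh : h < E.H) (π : Param d) (Q : List (Vec d)) (K : ℕ)
    {G : Vec d → ENNReal} (hG : Measurable G) (hG0 : ∀ r, G r ≤ G 0) :
    ∫⁻ y in {y | resid Q y ≠ 0}, G (resid Q y) ∂E.featLaw π h ≤
      E.featLaw π h {y | resid Q y ≠ 0} *
        ∫⁻ r, G r ∂E.dist (rejection π h Q K : Prog X A d (Vec d)) := by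
  induction K with
  | zero =>
    have : ∫⁻ r, G r ∂E.dist (rejection π h Q 0 : Prog X A d (Vec d)) = G 0 :=
      lintegral_dist_done hG
    rw [this]
    calc _ ≤ ∫⁻ _ in {y | resid Q y ≠ 0}, G 0 ∂E.featLaw π h := lintegral_mono fun y => hG0 _
      _ = _ := by rw [setLIntegral_const, mul_comm]
  | succ K ih =>
    rw [lintegral_rejection_succ hh π Q K hG, mul_add]
    set I := ∫⁻ y in {y | resid Q y ≠ 0}, G (resid Q y) ∂E.featLaw π h
    calc I = (E.featLaw π h {y | resid Q y = 0} + E.featLaw π h {y | resid Q y ≠ 0}) * I := by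
          rw [featLaw_resid_add hh, one_mul]
      _ = E.featLaw π h {y | resid Q y ≠ 0} * I + E.featLaw π h {y | resid Q y = 0} * I := by ring
      _ ≤ E.featLaw π h {y | resid Q y ≠ 0} * I + E.featLaw π h {y | resid Q y = 0} *
          (E.featLaw π h {y | resid Q y ≠ 0} *
            ∫⁻ r, G r ∂E.dist (rejection π h Q K : Prog X A d (Vec d))) := by gcongr
      _ = _ := by ring

/-- Rejection sampling returns the junk value `0` only if every draw has residual zero. -/
theorem rejection_zero_prob {h : ℕ} (hh : h < E.H) (π : Param d) (Q : List (Vec d)) (K : ℕ) :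
    E.dist (rejection π h Q K : Prog X A d (Vec d)) {0} ≤
      E.featLaw π h {y | resid Q y = 0} ^ K := by
  induction K with
  | zero => have := (measProg_rejection (E := E) hh π Q 0).isProb
            simpa using prob_le_one
  | succ K ih =>
    rw [← lintegral_indicator_one (measurableSet_singleton 0), lintegral_rejection_succ hh π Q K
      (measurable_one.indicator (measurableSet_singleton 0)),
      lintegral_indicator_one (measurableSet_singleton 0), pow_succ']
    have : ∫⁻ y in {y | resid Q y ≠ 0}, Set.indicator {0} 1 (resid Q y) ∂E.featLaw π h = 0 := by
      refine (setLIntegral_congr_fun (g := fun _ => 0) (measurableSet_resid_eq Q).compl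
        fun y hy => ?_).trans (by simp)
      exact Set.indicator_of_notMem (by exact hy) _
    rw [this, zero_add]
    gcongr

theorem rejection_orthogonal (π : Param d) (h : ℕ) {Q : List (Vec d)} (hQ : ONList Q) (K : ℕ)
    (ω : ℕ → Episode X Ξ) :
    ∀ q ∈ Q, inner ℝ q (E.eval (rejection π h Q K : Prog X A d (Vec d)) ω).1 = 0 := by
  classical
  intro q hq
  induction K generalizing ω with
  | zero => exact inner_zero_right _
  | succ K ih =>
    have h1 : (E.eval (rejection π h Q (K + 1) : Prog X A d (Vec d)) ω) =
        E.eval (if resid Q (E.feat π h (ω 0).1) ≠ 0 then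
          Prog.done (resid Q (E.feat π h (ω 0).1)) else rejection π h Q K : Prog X A d (Vec d))
            (fun n => ω (n + 1)) := rfl
    rw [h1]
    split_ifs with hr
    · exact inner_resid hQ hq _
    · exact ih _

/-- Rejection sampling finds a nonzero vector in the orthogonal complement. -/
theorem sat_rejection {h : ℕ} (hh : h < E.H) (π : Param d) {Q : List (Vec d)} (hQ : ONList Q)
    (K : ℕ) : E.Sat (rejection π h Q K : Prog X A d (Vec d))
      (E.featLaw π h {y | resid Q y = 0} ^ K) fun r => r ∉ lspan Q := by
  have h1 : E.Sat (rejection π h Q K : Prog X A d (Vec d)) 0 fun r => ∀ q ∈ Q, inner ℝ q r = 0 :=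
    Sat.of_forall (measProg_rejection hh π Q K) fun ω => rejection_orthogonal π h hQ K ω
  have h2 : E.Sat (rejection π h Q K : Prog X A d (Vec d))
      (E.featLaw π h {y | resid Q y = 0} ^ K) fun r => r ≠ 0 := by
    refine Sat.of_dist_le ?_
    have : {a : Vec d | ¬ a ≠ 0} = {0} := by ext; simp
    rw [this]
    exact rejection_zero_prob hh π Q K
  refine (h1.and h2 (measurableSet_singleton (0 : Vec d)).compl).mono (by simp) ?_
  rintro r ⟨hr, hr0⟩ hm
  apply hr0
  have h3 : ∀ z ∈ lspan Q, inner ℝ z r = 0 := by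
    intro z hz
    unfold lspan at hz
    induction hz using Submodule.span_induction with
    | mem x hx => exact hr x hx
    | zero => simp
    | add a b _ _ ha hb => rw [inner_add_left, ha, hb, add_zero]
    | smul c a _ ha => rw [real_inner_smul_left, ha, mul_zero]
  exact inner_self_eq_zero.1 (h3 r hm)

/-- With high probability, `n` fresh draws span the selected candidate with probability at least
`5/8`: some candidate is missed with probability below `1/4`, and all hit frequencies are
accurate up to `1/16`. -/
theorem sat_computeOutlierDirection {draw : Prog X A d (Vec d)} (hd : E.MeasProg draw) {n m : ℕ}
    (hm : 0 < m) {b : ENNReal} {P : Vec d → Prop} (hP : E.Sat draw b P) :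
    E.Sat (computeOutlierDirection draw n m)
      (n * b + (4 * (d / (n + 1))) ^ n +
        n * (2 * ofReal (exp (-(2 * m * (1 / 16) ^ 2)))))
      fun v => P v ∧ miss (E.dist draw) n ⊥ v ≤ ofReal (3 / 8) := by
  have := hd.isProb
  set ρ := E.dist draw with hρ
  have hdf : E.MeasFam fun _ : Unit => draw := MeasProg.fam hd
  -- by the Markov inequality, it is unlikely that all candidates belong to the following set
  have hB : MeasurableSet {y | ofReal (1 / 4) ≤ miss ρ n ⊥ y} :=
    measurableSet_le measurable_const (measurable_miss n ⊥)
  have hU : E.Sat (repeatProg draw n) (n * b + (4 * (d / (n + 1))) ^ n) fun U =>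
      (U.length = n ∧ ∀ y ∈ U, P y) ∧ ¬ ∀ y ∈ U, y ∈ {y | ofReal (1 / 4) ≤ miss ρ n ⊥ y} := by
    refine Sat.and (Sat.repeatProg hd hP n) (Sat.of_dist_le ?_) (measurableSet_forall_mem hB).compl
    rw [dist_repeatProg hd]
    simp only [not_not]
    have h1 := draws_forall_mem ρ hB n
    refine (le_of_eq h1).trans ?_
    gcongr
    have h2 := mul_meas_ge_le_lintegral (μ := ρ) (measurable_miss (ν := ρ) n ⊥)
      (ofReal (1 / 4))
    have h3 := h2.trans (lintegral_miss_le (ν := ρ) n)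
    calc ρ {y | ofReal (1 / 4) ≤ miss ρ n ⊥ y}
        = 4 * (ofReal (1 / 4) * ρ {y | ofReal (1 / 4) ≤ miss ρ n ⊥ y}) := by
          rw [← mul_assoc]
          have : (4 : ENNReal) * ofReal (1 / 4) = 1 := by
            rw [show (4 : ENNReal) = ofReal 4 by simp,
              ← ENNReal.ofReal_mul (by norm_num)]
            norm_num
          rw [this, one_mul]
      _ ≤ _ := by gcongr
  set test : Vec d → Prog X A d Bool := fun y => (repeatProg draw n).bind fun W =>
    compute ((n + 1) * d ^ 2) (spanTest y W) with htest
  have htf : E.MeasFam test := MeasFam.bind ((hdf.repeatProg n).comp (g := fun _ => ()) measurable_const)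
    (MeasFam.compute (Measurable.spanTest (by fun_prop) (by fun_prop)))
  -- success probability of a single trial
  have htd : ∀ y, (E.dist (test y) {b | b = true}).toReal = 1 - (miss ρ n ⊥ y).toReal := by
    intro y
    have h1 : MeasurableSet {W : List (Vec d) | y ∉ ⊥ ⊔ lspan W} := measurableSet_notMem_sup ⊥ y
    have h2 : E.dist (test y) {b | b = true} = draws ρ n {W | y ∉ ⊥ ⊔ lspan W}ᶜ := by
      rw [← lintegral_indicator_one (by exact MeasurableSet.of_discrete), htest]
      refine (lintegral_dist_bind ((hdf.repeatProg n).prog ()) (MeasFam.compute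
        (Measurable.spanTest measurable_const measurable_id)) (by fun_prop)).trans ?_
      rw [dist_repeatProg hd, ← lintegral_indicator_one h1.compl]
      refine lintegral_congr fun W => ?_
      rw [dist_compute, lintegral_dirac' _ (by fun_prop)]
      by_cases hyW : y ∈ lspan W
      · have h3 : spanTest y W = true := spanTest_eq_true.2 hyW
        simp [h3, hyW]
      · have h3 : spanTest y W = false :=
          Bool.eq_false_iff.2 fun h => hyW (spanTest_eq_true.1 h)
        simp [h3, hyW]
    rw [h2, prob_compl_eq_one_sub h1]
    exact ENNReal.toReal_sub_of_le (miss_le_one n ⊥ y) ENNReal.one_ne_top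
  set body : Vec d → Prog X A d (Vec d × ℕ) := fun y => (repeatProg (test y) m).bind fun hits =>
    compute m (y, hits.count true) with hbody
  have hbf : E.MeasFam body := MeasFam.bind (htf.repeatProg m) (MeasFam.compute (by fun_prop))
  have hbs : ∀ y, E.Sat (body y) (2 * ofReal (exp (-(2 * m * (1 / 16) ^ 2))))
      fun r => r.1 = y ∧ |((r.2 : ℕ) : ℝ) - m * (1 - (miss ρ n ⊥ y).toReal)| ≤ m * (1 / 16) := by
    intro y
    refine (Sat.bind ((htf.repeatProg m).prog y) (MeasFam.compute (by fun_prop))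
      (sat_count (htf.prog y) (f := id) measurable_id hm (by norm_num : (0 : ℝ) ≤ 1 / 16))
      (c := 0) fun hits hh => Sat.compute ?_).mono (by simp) fun _ h => h
    refine ⟨rfl, ?_⟩
    have : (E.dist (test y) {a | id a = true}).toReal = 1 - (miss ρ n ⊥ y).toReal := htd y
    rw [this, List.map_id] at hh
    exact hh
  have key : E.Sat ((repeatProg draw n).bind fun U => (forProg body U).bind fun S =>
      (compute n (((S.argmax Prod.snd).map Prod.fst).getD 0)))
      ((n * b + (4 * (d / (n + 1))) ^ n) + (n * (2 * ofReal (exp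
        (-(2 * m * (1 / 16) ^ 2)))) + 0))
      fun v => P v ∧ miss ρ n ⊥ v ≤ ofReal (3 / 8) := by
    have hlast : Measurable fun S : List (Vec d × ℕ) =>
        ((S.argmax Prod.snd).map Prod.fst).getD (0 : Vec d) :=
      Measurable.option_getD (Measurable.option_map (by fun_prop)
      (Measurable.list_argmax (by fun_prop) (by fun_prop))) measurable_const
    refine Sat.bind ((hdf.repeatProg n).prog ()) ?_ hU fun U hU' => ?_
    · exact MeasFam.bind (MeasFam.forProg (hbf.comp measurable_snd) measurable_id)
        (MeasFam.compute (hlast.comp measurable_snd))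
    · obtain ⟨⟨hlen, hPU⟩, hgood⟩ := hU'
      have hfor := Sat.forProg (l := U) (fun k _ => hbf.prog k) (fun k _ => hbs k)
      rw [hlen] at hfor
      refine Sat.bind ((MeasFam.forProg (ι := Unit) (f := fun _ => body)
        (hbf.comp measurable_snd) (l := fun _ => U) measurable_const).prog ())
        (MeasFam.compute hlast) hfor fun S hS => Sat.compute ?_
      -- a good candidate beats every candidate that is missed with probability above `3/8`
      push Not at hgood
      obtain ⟨y₀, hy₀, hm₀⟩ := hgood
      have hm₀ : miss ρ n ⊥ y₀ < ofReal (1 / 4) := not_le.1 hm₀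
      have hall : ∀ r ∈ S, r.1 ∈ U ∧
          |((r.2 : ℕ) : ℝ) - m * (1 - (miss ρ n ⊥ r.1).toReal)| ≤ m * (1 / 16) := by
        intro r hr
        obtain ⟨i, hi, rfl⟩ := List.mem_iff_getElem.1 hr
        have hi' : i < U.length := by rw [hS.length_eq]; exact hi
        have h5 := hS.get hi' hi
        simp only [List.get_eq_getElem] at h5
        rw [h5.1]
        exact ⟨List.getElem_mem _, h5.2⟩
      have hex : ∃ r ∈ S, r.1 = y₀ := by
        obtain ⟨i, hi, rfl⟩ := List.mem_iff_getElem.1 hy₀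
        have hi' : i < S.length := by rw [← hS.length_eq]; exact hi
        have h5 := hS.get hi hi'
        exact ⟨_, List.getElem_mem hi', h5.1⟩
      obtain ⟨r₀, hr₀, hr₀y⟩ := hex
      have hne : S.argmax Prod.snd ≠ none := by
        rw [Ne, List.argmax_eq_none]
        rintro rfl
        simp at hr₀
      obtain ⟨r, hr⟩ := Option.ne_none_iff_exists'.1 hne
      have hrS := List.argmax_mem (by rw [hr]; rfl : r ∈ S.argmax Prod.snd)
      have hle : r₀.2 ≤ r.2 := List.le_of_mem_argmax hr₀ (by rw [hr]; rfl)
      rw [hr]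
      simp only [Option.map_some, Option.getD_some]
      refine ⟨hPU _ (hall r hrS).1, ?_⟩
      have h6 := (hall r hrS).2
      have h7 := (hall r₀ hr₀).2
      rw [hr₀y] at h7
      have hne₀ : miss ρ n ⊥ y₀ ≠ ⊤ := ne_top_of_lt hm₀
      have h8 : (miss ρ n ⊥ y₀).toReal < 1 / 4 := by
        rw [← ENNReal.toReal_ofReal (by norm_num : (0 : ℝ) ≤ 1 / 4)]
        exact (ENNReal.toReal_lt_toReal hne₀ ENNReal.ofReal_ne_top).2 hm₀
      have hne1 : miss ρ n ⊥ r.1 ≠ ⊤ := ne_top_of_le_ne_top ENNReal.one_ne_top (miss_le_one _ _ _)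
      rw [ENNReal.le_ofReal_iff_toReal_le hne1 (by norm_num)]
      have hmR : (0 : ℝ) < m := by exact_mod_cast hm
      have hleR : (r₀.2 : ℝ) ≤ r.2 := by exact_mod_cast hle
      rw [abs_le] at h6 h7
      by_contra hcon
      rw [not_le] at hcon
      nlinarith [h6.2, h7.1]
  refine Sat.mono (p := computeOutlierDirection draw n m) key (by simp) fun _ h => h

end Setting

/-! ### Bellman backups and greedy policies -/

namespace Setting

variable {X : Type u} {A : Type v} {Ξ : Type w} [MeasurableSpace X] [MeasurableSpace A]
  [MeasurableSpace Ξ] {d : ℕ} (E : Setting X A Ξ d)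

/-- The feature of layer `h` on the trajectory of an arbitrary policy from `x`. -/
def polFeat (π : Policy X A) (h : ℕ) (x : X) : Vec d :=
  E.φ h (E.M.state π x h) (π h (E.M.state π x h))

/-- Linear Bellman completeness on all of `ℝᵈ`: the maps given on the Bellman balls extend by
homogeneity, and the maximum is attained at the action of the oracle. -/
theorem exists_backup {h : ℕ} (hh : h + 1 < E.H) : ∃ T : Vec d → Vec d, ∀ θ x a,
    inner ℝ (E.φ h x a) (T θ) = inner ℝ (E.φ (h + 1) (E.M.next h x a)
      (E.amax (h + 1) (E.M.next h x a) θ)) θ := by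
  obtain ⟨T, hT⟩ := E.complete h hh
  -- scaling by `‖θ‖ + 1` rather than by `‖θ‖` avoids a case distinction at `θ = 0`
  refine ⟨fun θ => (‖θ‖ + 1) • T ((‖θ‖ + 1)⁻¹ • θ), fun θ x a => ?_⟩
  have hc : 0 < ‖θ‖ + 1 := by positivity
  have hmem : (‖θ‖ + 1)⁻¹ • θ ∈ bellmanBall E.φ (h + 1) := by
    intro x a
    refine (abs_real_inner_le_norm _ _).trans ?_
    rw [norm_smul, norm_inv, Real.norm_of_nonneg hc.le]
    have h1 := E.feature_le (h + 1) hh x a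
    have h2 : (‖θ‖ + 1)⁻¹ * ‖θ‖ ≤ 1 := by
      rw [inv_mul_le_iff₀ hc]; linarith
    exact mul_le_one₀ h1 (by positivity) h2
  have : Nonempty A := ⟨a⟩
  rw [real_inner_smul_right, (hT _ hmem).2 x a]
  set x' := E.M.next h x a
  have hle : ∀ a', inner ℝ (E.φ (h + 1) x' a') ((‖θ‖ + 1)⁻¹ • θ) ≤
      (‖θ‖ + 1)⁻¹ * inner ℝ (E.φ (h + 1) x' (E.amax (h + 1) x' θ)) θ := by
    intro a'
    rw [real_inner_smul_right]
    exact mul_le_mul_of_nonneg_left (E.oracle (h + 1) hh x' θ a') (by positivity)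
  have hsup : ⨆ a', inner ℝ (E.φ (h + 1) x' a') ((‖θ‖ + 1)⁻¹ • θ) =
      (‖θ‖ + 1)⁻¹ * inner ℝ (E.φ (h + 1) x' (E.amax (h + 1) x' θ)) θ := by
    refine le_antisymm (ciSup_le hle) ?_
    rw [← real_inner_smul_right]
    exact le_ciSup (f := fun a' => inner ℝ (E.φ (h + 1) x' a') ((‖θ‖ + 1)⁻¹ • θ))
      ⟨_, by rintro _ ⟨a', rfl⟩; exact hle a'⟩ (E.amax (h + 1) x' θ)
  rw [hsup, ← mul_assoc, mul_inv_cancel₀ hc.ne', one_mul]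

open Classical in
/-- The linear Bellman map from layer `h + 1` to layer `h`, defined on all of `ℝᵈ`. -/
def backup (h : ℕ) : Vec d → Vec d :=
  if hh : h + 1 < E.H then Classical.choose (E.exists_backup hh) else 0

theorem inner_backup {h : ℕ} (hh : h + 1 < E.H) (θ : Vec d) (x : X) (a : A) :
    inner ℝ (E.φ h x a) (E.backup h θ) = inner ℝ (E.φ (h + 1) (E.M.next h x a)
      (E.amax (h + 1) (E.M.next h x a) θ)) θ := by
  unfold backup
  rw [dif_pos hh]
  exact Classical.choose_spec (E.exists_backup hh) θ x a

/-- `θ` satisfies the Bellman equations of the rewards `⟨φ_l, ws l⟩`, `l ≤ h`, when tested against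
vectors of the subspaces `S l`. -/
def IsBackup (S : ℕ → Submodule ℝ (Vec d)) (h : ℕ) (ws θ : Param d) : Prop :=
  θ h = ws h ∧ ∀ l < h, ∀ y ∈ S l, inner ℝ y (θ l) = inner ℝ y (ws l + E.backup l (θ (l + 1)))

/-- Exact backward induction, with no restriction on the features. -/
theorem exists_isBackup_top (h : ℕ) (ws : Param d) : ∃ θ, E.IsBackup (fun _ => ⊤) h ws θ := by
  let g : ℕ → Vec d := fun j => Nat.rec (ws h)
    (fun j t => ws (h - (j + 1)) + E.backup (h - (j + 1)) t) j
  refine ⟨fun l => g (h - l), by simp [g], fun l hl y _ => ?_⟩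
  have h1 : h - l = (h - (l + 1)) + 1 := by omega
  have h2 : h - ((h - (l + 1)) + 1) = l := by omega
  have h3 : g (h - l) = ws l + E.backup l (g (h - (l + 1))) := by
    rw [h1]
    change ws (h - ((h - (l + 1)) + 1)) + E.backup (h - ((h - (l + 1)) + 1)) (g (h - (l + 1))) = _
    rw [h2]
  simp only [h3]

variable {E}

section Backup

variable {S : ℕ → Submodule ℝ (Vec d)} {h : ℕ} {ws θ : Param d}

theorem IsBackup.partial_le (hb : E.IsBackup S h ws θ) (hh : h < E.H) {π : Policy X A} {x : X}
    (hS : ∀ l < h, E.polFeat π l x ∈ S l) {k : ℕ} (hk : k ≤ h) :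
    ∑ l ∈ Finset.range k, inner ℝ (E.polFeat π l x) (ws l) + inner ℝ (E.polFeat π k x) (θ k) ≤
      inner ℝ (E.polFeat π 0 x) (θ 0) := by
  induction k with
  | zero => simp
  | succ k ih =>
    refine le_trans ?_ (ih (by omega))
    rw [Finset.sum_range_succ, hb.2 k (by omega) _ (hS k (by omega)), inner_add_right]
    have h1 : inner ℝ (E.polFeat π (k + 1) x) (θ (k + 1)) ≤
        inner ℝ (E.polFeat π k x) (E.backup k (θ (k + 1))) := by
      have h2 := E.inner_backup (h := k) (by omega) (θ (k + 1)) (E.M.state π x k)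
        (π k (E.M.state π x k))
      exact (E.oracle (k + 1) (by omega) _ _ _).trans_eq h2.symm
    linarith

theorem IsBackup.partial_eq (hb : E.IsBackup S h ws θ) (hh : h < E.H) {x : X}
    (hS : ∀ l < h, E.feat θ l x ∈ S l) {k : ℕ} (hk : k ≤ h) :
    ∑ l ∈ Finset.range k, inner ℝ (E.feat θ l x) (ws l) + inner ℝ (E.feat θ k x) (θ k) =
      inner ℝ (E.feat θ 0 x) (θ 0) := by
  induction k with
  | zero => simp
  | succ k ih =>
    rw [← ih (by omega), Finset.sum_range_succ, hb.2 k (by omega) _ (hS k (by omega)),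
      inner_add_right]
    have h1 : inner ℝ (E.feat θ (k + 1) x) (θ (k + 1)) =
        inner ℝ (E.feat θ k x) (E.backup k (θ (k + 1))) :=
      (E.inner_backup (h := k) (by omega) (θ (k + 1)) (E.M.state (greedy E.amax θ) x k)
        (greedy E.amax θ k (E.M.state (greedy E.amax θ) x k))).symm
    linarith

/-- From an initial state `x`, the greedy policy of a solution of the Bellman equations tested on
`S` is at least as good as any policy, provided that both trajectories stay in `S`. -/
theorem IsBackup.optimal (hb : E.IsBackup S h ws θ) (hh : h < E.H) {π : Policy X A} {x : X}
    (hS : ∀ l < h, E.polFeat π l x ∈ S l) (hS' : ∀ l < h, E.feat θ l x ∈ S l) :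
    ∑ l ∈ Finset.range (h + 1), inner ℝ (E.polFeat π l x) (ws l) ≤
      ∑ l ∈ Finset.range (h + 1), inner ℝ (E.feat θ l x) (ws l) := by
  have h1 := hb.partial_le hh hS le_rfl
  have h2 := hb.partial_eq hh hS' le_rfl
  have h3 : inner ℝ (E.polFeat π 0 x) (θ 0) ≤ inner ℝ (E.feat θ 0 x) (θ 0) :=
    E.oracle 0 (by omega) x (θ 0) _
  rw [Finset.sum_range_succ, Finset.sum_range_succ, ← hb.1]
  linarith

end Backup

theorem sum_rewardAt (h : ℕ) (θ : Vec d) (F : ℕ → Vec d) :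
    ∑ l ∈ Finset.range (h + 1), inner ℝ (F l) (rewardAt h θ l) = inner ℝ (F h) θ := by
  rw [Finset.sum_eq_single h]
  · simp [rewardAt]
  · intro l _ hl; simp [rewardAt, Function.update_of_ne hl]
  · simp

theorem IsBackup.optimal_rewardAt {S : ℕ → Submodule ℝ (Vec d)} {h : ℕ} {θ : Vec d} {π : Param d}
    (hb : E.IsBackup S h (rewardAt h θ) π) (hh : h < E.H) {x : X}
    (hS : ∀ l < h, ∀ π, E.feat π l x ∈ S l) (π' : Param d) :
    inner ℝ (E.feat π' h x) θ ≤ inner ℝ (E.feat π h x) θ := by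
  have h1 := hb.optimal hh (π := greedy E.amax π') (x := x) (fun l hl => hS l hl π')
    fun l hl => hS l hl π
  rw [sum_rewardAt, sum_rewardAt] at h1
  exact h1

variable (E)

/-- Parameters of the mean rewards. -/
def rewardParam (h : ℕ) : Vec d := by
  classical
  exact if hh : h < E.H then Classical.choose (E.linear h hh) else 0

theorem norm_rewardParam (h : ℕ) : ‖E.rewardParam h‖ ≤ √d := by
  unfold rewardParam
  split_ifs with hh
  · exact (Classical.choose_spec (E.linear h hh)).1
  · simp

theorem meanReward_eq {h : ℕ} (hh : h < E.H) (x : X) (a : A) :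
    E.M.meanReward h x a = inner ℝ (E.φ h x a) (E.rewardParam h) := by
  unfold rewardParam
  rw [dif_pos hh, real_inner_comm]
  exact (Classical.choose_spec (E.linear h hh)).2 x a

theorem value_eq (π : Policy X A) (x : X) : E.M.value E.H π x =
    ∑ h ∈ Finset.range E.H, inner ℝ (E.polFeat π h x) (E.rewardParam h) :=
  Finset.sum_congr rfl fun _ hh => E.meanReward_eq (Finset.mem_range.1 hh) _ _

/-- Some greedy policy attains the optimal value at every initial state at once. -/
theorem exists_optimal : ∃ θ : Param d, ∀ x, E.M.optValue E.H x =
    E.M.value E.H (greedy E.amax θ) x := by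
  obtain ⟨θ, hθ⟩ := E.exists_isBackup_top (E.H - 1) E.rewardParam
  have hH : E.H - 1 + 1 = E.H := by have := E.H_pos; omega
  refine ⟨θ, fun x => ?_⟩
  have hle : ∀ π, E.M.value E.H π x ≤ E.M.value E.H (greedy E.amax θ) x := by
    intro π
    rw [value_eq, value_eq]
    have := hθ.optimal (by omega) (π := π) (x := x) (fun _ _ => Submodule.mem_top)
      fun _ _ => Submodule.mem_top
    rwa [hH] at this
  have : Nonempty (Policy X A) := ⟨greedy E.amax θ⟩
  exact le_antisymm (ciSup_le hle) (le_ciSup (f := fun π => E.M.value E.H π x)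
    ⟨_, by rintro _ ⟨π, rfl⟩; exact hle π⟩ _)

/-! ### Initial states from which the subspaces can be left -/

/-- The initial states from which some greedy policy leaves `S` in layer `h`. -/
def escape (h : ℕ) (S : Submodule ℝ (Vec d)) : Set X := {x | ∃ π : Param d, E.feat π h x ∉ S}

/-- The initial states from which all greedy policies stay in `S l` in the layers `l < h`. -/
def safe (h : ℕ) (S : ℕ → Submodule ℝ (Vec d)) : Set X :=
  {x | ∀ l < h, ∀ π : Param d, E.feat π l x ∈ S l}

variable {E}

/-- A union over uncountably many policies, which is measurable since finitely many of them, the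
exact optimizers of `±b` for a basis `b` of the orthogonal complement, leave the subspace if any
does. -/
theorem measurableSet_escape {h : ℕ} (hh : h < E.H) {Q : List (Vec d)} (hQ : ONList Q) :
    MeasurableSet (E.escape h (lspan Q)) := by
  choose V hV using fun θ : Vec d => E.exists_isBackup_top h (rewardAt h θ)
  have h1 : E.escape h (lspan Q) = ⋃ b ∈ {b | b ∈ complBasis Q},
      ({x | 0 < (inner ℝ (E.feat (V b) h x) b : ℝ)} ∪
        {x | 0 < (inner ℝ (E.feat (V (-b)) h x) (-b) : ℝ)}) := by
    ext x
    simp only [Set.mem_iUnion, Set.mem_ofPred_eq, exists_prop, Set.mem_union, escape]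
    have hopt : ∀ θ π, inner ℝ (E.feat π h x) θ ≤ (inner ℝ (E.feat (V θ) h x) θ : ℝ) :=
      fun θ π => (hV θ).optimal_rewardAt hh (fun _ _ _ => Submodule.mem_top) π
    constructor
    · rintro ⟨π, hπ⟩
      obtain ⟨b, hb, hne⟩ := exists_complBasis hQ hπ
      refine ⟨b, hb, ?_⟩
      rcases lt_or_gt_of_ne hne with h2 | h2
      · right
        refine lt_of_lt_of_le ?_ (hopt (-b) π)
        rw [inner_neg_right]; linarith
      · exact Or.inl (lt_of_lt_of_le h2 (hopt b π))
    · rintro ⟨b, hb, h2 | h2⟩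
      · exact ⟨V b, fun hm => by rw [inner_complBasis hQ hb hm] at h2; exact lt_irrefl _ h2⟩
      · refine ⟨V (-b), fun hm => ?_⟩
        rw [inner_neg_right, inner_complBasis hQ hb hm] at h2; simp at h2
  rw [h1]
  refine Set.Finite.measurableSet_biUnion (List.finite_toSet _) fun b _ => ?_
  refine MeasurableSet.union ?_ ?_ <;>
  · refine measurableSet_lt measurable_const ?_
    exact (E.measurable_feat hh _).inner measurable_const

theorem compl_safe (h : ℕ) (S : ℕ → Submodule ℝ (Vec d)) :
    (E.safe h S)ᶜ = ⋃ l ∈ Set.Iio h, E.escape l (S l) := by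
  ext x; simp [safe, escape]

theorem measurableSet_safe {h : ℕ} (hh : h ≤ E.H) {S : ℕ → Submodule ℝ (Vec d)}
    (hS : ∀ l < h, ∃ Q, ONList Q ∧ S l = lspan Q) : MeasurableSet (E.safe h S) := by
  refine MeasurableSet.of_compl ?_
  rw [compl_safe]
  refine MeasurableSet.biUnion (Set.to_countable _) fun l hl => ?_
  obtain ⟨Q, hQ, h1⟩ := hS l hl
  rw [h1]
  exact measurableSet_escape (lt_of_lt_of_le hl hh) hQ

/-- If the optimizers of the directions in the complement of `lspan Q` rarely leave `lspan Q`, then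
so does the union of the trajectories of all policies. -/
theorem start_escape_le {h : ℕ} (hh : h < E.H) {S : ℕ → Submodule ℝ (Vec d)} {Q : List (Vec d)}
    (hQ : ONList Q) {p : ENNReal}
    (hp : ∀ b ∈ complBasis Q, ∃ πm πp : Param d, E.IsBackup S h (rewardAt h (-b)) πm ∧
      E.IsBackup S h (rewardAt h b) πp ∧ E.featLaw πm h {y | resid Q y ≠ 0} ≤ p ∧
        E.featLaw πp h {y | resid Q y ≠ 0} ≤ p) :
    E.M.start (E.safe h S ∩ E.escape h (lspan Q)) ≤ 2 * d * p := by
  classical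
  choose! πm πp hm hpl hm' hp' using hp
  have hlaw : ∀ π : Param d, E.featLaw π h {y | resid Q y ≠ 0} =
      E.M.start {x | E.feat π h x ∉ lspan Q} := by
    intro π
    unfold featLaw
    refine (Measure.map_apply (E.measurable_feat hh π) (measurableSet_resid_eq Q).compl).trans ?_
    congr 1; ext x
    simp [resid_eq_zero_iff hQ]
  have hsub : E.safe h S ∩ E.escape h (lspan Q) ⊆ ⋃ b ∈ (complBasis Q).toFinset,
      ({x | E.feat (πm b) h x ∉ lspan Q} ∪ {x | E.feat (πp b) h x ∉ lspan Q}) := by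
    rintro x ⟨hx, π, hπ⟩
    obtain ⟨b, hb, hne⟩ := exists_complBasis hQ hπ
    simp only [Set.mem_iUnion, List.mem_toFinset, exists_prop]
    refine ⟨b, hb, ?_⟩
    -- a vector of `lspan Q` is orthogonal to `b`, so a policy which does better than `0` in
    -- direction `±b` leaves `lspan Q`, and the optimizer does at least as well
    rcases lt_or_gt_of_ne hne with h2 | h2
    · left
      intro hmem
      have h3 := (hm b hb).optimal_rewardAt hh hx π
      rw [inner_neg_right, inner_neg_right, inner_complBasis hQ hb hmem] at h3
      linarith
    · right
      intro hmem
      have h3 := (hpl b hb).optimal_rewardAt hh hx π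
      rw [inner_complBasis hQ hb hmem] at h3
      linarith
  refine (measure_mono hsub).trans ((measure_biUnion_finset_le _ _).trans ?_)
  calc _ ≤ ∑ b ∈ (complBasis Q).toFinset, 2 * p := by
        refine Finset.sum_le_sum fun b hb => (measure_union_le _ _).trans ?_
        rw [two_mul, ← hlaw, ← hlaw]
        exact add_le_add (hm' b (List.mem_toFinset.1 hb)) (hp' b (List.mem_toFinset.1 hb))
    _ = (complBasis Q).toFinset.card * (2 * p) := by rw [Finset.sum_const, nsmul_eq_mul]
    _ ≤ d * (2 * p) := by
        gcongr
        exact (List.toFinset_card_le _).trans (length_complBasis_le Q)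
    _ = 2 * d * p := by ring

end Setting

/-! ### Fitted Q-iteration -/

namespace Setting

variable {X : Type u} {A : Type v} {Ξ : Type w} [MeasurableSpace X] [MeasurableSpace A]
  [MeasurableSpace Ξ] {d : ℕ} {E : Setting X A Ξ d}

variable (E) in
/-- `E.Covers h n U Ψ V`: the subspace `V` arises from `U` by adding one direction for every policy
of `Ψ`, and each direction is contained, with probability at least `1/2`, in the span of the earlier
directions and `n` features of layer `h` sampled under its policy. -/
inductive Covers (h n : ℕ) : Submodule ℝ (Vec d) → List (Param d) → Submodule ℝ (Vec d) → Prop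
  | nil (U : Submodule ℝ (Vec d)) : Covers h n U [] U
  | cons {U V : Submodule ℝ (Vec d)} {π : Param d} {Ψ : List (Param d)} {y : Vec d}
      (hy : miss (E.featLaw π h) n U y ≤ ofReal (1 / 2))
      (hV : Covers h n (U ⊔ Submodule.span ℝ {y}) Ψ V) : Covers h n U (π :: Ψ) V

theorem Covers.snoc {h n : ℕ} {U V : Submodule ℝ (Vec d)} {Ψ : List (Param d)}
    (hc : E.Covers h n U Ψ V) {π : Param d} {y : Vec d}
    (hy : miss (E.featLaw π h) n V y ≤ ofReal (1 / 2)) :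
    E.Covers h n U (Ψ ++ [π]) (V ⊔ Submodule.span ℝ {y}) := by
  induction hc with
  | nil U => exact Covers.cons hy (Covers.nil _)
  | cons hy' _ ih => exact Covers.cons hy' (ih hy)

theorem measProg_drawTarget {h : ℕ} (hh : h + 1 < E.H) (π : Param d) (w θ : Vec d) :
    E.MeasProg (drawTarget π h w θ : Prog X A d (Vec d × ℝ)) :=
  (measFam_drawTarget hh).prog (π, w, θ)

/-- The regression targets carry no noise. -/
theorem sat_drawTarget {h : ℕ} (hh : h + 1 < E.H) (π : Param d) (w θ : Vec d) :
    E.Sat (drawTarget π h w θ : Prog X A d (Vec d × ℝ)) 0 fun p =>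
      p.2 = inner ℝ p.1 (w + E.backup h θ) := by
  refine Sat.of_forall (measProg_drawTarget hh π w θ) fun ω => ?_
  rw [inner_add_right]
  exact congrArg _ (E.inner_backup hh θ _ _).symm

theorem measFam_targetData {h : ℕ} (hh : h + 1 < E.H) (w θ : Vec d) (n : ℕ) :
    E.MeasFam fun Ψ : List (Param d) => (forProg (fun π => repeatProg (drawTarget π h w θ) n) Ψ :
      Prog X A d (List (List (Vec d × ℝ)))) :=
  MeasFam.forProg (f := fun _ π => repeatProg (drawTarget π h w θ) n)
    (MeasFam.repeatProg ((measFam_drawTarget hh).comp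
      (g := fun q : List (Param d) × Param d => (q.2, w, θ)) (by fun_prop)) n) measurable_id

theorem measurableSet_mem_sup_map_fst (U : Submodule ℝ (Vec d)) (y : Vec d) :
    MeasurableSet {l : List (Vec d × ℝ) | y ∈ U ⊔ lspan (l.map Prod.fst)} := by
  have h := (by fun_prop : Measurable fun l : List (Vec d × ℝ) => l.map Prod.fst)
    (measurableSet_notMem_sup U y).compl
  simpa [Set.preimage, Set.compl] using h

/-- The features sampled under the covering policies span the subspace. -/
theorem Covers.sat_targetData {h n₀ n R : ℕ} (hh : h + 1 < E.H) {U V : Submodule ℝ (Vec d)}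
    {Ψ : List (Param d)} (hc : E.Covers h n₀ U Ψ V) (hn : R * n₀ ≤ n) (w θ : Vec d) :
    E.Sat (forProg (fun π => repeatProg (drawTarget π h w θ) n) Ψ :
        Prog X A d (List (List (Vec d × ℝ)))) (Ψ.length * ofReal (1 / 2) ^ R) fun D =>
      (∀ p ∈ D.flatten, p.2 = inner ℝ p.1 (w + E.backup h θ)) ∧
        V ≤ U ⊔ lspan (D.flatten.map Prod.fst) := by
  induction hc with
  | nil U => exact (Sat.done ⟨by simp, le_sup_left⟩).mono (by simp) fun _ h => h
  | @cons U V π Ψ y hy hV ih =>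
    have hm := measProg_drawTarget hh π w θ
    have hfst : E.Sat (repeatProg (drawTarget π h w θ) n : Prog X A d (List (Vec d × ℝ)))
        (n * 0 + ofReal (1 / 2) ^ R) fun l =>
          (l.length = n ∧ ∀ p ∈ l, p.2 = inner ℝ p.1 (w + E.backup h θ)) ∧
            y ∈ U ⊔ lspan (l.map Prod.fst) := by
      refine Sat.and (Sat.repeatProg hm (sat_drawTarget hh π w θ) n) (Sat.of_dist_le ?_)
        (measurableSet_mem_sup_map_fst U y)
      have hp := hm.isProb
      have hp' := E.isProb_featLaw (h := h) (by omega) π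
      rw [dist_repeatProg hm]
      have h1 : draws (E.dist (drawTarget π h w θ : Prog X A d (Vec d × ℝ))) n
          {l | ¬ y ∈ U ⊔ lspan (l.map Prod.fst)} = miss (E.featLaw π h) n U y := by
        unfold miss
        rw [← map_dist_drawTarget hh π w θ, ← draws_map measurable_fst]
        exact (Measure.map_apply (by fun_prop) (measurableSet_notMem_sup U y)).symm
      rw [h1]
      -- `R` disjoint batches of `n₀` samples, each of which misses `y` with probability at most
      -- `1/2`
      exact (miss_mono_left hn U y).trans ((miss_mul_le R n₀ U y).trans (by gcongr))
    have key : E.Sat (forProg (fun π => repeatProg (drawTarget π h w θ) n) (π :: Ψ) :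
        Prog X A d (List (List (Vec d × ℝ)))) ((n * 0 + ofReal (1 / 2) ^ R) +
          (Ψ.length * ofReal (1 / 2) ^ R + 0)) fun D =>
      (∀ p ∈ D.flatten, p.2 = inner ℝ p.1 (w + E.backup h θ)) ∧
        V ≤ U ⊔ lspan (D.flatten.map Prod.fst) := by
      have hf := (measFam_targetData (E := E) hh w θ n)
      refine Sat.bind ((MeasFam.repeatProg (ι := Unit) hm.fam n).prog ()) ?_ hfst fun l hl => ?_
      · exact MeasFam.bind (hf.comp (g := fun _ => Ψ) measurable_const)
          (MeasFam.done (by fun_prop))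
      · refine Sat.bind (hf.prog Ψ) (MeasFam.done (by fun_prop)) ih fun D hD => Sat.done ?_
        obtain ⟨⟨-, hl1⟩, hl2⟩ := hl
        refine ⟨?_, hD.2.trans ?_⟩
        · intro p hp
          rw [List.flatten_cons, List.mem_append] at hp
          exact hp.elim (hl1 p) (hD.1 p)
        · rw [List.flatten_cons, List.map_append, lspan_append, ← sup_assoc]
          refine sup_le_sup_right (sup_le le_sup_left ?_) _
          rwa [Submodule.span_singleton_le_iff_mem]
    refine key.mono (le_of_eq ?_) fun _ h => h
    rw [List.length_cons]; push_cast; ring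

variable (E) in
/-- The policies `Ψ l` cover the subspaces `S l` in the layers `l < h`. -/
def LayerCover (n h : ℕ) (S : ℕ → Submodule ℝ (Vec d)) (Ψ : ℕ → List (Param d)) : Prop :=
  ∀ l < h, (∃ Q, ONList Q ∧ S l = lspan Q) ∧ (Ψ l).length ≤ d ∧ E.Covers l n ⊥ (Ψ l) (S l)

/-- Invariant of the backward pass over the layers below `h`. -/
theorem LayerCover.sat_fqiLoop {n₀ n R h : ℕ} (hh : h < E.H) {S : ℕ → Submodule ℝ (Vec d)}
    {Ψ : ℕ → List (Param d)} (hc : E.LayerCover n₀ h S Ψ) (hn : R * n₀ ≤ n) (ws θ : Param d) :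
    E.Sat (fqiLoop ws Ψ n h θ : Prog X A d (Param d)) (h * (d * ofReal (1 / 2) ^ R))
      fun θ' => (∀ l, h ≤ l → θ' l = θ l) ∧
        ∀ l < h, ∀ y ∈ S l, inner ℝ y (θ' l) = inner ℝ y (ws l + E.backup l (θ' (l + 1))) := by
  induction h generalizing θ with
  | zero => exact (Sat.done ⟨fun _ _ => rfl, by simp⟩).mono (by simp) fun _ h => h
  | succ h ih =>
    obtain ⟨_, hlen, hcov⟩ := hc h (by omega)
    have key : E.Sat (fqiLoop ws Ψ n (h + 1) θ : Prog X A d (Param d))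
        ((Ψ h).length * ofReal (1 / 2) ^ R + h * (d * ofReal (1 / 2) ^ R))
        fun θ' => (∀ l, h + 1 ≤ l → θ' l = θ l) ∧ ∀ l < h + 1, ∀ y ∈ S l,
          inner ℝ y (θ' l) = inner ℝ y (ws l + E.backup l (θ' (l + 1))) := by
      have hloop : E.MeasFam fun t : Vec d =>
          (fqiLoop ws Ψ n h (Function.update θ h t) : Prog X A d (Param d)) :=
        (measFam_fqiLoop (n := n) (E := E) (h := h) (by omega)).comp
          (g := fun t => (ws, Ψ, Function.update θ h t)) (Measurable.prodMk measurable_const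
            (Measurable.prodMk measurable_const
              (Measurable.function_update h measurable_const measurable_id)))
      refine Sat.bind ((measFam_targetData hh (ws h) (θ (h + 1)) n).prog (Ψ h)) ?_
        (hcov.sat_targetData hh hn (ws h) (θ (h + 1))) fun D hD => ?_
      · exact MeasFam.bind (MeasFam.compute (measurable_leastSquares (by fun_prop)))
          (hloop.comp measurable_snd)
      · refine Sat.compute_bind ?_
        refine (ih (by omega) (fun l hl => hc l (by omega)) _).mono le_rfl ?_
        rintro θ' ⟨h1, h2⟩
        refine ⟨fun l hl => ?_, fun l hl y hy => ?_⟩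
        · rw [h1 l (by omega), Function.update_of_ne (by omega)]
        · rcases Nat.lt_succ_iff_lt_or_eq.1 hl with hl | rfl
          · exact h2 l hl y hy
          · rw [h1 l le_rfl, h1 (l + 1) (by omega), Function.update_self,
              Function.update_of_ne (by omega)]
            -- noiseless targets: least squares is exact on the span of the sampled features
            refine inner_leastSquares hD.1 ?_
            simpa using hD.2 hy
    refine key.mono ?_ fun _ h => h
    calc _ ≤ d * ofReal (1 / 2) ^ R + h * (d * ofReal (1 / 2) ^ R) := by
          gcongr
      _ = _ := by push_cast; ring

/-- Fitted Q-iteration solves the Bellman equations exactly on the covered subspaces. -/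
theorem LayerCover.sat_fqi {n₀ n R h : ℕ} (hh : h < E.H) {S : ℕ → Submodule ℝ (Vec d)}
    {Ψ : ℕ → List (Param d)} (hc : E.LayerCover n₀ h S Ψ) (hn : R * n₀ ≤ n) (ws : Param d) :
    E.Sat (fqi h ws Ψ n : Prog X A d (Param d)) (h * (d * ofReal (1 / 2) ^ R))
      (E.IsBackup S h ws) :=
  (hc.sat_fqiLoop hh hn ws _).mono le_rfl fun θ hθ => ⟨by rw [hθ.1 h le_rfl]; simp, hθ.2⟩

end Setting

/-! ### The subspace cover -/

/-- What the analysis requires of the sample sizes: every elementary random event of the exploration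
phase fails with probability at most `b`. -/
structure Sizes.Suffice (s : Sizes) (d H : ℕ) (b : ENNReal) : Prop where
  eps_pos : 0 < s.eps
  nTest_pos : 0 < s.nTest
  mBoost_pos : 0 < s.mBoost
  nVec_pos : 0 < s.nVec
  cover : ∃ R : ℕ, R * s.nSpan ≤ s.nCover ∧ H * (d * ofReal (1 / 2) ^ R) ≤ b
  test : 2 * ofReal (exp (-(2 * s.nTest * (s.eps / (16 * H * d)) ^ 2))) ≤ b
  outlier : s.nSamp * ofReal (1 - 3 * s.eps / (16 * H * d)) ^ s.nReject +
    (4 * (d / (s.nSamp + 1))) ^ s.nSamp +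
      s.nSamp * (2 * ofReal (exp (-(2 * s.mBoost * (1 / 16) ^ 2)))) ≤ b
  span : 2 ^ s.nSamp * ofReal (1 - 3 * s.eps / (32 * H * d)) ^ s.nSpan ≤
    ofReal (1 / 8)
  vec : d * (2 * ofReal (exp (-(2 * s.nVec * (s.eps / (16 * d)) ^ 2)))) ≤ b

namespace Setting

variable {X : Type u} {A : Type v} {Ξ : Type w} [MeasurableSpace X] [MeasurableSpace A]
  [MeasurableSpace Ξ] {d : ℕ} {E : Setting X A Ξ d}

theorem dist_pair {α β : Type} [MeasurableSpace α] [MeasurableSpace β] {p : Prog X A d α}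
    {q : Prog X A d β} (hp : E.MeasProg p) (hq : E.MeasProg q) :
    E.dist (p.bind fun a => q.bind fun b => Prog.done (a, b)) = (E.dist p).prod (E.dist q) := by
  have h1 := hp.isProb
  have h2 := hq.isProb
  refine Measure.ext_of_lintegral _ fun G hG => ?_
  rw [lintegral_dist_bind hp (MeasFam.bind hq.fam (MeasFam.done (by fun_prop))) hG,
    lintegral_prod _ hG.aemeasurable]
  refine lintegral_congr fun a => ?_
  rw [lintegral_dist_bind hq (MeasFam.done (by fun_prop)) hG]
  exact lintegral_congr fun b => lintegral_dist_done hG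

theorem Sat.ite {α : Type} [MeasurableSpace α] {c : Prop} [Decidable c] {p q : Prog X A d α}
    {b : ENNReal} {P : α → Prop} (hp : c → E.Sat p b P) (hq : ¬ c → E.Sat q b P) :
    E.Sat (if c then p else q) b P := by
  split_ifs with h
  · exact hp h
  · exact hq h

theorem measProg_pair {α β : Type} [MeasurableSpace α] [MeasurableSpace β] {p : Prog X A d α}
    {q : Prog X A d β} (hp : E.MeasProg p) (hq : E.MeasProg q) :
    E.MeasProg (p.bind fun a => q.bind fun b => Prog.done (a, b)) := by
  have h : E.MeasFam fun a : α => (q.bind fun b => Prog.done (a, b) : Prog X A d (α × β)) :=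
    MeasFam.bind (MeasProg.fam hq) (MeasFam.done (by fun_prop))
  exact (MeasFam.bind (f := fun _ a => q.bind fun b => Prog.done (a, b))
    (MeasProg.fam (ι := Unit) hp) (h.comp measurable_snd)).prog ()

theorem measProg_outlierTest {h : ℕ} (hh : h < E.H) (π : Param d) (Q : List (Vec d)) :
    E.MeasProg (outlierTest π h Q : Prog X A d Bool) := (measFam_outlierTest hh).prog (π, Q)

theorem dist_outlierTest {h : ℕ} (hh : h < E.H) (π : Param d) (Q : List (Vec d)) :
    E.dist (outlierTest π h Q : Prog X A d Bool) {b | b = true} =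
      E.featLaw π h {y | resid Q y ≠ 0} := by
  classical
  have h1 : E.MeasProg (drawFeature π h : Prog X A d (Vec d)) := (measFam_drawFeature hh).prog π
  have hm : Measurable fun y : Vec d => decide (resid Q y ≠ 0) := by
    refine measurable_bool_of_true ?_
    simp only [decide_eq_true_eq]
    exact (measurableSet_resid_eq Q).compl
  have hS : MeasurableSet {y : Vec d | resid Q y ≠ 0} := (measurableSet_resid_eq Q).compl
  rw [← lintegral_indicator_one (MeasurableSet.of_discrete),
    ← lintegral_indicator_one hS, ← dist_drawFeature hh]
  refine (lintegral_dist_bind h1 (MeasFam.compute hm) (by fun_prop)).trans ?_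
  refine lintegral_congr fun y => ?_
  rw [dist_compute, lintegral_dirac' _ (by fun_prop)]
  by_cases hy : resid Q y = 0 <;> simp [hy]

/-- The frequencies in the tests are close to the probabilities of leaving the subspace. -/
theorem sat_pairTest {h : ℕ} (hh : h < E.H) (πm πp : Param d) (Q : List (Vec d)) {n : ℕ}
    (hn : 0 < n) {t : ℝ} (ht : 0 ≤ t) {b : ENNReal}
    (hb : 2 * ofReal (exp (-(2 * n * t ^ 2))) ≤ b) :
    E.Sat (pairTest h Q n πm πp : Prog X A d (List (Bool × Bool))) (b + b) fun l =>
      |(((l.map Prod.fst).count true : ℕ) : ℝ) -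
        n * (E.featLaw πm h {y | resid Q y ≠ 0}).toReal| ≤ n * t ∧
      |(((l.map Prod.snd).count true : ℕ) : ℝ) -
        n * (E.featLaw πp h {y | resid Q y ≠ 0}).toReal| ≤ n * t := by
  have hm := measProg_outlierTest hh πm Q
  have hp := measProg_outlierTest hh πp Q
  have i1 := hm.isProb
  have i2 := hp.isProb
  have hpair := measProg_pair hm hp
  have h1 := (sat_count hpair (f := Prod.fst) measurable_fst hn ht).mono hb fun _ h => h
  have h2 := (sat_count hpair (f := Prod.snd) measurable_snd hn ht).mono hb fun _ h => h
  have e1 : {a : Bool × Bool | a.1 = true} = {b | b = true} ×ˢ Set.univ := by ext ⟨a, b⟩; simp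
  have e2 : {a : Bool × Bool | a.2 = true} = Set.univ ×ˢ {b | b = true} := by ext ⟨a, b⟩; simp
  rw [dist_pair hm hp, e1, Measure.prod_prod, measure_univ, mul_one, dist_outlierTest hh] at h1
  rw [dist_pair hm hp, e2, Measure.prod_prod, measure_univ, one_mul, dist_outlierTest hh] at h2
  unfold pairTest
  refine Sat.and h1 h2 (measurableSet_le ?_ measurable_const)
  have h3 : Measurable fun l : List (Bool × Bool) => (l.map Prod.snd).count true := by fun_prop
  have h4 : Measurable fun l : List (Bool × Bool) => (((l.map Prod.snd).count true : ℕ) : ℝ) :=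
    (measurable_of_countable (fun k : ℕ => (k : ℝ))).comp h3
  exact (h4.sub_const _).norm

/-- A policy that leaves `lspan Q` often enough yields a new direction which it covers. -/
theorem sat_direction {h : ℕ} (hh : h < E.H) {s : Sizes} {b : ENNReal} (hs : s.Suffice d E.H b)
    {Q : List (Vec d)} (hQ : ONList Q) {π : Param d}
    (hπ : 3 * s.eps / (16 * E.H * d) ≤ (E.featLaw π h {y | resid Q y ≠ 0}).toReal) :
    E.Sat (computeOutlierDirection (rejection π h Q s.nReject) s.nSamp s.mBoost :
        Prog X A d (Vec d)) b fun y =>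
      y ∉ lspan Q ∧ miss (E.featLaw π h) s.nSpan (lspan Q) y ≤ ofReal (1 / 2) := by
  have hprob := E.isProb_featLaw hh π
  have hr := measProg_rejection (E := E) hh π Q s.nReject
  have hprobr := hr.isProb
  set p := E.featLaw π h {y | resid Q y ≠ 0} with hp
  have hp1 : p ≤ 1 := prob_le_one
  have hq : E.featLaw π h {y | resid Q y = 0} = ofReal (1 - p.toReal) := by
    rw [ENNReal.ofReal_sub _ ENNReal.toReal_nonneg, ENNReal.ofReal_toReal (by finiteness),
      ENNReal.ofReal_one, ← featLaw_resid_add hh π Q]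
    exact (ENNReal.add_sub_cancel_right (by finiteness)).symm
  have hq' : E.featLaw π h {y | resid Q y = 0} ≤ ofReal (1 - 3 * s.eps / (16 * E.H * d)) := by
    rw [hq]; exact ENNReal.ofReal_le_ofReal (by linarith)
  have key := sat_computeOutlierDirection hr (n := s.nSamp) hs.mBoost_pos
    (sat_rejection hh π hQ s.nReject)
  refine key.mono ?_ ?_
  · refine le_trans ?_ hs.outlier
    gcongr
  · rintro y ⟨hy1, hy2⟩
    refine ⟨hy1, ?_⟩
    have h1 := miss_compare (ν := E.featLaw π h)
      (ρ := E.dist (rejection π h Q s.nReject : Prog X A d (Vec d))) (Q := Q)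
      (fun G hG hG0 => rejection_dominates hh π Q s.nReject hG hG0) s.nSpan s.nSamp le_rfl y
    have h2 : E.featLaw π h {y | resid Q y = 0} + p / 2 ≤
        ofReal (1 - 3 * s.eps / (32 * E.H * d)) := by
      have hpr : p = ofReal p.toReal := (ENNReal.ofReal_toReal (by finiteness)).symm
      have hp1' : p.toReal ≤ 1 := ENNReal.toReal_le_of_le_ofReal zero_le_one (by simpa using hp1)
      have h3 : p / 2 = ofReal (p.toReal / 2) := by
        rw [ENNReal.ofReal_div_of_pos (by norm_num), ← hpr]; simp
      rw [hq, h3, ← ENNReal.ofReal_add (by linarith) (by positivity)]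
      refine ENNReal.ofReal_le_ofReal ?_
      have h4 : 3 * s.eps / (32 * E.H * d) = 3 * s.eps / (16 * E.H * d) / 2 := by
        rw [div_div]; ring_nf
      linarith
    calc miss (E.featLaw π h) s.nSpan (lspan Q) y
        ≤ _ := h1
      _ ≤ 2 ^ s.nSamp * ofReal (1 - 3 * s.eps / (32 * E.H * d)) ^ s.nSpan +
          ofReal (3 / 8) := by
          gcongr
          exact (miss_anti bot_le _ _).trans hy2
      _ ≤ ofReal (1 / 8) + ofReal (3 / 8) := by gcongr; exact hs.span
      _ = ofReal (1 / 2) := by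
          rw [← ENNReal.ofReal_add (by norm_num) (by norm_num)]; norm_num

variable (E) in
/-- Specification of the search for an outlier direction among the directions `B`. -/
def SearchPost (s : Sizes) (h : ℕ) (S : ℕ → Submodule ℝ (Vec d)) (Q B : List (Vec d)) :
    Option (Param d × Vec d) → Prop
  | none => ∀ b ∈ B, ∃ πm πp : Param d, E.IsBackup S h (rewardAt h (-b)) πm ∧
      E.IsBackup S h (rewardAt h b) πp ∧
      E.featLaw πm h {y | resid Q y ≠ 0} ≤ ofReal (5 * s.eps / (16 * E.H * d)) ∧
        E.featLaw πp h {y | resid Q y ≠ 0} ≤ ofReal (5 * s.eps / (16 * E.H * d))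
  | some (π, y) => y ∉ lspan Q ∧
      miss (E.featLaw π h) s.nSpan (lspan Q) y ≤ ofReal (1 / 2)

theorem LayerCover.sat_fqi' {s : Sizes} {b : ENNReal} (hs : s.Suffice d E.H b) {h n : ℕ}
    (hh : h < E.H) {S : ℕ → Submodule ℝ (Vec d)} {Ψ : ℕ → List (Param d)}
    (hc : E.LayerCover s.nSpan h S Ψ) (hn : s.nCover ≤ n) (ws : Param d) :
    E.Sat (fqi h ws Ψ n : Prog X A d (Param d)) b (E.IsBackup S h ws) := by
  obtain ⟨R, hR, hb⟩ := hs.cover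
  refine (hc.sat_fqi hh (hR.trans hn) ws).mono (le_trans ?_ hb) fun _ h => h
  gcongr

/-- Each of the directions in `B` costs two optimizations and two frequency estimates. -/
theorem LayerCover.sat_searchDirections {s : Sizes} {b : ENNReal} (hs : s.Suffice d E.H b) {h : ℕ}
    (hh : h < E.H) {S : ℕ → Submodule ℝ (Vec d)} {Ψ : ℕ → List (Param d)}
    (hc : E.LayerCover s.nSpan h S Ψ) {Q : List (Vec d)} (hQ : ONList Q) (B : List (Vec d)) :
    E.Sat (searchDirections E.H s h Ψ Q B : Prog X A d (Option (Param d × Vec d)))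
      (B.length * (4 * b) + b) (E.SearchPost s h S Q B) := by
  classical
  induction B with
  | nil => exact (Sat.done (P := E.SearchPost s h S Q []) (a := none)
      (by intro b hb; simp at hb)).mono zero_le fun _ h => h
  | cons θ B ih =>
    have hfqi : ∀ θ : Vec d, E.MeasProg (fqi h (rewardAt h θ) Ψ s.nCover : Prog X A d (Param d)) :=
      fun θ => (measFam_fqi_rewardAt hh).prog (θ, Ψ)
    have hrec : E.MeasProg (searchDirections E.H s h Ψ Q B : Prog X A d (Option (Param d × Vec d))) :=
      (measFam_searchDirections hh).prog (B, Ψ, Q)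
    have f3 := (measFam_pairTest (E := E) hh s.nTest).comp (κ := Param d × Param d)
      (g := fun q => (Q, q.1, q.2)) (by fun_prop)
    have f4 := (measFam_pairChoice (s := s) hh (hrec.fam (ι := Unit))).comp
      (κ := (Param d × Param d) × List (Bool × Bool))
      (g := fun q => (((), Q, q.1.1, q.1.2), q.2)) (by fun_prop)
    have f5 : E.MeasFam fun q : Param d × Param d => (pairTest h Q s.nTest q.1 q.2).bind
        (pairChoice E.H s h Q (searchDirections E.H s h Ψ Q B) q.1 q.2) := MeasFam.bind f3 f4
    rw [searchDirections_cons]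
    have key : E.Sat ((fqi h (rewardAt h (-θ)) Ψ s.nCover).bind fun πm =>
        (fqi h (rewardAt h θ) Ψ s.nCover).bind fun πp => (pairTest h Q s.nTest πm πp).bind
            (pairChoice E.H s h Q (searchDirections E.H s h Ψ Q B) πm πp) :
              Prog X A d (Option (Param d × Vec d)))
        (b + (b + ((b + b) + (B.length * (4 * b) + b)))) (E.SearchPost s h S Q (θ :: B)) := by
      refine Sat.bind (hfqi (-θ)) (MeasFam.bind (hfqi θ).fam f5)
        (hc.sat_fqi' hs hh le_rfl _) fun πm hπm => ?_
      refine Sat.bind (hfqi θ) (f5.comp (κ := Param d) (g := fun πp => (πm, πp)) (by fun_prop))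
        (hc.sat_fqi' hs hh le_rfl _) fun πp hπp => ?_
      have hd0 : (0 : ℝ) < E.H * d := by
        have := E.d_pos; have := E.H_pos; positivity
      refine Sat.bind (f3.prog (πm, πp)) (f4.comp (κ := List (Bool × Bool))
        (g := fun out => ((πm, πp), out)) (by fun_prop))
        (sat_pairTest hh πm πp Q hs.nTest_pos (t := s.eps / (16 * E.H * d))
          (by have := hs.eps_pos; positivity) hs.test) fun out ⟨hm, hp⟩ => ?_
      set km := (out.map Prod.fst).count true
      set kp := (out.map Prod.snd).count true
      have hn : (0 : ℝ) < s.nTest := by exact_mod_cast hs.nTest_pos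
      -- the threshold is `4 t`; the frequencies are accurate up to `t`, so the true probabilities
      -- are at least `3 t` when the test is passed, and at most `5 t` when it fails
      have e4 : s.eps / (4 * E.H * d) = 4 * (s.eps / (16 * E.H * d)) := by
        field_simp; ring
      have e3 : 3 * s.eps / (16 * E.H * d) = 3 * (s.eps / (16 * E.H * d)) := by ring
      have e5 : 5 * s.eps / (16 * E.H * d) = 5 * (s.eps / (16 * E.H * d)) := by ring
      set t := s.eps / (16 * E.H * d)
      refine Sat.compute_bind (Sat.compute_bind (Sat.ite (fun hlt => ?_) fun hlt => ?_))
      · refine Sat.mono (b := b + 0) ?_ (by simp) fun _ h => h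
        refine Sat.bind (P := fun y => y ∉ lspan Q ∧ miss (E.featLaw (if km ≤ kp then πp else πm) h)
          s.nSpan (lspan Q) y ≤ ofReal (1 / 2)) (MeasFam.prog (ι := Unit)
            (measFam_computeOutlierDirection (MeasProg.fam (measProg_rejection hh _ Q s.nReject))
              s.nSamp s.mBoost) ()) (MeasFam.done (measurable_some.comp (by fun_prop)))
          (sat_direction hh hs hQ ?_) fun y hy => Sat.done hy
        rw [e3]
        rw [e4] at hlt
        rw [abs_le] at hm hp
        split_ifs with hk
        · rw [max_eq_right hk] at hlt
          have := hp.2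
          refine le_of_mul_le_mul_left ?_ hn
          nlinarith
        · rw [max_eq_left (le_of_not_ge hk)] at hlt
          have := hm.2
          refine le_of_mul_le_mul_left ?_ hn
          nlinarith
      · refine ih.mono le_rfl ?_
        rintro (_ | ⟨π, y⟩) hpost
        · rintro b' hb'
          rcases List.mem_cons.1 hb' with rfl | hb'
          · refine ⟨πm, πp, hπm, hπp, ?_⟩
            rw [not_lt, e4] at hlt
            have hkm : (km : ℝ) ≤ s.nTest * (4 * t) :=
              le_trans (by exact_mod_cast le_max_left km kp) hlt
            have hkp : (kp : ℝ) ≤ s.nTest * (4 * t) :=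
              le_trans (by exact_mod_cast le_max_right km kp) hlt
            rw [abs_le] at hm hp
            have i1 := E.isProb_featLaw hh πm
            have i2 := E.isProb_featLaw hh πp
            have htp : 0 ≤ t := by have := hs.eps_pos; positivity
            rw [e5]
            constructor <;>
            · rw [ENNReal.le_ofReal_iff_toReal_le (by finiteness) (by positivity)]
              refine le_of_mul_le_mul_left ?_ hn
              nlinarith [hm.1, hp.1]
          · exact hpost b' hb'
        · exact hpost
    refine key.mono (le_of_eq ?_) fun _ h => h
    rw [List.length_cons]; push_cast; ring

variable (E) in
/-- Specification of the subspace cover of layer `h`: the policies cover the subspace, and only few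
initial states from which the earlier subspaces are never left allow to leave it. -/
def CoverPost (s : Sizes) (h : ℕ) (S : ℕ → Submodule ℝ (Vec d)) (r : List (Vec d) × List (Param d)) :
    Prop :=
  ONList r.1 ∧ r.2.length ≤ d ∧ E.Covers h s.nSpan ⊥ r.2 (lspan r.1) ∧
    E.M.start (E.safe h S ∩ E.escape h (lspan r.1)) ≤
      2 * d * ofReal (5 * s.eps / (16 * E.H * d))

/-- Every round adds a dimension, so that the search fails in one of the first `d + 1` rounds.
-/
theorem LayerCover.sat_subspaceLoop {s : Sizes} {b : ENNReal} (hs : s.Suffice d E.H b) {h : ℕ}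
    (hh : h < E.H) {S : ℕ → Submodule ℝ (Vec d)} {Ψ : ℕ → List (Param d)}
    (hc : E.LayerCover s.nSpan h S Ψ) (t : ℕ) {Q : List (Vec d)} (hQ : ONList Q)
    {Ψh : List (Param d)} (hlen : Ψh.length = Q.length)
    (hcov : E.Covers h s.nSpan ⊥ Ψh (lspan Q)) (ht : d < t + Q.length) :
    E.Sat (subspaceLoop E.H s h Ψ t Q Ψh : Prog X A d (List (Vec d) × List (Param d)))
      (t * (d * (4 * b) + b)) (E.CoverPost s h S) := by
  induction t generalizing Q Ψh with
  | zero => have := hQ.length_le; omega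
  | succ t ih =>
    have f1 : E.MeasProg (searchDirections E.H s h Ψ Q (complBasis Q) :
        Prog X A d (Option (Param d × Vec d))) :=
      (measFam_searchDirections hh).prog (complBasis Q, Ψ, Q)
    have f2 : E.MeasFam fun o : Option (Param d × Vec d) => (match o with
        | none => pure (Q, Ψh)
        | some (π, y) => do
          let Q' ← LBC.compute (4 * (d + 1) ^ 2) (gsStep Q y)
          subspaceLoop E.H s h Ψ t Q' (Ψh ++ [π]) : Prog X A d (List (Vec d) × List (Param d))) := by
      have h3 := (measFam_subspaceLoop (E := E) (s := s) hh t).comp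
        (κ := (Option (Param d × Vec d) × (Param d × Vec d)) × List (Vec d))
        (g := fun q => (Ψ, q.2, Ψh ++ [q.1.2.1])) (by fun_prop)
      have h4 := MeasFam.option (E := E) (ι := Option (Param d × Vec d)) (o := fun o => o)
        (p := fun _ r => (LBC.compute (4 * (d + 1) ^ 2) (gsStep Q r.2)).bind fun Q' =>
          subspaceLoop E.H s h Ψ t Q' (Ψh ++ [r.1])) (q := fun _ => Prog.done (Q, Ψh)) measurable_id
        (MeasFam.bind (MeasFam.compute (by fun_prop)) h3) (MeasFam.done measurable_const)
      convert h4 using 2 with o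
      rcases o with _ | ⟨π, y⟩ <;> rfl
    have key : E.Sat (subspaceLoop E.H s h Ψ (t + 1) Q Ψh :
        Prog X A d (List (Vec d) × List (Param d)))
        (((complBasis Q).length * (4 * b) + b) + t * (d * (4 * b) + b)) (E.CoverPost s h S) := by
      refine Sat.compute_bind (Sat.bind f1 f2 (hc.sat_searchDirections hs hh hQ _) ?_)
      rintro (_ | ⟨π, y⟩) hpost
      · refine (Sat.done (P := E.CoverPost s h S) ⟨hQ, ?_, hcov, ?_⟩).mono zero_le fun _ h => h
        · change Ψh.length ≤ d
          rw [hlen]; exact hQ.length_le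
        · exact start_escape_le hh hQ hpost
      · refine Sat.compute_bind (ih (onList_gsStep hQ y) ?_ ?_ ?_)
        · rw [gsStep_of_notMem hQ hpost.1]; simp [hlen]
        · rw [lspan_gsStep hQ]; exact hcov.snoc hpost.2
        · rw [gsStep_of_notMem hQ hpost.1, List.length_append, List.length_singleton]; omega
    refine key.mono ?_ fun _ h => h
    calc _ ≤ (d * (4 * b) + b) + t * (d * (4 * b) + b) := by
          gcongr; exact length_complBasis_le Q
      _ = _ := by push_cast; ring

theorem LayerCover.sat_subspaceCover {s : Sizes} {b : ENNReal} (hs : s.Suffice d E.H b) {h : ℕ}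
    (hh : h < E.H) {S : ℕ → Submodule ℝ (Vec d)} {Ψ : ℕ → List (Param d)}
    (hc : E.LayerCover s.nSpan h S Ψ) :
    E.Sat (subspaceCover E.H s h Ψ : Prog X A d (List (Vec d) × List (Param d)))
      ((d + 1 : ℕ) * (d * (4 * b) + b)) (E.CoverPost s h S) :=
  hc.sat_subspaceLoop hs hh (d + 1) onList_nil rfl
    (by rw [lspan_nil]; exact Covers.nil _) (by simp)

end Setting

/-! ### The robust spanner -/

section Columns

variable {d : ℕ}

theorem inv_norm_mul_inner_self (θ : Vec d) : ‖θ‖⁻¹ * inner ℝ θ θ = ‖θ‖ := by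
  rw [real_inner_self_eq_norm_sq]
  by_cases h : ‖θ‖ = 0
  · simp [h]
  · field_simp

/-- Tilting a new column towards the cofactor vector adds `ε ‖θ‖` to the determinant. -/
theorem abs_cdet_update_add (W : Fin d → Vec d) (i : Fin d) (y : Vec d) (ε : ℝ) :
    |cdet (Function.update W i (y + (ε * ‖cofactor W i‖⁻¹) • cofactor W i))| =
      |inner ℝ (cofactor W i) y + ε * ‖cofactor W i‖| := by
  rw [← abs_inner_cofactor, inner_add_right, real_inner_smul_right, mul_assoc,
    inv_norm_mul_inner_self]

theorem abs_cdet_update_sub (W : Fin d → Vec d) (i : Fin d) (y : Vec d) (ε : ℝ) :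
    |cdet (Function.update W i (y - (ε * ‖cofactor W i‖⁻¹) • cofactor W i))| =
      |-inner ℝ (cofactor W i) y + ε * ‖cofactor W i‖| := by
  rw [← abs_inner_cofactor, inner_sub_right, real_inner_smul_right, mul_assoc,
    inv_norm_mul_inner_self, ← abs_neg]
  ring_nf

theorem norm_tilt_le (θ : Vec d) {ε : ℝ} (hε : 0 ≤ ε) : ‖(ε * ‖θ‖⁻¹) • θ‖ ≤ ε := by
  rw [norm_smul, norm_mul, norm_inv, norm_norm, Real.norm_of_nonneg hε, mul_assoc]
  refine mul_le_of_le_one_right hε ?_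
  by_cases h : ‖θ‖ = 0
  · simp [h]
  · rw [inv_mul_cancel₀ h]

end Columns

/-- Answer to a query for column `i`: the estimates `w⁺`, `w⁻` are accurate, and the policies `z⁺`,
`z⁻` are nearly optimal for the two rewards `±θ_i`. Here `m π` stands for the mean feature under
the policy `π`. -/
def QueryPost {d : ℕ} (m : Param d → Vec d) (ε : ℝ) (W : Fin d → Vec d) (i : Fin d)
    (r : Vec d × Param d × Vec d × Param d × Vec d) : Prop :=
  r.1 = cofactor W i ∧ (‖r.2.2.1‖ ≤ 1 ∧ ‖r.2.2.1 - m r.2.1‖ ≤ ε) ∧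
    (‖r.2.2.2.2‖ ≤ 1 ∧ ‖r.2.2.2.2 - m r.2.2.2.1‖ ≤ ε) ∧
    (∀ π, inner ℝ r.1 (m π) ≤ inner ℝ r.1 r.2.2.1 + 3 / 2 * ε * ‖r.1‖) ∧
    ∀ π, -inner ℝ r.1 (m π) ≤ -inner ℝ r.1 r.2.2.2.2 + 3 / 2 * ε * ‖r.1‖

/-- The columns are bounded and close to the mean features of the stored policies. -/
def SpanInv {d : ℕ} (m : Param d → Vec d) (ε : ℝ) (st : SpanState d) : Prop :=
  (∀ i, ‖st.W i‖ ≤ 1 + 4 * ε) ∧ ∀ i, ‖st.W i - m (st.z i)‖ ≤ 5 * ε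

/-- The mean features of the policies `Γ i` form an approximate spanner, up to an error `5ε`. -/
def IsSpanner {d : ℕ} (m : Param d → Vec d) (ε : ℝ) (Γ : Fin d → Param d) : Prop :=
  ∃ w : Fin d → Vec d, (∀ i, ‖w i - m (Γ i)‖ ≤ 5 * ε) ∧
    ∀ π, ∃ c : Fin d → ℝ, (∀ i, |c i| ≤ 2) ∧ m π = ∑ i, c i • w i

section Det

variable {d : ℕ} {m : Param d → Vec d} {ε : ℝ}

theorem SpanInv.abs_cdet_le {st : SpanState d} (h : SpanInv m ε st) :
    |cdet st.W| ≤ (1 + 4 * ε) ^ d := by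
  refine (LBC.abs_cdet_le st.W).trans ?_
  calc ∏ i, ‖st.W i‖ ≤ ∏ _i : Fin d, (1 + 4 * ε) :=
        Finset.prod_le_prod (fun i _ => norm_nonneg _) fun i _ => h.1 i
    _ = _ := by simp

/-- The coefficients are given by the rule of Cramer. -/
theorem SpanInv.isSpanner {st : SpanState d} (h : SpanInv m ε st) (hpos : 0 < |cdet st.W|)
    (hq : ∀ i π, |inner ℝ (cofactor st.W i) (m π)| ≤ 2 * |cdet st.W|) :
    IsSpanner m ε st.z := by
  refine ⟨st.W, h.2, fun π => ⟨fun i => (cdet st.W)⁻¹ * cdet (Function.update st.W i (m π)),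
    fun i => ?_, ?_⟩⟩
  · rw [abs_mul, abs_inv, ← abs_inner_cofactor, inv_mul_le_iff₀ hpos, mul_comm]
    exact hq i π
  · have h0 : cdet st.W ≠ 0 := abs_pos.1 hpos
    have h1 := cramer_sum st.W (m π)
    simp only [mul_smul]
    rw [← Finset.smul_sum, ← h1, smul_smul, inv_mul_cancel₀ h0, one_smul]

theorem QueryPost.norm_tilted_le {W : Fin d → Vec d} {i : Fin d} {θ wp wm : Vec d} {zp zm : Param d}
    (h : QueryPost m ε W i (θ, zp, wp, zm, wm)) (hε : 0 ≤ ε) :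
    (‖wp + (4 * ε * ‖θ‖⁻¹) • θ‖ ≤ 1 + 4 * ε ∧ ‖wp + (4 * ε * ‖θ‖⁻¹) • θ - m zp‖ ≤ 5 * ε) ∧
    (‖wm - (4 * ε * ‖θ‖⁻¹) • θ‖ ≤ 1 + 4 * ε ∧ ‖wm - (4 * ε * ‖θ‖⁻¹) • θ - m zm‖ ≤ 5 * ε) := by
  obtain ⟨-, ⟨hp1, hp2⟩, ⟨hm1, hm2⟩, -⟩ := h
  simp only at hp1 hp2 hm1 hm2
  have ht := norm_tilt_le θ (by positivity : 0 ≤ 4 * ε)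
  refine ⟨⟨?_, ?_⟩, ⟨?_, ?_⟩⟩
  · exact (norm_add_le _ _).trans (add_le_add hp1 ht)
  · rw [add_sub_right_comm]
    exact (norm_add_le _ _).trans (by linarith)
  · exact (norm_sub_le _ _).trans (add_le_add hm1 ht)
  · rw [sub_right_comm]
    exact (norm_sub_le _ _).trans (by linarith)

end Det

theorem update_forall {d : ℕ} {β γ : Type*} {W : Fin d → β} {z : Fin d → γ} {P : β → γ → Prop}
    {i : Fin d} {y : β} {π : γ} (hy : P y π) {j : Fin d} (hj : j ≠ i → P (W j) (z j)) :
    P (Function.update W i y j) (Function.update z i π j) := by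
  by_cases h : j = i
  · subst h; simpa using hy
  · simpa [h] using hj h

namespace Setting

variable {X : Type u} {A : Type v} {Ξ : Type w} [MeasurableSpace X] [MeasurableSpace A]
  [MeasurableSpace Ξ] {d : ℕ} {E : Setting X A Ξ d}

section Spanner

variable {lo : Vec d → Prog X A d (Param d)} {vec : Param d → Prog X A d (Vec d)}
  {m : Param d → Vec d} {ε : ℝ} {b : ENNReal}

/-- A query is answered correctly if its two optimizations and two mean estimates are. -/
theorem sat_spanQuery (hlo : E.MeasFam lo) (hvec : E.MeasFam vec)
    (hl : ∀ θ, E.Sat (lo θ) b fun z => ∀ π, inner ℝ (m π) θ ≤ inner ℝ (m z) θ + 5 / 4 * ε * ‖θ‖)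
    (hv : ∀ z, E.Sat (vec z) b fun y => ‖y‖ ≤ 1 ∧ ‖y - m z‖ ≤ ε / 4) (hε : 0 ≤ ε)
    (st : SpanState d) (i : Fin d) :
    E.Sat (spanQuery lo vec st i) (4 * b) (QueryPost m ε st.W i) := by
  have key : E.Sat (spanQuery lo vec st i) (b + (b + (b + (b + 0)))) (QueryPost m ε st.W i) := by
    refine Sat.compute_bind ?_
    set θ := cofactor st.W i
    have c4 : ∀ zp wp zm, E.MeasFam fun wm : Vec d =>
        (Prog.done (θ, zp, wp, zm, wm) : Prog X A d (Vec d × Param d × Vec d × Param d × Vec d)) :=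
      fun _ _ _ => MeasFam.done (by fun_prop)
    have c3 : ∀ zp wp, E.MeasFam fun zm : Param d => ((vec zm).bind fun wm =>
        Prog.done (θ, zp, wp, zm, wm) : Prog X A d (Vec d × Param d × Vec d × Param d × Vec d)) :=
      fun zp wp => MeasFam.bind hvec (MeasFam.done (by fun_prop))
    have c2 : ∀ zp, E.MeasFam fun wp : Vec d => ((lo (-(‖θ‖⁻¹ • θ))).bind fun zm =>
        (vec zm).bind fun wm => Prog.done (θ, zp, wp, zm, wm) :
          Prog X A d (Vec d × Param d × Vec d × Param d × Vec d)) :=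
      fun zp => MeasFam.bind (hlo.comp (g := fun _ => -(‖θ‖⁻¹ • θ)) measurable_const)
        (MeasFam.bind (hvec.comp measurable_snd) (MeasFam.done (by fun_prop)))
    have c1 : E.MeasFam fun zp : Param d => ((vec zp).bind fun wp => (lo (-(‖θ‖⁻¹ • θ))).bind
        fun zm => (vec zm).bind fun wm => Prog.done (θ, zp, wp, zm, wm) :
          Prog X A d (Vec d × Param d × Vec d × Param d × Vec d)) :=
      MeasFam.bind hvec (MeasFam.bind (hlo.comp (g := fun _ => -(‖θ‖⁻¹ • θ)) measurable_const)
        (MeasFam.bind (hvec.comp measurable_snd) (MeasFam.done (by fun_prop))))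
    refine Sat.bind (hlo.prog _) c1 (hl _) fun zp hzp => ?_
    refine Sat.bind (hvec.prog _) (c2 zp) (hv _) fun wp hwp => ?_
    refine Sat.bind (hlo.prog _) (c3 zp wp) (hl _) fun zm hzm => ?_
    refine Sat.bind (hvec.prog _) (c4 zp wp zm) (hv _) fun wm hwm => Sat.done ?_
    have hθ : ‖θ‖ • (‖θ‖⁻¹ • θ) = θ := by
      by_cases h : ‖θ‖ = 0
      · rw [norm_eq_zero.1 h]; simp
      · rw [smul_smul, mul_inv_cancel₀ h, one_smul]
    have hu : ‖‖θ‖⁻¹ • θ‖ ≤ 1 := by simpa using norm_tilt_le θ zero_le_one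
    have hin : ∀ y : Vec d, inner ℝ θ y = ‖θ‖ * inner ℝ y (‖θ‖⁻¹ • θ) := fun y => by
      conv_lhs => rw [← hθ, real_inner_comm, real_inner_smul_right]
    have hest : ∀ y z : Vec d, ‖y - z‖ ≤ ε / 4 → |inner ℝ θ y - inner ℝ θ z| ≤ ‖θ‖ * (ε / 4) := by
      intro y z hyz
      rw [← inner_sub_right]
      exact (abs_real_inner_le_norm _ _).trans (by gcongr)
    have hopt : ∀ y z : Vec d, inner ℝ y (‖θ‖⁻¹ • θ) ≤ inner ℝ z (‖θ‖⁻¹ • θ) + 5 / 4 * ε * 1 →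
        inner ℝ θ y ≤ inner ℝ θ z + 5 / 4 * ε * ‖θ‖ := by
      intro y z hyz
      rw [hin y, hin z]
      have := mul_le_mul_of_nonneg_left hyz (norm_nonneg θ)
      linarith
    refine ⟨rfl, ⟨hwp.1, by linarith [hwp.2]⟩, ⟨hwm.1, by linarith [hwm.2]⟩, fun π => ?_, fun π => ?_⟩
    · have h1 := hopt (m π) (m zp) ((hzp π).trans (by gcongr))
      have h2 := (abs_le.1 (hest _ _ hwp.2)).1
      simp only
      linarith
    · have h1 := hopt (-m π) (-m zm) (by
        have := hzm π
        rw [inner_neg_right, inner_neg_right, norm_neg] at this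
        rw [inner_neg_left, inner_neg_left]
        exact this.trans (by gcongr))
      rw [inner_neg_right, inner_neg_right] at h1
      have h2 := (abs_le.1 (hest _ _ hwm.2)).2
      simp only
      linarith
  exact key.mono (le_of_eq (by ring)) fun _ h => h

/-- The first loop leaves a determinant of size at least `(5/2 ε) ^ d`: whichever sign is
chosen, the tilt by `4 ε` outweighs the error `3/2 ε`. -/
theorem sat_spanInit (hlo : E.MeasFam lo) (hvec : E.MeasFam vec)
    (hl : ∀ θ, E.Sat (lo θ) b fun z => ∀ π, inner ℝ (m π) θ ≤ inner ℝ (m z) θ + 5 / 4 * ε * ‖θ‖)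
    (hv : ∀ z, E.Sat (vec z) b fun y => ‖y‖ ≤ 1 ∧ ‖y - m z‖ ≤ ε / 4) (hε : 0 ≤ ε)
    (l : List (Fin d)) (hnd : l.Nodup) {c : ℝ} {st : SpanState d}
    (h1 : ∀ i ∈ l, st.W i = EuclideanSpace.single i 1) (h2 : ∀ i, ‖st.W i‖ ≤ 1 + 4 * ε)
    (h3 : ∀ i ∉ l, ‖st.W i - m (st.z i)‖ ≤ 5 * ε) (h4 : c ≤ |cdet st.W|) :
    E.Sat (spanInit lo vec (4 * ε) l st) (l.length * (4 * b)) fun st' => SpanInv m ε st' ∧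
      c * (5 / 2 * ε) ^ l.length ≤ |cdet st'.W| := by
  induction l generalizing c st with
  | nil => exact Sat.pure ⟨⟨h2, fun i => h3 i (by simp)⟩, by simpa using h4⟩
  | cons i l ih =>
    have hloU : E.MeasFam fun q : Unit × Vec d => lo q.2 := hlo.comp measurable_snd
    have hq := (measFam_spanQuery (linOpt := fun _ : Unit => lo) hloU hvec i).prog ((), st)
    have hrec : E.MeasFam fun st : SpanState d => spanInit lo vec (4 * ε) l st :=
      (measFam_spanInit (linOpt := fun _ : Unit => lo) hloU hvec (4 * ε) l).comp
        (g := fun st => ((), st)) (by fun_prop)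
    have key : E.Sat (spanInit lo vec (4 * ε) (i :: l) st) (4 * b + l.length * (4 * b))
        fun st' => SpanInv m ε st' ∧ c * (5 / 2 * ε) ^ (i :: l).length ≤ |cdet st'.W| := by
      refine Sat.bind hq (MeasFam.bind (MeasFam.compute (Measurable.ite
        (measurableSet_le (by fun_prop) (by fun_prop)) (by fun_prop) (by fun_prop)))
        (hrec.comp measurable_snd)) (sat_spanQuery hlo hvec hl hv hε st i) ?_
      rintro ⟨θ, zp, wp, zm, wm⟩ hpost
      have hn := hpost.norm_tilted_le hε
      obtain ⟨hθ, -, -, hp, hm⟩ := hpost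
      simp only at hθ hp hm
      have hlow : |cdet st.W| ≤ ‖θ‖ := by
        rw [← Function.update_eq_self i st.W, ← abs_inner_cofactor, h1 i (by simp), hθ]
        refine (abs_real_inner_le_norm _ _).trans (le_of_eq ?_)
        simp
      have hfin : ∀ y π, (‖y‖ ≤ 1 + 4 * ε ∧ ‖y - m π‖ ≤ 5 * ε) →
          5 / 2 * ε * ‖θ‖ ≤ |cdet (Function.update st.W i y)| →
          E.Sat (spanInit lo vec (4 * ε) l (st.set i y π)) (l.length * (4 * b))
            fun st' => SpanInv m ε st' ∧ c * (5 / 2 * ε) ^ (i :: l).length ≤ |cdet st'.W| := by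
        intro y π hy hdet
        have hi : i ∉ l := (List.nodup_cons.1 hnd).1
        refine (ih (List.nodup_cons.1 hnd).2 (c := c * (5 / 2 * ε)) ?_ ?_ ?_ ?_).mono le_rfl ?_
        · intro j hj
          have hne : j ≠ i := fun h => hi (h ▸ hj)
          simpa [SpanState.set, hne] using h1 j (by simp [hj])
        · intro j
          exact update_forall (P := fun y (_ : Param d) => ‖y‖ ≤ 1 + 4 * ε) (z := st.z) (π := π)
            hy.1 fun _ => h2 j
        · intro j hj
          exact update_forall (P := fun y π => ‖y - m π‖ ≤ 5 * ε) hy.2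
            fun hne => h3 j (by simp [hne, hj])
        · refine le_trans ?_ hdet
          calc c * (5 / 2 * ε) ≤ |cdet st.W| * (5 / 2 * ε) := by gcongr
            _ ≤ ‖θ‖ * (5 / 2 * ε) := by gcongr
            _ = _ := by ring
        · rintro st' ⟨h5, h6⟩
          refine ⟨h5, le_trans (le_of_eq ?_) h6⟩
          rw [List.length_cons, pow_succ']; ring
      -- the two estimates are compared through the mean feature of an arbitrary policy
      have hsum := (hp 0).trans' (by have := hm 0; linarith :
        inner ℝ θ wm - 3 / 2 * ε * ‖θ‖ ≤ inner ℝ θ (m 0))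
      refine Sat.compute_bind ?_
      split_ifs with hle
      · refine hfin _ _ hn.1 ?_
        rw [hθ, abs_cdet_update_add, ← hθ]
        exact le_trans (by linarith) (le_abs_self _)
      · refine hfin _ _ hn.2 ?_
        rw [hθ, abs_cdet_update_sub, ← hθ]
        exact le_trans (by linarith) (le_abs_self _)
    refine key.mono (le_of_eq ?_) fun _ h => h
    rw [List.length_cons]; push_cast; ring

variable (m ε) in
/-- Specification of a pass over the columns `l`. -/
def PassPost (st : SpanState d) (l : List (Fin d)) : Option (SpanState d) → Prop
  | none => ∀ i ∈ l, ∀ π, |inner ℝ (cofactor st.W i) (m π)| ≤ 2 * |cdet st.W|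
  | some st' => SpanInv m ε st' ∧ 2 * |cdet st.W| ≤ |cdet st'.W|

/-- If no replacement is made, then the coefficients from the rule of Cramer are at most `2`; if
one is made, the determinant doubles. -/
theorem sat_spanPass (hlo : E.MeasFam lo) (hvec : E.MeasFam vec)
    (hl : ∀ θ, E.Sat (lo θ) b fun z => ∀ π, inner ℝ (m π) θ ≤ inner ℝ (m z) θ + 5 / 4 * ε * ‖θ‖)
    (hv : ∀ z, E.Sat (vec z) b fun y => ‖y‖ ≤ 1 ∧ ‖y - m z‖ ≤ ε / 4) (hε : 0 ≤ ε)
    {st : SpanState d} (hst : SpanInv m ε st) (l : List (Fin d)) :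
    E.Sat (spanPass lo vec 2 (4 * ε) st l) (l.length * (4 * b)) (PassPost m ε st l) := by
  induction l with
  | nil => exact Sat.pure (P := PassPost m ε st []) (a := none) (by intro i hi; simp at hi)
  | cons i l ih =>
    have hloU : E.MeasFam fun q : Unit × Vec d => lo q.2 := hlo.comp measurable_snd
    have hq := (measFam_spanQuery (linOpt := fun _ : Unit => lo) hloU hvec i).prog ((), st)
    have hrec : E.MeasProg (spanPass lo vec 2 (4 * ε) st l) :=
      (measFam_spanPass (linOpt := fun _ : Unit => lo) hloU hvec 2 (4 * ε) l).prog ((), st)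
    have key : E.Sat (spanPass lo vec 2 (4 * ε) st (i :: l)) (4 * b + l.length * (4 * b))
        (PassPost m ε st (i :: l)) := by
      refine Sat.bind hq (MeasFam.matchOption (MeasFam.compute (Measurable.ite
        (measurableSet_le (by fun_prop) (by fun_prop)) (by fun_prop) (Measurable.ite
        (measurableSet_le (by fun_prop) (by fun_prop)) (by fun_prop) measurable_const)))
        (MeasProg.fam hrec) (MeasFam.done (by fun_prop)))
        (sat_spanQuery hlo hvec hl hv hε st i) ?_
      rintro ⟨θ, zp, wp, zm, wm⟩ hpost
      have hn := hpost.norm_tilted_le hε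
      obtain ⟨hθ, -, -, hp, hm⟩ := hpost
      simp only at hθ hp hm
      have hself : |(inner ℝ θ (st.W i) : ℝ)| = |cdet st.W| := by
        rw [hθ, abs_inner_cofactor, Function.update_eq_self]
      have hinv : ∀ y π, (‖y‖ ≤ 1 + 4 * ε ∧ ‖y - m π‖ ≤ 5 * ε) → SpanInv m ε (st.set i y π) :=
        fun y π hy => ⟨fun j => update_forall (P := fun y (_ : Param d) => ‖y‖ ≤ 1 + 4 * ε)
          (z := st.z) (π := π) hy.1 fun _ => hst.1 j,
          fun j => update_forall (P := fun y π => ‖y - m π‖ ≤ 5 * ε) hy.2 fun _ => hst.2 j⟩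
      have hyes : ∀ st', SpanInv m ε st' → 2 * |cdet st.W| ≤ |cdet st'.W| →
          E.Sat (Prog.done (some st') : Prog X A d (Option (SpanState d))) (l.length * (4 * b))
            (PassPost m ε st (i :: l)) := fun st' h1 h2 => Sat.pure (by exact ⟨h1, h2⟩)
      refine Sat.compute_bind ?_
      split_ifs with h1 h2
      · refine hyes _ (hinv _ _ hn.1) ?_
        change _ ≤ |cdet (Function.update st.W i _)|
        rw [hθ, abs_cdet_update_add, ← hθ, ← hself]
        exact h1.trans (le_abs_self _)
      · refine hyes _ (hinv _ _ hn.2) ?_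
        change _ ≤ |cdet (Function.update st.W i _)|
        rw [hθ, abs_cdet_update_sub, ← hθ, ← hself]
        exact h2.trans (le_abs_self _)
      · refine ih.mono le_rfl ?_
        rintro (_ | st') hpass
        · intro j hj π
          rcases List.mem_cons.1 hj with rfl | hj
          · rw [hself] at h1 h2
            have hnn : 0 ≤ ε * ‖θ‖ := by positivity
            have := hp π
            have := hm π
            rw [← hθ, abs_le]
            constructor <;> linarith
          · exact hpass j hj π
        · exact hpass
    refine key.mono (le_of_eq ?_) fun _ h => h
    rw [List.length_cons]; push_cast; ring

/-- The loop terminates in time, since the determinant doubles in every pass and is bounded by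
Hadamard's inequality. -/
theorem sat_spanLoop (hlo : E.MeasFam lo) (hvec : E.MeasFam vec)
    (hl : ∀ θ, E.Sat (lo θ) b fun z => ∀ π, inner ℝ (m π) θ ≤ inner ℝ (m z) θ + 5 / 4 * ε * ‖θ‖)
    (hv : ∀ z, E.Sat (vec z) b fun y => ‖y‖ ≤ 1 ∧ ‖y - m z‖ ≤ ε / 4) (hε : 0 ≤ ε) (N : ℕ)
    {st : SpanState d} (hst : SpanInv m ε st) (hN : (1 + 4 * ε) ^ d < |cdet st.W| * 2 ^ N) :
    E.Sat (spanLoop lo vec 2 (4 * ε) N st) (N * (d * (4 * b)))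
      fun o => ∃ Γ, o = some Γ ∧ IsSpanner m ε Γ := by
  induction N generalizing st with
  | zero =>
    rw [pow_zero, mul_one] at hN
    exact absurd hst.abs_cdet_le (not_le.2 hN)
  | succ N ih =>
    have hloU : E.MeasFam fun q : Unit × Vec d => lo q.2 := hlo.comp measurable_snd
    have hpass : E.MeasProg (spanPass lo vec 2 (4 * ε) st (List.finRange d)) :=
      (measFam_spanPass (linOpt := fun _ : Unit => lo) hloU hvec 2 (4 * ε) _).prog ((), st)
    have hrec : E.MeasFam fun st : SpanState d => spanLoop lo vec 2 (4 * ε) N st :=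
      (measFam_spanLoop (linOpt := fun _ : Unit => lo) hloU hvec 2 (4 * ε) N).comp
        (g := fun st => ((), st)) (by fun_prop)
    have hcont : E.MeasFam fun o : Option (SpanState d) => (match o with
        | none => pure (some st.z)
        | some st' => spanLoop lo vec 2 (4 * ε) N st' : Prog X A d (Option (Fin d → Param d))) := by
      have h4 := MeasFam.option (E := E) (ι := Option (SpanState d)) (o := fun o => o)
        (p := fun _ r => spanLoop lo vec 2 (4 * ε) N r) (q := fun _ => Prog.done (some st.z))
        measurable_id (hrec.comp measurable_snd) (MeasFam.done measurable_const)
      convert h4 using 2 with o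
      rcases o with _ | st' <;> rfl
    -- otherwise `hN` reads `(1 + 4 ε) ^ d < 0`
    have hpos : 0 < |cdet st.W| := by
      by_contra h0
      have h0' : |cdet st.W| = 0 := le_antisymm (not_lt.1 h0) (abs_nonneg _)
      rw [h0', zero_mul] at hN
      exact absurd hN (not_lt.2 (by positivity))
    have key : E.Sat (spanLoop lo vec 2 (4 * ε) (N + 1) st)
        ((List.finRange d).length * (4 * b) + N * (d * (4 * b)))
        fun o => ∃ Γ, o = some Γ ∧ IsSpanner m ε Γ := by
      refine Sat.bind hpass hcont (sat_spanPass hlo hvec hl hv hε hst _) ?_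
      rintro (_ | st') hpost
      · exact Sat.pure ⟨st.z, rfl, hst.isSpanner hpos fun i π => hpost i (List.mem_finRange i) π⟩
      · refine ih hpost.1 (hN.trans_le ?_)
        rw [pow_succ']
        calc |cdet st.W| * (2 * 2 ^ N) = 2 * |cdet st.W| * 2 ^ N := by ring
          _ ≤ |cdet st'.W| * 2 ^ N := by gcongr; exact hpost.2
    refine key.mono (le_of_eq ?_) fun _ h => h
    rw [List.length_finRange]; push_cast; ring

theorem sat_robustSpanner (hlo : E.MeasFam lo) (hvec : E.MeasFam vec)
    (hl : ∀ θ, E.Sat (lo θ) b fun z => ∀ π, inner ℝ (m π) θ ≤ inner ℝ (m z) θ + 5 / 4 * ε * ‖θ‖)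
    (hv : ∀ z, E.Sat (vec z) b fun y => ‖y‖ ≤ 1 ∧ ‖y - m z‖ ≤ ε / 4) (hε : 0 ≤ ε) (N : ℕ)
    (hN : (1 + 4 * ε) ^ d < (5 / 2 * ε) ^ d * 2 ^ N) :
    E.Sat (robustSpanner lo vec 2 (4 * ε) N) ((N + 1) * (d * (4 * b)))
      fun o => ∃ Γ, o = some Γ ∧ IsSpanner m ε Γ := by
  have hloU : E.MeasFam fun q : Unit × Vec d => lo q.2 := hlo.comp measurable_snd
  have hinit := (measFam_spanInit (linOpt := fun _ : Unit => lo) hloU hvec (4 * ε)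
    (List.finRange d)).prog ((), ⟨fun i => EuclideanSpace.single i (1 : ℝ), fun _ => 0⟩)
  have hrec : E.MeasFam fun st : SpanState d => spanLoop lo vec 2 (4 * ε) N st :=
    (measFam_spanLoop (linOpt := fun _ : Unit => lo) hloU hvec 2 (4 * ε) N).comp
      (g := fun st => ((), st)) (by fun_prop)
  have hone : cdet (fun i : Fin d => EuclideanSpace.single i (1 : ℝ)) = 1 := by
    rw [cdet_eq]
    convert Matrix.det_one (R := ℝ) (n := Fin d)
    ext r c
    simp [Matrix.one_apply]
  have key : E.Sat (robustSpanner lo vec 2 (4 * ε) N)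
      ((List.finRange d).length * (4 * b) + N * (d * (4 * b)))
      fun o => ∃ Γ, o = some Γ ∧ IsSpanner m ε Γ := by
    refine Sat.bind hinit hrec (sat_spanInit hlo hvec hl hv hε _ (List.nodup_finRange d) (c := 1)
      (fun i _ => rfl) (fun i => ?_) (fun i hi => absurd (List.mem_finRange i) hi) ?_)
      fun st hst => sat_spanLoop hlo hvec hl hv hε N hst.1 ?_
    · simp; positivity
    · change 1 ≤ |cdet (fun i : Fin d => EuclideanSpace.single i (1 : ℝ))|
      rw [hone]; simp
    · refine hN.trans_le ?_
      have := hst.2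
      rw [List.length_finRange, one_mul] at this
      gcongr
  refine key.mono (le_of_eq ?_) fun _ h => h
  rw [List.length_finRange]; ring

end Spanner

end Setting

/-! ### The exploration phase -/

section Mean

variable {Ω : Type*} [MeasurableSpace Ω] {d : ℕ}

theorem integral_apply {μ : Measure Ω} {Y : Ω → Vec d} (hY : Integrable Y μ) (j : Fin d) :
    (∫ x, Y x ∂μ) j = ∫ x, Y x j ∂μ :=
  ((EuclideanSpace.proj j : Vec d →L[ℝ] ℝ).integral_comp_comm hY).symm

theorem norm_le_of_coord {y : Vec d} {t : ℝ} (ht : 0 ≤ t) (h : ∀ j, |y j| ≤ t) : ‖y‖ ≤ √d * t := by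
  rw [EuclideanSpace.norm_eq]
  refine Real.sqrt_le_iff.2 ⟨by positivity, ?_⟩
  rw [mul_pow, Real.sq_sqrt (by positivity)]
  calc ∑ j, ‖y j‖ ^ 2 ≤ ∑ _j : Fin d, t ^ 2 := by
        refine Finset.sum_le_sum fun j _ => ?_
        rw [Real.norm_eq_abs]
        have := h j
        gcongr
    _ = d * t ^ 2 := by simp

/-- Concentration of the mean of independent random vectors in the unit ball. -/
theorem draws_mean_le {μ : Measure Ω} [IsProbabilityMeasure μ] {Y : Ω → Vec d} (hY : Measurable Y)
    (hY1 : ∀ x, ‖Y x‖ ≤ 1) {n : ℕ} (hn : 0 < n) {t : ℝ} (ht : 0 ≤ t) :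
    draws (μ.map Y) n {l | √d * (2 * t) < ‖(n : ℝ)⁻¹ • l.sum - ∫ x, Y x ∂μ‖} ≤
      d * (2 * ofReal (exp (-(2 * n * t ^ 2)))) := by
  have hint : Integrable Y μ := Integrable.of_bound (C := 1) hY.aestronglyMeasurable
    (Filter.Eventually.of_forall hY1)
  have hcoord : ∀ j x, |Y x j| ≤ 1 := fun j x => (PiLp.norm_apply_le (Y x) j).trans (hY1 x)
  have hYj : ∀ j, Measurable fun x => Y x j := fun j => by fun_prop
  have hintj : ∀ j, Integrable (fun x => Y x j) μ := fun j =>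
    Integrable.of_bound (C := 1) (hYj j).aestronglyMeasurable
      (Filter.Eventually.of_forall (hcoord j))
  have hS : MeasurableSet {l : List (Vec d) |
      √d * (2 * t) < ‖(n : ℝ)⁻¹ • l.sum - ∫ x, Y x ∂μ‖} :=
    measurableSet_lt measurable_const (by fun_prop)
  rw [← draws_map hY, Measure.map_apply (by fun_prop) hS]
  -- rescale every coordinate from `[-1, 1]` to `[0, 1]`
  set f : Fin d → Ω → ℝ := fun j x => (1 + Y x j) / 2 with hf
  have hfm : ∀ j, Measurable (f j) := fun j => by fun_prop
  have hf01 : ∀ j x, f j x ∈ Set.Icc (0 : ℝ) 1 := fun j x => by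
    have := abs_le.1 (hcoord j x)
    constructor <;> simp only [hf] <;> linarith
  have hsum : ∀ j (l : List Ω), ((l.map Y).sum) j = 2 * (l.map (f j)).sum - l.length := by
    intro j l
    induction l with
    | nil => simp
    | cons x l ih =>
      rw [List.map_cons, List.sum_cons, PiLp.add_apply, ih, List.map_cons, List.sum_cons,
        List.length_cons]
      simp only [hf]; push_cast; ring
  have hmean : ∀ j, (∫ x, Y x ∂μ) j = 2 * ∫ x, f j x ∂μ - 1 := by
    intro j
    rw [integral_apply hint]
    simp only [hf]
    rw [integral_div, integral_add (integrable_const _) (hintj j)]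
    simp only [integral_const, probReal_univ, smul_eq_mul]
    ring
  have hlen : ∀ᵐ l ∂draws μ n, l.length = n := by
    have := drawsL_length (allProb_replicate μ n)
    simpa [draws] using this
  have hsub : (List.map Y ⁻¹' {l : List (Vec d) |
      √d * (2 * t) < ‖(n : ℝ)⁻¹ • l.sum - ∫ x, Y x ∂μ‖}) ≤ᵐ[draws μ n]
      ⋃ j ∈ Finset.univ, ({l : List Ω | n * t < (l.map (f j)).sum - n * ∫ x, f j x ∂μ} ∪
        {l | n * t < n * ∫ x, f j x ∂μ - (l.map (f j)).sum}) := by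
    filter_upwards [hlen] with l hl hmem
    by_contra hcon
    refine not_le.2 hmem (norm_le_of_coord (by positivity) fun j => ?_)
    have hcon' : ∀ j, ¬ (n * t < (l.map (f j)).sum - n * ∫ x, f j x ∂μ ∨
        n * t < n * ∫ x, f j x ∂μ - (l.map (f j)).sum) := by
      intro j hj
      exact hcon (Set.mem_biUnion (Finset.mem_univ j) hj)
    have h1 := hcon' j
    rw [not_or, not_lt, not_lt] at h1
    have hn' : (0 : ℝ) < n := by exact_mod_cast hn
    rw [PiLp.sub_apply, PiLp.smul_apply, hsum, hmean, hl, smul_eq_mul]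
    have h2 : (n : ℝ)⁻¹ * (2 * (l.map (f j)).sum - n) - (2 * ∫ x, f j x ∂μ - 1) =
        (n : ℝ)⁻¹ * (2 * ((l.map (f j)).sum - n * ∫ x, f j x ∂μ)) := by
      field_simp; ring
    rw [h2, abs_mul, abs_of_pos (inv_pos.2 hn'), inv_mul_le_iff₀ hn', abs_le]
    constructor <;> linarith [h1.1, h1.2]
  refine (measure_mono_ae hsub).trans ((measure_biUnion_finset_le _ _).trans ?_)
  calc _ ≤ ∑ _j : Fin d, 2 * ofReal (exp (-(2 * n * t ^ 2))) := by
        refine Finset.sum_le_sum fun j _ => (measure_union_le _ _).trans ?_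
        rw [two_mul]
        exact add_le_add (hoeffding_upper (hfm j) (hf01 j) hn ht)
          (hoeffding_lower (hfm j) (hf01 j) hn ht)
    _ = _ := by simp

theorem norm_inv_smul_sum_le {n : ℕ} {l : List (Vec d)} (hl : l.length = n) (h : ∀ y ∈ l, ‖y‖ ≤ 1) :
    ‖(n : ℝ)⁻¹ • l.sum‖ ≤ 1 := by
  have h1 : ‖l.sum‖ ≤ l.length := by
    clear hl
    induction l with
    | nil => simp
    | cons y l ih =>
      rw [List.sum_cons, List.length_cons, Nat.cast_succ, add_comm (l.length : ℝ)]
      exact (norm_add_le _ _).trans (add_le_add (h y (by simp)) (ih fun z hz => h z (by simp [hz])))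
  rw [norm_smul, norm_inv, RCLike.norm_natCast, inv_mul_eq_div]
  exact div_le_one_of_le₀ (hl ▸ h1) (by positivity)

end Mean

namespace Setting

variable {X : Type u} {A : Type v} {Ξ : Type w} [MeasurableSpace X] [MeasurableSpace A]
  [MeasurableSpace Ξ] {d : ℕ} {E : Setting X A Ξ d}

variable (E) in
/-- The expected feature of layer `h` under the greedy policy with parameters `π`. -/
def meanFeat (h : ℕ) (π : Param d) : Vec d := ∫ x, E.feat π h x ∂E.M.start

theorem integrable_feat {h : ℕ} (hh : h < E.H) (π : Param d) :
    Integrable (E.feat π h) E.M.start :=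
  Integrable.of_bound (C := 1) (E.measurable_feat hh π).aestronglyMeasurable
    (Filter.Eventually.of_forall (E.norm_feat_le hh π))

theorem integrable_inner_feat {h : ℕ} (hh : h < E.H) (π : Param d) (θ : Vec d) :
    Integrable (fun x => (inner ℝ (E.feat π h x) θ : ℝ)) E.M.start :=
  (integrable_feat hh π).inner_const θ

theorem inner_meanFeat {h : ℕ} (hh : h < E.H) (π : Param d) (θ : Vec d) :
    inner ℝ (E.meanFeat h π) θ = ∫ x, (inner ℝ (E.feat π h x) θ : ℝ) ∂E.M.start := by
  rw [real_inner_comm]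
  unfold meanFeat
  rw [← integral_inner (integrable_feat hh π)]
  simp only [real_inner_comm]

/-- A function that is nonpositive on the safe initial states and at most `c` elsewhere. -/
theorem integral_le_of_safe {h : ℕ} (hh : h ≤ E.H) {S : ℕ → Submodule ℝ (Vec d)}
    (hS : ∀ l < h, ∃ Q, ONList Q ∧ S l = lspan Q) {p : ℝ} (hp0 : 0 ≤ p)
    (hp : E.M.start (E.safe h S)ᶜ ≤ ofReal p) {f : X → ℝ} (hf : Integrable f E.M.start)
    {c : ℝ} (hc0 : 0 ≤ c) (hc : ∀ x, f x ≤ c) (h0 : ∀ x ∈ E.safe h S, f x ≤ 0) :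
    ∫ x, f x ∂E.M.start ≤ c * p := by
  have hms := (measurableSet_safe hh hS).compl
  have h1 : ∀ x, f x ≤ (E.safe h S)ᶜ.indicator (fun _ => c) x := by
    intro x
    by_cases hx : x ∈ E.safe h S
    · rw [Set.indicator_of_notMem (by simpa using hx)]; exact h0 x hx
    · rw [Set.indicator_of_mem (by simpa using hx)]; exact hc x
  calc ∫ x, f x ∂E.M.start ≤ ∫ x, (E.safe h S)ᶜ.indicator (fun _ => c) x ∂E.M.start :=
        integral_mono hf ((integrable_const c).indicator hms) h1
    _ = (E.M.start.real (E.safe h S)ᶜ) * c := by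
        rw [integral_indicator_const _ hms, smul_eq_mul]
    _ ≤ p * c := by
        gcongr
        exact ENNReal.toReal_le_of_le_ofReal hp0 hp
    _ = c * p := mul_comm _ _

/-- Policies that are exactly optimal from the safe initial states are nearly optimal. -/
theorem IsBackup.inner_meanFeat_le {h : ℕ} (hh : h < E.H) {S : ℕ → Submodule ℝ (Vec d)}
    (hS : ∀ l < h, ∃ Q, ONList Q ∧ S l = lspan Q) {p : ℝ} (hp0 : 0 ≤ p)
    (hp : E.M.start (E.safe h S)ᶜ ≤ ofReal p) {θ : Vec d} {z : Param d}
    (hz : E.IsBackup S h (rewardAt h θ) z) (π : Param d) :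
    inner ℝ (E.meanFeat h π) θ ≤ inner ℝ (E.meanFeat h z) θ + 2 * p * ‖θ‖ := by
  have h1 := integral_le_of_safe hh.le hS hp0 hp
    (f := fun x => inner ℝ (E.feat π h x) θ - inner ℝ (E.feat z h x) θ)
    ((integrable_inner_feat hh π θ).sub (integrable_inner_feat hh z θ)) (c := 2 * ‖θ‖)
    (by positivity) (fun x => ?_) fun x hx => ?_
  · rw [integral_sub (integrable_inner_feat hh π θ) (integrable_inner_feat hh z θ),
      ← inner_meanFeat hh, ← inner_meanFeat hh] at h1
    linarith
  · have hb : ∀ π : Param d, |inner ℝ (E.feat π h x) θ| ≤ ‖θ‖ := fun π =>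
      (abs_real_inner_le_norm _ _).trans (mul_le_of_le_one_left (norm_nonneg _)
        (E.norm_feat_le hh π x))
    have h2 := abs_le.1 (hb π)
    have h3 := abs_le.1 (hb z)
    linarith [h2.2, h3.1]
  · linarith [hz.optimal_rewardAt hh hx π]

theorem measProg_drawFeature {h : ℕ} (hh : h < E.H) (π : Param d) :
    E.MeasProg (drawFeature π h : Prog X A d (Vec d)) := (measFam_drawFeature hh).prog π

/-- The empirical mean of the features is accurate. -/
theorem sat_vecEval {h : ℕ} (hh : h < E.H) (π : Param d) {n : ℕ} (hn : 0 < n) {t : ℝ}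
    (ht : 0 ≤ t) :
    E.Sat (vecEval h n π : Prog X A d (Vec d))
      (d * (2 * ofReal (exp (-(2 * n * t ^ 2))))) fun y =>
        ‖y‖ ≤ 1 ∧ ‖y - E.meanFeat h π‖ ≤ √d * (2 * t) := by
  have hm := measProg_drawFeature (E := E) hh π
  have h1 : E.Sat (drawFeature π h : Prog X A d (Vec d)) 0 fun y => ‖y‖ ≤ 1 :=
    Sat.of_forall hm fun ω => E.norm_feat_le hh π _
  have h2 : MeasurableSet {l : List (Vec d) |
      ‖(n : ℝ)⁻¹ • l.sum - E.meanFeat h π‖ ≤ √d * (2 * t)} :=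
    measurableSet_le (by fun_prop) measurable_const
  have h3 : E.Sat (repeatProg (drawFeature π h) n : Prog X A d (List (Vec d)))
      (d * (2 * ofReal (exp (-(2 * n * t ^ 2))))) fun l =>
        ‖(n : ℝ)⁻¹ • l.sum - E.meanFeat h π‖ ≤ √d * (2 * t) := by
    refine Sat.of_dist_le ?_
    rw [dist_repeatProg hm, dist_drawFeature hh]
    simp only [not_le]
    exact draws_mean_le (E.measurable_feat hh π) (E.norm_feat_le hh π) hn ht
  have key : E.Sat (vecEval h n π : Prog X A d (Vec d))
      ((n * 0 + d * (2 * ofReal (exp (-(2 * n * t ^ 2))))) + 0) fun y =>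
        ‖y‖ ≤ 1 ∧ ‖y - E.meanFeat h π‖ ≤ √d * (2 * t) := by
    refine Sat.bind ((MeasFam.repeatProg (ι := Unit) (MeasProg.fam hm) n).prog ())
      (MeasFam.compute (by fun_prop)) (Sat.and (Sat.repeatProg hm h1 n) h3 h2) ?_
    rintro l ⟨⟨hlen, hl⟩, hl'⟩
    exact Sat.compute ⟨norm_inv_smul_sum_le hlen hl, hl'⟩
  exact key.mono (by simp) fun _ h => h

variable (E) in
/-- What the first `h` rounds of the exploration phase achieve: the policies `Ψ l` cover subspaces
which are rarely left, and the policies `Γ l` are approximate spanners. -/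
structure ExplorationPost (s : Sizes) (h : ℕ) (R : Exploration d) : Prop where
  cover : E.LayerCover s.nSpan h (fun l => lspan (R.S l)) R.Ψ
  onList : ∀ l < h, ONList (R.S l)
  escape_le : E.M.start (E.safe h fun l => lspan (R.S l))ᶜ ≤
    h * (2 * d * ofReal (5 * s.eps / (16 * E.H * d)))
  spanner : ∀ l < h, IsSpanner (E.meanFeat l) s.eps (R.Γ l)

/-- The probabilities to leave the subspaces, summed over the layers. -/
theorem escape_bound {h : ℕ} (hh : h ≤ E.H) {ε : ℝ} (hε : 0 ≤ ε) :
    (h : ENNReal) * (2 * d * ofReal (5 * ε / (16 * E.H * d))) ≤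
      ofReal (5 / 8 * ε) := by
  have hd : (0 : ℝ) < d := by have := E.d_pos; positivity
  have hH : (0 : ℝ) < E.H := by have := E.H_pos; positivity
  have h2 : (2 : ENNReal) = ofReal 2 := by simp
  rw [← ENNReal.ofReal_natCast h, ← ENNReal.ofReal_natCast d, h2,
    ← ENNReal.ofReal_mul (by positivity), ← ENNReal.ofReal_mul (by positivity),
    ← ENNReal.ofReal_mul (by positivity)]
  refine ENNReal.ofReal_le_ofReal ?_
  have hh' : (h : ℝ) ≤ E.H := by exact_mod_cast hh
  calc (h : ℝ) * (2 * d * (5 * ε / (16 * E.H * d))) ≤ E.H * (2 * d * (5 * ε / (16 * E.H * d))) := by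
        gcongr
    _ = 5 / 8 * ε := by field_simp; ring

theorem safe_congr {h : ℕ} {S S' : ℕ → Submodule ℝ (Vec d)} (hS : ∀ l < h, S l = S' l) :
    E.safe h S = E.safe h S' := by
  ext x
  exact forall_congr' fun l => forall_congr' fun hl => by rw [hS l hl]

theorem compl_safe_succ (h : ℕ) (S : ℕ → Submodule ℝ (Vec d)) :
    (E.safe (h + 1) S)ᶜ ⊆ (E.safe h S)ᶜ ∪ (E.safe h S ∩ E.escape h (S h)) := by
  intro x hx
  by_cases hs : x ∈ E.safe h S
  · refine Or.inr ⟨hs, ?_⟩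
    by_contra hne
    refine hx fun l hl π => ?_
    rcases Nat.lt_succ_iff_lt_or_eq.1 hl with hl | rfl
    · exact hs l hl π
    · by_contra hπ
      exact hne ⟨π, hπ⟩
  · exact Or.inl hs

theorem ExplorationPost.step {s : Sizes} {h : ℕ} {R : Exploration d} (hR : E.ExplorationPost s h R)
    {r : List (Vec d) × List (Param d)} (hr : E.CoverPost s h (fun l => lspan (R.S l)) r)
    {Γ : Fin d → Param d} (hΓ : IsSpanner (E.meanFeat h) s.eps Γ) :
    E.ExplorationPost s (h + 1) ⟨Function.update R.S h r.1, Function.update R.Ψ h r.2,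
      Function.update R.Γ h Γ⟩ := by
  have hne : ∀ {l}, l < h → l ≠ h := fun hl => hl.ne
  have hon : ∀ l < h + 1, ONList (Function.update R.S h r.1 l) := by
    intro l hl
    rcases Nat.lt_succ_iff_lt_or_eq.1 hl with hl | rfl
    · rw [Function.update_of_ne (hne hl)]; exact hR.onList l hl
    · rw [Function.update_self]; exact hr.1
  refine ⟨fun l hl => ⟨⟨_, hon l hl, rfl⟩, ?_⟩, hon, ?_, fun l hl => ?_⟩
  · rcases Nat.lt_succ_iff_lt_or_eq.1 hl with hl | rfl
    · simp only [Function.update_of_ne (hne hl)]; exact (hR.cover l hl).2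
    · simp only [Function.update_self]; exact ⟨hr.2.1, hr.2.2.1⟩
  · refine (measure_mono (compl_safe_succ h _)).trans ((measure_union_le _ _).trans ?_)
    rw [safe_congr (S' := fun l => lspan (R.S l))
      fun l hl => by simp only [Function.update_of_ne (hne hl)]]
    simp only [Function.update_self]
    refine (add_le_add hR.escape_le hr.2.2.2).trans (le_of_eq ?_)
    push_cast; ring
  · rcases Nat.lt_succ_iff_lt_or_eq.1 hl with hl | rfl
    · simp only [Function.update_of_ne (hne hl)]; exact hR.spanner l hl
    · simp only [Function.update_self]; exact hΓ

theorem ExplorationPost.sat_robustSpanner {s : Sizes} {b : ENNReal} (hs : s.Suffice d E.H b)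
    (hrob : s.epsRob = 4 * s.eps)
    (hN : (1 + 4 * s.eps) ^ d < (5 / 2 * s.eps) ^ d * 2 ^ s.nIter) {h : ℕ} (hh : h < E.H)
    {R : Exploration d} (hR : E.ExplorationPost s h R) :
    E.Sat (robustSpanner (fun θ => fqi h (rewardAt h θ) R.Ψ s.nCover) (vecEval h s.nVec) 2 s.epsRob
      s.nIter : Prog X A d (Option (Fin d → Param d))) ((s.nIter + 1) * (d * (4 * b)))
      fun o => ∃ Γ, o = some Γ ∧ IsSpanner (E.meanFeat h) s.eps Γ := by
  have hε := hs.eps_pos.le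
  rw [hrob]
  have hlo : E.MeasFam fun θ => (fqi h (rewardAt h θ) R.Ψ s.nCover : Prog X A d (Param d)) :=
    (measFam_fqi_rewardAt hh).comp (g := fun θ => (θ, R.Ψ)) (by fun_prop)
  refine LBC.Setting.sat_robustSpanner hlo (measFam_vecEval hh s.nVec) (fun θ => ?_) (fun z => ?_)
    hε _ hN
  · refine (hR.cover.sat_fqi' hs hh le_rfl (rewardAt h θ)).mono le_rfl fun z hz π => ?_
    have h1 := hz.inner_meanFeat_le hh (fun l hl => ⟨_, hR.onList l hl, rfl⟩)
      (by positivity : 0 ≤ 5 / 8 * s.eps) (hR.escape_le.trans (escape_bound hh.le hε)) π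
    linarith
  · have hd : (0 : ℝ) < d := by have := E.d_pos; positivity
    refine (sat_vecEval hh z hs.nVec_pos (t := s.eps / (16 * d)) (by positivity)).mono hs.vec ?_
    rintro y ⟨h1, h2⟩
    refine ⟨h1, h2.trans ?_⟩
    have h3 : √(d : ℝ) ≤ d := by
      rw [Real.sqrt_le_left (by positivity)]
      have : (1 : ℝ) ≤ d := by exact_mod_cast E.d_pos
      nlinarith
    calc √(d : ℝ) * (2 * (s.eps / (16 * d))) ≤ d * (2 * (s.eps / (16 * d))) := by gcongr
      _ ≤ s.eps / 4 := by
          have : (d : ℝ) * (2 * (s.eps / (16 * d))) = s.eps / 8 := by field_simp; ring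
          linarith

/-- The exploration phase succeeds, by induction over the layers. -/
theorem sat_exploreUpTo {s : Sizes} {b : ENNReal} (hs : s.Suffice d E.H b)
    (hrob : s.epsRob = 4 * s.eps)
    (hN : (1 + 4 * s.eps) ^ d < (5 / 2 * s.eps) ^ d * 2 ^ s.nIter) {h : ℕ} (hh : h ≤ E.H) :
    E.Sat (exploreUpTo E.H s h : Prog X A d (Option (Exploration d)))
      (h * ((d + 1 : ℕ) * (d * (4 * b) + b) + (s.nIter + 1) * (d * (4 * b))))
      fun o => ∃ R, o = some R ∧ E.ExplorationPost s h R := by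
  induction h with
  | zero =>
    refine Sat.pure ⟨_, rfl, ⟨by intro l hl; omega, by intro l hl; omega, ?_, by intro l hl; omega⟩⟩
    have : E.safe 0 (fun l => lspan ([] : List (Vec d))) = Set.univ := by
      ext x; simp [safe]
    change E.M.start (E.safe 0 (fun l => lspan ([] : List (Vec d))))ᶜ ≤ _
    rw [this]; simp
  | succ h ih =>
    have key : E.Sat (exploreUpTo E.H s (h + 1) : Prog X A d (Option (Exploration d)))
        (h * ((d + 1 : ℕ) * (d * (4 * b) + b) + (s.nIter + 1) * (d * (4 * b))) +
          ((d + 1 : ℕ) * (d * (4 * b) + b) + ((s.nIter + 1) * (d * (4 * b)) + 0)))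
        fun o => ∃ R, o = some R ∧ E.ExplorationPost s (h + 1) R := by
      rw [exploreUpTo_succ]
      refine Sat.bind (measProg_exploreUpTo s (by omega)) (measFam_exploreLayer (by omega))
        (ih (by omega)) ?_
      rintro _ ⟨R, rfl, hR⟩
      refine Sat.bind ((measFam_subspaceCover (by omega)).prog R.Ψ) ?_
        (hR.cover.sat_subspaceCover hs (by omega)) fun r hr => ?_
      · exact MeasFam.bind (f := fun r => recordLayer h R r)
          ((measFam_layerSpanner (by omega)).comp (g := fun _ => R.Ψ) measurable_const)
          (measFam_recordLayer h (by fun_prop) (by fun_prop) (by fun_prop))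
      · refine Sat.bind ((measFam_layerSpanner (by omega)).prog R.Ψ)
          (measFam_recordLayer h (by fun_prop) (by fun_prop) (by fun_prop))
          (hR.sat_robustSpanner hs hrob hN (by omega)) ?_
        rintro _ ⟨Γ, rfl, hΓ⟩
        exact Sat.done ⟨_, rfl, hR.step hr hΓ⟩
    refine key.mono (le_of_eq ?_) fun _ h => h
    push_cast; ring

end Setting

/-! ### The sample sizes suffice -/

theorem ofReal_pow_le_exp {p x : ℝ} (hp : p ≤ 1) {n : ℕ} (hx : x ≤ n * p) :
    ofReal (1 - p) ^ n ≤ ofReal (exp (-x)) := by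
  rw [← ENNReal.ofReal_pow (by linarith)]
  refine ENNReal.ofReal_le_ofReal ?_
  calc (1 - p) ^ n ≤ exp (-p) ^ n := by
        have := Real.add_one_le_exp (-p)
        exact pow_le_pow_left₀ (by linarith) (by linarith) n
    _ = exp (n * -p) := (Real.exp_nat_mul _ _).symm
    _ ≤ _ := Real.exp_le_exp.2 (by linarith)

theorem ofReal_half_pow_ceil_le {x : ℝ} (hx : 0 < x) :
    ofReal (1 / 2) ^ ⌈logb 2 x⌉₊ ≤ ofReal x⁻¹ := by
  rw [← ENNReal.ofReal_pow (by norm_num)]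
  refine ENNReal.ofReal_le_ofReal ?_
  rw [one_div, inv_pow]
  refine inv_anti₀ hx ?_
  rw [← Real.rpow_natCast, ← Real.logb_le_iff_le_rpow (by norm_num) hx]
  exact Nat.le_ceil _

theorem exp_neg_log_div {x : ℝ} (hx : 0 < x) : exp (-log x) = x⁻¹ := by
  rw [Real.exp_neg, Real.exp_log hx]

/-- The frequencies of all `m` candidates are accurate: `m` is polynomial in `d` and `ℓ`, which
a part of the exponent compensates. -/
theorem boosting_size {d m B : ℕ} {η ℓ : ℝ} (hd' : (1 : ℝ) ≤ d) (hm0 : (2048 : ℝ) ≤ m)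
    (hm' : m ≤ 512 * (d : ℝ) ^ 2 * (ℓ + log (64 * d)) + 1)
    (h64' : log (64 * d) ≤ 64 * d) (hB : 2048 * (d : ℝ) ^ 2 * ℓ ≤ B) (hℓ4 : 4 ≤ ℓ)
    (hexp : exp (-ℓ) = η / 4) :
    (m : ENNReal) * (2 * ofReal (exp (-(2 * B * (1 / 16) ^ 2)))) ≤
      ofReal (η / 3) := by
  have hη : 0 < η := by have := Real.exp_pos (-ℓ); linarith
  have hd2 : (1 : ℝ) ≤ (d : ℝ) ^ 2 := one_le_pow₀ hd'
  have hd3 : (d : ℝ) ≤ (d : ℝ) ^ 2 := by nlinarith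
  have hy4 : 4 ≤ (d : ℝ) ^ 2 * ℓ := by nlinarith
  have e2 : (2 : ENNReal) = ofReal 2 := by norm_num
  rw [e2, ← ENNReal.ofReal_mul (by norm_num), ← ENNReal.ofReal_natCast m,
    ← ENNReal.ofReal_mul (by positivity)]
  refine ENNReal.ofReal_le_ofReal ?_
  set y := (d : ℝ) ^ 2 * ℓ with hy
  have hly : ℓ ≤ y := by nlinarith
  have hdy : (d : ℝ) ^ 2 ≤ y := by nlinarith
  have h1 : exp (-(2 * B * (1 / 16) ^ 2)) ≤ exp (-ℓ) * exp (-(15 * y)) := by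
    rw [← Real.exp_add]
    exact Real.exp_le_exp.2 (by linarith)
  have hy1 : y ≤ y ^ 2 := by nlinarith
  have hmy : (m : ℝ) ≤ 2 ^ 16 * y ^ 2 := by
    have h3 : (d : ℝ) ^ 2 * (64 * d) ≤ 64 * y ^ 2 := by
      have : (d : ℝ) ^ 2 * d ≤ y * y := mul_le_mul hdy (hd3.trans hdy) (by positivity) (by positivity)
      linarith [sq y]
    have h4 : (d : ℝ) ^ 2 * log (64 * d) ≤ 64 * y ^ 2 :=
      (mul_le_mul_of_nonneg_left h64' (by positivity)).trans h3
    have h5 : (m : ℝ) ≤ 512 * y + 512 * ((d : ℝ) ^ 2 * log (64 * d)) + 1 := by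
      rw [hy]; linarith
    linarith
  have h2 : (2 : ℝ) ^ 52 * y ^ 2 ≤ exp (15 * y) := by
    have h5 : y ^ 2 ≤ exp (2 * y) := by
      have := Real.add_one_le_exp y
      rw [two_mul, Real.exp_add, ← sq]
      exact pow_le_pow_left₀ (by linarith) (by linarith) 2
    have h6 : (2 : ℝ) ^ 52 ≤ exp (13 * y) := by
      calc (2 : ℝ) ^ 52 ≤ exp 1 ^ 52 := by
            refine pow_le_pow_left₀ (by norm_num) ?_ _
            have := Real.add_one_le_exp (1 : ℝ); linarith
        _ = exp 52 := by rw [← Real.exp_nat_mul]; norm_num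
        _ ≤ _ := Real.exp_le_exp.2 (by linarith)
    calc (2 : ℝ) ^ 52 * y ^ 2 ≤ exp (13 * y) * exp (2 * y) :=
          mul_le_mul h6 h5 (by positivity) (by positivity)
      _ = _ := by rw [← Real.exp_add]; ring_nf
  have h7 : 6 * (m : ℝ) * exp (-(15 * y)) ≤ 4 := by
    rw [Real.exp_neg, ← div_eq_mul_inv, div_le_iff₀ (Real.exp_pos _)]
    linarith [sq_nonneg y]
  calc (m : ℝ) * (2 * exp (-(2 * B * (1 / 16) ^ 2)))
      ≤ m * (2 * (exp (-ℓ) * exp (-(15 * y)))) := by gcongr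
    _ = (6 * m * exp (-(15 * y))) * (η / 12) := by rw [hexp]; ring
    _ ≤ 4 * (η / 12) := by gcongr
    _ = η / 3 := by ring

/-- The failure probability of a round is at most the confidence parameter, for the sample sizes of
the rejection sampling, of the candidates and of the boosting trials. -/
theorem outlier_sizes {d H m B J : ℕ} {ε η : ℝ} (hd : 1 ≤ d) (hH : 1 ≤ H) (hε : 0 < ε) (hε1 : ε ≤ 1)
    (hη : 0 < η) (hη1 : η ≤ 1 / 32)
    (hm : 512 * (d : ℝ) ^ 2 * log (256 * d / η) ≤ m)
    (hm' : m ≤ 512 * (d : ℝ) ^ 2 * log (256 * d / η) + 1)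
    (hB : 2048 * (d : ℝ) ^ 2 * log (4 / η) ≤ B)
    (hJ : 8 * H * d * log ((m + (m : ℝ) ^ 2 * B) / η) / ε ≤ J) :
    (m : ENNReal) * ofReal (1 - 3 * ε / (16 * H * d)) ^ J +
      (4 * ((d : ENNReal) / (m + 1))) ^ m +
      m * (2 * ofReal (exp (-(2 * B * (1 / 16) ^ 2)))) ≤ ofReal η := by
  have hd' : (1 : ℝ) ≤ d := by exact_mod_cast hd
  have hH' : (1 : ℝ) ≤ H := by exact_mod_cast hH
  have hd2 : (1 : ℝ) ≤ (d : ℝ) ^ 2 := one_le_pow₀ hd'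
  have hl2 := Real.log_two_gt_d9
  have hl2' := Real.log_two_lt_d9
  have hℓ4 : 4 ≤ log (4 / η) := by
    have : log (2 ^ 7) ≤ log (4 / η) := by
      refine Real.log_le_log (by norm_num) ?_
      rw [le_div_iff₀ hη]; linarith
    rw [Real.log_pow] at this
    push_cast at this; linarith
  have hℓ : log (256 * d / η) = log (4 / η) + log (64 * d) := by
    rw [← Real.log_mul (by positivity) (by positivity)]; congr 1; ring
  have h64 : 0 ≤ log (64 * d) := Real.log_nonneg (by linarith)
  have h64' : log (64 * d) ≤ 64 * d := (Real.log_le_self (by positivity))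
  generalize hℓdef : log (4 / η) = ℓ at *
  rw [hℓ] at hm hm'
  have hexp : exp (-ℓ) = η / 4 := by
    rw [← hℓdef, exp_neg_log_div (by positivity), inv_div]
  have hm1 : 512 * ((d : ℝ) ^ 2 * ℓ) ≤ m := by nlinarith [mul_nonneg (sq_nonneg (d : ℝ)) h64]
  have hy4 : 4 ≤ (d : ℝ) ^ 2 * ℓ := by nlinarith
  have hm0 : (2048 : ℝ) ≤ m := by linarith
  have hB0 : (8192 : ℝ) ≤ B := by nlinarith
  -- rejection sampling returns zero for some candidate
  have t1 : (m : ENNReal) * ofReal (1 - 3 * ε / (16 * H * d)) ^ J ≤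
      ofReal (η / 3) := by
    have hq : 3 * ε / (16 * H * d) ≤ 1 := by
      rw [div_le_one (by positivity)]; nlinarith
    have hN : 1 ≤ (m + (m : ℝ) ^ 2 * B) / η := by
      rw [one_le_div hη]; nlinarith [mul_nonneg (sq_nonneg (m : ℝ)) (by linarith : (0 : ℝ) ≤ B)]
    have hlog : 0 ≤ log ((m + (m : ℝ) ^ 2 * B) / η) := Real.log_nonneg hN
    have hle : log ((m + (m : ℝ) ^ 2 * B) / η) ≤ J * (3 * ε / (16 * H * d)) := by
      have := mul_le_mul_of_nonneg_right hJ (by positivity : 0 ≤ 3 * ε / (16 * H * d))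
      refine le_trans ?_ this
      have e : 8 * H * d * log ((m + (m : ℝ) ^ 2 * B) / η) / ε * (3 * ε / (16 * H * d)) =
          3 / 2 * log ((m + (m : ℝ) ^ 2 * B) / η) := by field_simp; ring
      rw [e]; linarith
    refine (mul_le_mul_right (ofReal_pow_le_exp hq hle) _).trans ?_
    rw [← ENNReal.ofReal_natCast m, ← ENNReal.ofReal_mul (by positivity),
      exp_neg_log_div (by linarith), inv_div]
    refine ENNReal.ofReal_le_ofReal ?_
    have e : m * (η / (m + (m : ℝ) ^ 2 * B)) = η / (1 + m * B) := by
      have : (m : ℝ) ≠ 0 := by linarith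
      field_simp
    rw [e]
    exact div_le_div_of_nonneg_left hη.le (by norm_num) (by nlinarith)
  -- all candidates are bad
  have t2 : (4 * ((d : ENNReal) / (m + 1))) ^ m ≤ ofReal (η / 3) := by
    have e : 4 * ((d : ENNReal) / (m + 1)) = ofReal (4 * (d / (m + 1))) := by
      rw [ENNReal.ofReal_mul (by norm_num), ENNReal.ofReal_div_of_pos (by positivity),
        ENNReal.ofReal_natCast, ENNReal.ofReal_add (by positivity) (by norm_num),
        ENNReal.ofReal_natCast]
      norm_num
    rw [e, ← ENNReal.ofReal_pow (by positivity)]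
    refine ENNReal.ofReal_le_ofReal ?_
    have h8 : 8 * (d : ℝ) ≤ m + 1 := by
      have : (d : ℝ) ≤ d ^ 2 := by rw [sq]; exact le_mul_of_one_le_left (by positivity) hd'
      have : (d : ℝ) ^ 2 * 4 ≤ d ^ 2 * ℓ := mul_le_mul_of_nonneg_left hℓ4 (by positivity)
      linarith
    have hle : 4 * ((d : ℝ) / (m + 1)) ≤ 1 / 2 := by
      rw [← mul_div_assoc, div_le_iff₀ (by positivity)]; linarith
    calc (4 * ((d : ℝ) / (m + 1))) ^ m ≤ (1 / 2) ^ m := pow_le_pow_left₀ (by positivity) hle m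
      _ ≤ exp (-(1 / 2)) ^ m := by
          refine pow_le_pow_left₀ (by norm_num) ?_ m
          have := Real.add_one_le_exp (-(1 / 2) : ℝ); linarith
      _ = exp (m * (-(1 / 2))) := (Real.exp_nat_mul _ _).symm
      _ ≤ exp (-ℓ) := Real.exp_le_exp.2 (by nlinarith)
      _ ≤ η / 3 := by rw [hexp]; linarith
  -- some hit frequency is inaccurate
  have t3 := boosting_size hd' hm0 hm' h64' hB hℓ4 hexp
  calc _ ≤ ofReal (η / 3) + ofReal (η / 3) + ofReal (η / 3) :=
        add_le_add (add_le_add t1 t2) t3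
    _ = ofReal η := by
        rw [← ENNReal.ofReal_add (by positivity) (by positivity),
          ← ENNReal.ofReal_add (by positivity) (by positivity)]
        congr 1; ring

/-- The number of draws that suffices for `m` nonzero residuals. -/
theorem span_size {d H m J : ℕ} {ε : ℝ} (hd : 1 ≤ d) (hH : 1 ≤ H) (hε : 0 < ε) (hε1 : ε ≤ 1)
    (hJ : 16 * H * d * √(log (4 * d) * m) / ε
      + 32 * H * d * log (4 * d) / ε + 8 * H * d * m / ε ≤ J) :
    2 ^ m * ofReal (1 - 3 * ε / (32 * H * d)) ^ J ≤ ofReal (1 / 8) := by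
  have hd' : (1 : ℝ) ≤ d := by exact_mod_cast hd
  have hH' : (1 : ℝ) ≤ H := by exact_mod_cast hH
  have hl2' := Real.log_two_lt_d9
  have hq : 3 * ε / (32 * H * d) ≤ 1 := by
    rw [div_le_one (by positivity)]; nlinarith
  have hle : 3 * log (4 * d) + 3 / 4 * m ≤ J * (3 * ε / (32 * H * d)) := by
    have h0 : 0 ≤ 16 * H * d * √(log (4 * d) * m) / ε := by positivity
    have h1 : 32 * H * d * log (4 * d) / ε + 8 * H * d * m / ε ≤ J := by linarith
    have := mul_le_mul_of_nonneg_right h1 (by positivity : 0 ≤ 3 * ε / (32 * H * d))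
    refine le_trans (le_of_eq ?_) this
    field_simp; ring
  have e2 : (2 : ENNReal) ^ m = ofReal (exp (m * log 2)) := by
    rw [Real.exp_nat_mul, Real.exp_log (by norm_num), ENNReal.ofReal_pow (by norm_num)]; norm_num
  refine (mul_le_mul_right (ofReal_pow_le_exp hq hle) _).trans ?_
  rw [e2, ← ENNReal.ofReal_mul (Real.exp_pos _).le, ← Real.exp_add]
  refine ENNReal.ofReal_le_ofReal ?_
  have h4 : log (2 ^ 2) ≤ log (4 * d) := Real.log_le_log (by norm_num) (by linarith)
  rw [Real.log_pow] at h4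
  have hm0 : (0 : ℝ) ≤ m := by positivity
  have e8 : (1 / 8 : ℝ) = exp (-(3 * log 2)) := by
    have := Real.exp_nat_mul (-log 2) 3
    rw [Real.exp_neg, Real.exp_log (by norm_num)] at this
    push_cast at this
    rw [show -(3 * log 2) = 3 * -log 2 by ring, this]; norm_num
  rw [e8]
  refine Real.exp_le_exp.2 ?_
  push_cast at h4
  have := Real.log_pos (by norm_num : (1 : ℝ) < 2)
  nlinarith

section Sizes

variable {d H : ℕ} {c₁ ε δ : ℝ}

/-- The number of passes allowed in the second loop of the spanner computation. -/
def numIter (d : ℕ) (ε : ℝ) : ℕ := d + ⌈(d : ℝ) / 2 * logb 2 (100 * d / (4 * ε) ^ 2)⌉₊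

/-- The failure probability `δ'` of an elementary random event. -/
def conf (d H : ℕ) (ε δ : ℝ) : ℝ := δ / (8 * H * d ^ 2 * numIter d ε)

theorem two_le_numIter (hd : 1 ≤ d) (hε : 0 < ε) (hε1 : ε ≤ 1) : 2 ≤ numIter d ε := by
  have hd' : (1 : ℝ) ≤ d := by exact_mod_cast hd
  have : 0 < ⌈(d : ℝ) / 2 * logb 2 (100 * d / (4 * ε) ^ 2)⌉₊ := by
    refine Nat.ceil_pos.2 (mul_pos (by positivity) (Real.logb_pos (by norm_num) ?_))
    rw [lt_div_iff₀ (by positivity)]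
    nlinarith [mul_le_mul hε1 hε1 hε.le (by norm_num)]
  unfold numIter; omega

theorem conf_pos (hd : 1 ≤ d) (hH : 1 ≤ H) (hε : 0 < ε) (hε1 : ε ≤ 1) (hδ : 0 < δ) :
    0 < conf d H ε δ := by
  have := two_le_numIter hd hε hε1
  have : 0 < numIter d ε := by omega
  unfold conf; positivity

theorem conf_mul_le (hd : 1 ≤ d) (hH : 1 ≤ H) (hε : 0 < ε) (hε1 : ε ≤ 1) (hδ : 0 < δ) (hδ4 : δ ≤ 1 / 4) :
    64 * d * conf d H ε δ ≤ 1 := by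
  have h2 : (2 : ℝ) ≤ numIter d ε := by exact_mod_cast two_le_numIter hd hε hε1
  have hd' : (1 : ℝ) ≤ d := by exact_mod_cast hd
  have hH' : (1 : ℝ) ≤ H := by exact_mod_cast hH
  unfold conf
  rw [← mul_div_assoc, div_le_one (by positivity)]
  have h3 : 1 * (d : ℝ) ≤ H * d ^ 2 := by
    rw [sq]; nlinarith [mul_le_mul hH' hd' (by norm_num) (by linarith), mul_nonneg (by linarith : (0 : ℝ) ≤ d) (by linarith : (0:ℝ) ≤ d)]
  have h4 : 1 * (d : ℝ) * 2 ≤ H * d ^ 2 * numIter d ε :=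
    mul_le_mul h3 h2 (by norm_num) (by positivity)
  nlinarith

/-- The sample sizes, with the confidence parameter in the form of `conf`. -/
theorem sizes_spec (c₁ : ℝ) (d H : ℕ) (ε δ : ℝ) :
    let s := sizes c₁ d H ε δ
    s.nIter = numIter d ε ∧
    s.nSamp =
      ⌈512 * (d : ℝ) ^ 2 * log (256 * d / conf d H ε δ)⌉₊ ∧
    s.mBoost = ⌈2048 * (d : ℝ) ^ 2 * log (4 / conf d H ε δ)⌉₊ ∧
    s.nReject = ⌈8 * H * d * log ((s.nSamp +
      (s.nSamp : ℝ) ^ 2 * s.mBoost) / conf d H ε δ) / ε⌉₊ ∧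
    s.nTest =
      ⌈128 * (H : ℝ) ^ 2 * (d : ℝ) ^ 2 * log (4 / conf d H ε δ) / ε ^ 2⌉₊ ∧
    s.nVec =
      ⌈c₁ * (H : ℝ) ^ 4 * (d : ℝ) ^ 2 / ε ^ 2 * log (1 / conf d H ε δ)⌉₊ ∧
    s.nSpan = ⌈16 * H * d * √(log (4 * d) * s.nSamp) / ε
      + 32 * H * d * log (4 * d) / ε + 8 * H * d * s.nSamp / ε⌉₊ ∧
    s.nCover =
      ⌈logb 2 ((H : ℝ) ^ 2 * d / conf d H ε δ)⌉₊ * s.nSpan ∧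
    s.eps = ε :=
  ⟨rfl, rfl, rfl, rfl, rfl, rfl, rfl, rfl, rfl⟩

/-- Every elementary event fails with probability at most `conf d H ε δ`. -/
theorem suffice_sizes (hc : 256 ≤ c₁) (hd : 1 ≤ d) (hH : 1 ≤ H) (hε : 0 < ε) (hε1 : ε ≤ 1)
    (hδ : 0 < δ) (hδ4 : δ ≤ 1 / 4) :
    (sizes c₁ d H ε δ).Suffice d H (ofReal (conf d H ε δ)) := by
  have hd' : (1 : ℝ) ≤ d := by exact_mod_cast hd
  have hH' : (1 : ℝ) ≤ H := by exact_mod_cast hH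
  have hη := conf_pos hd hH hε hε1 hδ
  have hηd := conf_mul_le hd hH hε hε1 hδ hδ4
  have hη1 : conf d H ε δ ≤ 1 / 64 := by nlinarith
  obtain ⟨hN, hS, hB, hJ, hT, hV, hP, hC, hE⟩ := sizes_spec c₁ d H ε δ
  generalize sizes c₁ d H ε δ = s at *
  generalize conf d H ε δ = η at *
  have hl1 : 0 < log (1 / η) := Real.log_pos (by rw [lt_div_iff₀ hη]; linarith)
  have hl4 : 0 < log (4 / η) := Real.log_pos (by rw [lt_div_iff₀ hη]; linarith)
  have hl256 : 0 ≤ log (256 * d / η) := Real.log_nonneg (by rw [le_div_iff₀ hη]; linarith)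
  have hTle : 128 * (H : ℝ) ^ 2 * (d : ℝ) ^ 2 * log (4 / η) / ε ^ 2 ≤ s.nTest :=
    hT ▸ Nat.le_ceil _
  have hVle : c₁ * (H : ℝ) ^ 4 * (d : ℝ) ^ 2 / ε ^ 2 * log (1 / η) ≤ s.nVec :=
    hV ▸ Nat.le_ceil _
  refine ⟨hE ▸ hε, hT ▸ Nat.ceil_pos.2 (by positivity), hB ▸ Nat.ceil_pos.2 (by positivity),
    hV ▸ Nat.ceil_pos.2 (by positivity), ⟨_, hC.ge, ?_⟩, ?_, ?_, ?_, ?_⟩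
  · refine (mul_le_mul_right (mul_le_mul_right (ofReal_half_pow_ceil_le (by positivity)) _) _).trans ?_
    rw [← ENNReal.ofReal_natCast d, ← ENNReal.ofReal_natCast H,
      ← ENNReal.ofReal_mul (by positivity), ← ENNReal.ofReal_mul (by positivity)]
    refine ENNReal.ofReal_le_ofReal ?_
    have e : (H : ℝ) * (d * ((H : ℝ) ^ 2 * d / η)⁻¹) = η / H := by field_simp
    rw [e]
    exact div_le_self hη.le hH'
  · have e2 : (2 : ENNReal) = ofReal 2 := by norm_num
    rw [e2, ← ENNReal.ofReal_mul (by norm_num)]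
    refine ENNReal.ofReal_le_ofReal ?_
    have h1 : log (4 / η) ≤ 2 * s.nTest * (s.eps / (16 * H * d)) ^ 2 := by
      have := mul_le_mul_of_nonneg_right hTle (by positivity : 0 ≤ 2 * (ε / (16 * H * d)) ^ 2)
      rw [hE]
      calc log (4 / η) = 128 * (H : ℝ) ^ 2 * (d : ℝ) ^ 2 * log (4 / η) / ε ^ 2 *
            (2 * (ε / (16 * H * d)) ^ 2) := by field_simp; ring
        _ ≤ _ := this
        _ = _ := by ring
    calc 2 * exp (-(2 * s.nTest * (s.eps / (16 * H * d)) ^ 2))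
        ≤ 2 * exp (-log (4 / η)) := by gcongr
      _ = η / 2 := by rw [exp_neg_log_div (by positivity)]; field_simp; ring
      _ ≤ η := by linarith
  · rw [hE]
    refine outlier_sizes hd hH hε hε1 hη (by linarith) (hS ▸ Nat.le_ceil _)
      (hS ▸ (Nat.ceil_lt_add_one (by positivity)).le) (hB ▸ Nat.le_ceil _) (hJ ▸ Nat.le_ceil _)
  · rw [hE]
    exact span_size hd hH hε hε1 (hP ▸ Nat.le_ceil _)
  · have e2 : (2 : ENNReal) = ofReal 2 := by norm_num
    rw [e2, ← ENNReal.ofReal_mul (by norm_num), ← ENNReal.ofReal_natCast d,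
      ← ENNReal.ofReal_mul (by positivity)]
    refine ENNReal.ofReal_le_ofReal ?_
    have h1 : 2 * log (1 / η) ≤ 2 * s.nVec * (s.eps / (16 * d)) ^ 2 := by
      have := mul_le_mul_of_nonneg_right hVle (by positivity : 0 ≤ 2 * (ε / (16 * d)) ^ 2)
      rw [hE]
      have hH4 : 1 ≤ (H : ℝ) ^ 4 := one_le_pow₀ hH'
      have hcH : 256 ≤ c₁ * (H : ℝ) ^ 4 := by nlinarith
      calc 2 * log (1 / η) ≤ (c₁ * (H : ℝ) ^ 4) / 128 * log (1 / η) := by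
            gcongr; linarith
        _ = c₁ * (H : ℝ) ^ 4 * (d : ℝ) ^ 2 / ε ^ 2 * log (1 / η) *
            (2 * (ε / (16 * d)) ^ 2) := by field_simp; ring
        _ ≤ _ := this
        _ = _ := by ring
    have h2 : exp (-(2 * log (1 / η))) = η ^ 2 := by
      have := Real.exp_nat_mul (-log (1 / η)) 2
      rw [exp_neg_log_div (by positivity)] at this
      push_cast at this
      rw [show -(2 * log (1 / η)) = 2 * -log (1 / η) by ring, this]; field_simp
    calc d * (2 * exp (-(2 * s.nVec * (s.eps / (16 * d)) ^ 2)))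
        ≤ d * (2 * exp (-(2 * log (1 / η)))) := by gcongr
      _ = (2 * d * η) * η := by rw [h2]; ring
      _ ≤ 1 * η := by gcongr; linarith
      _ = η := one_mul _

/-- The determinant doubles in every pass; this number of passes takes it from its initial size
beyond what Hadamard's inequality allows. -/
theorem numIter_large (hd : 1 ≤ d) (hε : 0 < ε) (hε1 : ε ≤ 1) :
    (1 + 4 * ε) ^ d < (5 / 2 * ε) ^ d * 2 ^ numIter d ε := by
  have hd' : (1 : ℝ) ≤ d := by exact_mod_cast hd
  set y : ℝ := 100 * d / (4 * ε) ^ 2 with hy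
  have hy0 : 0 < y := by positivity
  have hN : (d : ℝ) + d / 2 * logb 2 y ≤ numIter d ε := by
    unfold numIter; push_cast
    have := Nat.le_ceil ((d : ℝ) / 2 * logb 2 y)
    linarith
  have h2 : (4 * y) ^ d ≤ ((2 : ℝ) ^ numIter d ε) ^ 2 := by
    have e1 : (4 * y) ^ d = (2 : ℝ) ^ ((2 * d : ℝ) + d * logb 2 y) := by
      rw [Real.rpow_add (by norm_num), mul_comm (d : ℝ) (logb 2 y), Real.rpow_mul (by norm_num),
        Real.rpow_mul (by norm_num), Real.rpow_logb (by norm_num) (by norm_num) hy0,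
        Real.rpow_natCast, Real.rpow_natCast, mul_pow]
      norm_num
    have e2 : ((2 : ℝ) ^ numIter d ε) ^ 2 = (2 : ℝ) ^ ((numIter d ε : ℝ) * 2) := by
      rw [Real.rpow_mul (by norm_num), Real.rpow_natCast]; norm_num
    rw [e1, e2]
    exact Real.rpow_le_rpow_of_exponent_le (by norm_num) (by linarith)
  refine lt_of_pow_lt_pow_left₀ 2 (by positivity) ?_
  calc ((1 + 4 * ε) ^ d) ^ 2 = ((1 + 4 * ε) ^ 2) ^ d := by rw [← pow_mul, ← pow_mul, mul_comm d 2]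
    _ < ((5 / 2 * ε) ^ 2 * (4 * y)) ^ d := by
        refine pow_lt_pow_left₀ ?_ (by positivity) (by omega)
        have : (5 / 2 * ε) ^ 2 * (4 * y) = 625 / 4 * d := by rw [hy]; field_simp; ring
        rw [this]; nlinarith
    _ = ((5 / 2 * ε) ^ d) ^ 2 * (4 * y) ^ d := by
        rw [mul_pow, ← pow_mul, ← pow_mul, mul_comm 2 d]
    _ ≤ ((5 / 2 * ε) ^ d) ^ 2 * ((2 : ℝ) ^ numIter d ε) ^ 2 := by gcongr
    _ = _ := by rw [← mul_pow]

/-- Union bound over all elementary events of the exploration phase. -/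
theorem exploration_failure_le (hd : 1 ≤ d) (hH : 1 ≤ H) (hε : 0 < ε) (hε1 : ε ≤ 1) (hδ : 0 < δ) :
    (H : ENNReal) * (((d + 1 : ℕ) : ENNReal) * (d * (4 * ofReal (conf d H ε δ)) +
        ofReal (conf d H ε δ)) +
      (numIter d ε + 1) * (d * (4 * ofReal (conf d H ε δ)))) ≤ ofReal (2 * δ) := by
  have hd' : (1 : ℝ) ≤ d := by exact_mod_cast hd
  have hH' : (1 : ℝ) ≤ H := by exact_mod_cast hH
  have h2 : (2 : ℝ) ≤ numIter d ε := by exact_mod_cast two_le_numIter hd hε hε1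
  have hη := conf_pos hd hH hε hε1 hδ
  have hηN : conf d H ε δ * (8 * H * d ^ 2 * numIter d ε) = δ := by
    unfold conf
    exact div_mul_cancel₀ _ (by positivity)
  generalize conf d H ε δ = η at *
  generalize numIter d ε = N at *
  have e : (H : ENNReal) * (((d + 1 : ℕ) : ENNReal) * (d * (4 * ofReal η) +
        ofReal η) + (N + 1) * (d * (4 * ofReal η))) =
      ofReal (H * (((d + 1 : ℕ) : ℝ) * (d * (4 * η) + η) + (N + 1) * (d * (4 * η)))) := by
    rw [ENNReal.ofReal_mul (by positivity), ENNReal.ofReal_add (by positivity) (by positivity),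
      ENNReal.ofReal_mul (by positivity), ENNReal.ofReal_add (by positivity) (by positivity),
      ENNReal.ofReal_mul (by positivity), ENNReal.ofReal_mul (by positivity),
      ENNReal.ofReal_mul (by positivity), ENNReal.ofReal_natCast, ENNReal.ofReal_natCast,
      ENNReal.ofReal_natCast, ENNReal.ofReal_add (by positivity) (by positivity),
      ENNReal.ofReal_natCast]
    norm_num
  rw [e]
  refine ENNReal.ofReal_le_ofReal ?_
  rw [← hηN]
  push_cast
  have hdd : (d : ℝ) ≤ d ^ 2 := by nlinarith
  have h1 : ((d : ℝ) + 1) * (4 * d + 1) + (N + 1) * (4 * d) ≤ 16 * d ^ 2 * N := by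
    have hN0 : (d : ℝ) * N ≤ d ^ 2 * N := mul_le_mul_of_nonneg_right hdd (by linarith)
    have hN1 : (d : ℝ) ^ 2 * 2 ≤ d ^ 2 * N := mul_le_mul_of_nonneg_left h2 (by positivity)
    nlinarith
  calc (H : ℝ) * ((d + 1) * (d * (4 * η) + η) + (N + 1) * (d * (4 * η)))
      = H * η * ((d + 1) * (4 * d + 1) + (N + 1) * (4 * d)) := by ring
    _ ≤ H * η * (16 * d ^ 2 * N) := by gcongr
    _ = _ := by ring

end Sizes

/-! ### Ridge regression on the spanner policies -/

theorem measurable_list_take {α : Type*} [MeasurableSpace α] (n : ℕ) :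
    Measurable fun l : List α => l.take n := by
  suffices h : Measurable fun p : List α × Unit => p.1.take n from
    h.comp (measurable_id.prodMk (measurable_const (a := ())))
  induction n with
  | zero => simp
  | succ n ih =>
    refine measurable_list_of_cons (by simp) fun m _ => ?_
    simp only [List.take_succ_cons]
    exact measurable_fst.list_cons (ih.comp (by fun_prop : Measurable
      fun p : α × (Fin m → α) × Unit => (List.ofFn p.2.1, p.2.2)))

/-- The `i`-th block of length `n` of a list. -/
def block {α : Type*} (n i : ℕ) (l : List α) : List α := (l.drop (i * n)).take n

theorem measurable_block {α : Type*} [MeasurableSpace α] (n i : ℕ) :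
    Measurable (block n i : List α → List α) :=
  (measurable_list_take n).comp (by fun_prop)

section Ridge

variable {d : ℕ}

theorem inner_ridgeDir_comm (ys : List (Vec d)) (b c : Vec d) :
    (inner ℝ (ridgeDir ys b) c : ℝ) = inner ℝ b (ridgeDir ys c) := by
  have hb := ridgeDir_spec ys b
  have hc := ridgeDir_spec ys c
  set r := ridgeDir ys b
  set s := ridgeDir ys c
  rw [← hc, real_inner_comm s b, ← hb, inner_add_right, inner_add_right, inner_list_sum,
    inner_list_sum, List.map_map, List.map_map, real_inner_comm]
  congr 2
  refine List.map_congr_left fun y _ => ?_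
  simp only [Function.comp, inner_smul_right]
  rw [real_inner_comm r y, real_inner_comm s y]; ring

theorem norm_ridgeDir_le (ys : List (Vec d)) (b : Vec d) : ‖ridgeDir ys b‖ ≤ ‖b‖ := by
  have h := ridgeDir_energy ys b
  have h0 : 0 ≤ (ys.map fun y => (inner ℝ (ridgeDir ys b) y : ℝ) ^ 2).sum :=
    List.sum_nonneg fun a ha => by obtain ⟨y, _, rfl⟩ := List.mem_map.1 ha; positivity
  have h1 := real_inner_le_norm (ridgeDir ys b) b
  by_contra hlt
  nlinarith [norm_nonneg (ridgeDir ys b), norm_nonneg b]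

theorem ridgeDir_energy_le (ys : List (Vec d)) {b : Vec d} (hb : ‖b‖ ≤ 1) :
    (ys.map fun y => (inner ℝ (ridgeDir ys b) y : ℝ) ^ 2).sum ≤ 1 := by
  have h := ridgeDir_energy ys b
  have h1 := real_inner_le_norm (ridgeDir ys b) b
  have h2 := norm_ridgeDir_le ys b
  nlinarith [norm_nonneg (ridgeDir ys b), norm_nonneg b, sq_nonneg ‖ridgeDir ys b‖]

theorem block_flatten {α : Type*} {n : ℕ} {L : List (List α)} (hL : ∀ l ∈ L, l.length = n) {i : ℕ}
    (hi : i < L.length) : block n i L.flatten = L[i] := by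
  unfold block
  induction L generalizing i with
  | nil => simp at hi
  | cons l L ih =>
    have hl := hL l (by simp)
    rw [List.flatten_cons]
    cases i with
    | zero => simp [← hl]
    | succ i =>
      have : (i + 1) * n = l.length + i * n := by rw [hl]; ring
      rw [this, List.drop_append, List.drop_eq_nil_of_le (Nat.le_add_right _ _),
        Nat.add_sub_cancel_left, List.nil_append, ih (fun l hl => hL l (by simp [hl])) (by simpa using hi)]
      rfl

theorem sq_sum_le_length_mul (l : List ℝ) : l.sum ^ 2 ≤ l.length * (l.map fun t => t ^ 2).sum := by
  have h := sq_sum_le_card_mul_sum_sq (s := Finset.univ) (f := fun i : Fin l.length => l[i])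
  rw [Finset.card_univ, Fintype.card_fin] at h
  have e1 : ∑ i : Fin l.length, l[i] = l.sum := by simp [Fin.sum_univ_getElem]
  have e2 : ∑ i : Fin l.length, l[i] ^ 2 = (l.map fun t => t ^ 2).sum := by
    rw [← Fin.sum_univ_fun_getElem l (fun t => t ^ 2)]; rfl
  rw [e1, e2] at h
  exact h

/-- Regression data that contain `n` samples with mean `b` determine the direction `b` up to
variance `1/n`. -/
theorem ridgeDir_block (ys : List (Vec d)) {n : ℕ} (hn : 0 < n) (i : ℕ) :
    ‖ridgeDir ys ((n : ℝ)⁻¹ • (block n i ys).sum)‖ ^ 2 +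
      (ys.map fun y => (inner ℝ (ridgeDir ys ((n : ℝ)⁻¹ • (block n i ys).sum)) y : ℝ) ^ 2).sum ≤
      (n : ℝ)⁻¹ := by
  set a := ridgeDir ys ((n : ℝ)⁻¹ • (block n i ys).sum) with ha
  have hE := ridgeDir_energy ys ((n : ℝ)⁻¹ • (block n i ys).sum)
  rw [← ha] at hE
  have hn' : (0 : ℝ) < n := by exact_mod_cast hn
  set S := (ys.map fun y => (inner ℝ a y : ℝ) ^ 2).sum with hS
  have hsub : (block n i ys).Sublist ys := (List.take_sublist _ _).trans (List.drop_sublist _ _)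
  have h1 : ((block n i ys).map fun y => (inner ℝ a y : ℝ) ^ 2).sum ≤ S :=
    (hsub.map _).sum_le_sum fun t ht => by
      obtain ⟨y, _, rfl⟩ := List.mem_map.1 ht; positivity
  have h2 := sq_sum_le_length_mul ((block n i ys).map fun y => (inner ℝ a y : ℝ))
  rw [List.map_map, List.length_map, ← inner_list_sum] at h2
  have h3 : ((block n i ys).length : ℝ) ≤ n := by
    exact_mod_cast List.length_take_le _ _
  have h4 : (inner ℝ a (block n i ys).sum : ℝ) ^ 2 ≤ n * S := by
    refine h2.trans (mul_le_mul h3 h1 ?_ hn'.le)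
    exact List.sum_nonneg fun t ht => by
      obtain ⟨y, _, rfl⟩ := List.mem_map.1 ht; exact sq_nonneg _
  rw [inner_smul_right] at hE
  rw [hE]
  set q := (inner ℝ a (block n i ys).sum : ℝ)
  have h5 : S ≤ (n : ℝ)⁻¹ * q := by nlinarith [sq_nonneg ‖a‖]
  -- `q ^ 2 ≤ n S` by Cauchy-Schwarz, and `S ≤ q / n` by the energy identity
  have h6 : q ^ 2 ≤ q := by
    calc q ^ 2 ≤ n * S := h4
      _ ≤ n * ((n : ℝ)⁻¹ * q) := by gcongr
      _ = q := by field_simp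
  have h7 : q ≤ 1 := by nlinarith
  calc (n : ℝ)⁻¹ * q ≤ (n : ℝ)⁻¹ * 1 := by gcongr
    _ = _ := mul_one _

/-- The noise of the data `D` relative to the parameter `ws`, as seen by ridge regression in
direction `b`. -/
def ridgeNoise (D : List (Vec d × ℝ)) (ws b : Vec d) : ℝ :=
  (D.map fun p => (inner ℝ (ridgeDir (D.map Prod.fst) b) p.1 : ℝ) * (p.2 - inner ℝ ws p.1)).sum

theorem measurable_ridgeNoise {J : Type*} [MeasurableSpace J] {D : J → List (Vec d × ℝ)}
    {b : J → Vec d} (hD : Measurable D) (hb : Measurable b) (ws : Vec d) :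
    Measurable fun j => ridgeNoise (D j) ws (b j) := by
  refine Measurable.list_sum (Measurable.list_map (f := fun j (p : Vec d × ℝ) =>
    (inner ℝ (ridgeDir ((D j).map Prod.fst) (b j)) p.1 : ℝ) * (p.2 - inner ℝ ws p.1)) ?_ hD)
  have h1 : Measurable fun q : J × Vec d × ℝ => ridgeDir ((D q.1).map Prod.fst) (b q.1) :=
    measurable_ridgeDir (by fun_prop) (by fun_prop)
  exact (h1.inner (by fun_prop)).mul (by fun_prop)

/-- The regularization bias has norm at most `‖ws‖`; the noise is controlled coordinatewise. -/
theorem norm_ridge_sub_le (D : List (Vec d × ℝ)) {ws : Vec d} (hws : ‖ws‖ ≤ √d) {T : ℝ} (hT : 0 ≤ T)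
    (h : ∀ j, |ridgeNoise D ws (EuclideanSpace.single j 1)| ≤ T) :
    ‖ridge 1 D - ws‖ ≤ √d * (1 + T) := by
  set a := ridgeDir (D.map Prod.fst) ws
  have h1 : ‖ridge 1 D - ws + a‖ ≤ √d * T := by
    refine norm_le_of_coord hT fun j => ?_
    have e : (ridge 1 D - ws + a) j = ridgeNoise D ws (EuclideanSpace.single j 1) := by
      have h2 := inner_ridge_sub D ws (EuclideanSpace.single j 1)
      rw [inner_ridgeDir_comm] at h2
      simp only [EuclideanSpace.inner_single_left, map_one, one_mul] at h2
      rw [PiLp.add_apply, h2]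
      exact sub_add_cancel _ _
    rw [e]; exact h j
  calc ‖ridge 1 D - ws‖ = ‖(ridge 1 D - ws + a) - a‖ := by rw [add_sub_cancel_right]
    _ ≤ ‖ridge 1 D - ws + a‖ + ‖a‖ := norm_sub_le _ _
    _ ≤ √d * T + √d := add_le_add h1 ((norm_ridgeDir_le _ _).trans hws)
    _ = _ := by ring

/-- In the direction of the mean of a block, the bias is of order `1 / √n` as well. -/
theorem abs_inner_block_ridge_sub_le (D : List (Vec d × ℝ)) {ws : Vec d} (hws : ‖ws‖ ≤ √d) {n : ℕ}
    (hn : 0 < n) (i : ℕ) {T : ℝ}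
    (h : |ridgeNoise D ws ((n : ℝ)⁻¹ • (block n i (D.map Prod.fst)).sum)| ≤ T) :
    |inner ℝ ((n : ℝ)⁻¹ • (block n i (D.map Prod.fst)).sum) (ridge 1 D - ws)| ≤
      T + √d / √n := by
  rw [inner_ridge_sub]
  set b := (n : ℝ)⁻¹ • (block n i (D.map Prod.fst)).sum
  have h1 := ridgeDir_block (D.map Prod.fst) hn i
  have h0 : 0 ≤ ((D.map Prod.fst).map fun y =>
      (inner ℝ (ridgeDir (D.map Prod.fst) b) y : ℝ) ^ 2).sum :=
    List.sum_nonneg fun a ha => by obtain ⟨y, _, rfl⟩ := List.mem_map.1 ha; positivity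
  have h2 : ‖ridgeDir (D.map Prod.fst) b‖ ≤ 1 / √n := by
    rw [one_div, ← Real.sqrt_inv]
    exact Real.le_sqrt_of_sq_le (by linarith)
  have h3 : |inner ℝ (ridgeDir (D.map Prod.fst) b) ws| ≤ √d / √n := by
    refine (abs_real_inner_le_norm _ _).trans ?_
    calc _ ≤ 1 / √n * √d := by gcongr
      _ = _ := by ring
  exact (abs_sub _ _).trans (add_le_add h h3)

end Ridge

namespace Setting

variable {X : Type u} {A : Type v} {Ξ : Type w} [MeasurableSpace X] [MeasurableSpace A]
  [MeasurableSpace Ξ] {d : ℕ} {E : Setting X A Ξ d}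

theorem measProg_drawReward {h : ℕ} (hh : h < E.H) (π : Param d) :
    E.MeasProg (drawReward π h : Prog X A d (Vec d × ℝ)) := (measFam_drawReward hh).prog π

/-- Rewards, centered at their means, are conditionally subgaussian given the features. -/
theorem condSubG_drawReward {h : ℕ} (hh : h < E.H) (π : Param d) :
    CondSubG ((E.dist (drawReward π h : Prog X A d (Vec d × ℝ))).map
      fun p => (p.1, p.2 - inner ℝ (E.rewardParam h) p.1)) := by
  have hm2 : Measurable fun q : X × Ξ =>
      E.M.reward h (E.M.state (greedy E.amax π) q.1 h)
        (greedy E.amax π h (E.M.state (greedy E.amax π) q.1 h)) q.2 := by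
    have h1 : Measurable fun q : X × Ξ => (π, q.1) := by fun_prop
    exact (E.meas.reward h hh).comp ((((E.measurable_state hh).comp h1).prodMk
      ((E.measurable_action hh).comp h1)).prodMk (measurable_snd : Measurable fun q : X × Ξ => q.2))
  have hm1 := E.measurable_feat hh π
  rw [dist_drawReward hh, Measure.map_map (by fun_prop) (by fun_prop)]
  refine condSubG_of_prod (Y := E.feat π h) (R := fun q : X × Ξ =>
      E.M.reward h (E.M.state (greedy E.amax π) q.1 h)
        (greedy E.amax π h (E.M.state (greedy E.amax π) q.1 h)) q.2)
    (m := fun x => inner ℝ (E.rewardParam h) (E.feat π h x)) hm1 hm2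
    (by fun_prop) (fun q => E.reward_mem h hh _ _ _)
    (fun x => by
      rw [real_inner_comm]
      exact E.meanReward_eq hh (E.M.state (greedy E.amax π) x h)
        (greedy E.amax π h (E.M.state (greedy E.amax π) x h)))

/-- The data of the ridge regression of layer `h`. -/
def rewardData (Γ : Fin d → Param d) (n h : ℕ) : Prog X A d (List (List (Vec d × ℝ))) :=
  forProg (fun i => repeatProg (drawReward (Γ i) h) n) (List.finRange d)

theorem measProg_rewardData {h : ℕ} (hh : h < E.H) (Γ : Fin d → Param d) (n : ℕ) :
    E.MeasProg (rewardData Γ n h : Prog X A d (List (List (Vec d × ℝ)))) :=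
  (measFam_rewardData hh n).prog Γ

/-- Tail bound for the noise with weights `g` that may depend on the whole list of features. -/
theorem rewardData_noise_tail {h : ℕ} (hh : h < E.H) (Γ : Fin d → Param d) (n : ℕ)
    {g : List (Vec d) × Vec d → ℝ} (hg : Measurable g) {b t : ℝ} (hb : 0 < b) (ht : 0 ≤ t)
    (hgb : ∀ ys : List (Vec d), (ys.map fun y => g (ys, y) ^ 2).sum ≤ b) :
    E.dist (rewardData Γ n h : Prog X A d (List (List (Vec d × ℝ)))) {D | t <
      (D.flatten.map fun p => g (D.flatten.map Prod.fst, p.1) *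
        (p.2 - inner ℝ (E.rewardParam h) p.1)).sum} ≤ ofReal (exp (-(2 * t ^ 2 / b))) := by
  have hmp : ∀ i, E.MeasProg (drawReward (Γ i) h : Prog X A d (Vec d × ℝ)) :=
    fun i => measProg_drawReward hh (Γ i)
  have hprob : ∀ i, IsProbabilityMeasure (E.dist (drawReward (Γ i) h : Prog X A d (Vec d × ℝ))) :=
    fun i => (hmp i).isProb
  set l := (List.finRange d).flatMap fun i => List.replicate n
    (E.dist (drawReward (Γ i) h : Prog X A d (Vec d × ℝ))) with hl
  have hlp : AllProb l := by
    intro ν hν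
    obtain ⟨i, _, hi⟩ := List.mem_flatMap.1 hν
    rw [(List.mem_replicate.1 hi).2]; exact hprob i
  have hdist : (E.dist (rewardData Γ n h : Prog X A d (List (List (Vec d × ℝ))))).map List.flatten =
      drawsL l := by
    unfold rewardData
    rw [dist_forProg _ fun i => (MeasFam.repeatProg (ι := Unit) (MeasProg.fam (hmp i)) n).prog ()]
    simp only [dist_repeatProg (hmp _)]
    exact drawsL_flatten hprob n _
  set ψ : Vec d × ℝ → Vec d × ℝ := fun p => (p.1, p.2 - inner ℝ (E.rewardParam h) p.1) with hψ
  have hψm : Measurable ψ := by fun_prop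
  have hlp' : AllProb (l.map fun ν => ν.map ψ) := by
    intro μ hμ
    obtain ⟨ν, hν, rfl⟩ := List.mem_map.1 hμ
    have := hlp ν hν
    exact Measure.isProbabilityMeasure_map hψm.aemeasurable
  have hsg : ∀ ν ∈ l.map fun ν => ν.map ψ, CondSubG ν := by
    intro μ hμ
    obtain ⟨ν, hν, rfl⟩ := List.mem_map.1 hμ
    obtain ⟨i, _, hi⟩ := List.mem_flatMap.1 hν
    rw [(List.mem_replicate.1 hi).2]
    exact condSubG_drawReward hh (Γ i)
  have htail := drawsL_tail hlp' hsg hg hb ht fun ys _ => hgb ys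
  have hBm : MeasurableSet {D : List (Vec d × ℝ) |
      t < (D.map fun p => g (D.map Prod.fst, p.1) * p.2).sum} :=
    measurableSet_lt measurable_const (Measurable.list_sum (Measurable.list_map
      (f := fun (D : List (Vec d × ℝ)) (p : Vec d × ℝ) => g (D.map Prod.fst, p.1) * p.2)
      (by fun_prop) measurable_id))
  rw [← drawsL_map hlp hψm, Measure.map_apply (by fun_prop) hBm, ← hdist,
    Measure.map_apply (by fun_prop) ((by fun_prop : Measurable (List.map ψ)) hBm)] at htail
  refine le_trans (measure_mono ?_) htail
  intro D hD
  have e1 : (D.flatten.map ψ).map Prod.fst = D.flatten.map Prod.fst := by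
    rw [List.map_map]; rfl
  change t < ((D.flatten.map ψ).map fun p => g ((D.flatten.map ψ).map Prod.fst, p.1) * p.2).sum
  rw [e1, List.map_map]
  exact hD

/-- Two-sided bound for the noise in finitely many directions, which may depend on the features. -/
theorem sat_ridgeNoise {h : ℕ} (hh : h < E.H) (Γ : Fin d → Param d) (n : ℕ)
    {u : Fin d → List (Vec d) → Vec d} (hu : ∀ j, Measurable (u j)) {b t lam : ℝ} (hb : 0 < b)
    (ht : 0 ≤ t) (hub : ∀ j (ys : List (Vec d)),
      (ys.map fun y => (inner ℝ (ridgeDir ys (u j ys)) y : ℝ) ^ 2).sum ≤ b)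
    (hlam : lam ≤ 2 * t ^ 2 / b) :
    E.Sat (rewardData Γ n h : Prog X A d (List (List (Vec d × ℝ))))
      (d * (2 * ofReal (exp (-lam)))) fun D => ∀ j,
        |ridgeNoise D.flatten (E.rewardParam h) (u j (D.flatten.map Prod.fst))| ≤ t := by
  refine Sat.of_dist_le ?_
  have hmeas : ∀ j, Measurable fun q : List (Vec d) × Vec d =>
      (inner ℝ (ridgeDir q.1 (u j q.1)) q.2 : ℝ) := fun j =>
    (measurable_ridgeDir measurable_fst ((hu j).comp measurable_fst)).inner measurable_snd
  have h1 : ∀ j, E.dist (rewardData Γ n h : Prog X A d (List (List (Vec d × ℝ))))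
      {D | t < |ridgeNoise D.flatten (E.rewardParam h) (u j (D.flatten.map Prod.fst))|} ≤
      2 * ofReal (exp (-lam)) := by
    intro j
    have hp := rewardData_noise_tail hh Γ n (hmeas j) hb ht (hub j)
    have hn := rewardData_noise_tail hh Γ n (hmeas j).neg hb ht
      (by simpa only [Pi.neg_apply, neg_sq] using hub j)
    have hle : ofReal (exp (-(2 * t ^ 2 / b))) ≤ ofReal (exp (-lam)) :=
      ENNReal.ofReal_le_ofReal (Real.exp_le_exp.2 (by linarith))
    rw [two_mul]
    refine le_trans ?_ (add_le_add (hp.trans hle) (hn.trans hle))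
    refine le_trans (measure_mono ?_) (measure_union_le _ _)
    intro D hD
    rcases lt_abs.1 (show t < |_| from hD) with hD | hD
    · exact Or.inl hD
    · refine Or.inr ?_
      have e : -ridgeNoise D.flatten (E.rewardParam h) (u j (D.flatten.map Prod.fst)) =
          (D.flatten.map fun p => -(inner ℝ (ridgeDir (D.flatten.map Prod.fst)
            (u j (D.flatten.map Prod.fst))) p.1 : ℝ) *
              (p.2 - inner ℝ (E.rewardParam h) p.1)).sum := by
        unfold ridgeNoise
        rw [← neg_one_mul, ← List.sum_map_mul_left]
        simp only [neg_mul, one_mul]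
      rw [e] at hD
      exact hD
  have h2 : {D : List (List (Vec d × ℝ)) | ¬ ∀ j,
      |ridgeNoise D.flatten (E.rewardParam h) (u j (D.flatten.map Prod.fst))| ≤ t} =
      ⋃ j, {D | t < |ridgeNoise D.flatten (E.rewardParam h) (u j (D.flatten.map Prod.fst))|} := by
    ext D; simp
  rw [h2]
  refine (measure_iUnion_fintype_le _ _).trans ((Finset.sum_le_sum fun j _ => h1 j).trans ?_)
  simp

/-- The empirical mean features are close to the expected ones. -/
theorem sat_rewardData_mean {h : ℕ} (hh : h < E.H) (Γ : Fin d → Param d) {n : ℕ} (hn : 0 < n)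
    {t : ℝ} (ht : 0 ≤ t) :
    E.Sat (rewardData Γ n h : Prog X A d (List (List (Vec d × ℝ))))
      (d * (d * (2 * ofReal (exp (-(2 * n * t ^ 2)))))) fun D => ∀ i : Fin d,
        ‖(n : ℝ)⁻¹ • (block n i (D.flatten.map Prod.fst)).sum - E.meanFeat h (Γ i)‖ ≤
          √d * (2 * t) := by
  have h1 : ∀ i ∈ List.finRange d, E.Sat (repeatProg (drawReward (Γ i) h) n :
      Prog X A d (List (Vec d × ℝ))) (d * (2 * ofReal (exp (-(2 * n * t ^ 2)))))
      fun D => D.length = n ∧ ‖(n : ℝ)⁻¹ • (D.map Prod.fst).sum - E.meanFeat h (Γ i)‖ ≤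
        √d * (2 * t) := by
    intro i _
    have hm := measProg_drawReward (E := E) hh (Γ i)
    have := hm.isProb
    have hS : MeasurableSet {D : List (Vec d × ℝ) |
        ‖(n : ℝ)⁻¹ • (D.map Prod.fst).sum - E.meanFeat h (Γ i)‖ ≤ √d * (2 * t)} :=
      measurableSet_le (by fun_prop) measurable_const
    have h2 := Sat.repeatProg hm (b := 0) (P := fun _ => True)
      (Sat.of_forall hm fun _ => trivial) n
    have h3 : E.Sat (repeatProg (drawReward (Γ i) h) n : Prog X A d (List (Vec d × ℝ)))
        (d * (2 * ofReal (exp (-(2 * n * t ^ 2))))) fun D =>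
        ‖(n : ℝ)⁻¹ • (D.map Prod.fst).sum - E.meanFeat h (Γ i)‖ ≤ √d * (2 * t) := by
      refine Sat.of_dist_le ?_
      have h4 := draws_mean_le (μ := E.M.start) (E.measurable_feat hh (Γ i))
        (E.norm_feat_le hh (Γ i)) hn ht
      have h5 : (E.dist (drawReward (Γ i) h : Prog X A d (Vec d × ℝ))).map Prod.fst =
          E.M.start.map (E.feat (Γ i) h) := by
        rw [← law_map_start, Measure.map_map (E.measurable_feat hh (Γ i)) (by fun_prop)]
        exact Measure.map_map measurable_fst (Measurable.fst hm)
      rw [← h5, ← draws_map measurable_fst, Measure.map_apply (by fun_prop)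
        (measurableSet_lt measurable_const (by fun_prop))] at h4
      rw [dist_repeatProg hm]
      simp only [not_le]
      exact h4
    exact (h2.and h3 hS).mono (by simp) fun D hD => ⟨hD.1.1, hD.2⟩
  refine (Sat.forProg (fun i _ => (MeasFam.repeatProg (ι := Unit) (MeasProg.fam
    (measProg_drawReward hh (Γ i))) n).prog ()) h1).mono (by simp) fun D hD => ?_
  rw [List.forall₂_iff_get] at hD
  obtain ⟨hlen, hD⟩ := hD
  have hlen' : D.length = d := by simpa using hlen.symm
  have hall : ∀ l ∈ D, l.length = n := by
    intro l hl
    obtain ⟨k, hk, rfl⟩ := List.mem_iff_getElem.1 hl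
    exact (hD k (by omega) hk).1
  intro i
  have hi : (i : ℕ) < D.length := by omega
  have hb : block n i (D.flatten.map Prod.fst) = D[(i : ℕ)].map Prod.fst := by
    rw [← block_flatten hall hi]
    unfold block
    rw [List.map_take, List.map_drop]
  have h2 := (hD i (by simp) hi).2
  rw [hb]
  simpa using h2

end Setting

/-! ### Policy optimization -/

/-- Accuracy along a spanner extends to the mean features of all policies. -/
theorem IsSpanner.abs_inner_le {d : ℕ} {m : Param d → Vec d} {ε κ : ℝ} {Γ : Fin d → Param d}
    (h : IsSpanner m ε Γ) {Δ : Vec d} (hκ : ∀ i, |inner ℝ (m (Γ i)) Δ| ≤ κ) (π : Param d) :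
    |inner ℝ (m π) Δ| ≤ 2 * d * (κ + 5 * ε * ‖Δ‖) := by
  obtain ⟨w, hw, hm⟩ := h
  obtain ⟨c, hc, hπ⟩ := hm π
  have h1 : ∀ i, |inner ℝ (c i • w i) Δ| ≤ 2 * (κ + 5 * ε * ‖Δ‖) := by
    intro i
    have h2 : |inner ℝ (w i) Δ| ≤ κ + 5 * ε * ‖Δ‖ := by
      have e : (inner ℝ (w i) Δ : ℝ) = inner ℝ (m (Γ i)) Δ + inner ℝ (w i - m (Γ i)) Δ := by
        rw [← inner_add_left, add_sub_cancel]
      rw [e]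
      refine (abs_add_le _ _).trans (add_le_add (hκ i) ((abs_real_inner_le_norm _ _).trans ?_))
      exact mul_le_mul_of_nonneg_right (hw i) (norm_nonneg _)
    rw [real_inner_smul_left, abs_mul]
    exact mul_le_mul (hc i) h2 (abs_nonneg _) (by norm_num)
  rw [hπ, sum_inner]
  refine (Finset.abs_sum_le_sum_abs _ _).trans ((Finset.sum_le_sum fun i _ => h1 i).trans ?_)
  simp only [Finset.sum_const, Finset.card_univ, Fintype.card_fin, nsmul_eq_mul]
  exact le_of_eq (by ring)

namespace Setting

variable {X : Type u} {A : Type v} {Ξ : Type w} [MeasurableSpace X] [MeasurableSpace A]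
  [MeasurableSpace Ξ] {d : ℕ} {E : Setting X A Ξ d}

variable (E) in
/-- The estimated reward parameter `y` of layer `h` is accurate along the mean features of the
policies `Γ i`, and its overall error is bounded. -/
structure RewardEstimate (Γ : Fin d → Param d) (n : ℕ) (lam : ℝ) (h : ℕ) (y : Vec d) : Prop where
  norm_sub_le : ‖y - E.rewardParam h‖ ≤ 2 * √d * √lam
  inner_le : ∀ i, |inner ℝ (E.meanFeat h (Γ i)) (y - E.rewardParam h)| ≤ 6 * d * lam / √n

/-- Ridge regression on the data of the spanner policies yields an accurate reward estimate. -/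
theorem sat_ridgeProg {h : ℕ} (hh : h < E.H) (Γ : ℕ → Fin d → Param d) {n : ℕ} (hn : 0 < n)
    {lam : ℝ} (hlam : 1 ≤ lam) :
    E.Sat (ridgeProg Γ n h : Prog X A d (Vec d))
      (d * (2 * ofReal (exp (-lam))) + d * (2 * ofReal (exp (-lam))) +
        d * (d * (2 * ofReal (exp (-lam)))))
      (E.RewardEstimate (Γ h) n lam h) := by
  have hn' : (0 : ℝ) < n := by exact_mod_cast hn
  have hd' : (1 : ℝ) ≤ d := by exact_mod_cast E.d_pos
  have hs1 : 1 ≤ √lam := Real.one_le_sqrt.2 hlam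
  have hss : √lam ^ 2 = lam := Real.sq_sqrt (by linarith)
  have hns : √(n : ℝ) ^ 2 = n := Real.sq_sqrt hn'.le
  have hn0 : 0 < √(n : ℝ) := Real.sqrt_pos.2 hn'
  have hdd : √(d : ℝ) ^ 2 = d := Real.sq_sqrt (by linarith)
  have hd1 : 1 ≤ √(d : ℝ) := Real.one_le_sqrt.2 hd'
  -- noise in the coordinate directions, for the norm of the error
  have h1 := sat_ridgeNoise hh (Γ h) n (u := fun j _ => EuclideanSpace.single j (1 : ℝ))
    (fun j => measurable_const) (b := 1) (t := √lam) (lam := lam) one_pos (by positivity)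
    (fun j ys => ridgeDir_energy_le ys (by simp)) (by rw [hss]; linarith)
  -- noise in the directions of the empirical mean features
  have h2 := sat_ridgeNoise hh (Γ h) n (u := fun j ys => (n : ℝ)⁻¹ • (block n j ys).sum)
    (fun j => by have := measurable_block (α := Vec d) n j; fun_prop) (b := (n : ℝ)⁻¹) (t := √lam / √n) (lam := lam)
    (by positivity) (by positivity)
    (fun j ys => by
      have := ridgeDir_block ys hn j
      linarith [sq_nonneg ‖ridgeDir ys ((n : ℝ)⁻¹ • (block n j ys).sum)‖])
    (by rw [div_pow, hss, hns]; field_simp; linarith)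
  -- empirical and true mean features
  have h3 := sat_rewardData_mean hh (Γ h) hn (t := √lam / √n) (by positivity)
  have hS2 : MeasurableSet {D : List (List (Vec d × ℝ)) | ∀ j : Fin d,
      |ridgeNoise D.flatten (E.rewardParam h)
        ((n : ℝ)⁻¹ • (block n j (D.flatten.map Prod.fst)).sum)| ≤ √lam / √n} := by
    rw [Set.ofPred_forall]
    refine MeasurableSet.iInter fun j => measurableSet_le ?_ measurable_const
    have := measurable_block (α := Vec d) n j
    exact (measurable_ridgeNoise (by fun_prop) (by fun_prop) _).abs
  have hS3 : MeasurableSet {D : List (List (Vec d × ℝ)) | ∀ i : Fin d,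
        ‖(n : ℝ)⁻¹ • (block n i (D.flatten.map Prod.fst)).sum - E.meanFeat h (Γ h i)‖ ≤
          √d * (2 * (√lam / √n))} := by
    rw [Set.ofPred_forall]
    refine MeasurableSet.iInter fun i => measurableSet_le ?_ measurable_const
    have := measurable_block (α := Vec d) n i
    fun_prop
  have key : E.Sat (ridgeProg Γ n h : Prog X A d (Vec d))
      (d * (2 * ofReal (exp (-lam))) + d * (2 * ofReal (exp (-lam))) +
        d * (d * (2 * ofReal (exp (-(2 * n * (√lam / √n) ^ 2))))) + 0)
      (E.RewardEstimate (Γ h) n lam h) := by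
    refine Sat.bind (measProg_rewardData hh (Γ h) n)
      (MeasFam.compute (measurable_ridge (by fun_prop))) (Sat.and (Sat.and h1 h2 hS2) h3 hS3) ?_
    rintro D ⟨⟨hD1, hD2⟩, hD3⟩
    have hΔ := norm_ridge_sub_le D.flatten (E.norm_rewardParam h) (by positivity) hD1
    refine Sat.compute ⟨hΔ.trans ?_, fun i => ?_⟩
    · nlinarith
    · set Δ := ridge 1 D.flatten - E.rewardParam h
      have h4 := abs_inner_block_ridge_sub_le D.flatten (E.norm_rewardParam h) hn i (hD2 i)
      set b := (n : ℝ)⁻¹ • (block n i (D.flatten.map Prod.fst)).sum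
      have h5 : |inner ℝ (E.meanFeat h (Γ h i) - b) Δ| ≤
          √d * (2 * (√lam / √n)) * (√d * (1 + √lam)) := by
        refine (abs_real_inner_le_norm _ _).trans (mul_le_mul ?_ hΔ (norm_nonneg _) (by positivity))
        rw [norm_sub_rev]; exact hD3 i
      have e : (inner ℝ (E.meanFeat h (Γ h i)) Δ : ℝ) =
          inner ℝ b Δ + inner ℝ (E.meanFeat h (Γ h i) - b) Δ := by
        rw [← inner_add_left, add_sub_cancel]
      rw [e]
      refine (abs_add_le _ _).trans ((add_le_add h4 h5).trans ?_)
      have e2 : √lam / √n + √d / √n + √d * (2 * (√lam / √n)) * (√d * (1 + √lam)) =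
          (√lam + √d + 2 * d * √lam + 2 * d * lam) / √n := by
        rw [← hdd, ← hss]
        simp only [Real.sqrt_sq (Real.sqrt_nonneg _)]
        field_simp; ring
      rw [e2]
      refine div_le_div_of_nonneg_right ?_ hn0.le
      have h6 : √lam ≤ lam := by nlinarith
      have h7 : √(d : ℝ) ≤ d := by nlinarith
      nlinarith [mul_le_mul h7 hlam (by norm_num) (by linarith),
        mul_le_mul_of_nonneg_left h6 (by linarith : (0 : ℝ) ≤ d)]
  refine key.mono ?_ fun _ h => h
  rw [add_zero]
  gcongr
  rw [div_pow, hss, hns]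
  have : 2 * n * (lam / n) = 2 * lam := by field_simp
  linarith

variable (E) in
/-- The greedy policy with parameters `θ` is `ε`-optimal on average over the initial state. -/
def NearOptimal (ε : ℝ) (θ : Param d) : Prop :=
  Integrable (fun x => E.M.optValue E.H x - E.M.value E.H (greedy E.amax θ) x) E.M.start ∧
    ∫ x, (E.M.optValue E.H x - E.M.value E.H (greedy E.amax θ) x) ∂E.M.start ≤ ε

/-- Near-optimality in terms of the mean features, which shows that it is a measurable
condition. -/
theorem nearOptimal_iff {ε : ℝ} {θs : Param d}
    (hθs : ∀ x, E.M.optValue E.H x = E.M.value E.H (greedy E.amax θs) x) (θ : Param d) :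
    E.NearOptimal ε θ ↔ ∑ h ∈ Finset.range E.H, (inner ℝ (E.meanFeat h θs) (E.rewardParam h) -
      inner ℝ (E.meanFeat h θ) (E.rewardParam h) : ℝ) ≤ ε := by
  have hint : ∀ h ∈ Finset.range E.H, ∀ (π : Param d),
      Integrable (fun x => (inner ℝ (E.feat π h x) (E.rewardParam h) : ℝ)) E.M.start :=
    fun h hh π => integrable_inner_feat (Finset.mem_range.1 hh) π _
  have hsub := fun h hh => (hint h hh θs).sub (hint h hh θ)
  have e : (fun x => E.M.optValue E.H x - E.M.value E.H (greedy E.amax θ) x) = fun x =>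
      ∑ h ∈ Finset.range E.H, (inner ℝ (E.feat θs h x) (E.rewardParam h) -
        inner ℝ (E.feat θ h x) (E.rewardParam h) : ℝ) := by
    funext x
    rw [hθs x, value_eq, value_eq, ← Finset.sum_sub_distrib]
    rfl
  unfold NearOptimal
  have hi := integrable_finsetSum _ hsub
  simp only [Pi.sub_apply] at hi
  rw [e, and_iff_right hi]
  have e2 : ∫ x, ∑ h ∈ Finset.range E.H, (inner ℝ (E.feat θs h x) (E.rewardParam h) -
        inner ℝ (E.feat θ h x) (E.rewardParam h) : ℝ) ∂E.M.start =
      ∑ h ∈ Finset.range E.H, (inner ℝ (E.meanFeat h θs) (E.rewardParam h) -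
        inner ℝ (E.meanFeat h θ) (E.rewardParam h) : ℝ) := by
    refine (integral_finsetSum _ hsub).trans (Finset.sum_congr rfl fun h hh => ?_)
    rw [inner_meanFeat (Finset.mem_range.1 hh), inner_meanFeat (Finset.mem_range.1 hh)]
    exact integral_sub (hint h hh θs) (hint h hh θ)
  rw [e2]

/-- The value of the policy computed from the estimated rewards: exact optimization on the safe
initial states, and accuracy of the estimates along all mean features. -/
theorem suboptimality_le {s : Sizes} (hs : 0 < s.eps) {R : Exploration d}
    (hR : E.ExplorationPost s E.H R) {n : ℕ} {lam : ℝ} (hlam : 1 ≤ lam) {ws θ : Param d}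
    (hws : ∀ h < E.H, E.RewardEstimate (R.Γ h) n lam h (ws h))
    (hθ : E.IsBackup (fun l => lspan (R.S l)) (E.H - 1) ws θ) :
    E.NearOptimal (E.H * (6 * √d * √lam) * (5 / 8 * s.eps) +
      E.H * (4 * d * (6 * d * lam / √n + 5 * s.eps * (2 * √d * √lam)))) θ := by
  obtain ⟨θs, hθs⟩ := E.exists_optimal
  rw [nearOptimal_iff hθs]
  have hd' : (1 : ℝ) ≤ d := by exact_mod_cast E.d_pos
  have hs1 : 1 ≤ √lam := Real.one_le_sqrt.2 hlam
  have hH : E.H - 1 + 1 = E.H := by have := E.H_pos; omega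
  -- loss of the policy with respect to the estimated rewards
  set g : X → ℝ := fun x => ∑ h ∈ Finset.range E.H,
    (inner ℝ (E.feat θs h x) (ws h) - inner ℝ (E.feat θ h x) (ws h)) with hg
  have hint : ∀ h ∈ Finset.range E.H, ∀ π : Param d,
      Integrable (fun x => (inner ℝ (E.feat π h x) (ws h) : ℝ)) E.M.start := fun h hh π =>
    integrable_inner_feat (Finset.mem_range.1 hh) π _
  have hgi : Integrable g E.M.start :=
    integrable_finsetSum _ fun h hh => (hint h hh _).sub (hint h hh _)
  have hgm : ∫ x, g x ∂E.M.start = ∑ h ∈ Finset.range E.H,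
      (inner ℝ (E.meanFeat h θs) (ws h) - inner ℝ (E.meanFeat h θ) (ws h) : ℝ) := by
    refine (integral_finsetSum _ fun h hh => (hint h hh θs).sub (hint h hh θ)).trans
      (Finset.sum_congr rfl fun h hh => ?_)
    rw [inner_meanFeat (Finset.mem_range.1 hh), inner_meanFeat (Finset.mem_range.1 hh)]
    exact integral_sub (hint h hh _) (hint h hh _)
  -- the remaining terms are the errors of the estimated rewards, along both policies
  have hsplit : ∑ h ∈ Finset.range E.H, (inner ℝ (E.meanFeat h θs) (E.rewardParam h) -
        inner ℝ (E.meanFeat h θ) (E.rewardParam h) : ℝ) = ∫ x, g x ∂E.M.start +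
      ∑ h ∈ Finset.range E.H, (inner ℝ (E.meanFeat h θ) (ws h - E.rewardParam h) -
        inner ℝ (E.meanFeat h θs) (ws h - E.rewardParam h) : ℝ) := by
    rw [hgm, ← Finset.sum_add_distrib]
    refine Finset.sum_congr rfl fun h _ => ?_
    rw [inner_sub_right, inner_sub_right]; ring
  rw [hsplit]
  have hnorm : ∀ h < E.H, ‖ws h‖ ≤ 3 * √d * √lam := by
    intro h hh
    have h1 := (hws h hh).norm_sub_le
    have h2 := E.norm_rewardParam h
    have h3 := norm_add_le (ws h - E.rewardParam h) (E.rewardParam h)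
    rw [sub_add_cancel] at h3
    nlinarith [Real.sqrt_nonneg (d : ℝ)]
  refine add_le_add ?_ ?_
  · refine integral_le_of_safe (h := E.H) le_rfl (S := fun l => lspan (R.S l))
      (fun l hl => ⟨R.S l, hR.onList l hl, rfl⟩) (by linarith) (hR.escape_le.trans ?_) hgi
      (by positivity) (fun x => ?_) fun x hx => ?_
    · exact escape_bound le_rfl hs.le
    · have : ∀ h ∈ Finset.range E.H, (inner ℝ (E.feat θs h x) (ws h) : ℝ) -
          inner ℝ (E.feat θ h x) (ws h) ≤ 6 * √d * √lam := by
        intro h hh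
        have hh := Finset.mem_range.1 hh
        have hb : ∀ π : Param d, |inner ℝ (E.feat π h x) (ws h)| ≤ ‖ws h‖ := fun π =>
          (abs_real_inner_le_norm _ _).trans (mul_le_of_le_one_left (norm_nonneg _)
            (E.norm_feat_le hh π x))
        have h1 := abs_le.1 (hb θs)
        have h2 := abs_le.1 (hb θ)
        linarith [hnorm h hh, h1.2, h2.1]
      exact (Finset.sum_le_sum this).trans (by simp)
    · have h1 := hθ.optimal (by omega) (π := greedy E.amax θs) (x := x)
        (fun l hl => hx l (by omega) θs) (fun l hl => hx l (by omega) θ)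
      rw [hH] at h1
      rw [hg]; simp only [Finset.sum_sub_distrib]
      exact sub_nonpos.2 h1
  · have : ∀ h ∈ Finset.range E.H, inner ℝ (E.meanFeat h θ) (ws h - E.rewardParam h) -
        inner ℝ (E.meanFeat h θs) (ws h - E.rewardParam h) ≤
        4 * d * (6 * d * lam / √n + 5 * s.eps * (2 * √d * √lam)) := by
      intro h hh
      have hh := Finset.mem_range.1 hh
      have hb := fun π => (hR.spanner h hh).abs_inner_le (hws h hh).inner_le π
      have h1 := abs_le.1 (hb θ)
      have h2 := abs_le.1 (hb θs)
      have h3 : 2 * (d : ℝ) * (6 * d * lam / √n + 5 * s.eps * ‖ws h - E.rewardParam h‖) ≤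
          2 * d * (6 * d * lam / √n + 5 * s.eps * (2 * √d * √lam)) := by
        gcongr
        exact (hws h hh).norm_sub_le
      linarith [h1.2, h2.1]
    exact (Finset.sum_le_sum this).trans (by simp)

/-- The optimization phase, given a successful exploration phase. -/
theorem sat_policyOpt {s : Sizes} {b : ENNReal} (hs : s.Suffice d E.H b) {R : Exploration d}
    (hR : E.ExplorationPost s E.H R) {n : ℕ} (hn : 0 < n) (hn' : s.nCover ≤ n) {lam : ℝ}
    (hlam : 1 ≤ lam) :
    E.Sat (policyOpt E.H R.Ψ R.Γ n 1 : Prog X A d (Param d))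
      (E.H * (d * (2 * ofReal (exp (-lam))) +
        d * (2 * ofReal (exp (-lam))) +
          d * (d * (2 * ofReal (exp (-lam))))) + b) fun θ =>
      E.NearOptimal (E.H * (6 * √d * √lam) * (5 / 8 * s.eps) +
        E.H * (4 * d * (6 * d * lam / √n + 5 * s.eps * (2 * √d * √lam)))) θ := by
  have hH := E.H_pos
  rw [policyOpt_eq]
  refine Sat.bind ((measFam_ridgeProgs n (List.range E.H) (by simp)).prog R.Γ) ?_
    (Sat.mono (Sat.forProg (P := fun h y => E.RewardEstimate (R.Γ h) n lam h y)
      (fun h hh => (measFam_ridgeProg (List.mem_range.1 hh) n).prog R.Γ)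
      fun h hh => sat_ridgeProg (List.mem_range.1 hh) R.Γ hn hlam) (by simp) fun _ h => h) ?_
  · exact (measFam_fqi (n := n) (by omega)).comp (g := fun q : List (Vec d) =>
      (fun h => q.getD h 0, R.Ψ)) (by fun_prop)
  · intro ws hws
    rw [List.forall₂_iff_get] at hws
    obtain ⟨hlen, hws⟩ := hws
    have hlen' : ws.length = E.H := by simpa using hlen.symm
    have hws' : ∀ h < E.H, E.RewardEstimate (R.Γ h) n lam h (ws.getD h 0) := by
      intro h hh
      have := hws h (by simpa using hh) (by omega)
      rw [List.getD_eq_getElem _ _ (by omega)]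
      simpa using this
    have hc : E.LayerCover s.nSpan (E.H - 1) (fun l => lspan (R.S l)) R.Ψ :=
      fun l hl => hR.cover l (by omega)
    refine (hc.sat_fqi' hs (by omega) hn' _).mono le_rfl fun θ hθ => ?_
    exact suboptimality_le hs.eps_pos hR hlam hws' hθ

end Setting

/-! ### The output of the whole procedure -/

section Final

variable {d H : ℕ} {ε δ : ℝ}

theorem one_le_logFactor (d H : ℕ) (ε δ : ℝ) : 1 ≤ logFactor d H ε δ := le_max_left _ _

/-- The logarithm of the union bound of the policy optimization phase. -/
def logUnion (d H : ℕ) (δ : ℝ) : ℝ := log (24 * d ^ 2 * H / δ)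

theorem one_le_logUnion (hd : 1 ≤ d) (hH : 1 ≤ H) (hδ : 0 < δ) (hδ1 : δ < 1) :
    1 ≤ logUnion d H δ := by
  have hd' : (1 : ℝ) ≤ d := by exact_mod_cast hd
  have hH' : (1 : ℝ) ≤ H := by exact_mod_cast hH
  rw [logUnion, Real.le_log_iff_exp_le (by positivity), le_div_iff₀ hδ]
  have h1 := Real.exp_one_lt_d9
  have h2 : 1 ≤ (d : ℝ) ^ 2 * H := by nlinarith [one_le_pow₀ hd' (n := 2)]
  nlinarith [Real.exp_pos 1]

theorem logUnion_le (hd : 1 ≤ d) (hH : 1 ≤ H) (hε : 0 < ε) (hε1 : ε < 1) (hδ : 0 < δ) (hδ1 : δ < 1) :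
    logUnion d H δ ≤ 6 * logFactor d H ε δ := by
  have hd' : (1 : ℝ) ≤ d := by exact_mod_cast hd
  have hH' : (1 : ℝ) ≤ H := by exact_mod_cast hH
  have hL := one_le_logFactor d H ε δ
  have hL2 : log (d * H / (δ * ε)) ≤ logFactor d H ε δ := le_max_right _ _
  have h1 : 24 * (d : ℝ) ^ 2 * H / δ ≤ 2 ^ 5 * (d * H / (δ * ε)) ^ 2 := by
    have e : 2 ^ 5 * ((d : ℝ) * H / (δ * ε)) ^ 2 = 32 * d ^ 2 * H / δ * (H / (δ * ε ^ 2)) := by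
      field_simp; norm_num
    rw [e]
    have h2 : 1 ≤ H / (δ * ε ^ 2) := by
      rw [one_le_div (by positivity)]
      nlinarith [mul_le_mul hε1.le hε1.le hε.le (by norm_num), sq_nonneg ε]
    have h3 : 24 * (d : ℝ) ^ 2 * H / δ ≤ 32 * d ^ 2 * H / δ := by gcongr; norm_num
    exact h3.trans (le_mul_of_one_le_right (by positivity) h2)
  have h4 := Real.log_le_log (by positivity) h1
  rw [Real.log_mul (by norm_num) (by positivity), Real.log_pow, Real.log_pow] at h4
  have := Real.log_two_lt_d9
  unfold logUnion
  push_cast at h4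
  linarith

/-- The accuracy of the exploration phase. -/
def exploreEps (c₀ : ℝ) (d H : ℕ) (ε δ : ℝ) : ℝ :=
  ε / (c₀ * (d : ℝ) ^ 2 * (H : ℝ) ^ 2 * logFactor d H ε δ)

theorem exploreEps_pos {c₀ : ℝ} (hc : 1 ≤ c₀) (hd : 1 ≤ d) (hH : 1 ≤ H) (hε : 0 < ε) :
    0 < exploreEps c₀ d H ε δ := by
  have := one_le_logFactor d H ε δ
  unfold exploreEps; positivity

theorem exploreEps_le_one {c₀ : ℝ} (hc : 1 ≤ c₀) (hd : 1 ≤ d) (hH : 1 ≤ H) (hε1 : ε < 1) :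
    exploreEps c₀ d H ε δ ≤ 1 := by
  have hL := one_le_logFactor d H ε δ
  have hd' : (1 : ℝ) ≤ (d : ℝ) ^ 2 := one_le_pow₀ (by exact_mod_cast hd)
  have hH' : (1 : ℝ) ≤ (H : ℝ) ^ 2 := one_le_pow₀ (by exact_mod_cast hH)
  unfold exploreEps
  rw [div_le_one (by positivity)]
  have h1 := one_le_mul_of_one_le_of_one_le (one_le_mul_of_one_le_of_one_le
    (one_le_mul_of_one_le_of_one_le hc hd') hH') hL
  linarith

theorem suboptimality_bound {c₀ c₂ : ℝ} (hc₀ : 1000000 ≤ c₀) (hc₂ : 1000000 ≤ c₂) (hd : 1 ≤ d)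
    (hH : 1 ≤ H) (hε : 0 < ε) (hε1 : ε < 1) (hδ : 0 < δ) (hδ1 : δ < 1) {n : ℕ}
    (hn : c₂ * ((d : ℝ) ^ 4 * (H : ℝ) ^ 2 * logFactor d H ε δ ^ 2 / ε ^ 2) ≤ n) :
    H * (6 * √d * √(logUnion d H δ)) * (5 / 8 * exploreEps c₀ d H ε δ) +
      H * (4 * d * (6 * d * logUnion d H δ / √n +
        5 * exploreEps c₀ d H ε δ * (2 * √d * √(logUnion d H δ)))) ≤ ε := by
  have hd' : (1 : ℝ) ≤ d := by exact_mod_cast hd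
  have hH' : (1 : ℝ) ≤ H := by exact_mod_cast hH
  have hL := one_le_logFactor d H ε δ
  have hlam := logUnion_le hd hH hε hε1 hδ hδ1
  have hlam1 := one_le_logUnion hd hH hδ hδ1
  have he : exploreEps c₀ d H ε δ * (c₀ * (d : ℝ) ^ 2 * (H : ℝ) ^ 2 * logFactor d H ε δ) = ε := by
    unfold exploreEps; exact div_mul_cancel₀ _ (by positivity)
  have he0 := exploreEps_pos (δ := δ) (by linarith : 1 ≤ c₀) hd hH hε
  generalize logFactor d H ε δ = L at *
  generalize logUnion d H δ = lam at *
  generalize exploreEps c₀ d H ε δ = ε' at *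
  have hs : √lam ≤ 3 * L := Real.sqrt_le_iff.2 ⟨by linarith, by nlinarith⟩
  have hds : √(d : ℝ) ≤ d := Real.sqrt_le_iff.2 ⟨by linarith, by nlinarith⟩
  have hds' : √(d : ℝ) * √lam ≤ d * (3 * L) := by gcongr
  have hsn : 1000 * ((d : ℝ) ^ 2 * H * L / ε) ≤ √n := by
    refine Real.le_sqrt_of_sq_le (le_trans ?_ hn)
    have : (1000 * ((d : ℝ) ^ 2 * H * L / ε)) ^ 2 =
        1000000 * ((d : ℝ) ^ 4 * (H : ℝ) ^ 2 * L ^ 2 / ε ^ 2) := by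
      rw [mul_pow, div_pow]; ring
    rw [this]; gcongr
  have hκ : 6 * d * lam / √n ≤ 36 * ε / (1000 * d * H) := by
    calc 6 * d * lam / √n ≤ 6 * d * (6 * L) / (1000 * ((d : ℝ) ^ 2 * H * L / ε)) := by gcongr
      _ = 36 * ε / (1000 * d * H) := by field_simp; ring
  have t2 : H * (4 * d * (6 * d * lam / √n)) ≤ 144 / 1000 * ε := by
    calc H * (4 * d * (6 * d * lam / √n)) ≤ H * (4 * d * (36 * ε / (1000 * d * H))) := by gcongr
      _ = 144 / 1000 * ε := by field_simp; ring
  have hε' : ε' * (1000000 * ((d : ℝ) ^ 2 * H * L)) ≤ ε := by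
    rw [← he]
    refine mul_le_mul_of_nonneg_left ?_ he0.le
    have h1 : (d : ℝ) ^ 2 * H * L ≤ d ^ 2 * (H : ℝ) ^ 2 * L := by
      gcongr; nlinarith
    calc 1000000 * ((d : ℝ) ^ 2 * H * L) ≤ c₀ * (d ^ 2 * (H : ℝ) ^ 2 * L) := by gcongr
      _ = _ := by ring
  have hX : H * (√(d : ℝ) * √lam) * ε' ≤ d * (H * (√(d : ℝ) * √lam) * ε') :=
    le_mul_of_one_le_left (by positivity) hd'
  have hY : d * (H * (√(d : ℝ) * √lam) * ε') ≤ 3 / 1000000 * ε := by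
    calc d * (H * (√(d : ℝ) * √lam) * ε') ≤ d * (H * (d * (3 * L)) * ε') := by gcongr
      _ = 3 / 1000000 * (ε' * (1000000 * ((d : ℝ) ^ 2 * H * L))) := by ring
      _ ≤ 3 / 1000000 * ε := by gcongr
  have e : H * (6 * √d * √lam) * (5 / 8 * ε') +
      H * (4 * d * (6 * d * lam / √n + 5 * ε' * (2 * √d * √lam))) =
      15 / 4 * (H * (√(d : ℝ) * √lam) * ε') + H * (4 * d * (6 * d * lam / √n)) +
        40 * (d * (H * (√(d : ℝ) * √lam) * ε')) := by ring
  rw [e]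
  linarith

end Final

namespace Setting

variable {X : Type u} {A : Type v} {Ξ : Type w} [MeasurableSpace X] [MeasurableSpace A]
  [MeasurableSpace Ξ] {d : ℕ} {E : Setting X A Ξ d}

theorem measurable_meanFeat {h : ℕ} (hh : h < E.H) : Measurable fun θ => E.meanFeat h θ := by
  have h1 : StronglyMeasurable fun q : Param d × X => E.feat q.1 h q.2 :=
    (E.measurable_feat₂ hh).stronglyMeasurable
  exact (h1.integral_prod_right (ν := E.M.start)).measurable

theorem measurableSet_nearOptimal (ε : ℝ) : MeasurableSet {θ | E.NearOptimal ε θ} := by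
  obtain ⟨θs, hθs⟩ := E.exists_optimal
  simp only [nearOptimal_iff hθs]
  refine measurableSet_le (Finset.measurable_fun_sum _ fun h hh => ?_) measurable_const
  have := measurable_meanFeat (E := E) (Finset.mem_range.1 hh)
  fun_prop

/-- The exploration phase uses up half of the failure probability, the optimization phase the
rest. -/
theorem sat_procedure {c₀ c₁ c₂ ε δ : ℝ} (hc₀ : 1000000 ≤ c₀) (hc₁ : 1000000 ≤ c₁)
    (hc₂ : 1000000 ≤ c₂) (hε : 0 < ε) (hε1 : ε < 1) (hδ : 0 < δ) (hδ1 : δ < 1) :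
    E.Sat (procedure c₀ c₁ c₂ E.H ε δ : Prog X A d (Option (Param d))) (ofReal δ)
      fun o => ∃ θ, o = some θ ∧ E.NearOptimal ε θ := by
  have hd := E.d_pos
  have hH := E.H_pos
  have hd' : (1 : ℝ) ≤ d := by exact_mod_cast hd
  have hH' : (1 : ℝ) ≤ E.H := by exact_mod_cast hH
  have he0 := exploreEps_pos (δ := δ) (by linarith : 1 ≤ c₀) hd hH hε
  have he1 := exploreEps_le_one (δ := δ) (by linarith : 1 ≤ c₀) hd hH hε1
  have hδ4 : 0 < δ / 4 := by positivity
  have hs := suffice_sizes (c₁ := c₁) (by linarith) hd hH he0 he1 hδ4 (by linarith)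
  set ε' := exploreEps c₀ d E.H ε δ with hε'
  set s := sizes c₁ d E.H ε' (δ / 4) with hsdef
  set n := max s.nCover ⌈c₂ * ((d : ℝ) ^ 4 * (E.H : ℝ) ^ 2 * logFactor d E.H ε δ ^ 2 / ε ^ 2)⌉₊
    with hn
  have hL := one_le_logFactor d E.H ε δ
  have hnle : c₂ * ((d : ℝ) ^ 4 * (E.H : ℝ) ^ 2 * logFactor d E.H ε δ ^ 2 / ε ^ 2) ≤ n :=
    (Nat.le_ceil _).trans (Nat.cast_le.2 (le_max_right _ _))
  have hn0 : 0 < n := by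
    have : (0 : ℝ) < n := lt_of_lt_of_le (by positivity) hnle
    exact_mod_cast this
  have hlam := one_le_logUnion hd hH hδ hδ1
  have h1 := sat_exploreUpTo hs rfl (numIter_large hd he0 he1) (le_refl E.H)
  have h1' := h1.mono (exploration_failure_le hd hH he0 he1 hδ4) fun _ h => h
  have h2 : ∀ R, E.ExplorationPost s E.H R →
      E.Sat (policyOpt E.H R.Ψ R.Γ n 1 : Prog X A d (Param d)) (ofReal (δ / 2))
        (E.NearOptimal ε) := by
    intro R hR
    refine (sat_policyOpt hs hR hn0 (le_max_left _ _) hlam).mono ?_ fun θ hθ =>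
      ⟨hθ.1, hθ.2.trans (suboptimality_bound hc₀ hc₂ hd hH hε hε1 hδ hδ1 hnle)⟩
    have hexp : exp (-logUnion d E.H δ) = δ / (24 * d ^ 2 * E.H) := by
      unfold logUnion
      rw [exp_neg_log_div (by positivity), inv_div]
    rw [hexp]
    set p := δ / (24 * d ^ 2 * E.H) with hp
    have hp0 : 0 < p := by positivity
    have e2 : (2 : ENNReal) = ofReal 2 := by norm_num
    have h3 := conf_mul_le hd hH he0 he1 hδ4 (by linarith)
    have h4 : conf d E.H ε' (δ / 4) ≤ δ / 4 := by
      have : (1 : ℝ) ≤ numIter d ε' := by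
        have := two_le_numIter hd he0 he1
        exact_mod_cast (by omega : 1 ≤ numIter d ε')
      unfold conf
      refine div_le_self hδ4.le ?_
      have h5 := one_le_mul_of_one_le_of_one_le (one_le_mul_of_one_le_of_one_le
        (one_le_mul_of_one_le_of_one_le (by norm_num : (1 : ℝ) ≤ 8) hH')
          (one_le_pow₀ hd' (n := 2))) this
      exact h5
    rw [e2, ← ENNReal.ofReal_natCast d, ← ENNReal.ofReal_natCast E.H,
      ← ENNReal.ofReal_mul (by positivity), ← ENNReal.ofReal_mul (by positivity),
      ← ENNReal.ofReal_mul (by positivity), ← ENNReal.ofReal_add (by positivity) (by positivity),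
      ← ENNReal.ofReal_add (by positivity) (by positivity), ← ENNReal.ofReal_mul (by positivity),
      ← ENNReal.ofReal_add (by positivity) (conf_pos hd hH he0 he1 hδ4).le]
    refine ENNReal.ofReal_le_ofReal ?_
    have h6 : E.H * (d * (2 * p) + d * (2 * p) + d * (d * (2 * p))) ≤ δ / 4 := by
      have h7 : (d : ℝ) * (2 * p) ≤ d * (d * (2 * p)) := le_mul_of_one_le_left (by positivity) hd'
      calc E.H * (d * (2 * p) + d * (2 * p) + d * (d * (2 * p)))
          ≤ E.H * (d * (d * (2 * p)) + d * (d * (2 * p)) + d * (d * (2 * p))) := by gcongr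
        _ = δ / 4 := by rw [hp]; field_simp; ring
    linarith
  have key : E.Sat (procedure c₀ c₁ c₂ E.H ε δ : Prog X A d (Option (Param d)))
      (ofReal (2 * (δ / 4)) + (ofReal (δ / 2) + 0))
      fun o => ∃ θ, o = some θ ∧ E.NearOptimal ε θ := by
    refine Sat.bind (measProg_exploreUpTo s le_rfl) ?_ h1' ?_
    · refine MeasFam.of_option (MeasFam.prog (ι := Unit) (MeasFam.done measurable_const) ()) ?_
      refine MeasFam.bind ((measFam_policyOpt n).comp (by fun_prop : Measurable fun R :
        Exploration d => (R.Ψ, R.Γ))) (MeasFam.done (by fun_prop))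
    · rintro _ ⟨R, rfl, hR⟩
      refine Sat.bind ((measFam_policyOpt n).prog (R.Ψ, R.Γ)) (MeasFam.done (by fun_prop))
        (h2 R hR) fun θ hθ => Sat.done ⟨θ, rfl, hθ⟩
  refine key.mono (le_of_eq ?_) fun _ h => h
  rw [add_zero, ← ENNReal.ofReal_add (by positivity) (by positivity)]
  congr 1; ring

/-- The specification of the procedure, in terms of the law of the infinite sequence of
episodes. -/
theorem law_not_nearOptimal_le {c₀ c₁ c₂ ε δ : ℝ} (hc₀ : 1000000 ≤ c₀) (hc₁ : 1000000 ≤ c₁)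
    (hc₂ : 1000000 ≤ c₂) (hε : 0 < ε) (hε1 : ε < 1) (hδ : 0 < δ) (hδ1 : δ < 1) :
    E.M.law {ω | ¬ ∃ θ : Param d, ((procedure c₀ c₁ c₂ E.H ε δ).run E.M E.φ E.amax ω).1 = some θ ∧
      E.NearOptimal ε θ} ≤ ofReal δ := by
  have hm : MeasurableSet {o : Option (Param d) | ∃ θ, o = some θ ∧ E.NearOptimal ε θ} := by
    have : {o : Option (Param d) | ∃ θ, o = some θ ∧ E.NearOptimal ε θ} =
        some '' {θ | E.NearOptimal ε θ} := by
      ext o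
      constructor
      · rintro ⟨θ, rfl, hθ⟩; exact ⟨θ, hθ, rfl⟩
      · rintro ⟨θ, hθ, rfl⟩; exact ⟨θ, rfl, hθ⟩
    rw [this]
    exact measurableEmbedding_some.measurableSet_image.2 (measurableSet_nearOptimal ε)
  have h1 := sat_procedure (E := E) hc₀ hc₁ hc₂ hε hε1 hδ hδ1 _ hm.compl fun o ho => ho
  rw [(measProg_procedure c₀ c₁ c₂ ε δ).dist_apply hm.compl] at h1
  refine le_trans (measure_mono ?_) h1
  intro ω hω
  have := E.run_fst (procedure c₀ c₁ c₂ E.H ε δ : Prog X A d (Option (Param d))) ω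
  change ¬ ∃ θ, (E.eval _ ω).1 = some θ ∧ _
  rw [← this]
  exact hω

end Setting

/-! ### Worst-case cost of programs -/

/-- All components of a cost, added up. -/
def Cost.total (c : Cost) : ℕ := c.episodes + c.oracleCalls + c.steps

theorem Cost.total_plus (c c' : Cost) : (c.plus c').total = c.total + c'.total := by
  unfold Cost.plus Cost.total; simp only; omega

section Bounded

variable {X : Type u} {A : Type v} {d : ℕ} {α β : Type}

/-- Whatever the answers of the environment are, a run of the program has total cost at most `B`, and
its output satisfies `P`. -/
def Bounded : Prog X A d α → ℕ → (α → Prop) → Prop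
  | .done a, _, P => P a
  | .episode _ h k, B, P => ∃ C, 2 * h + 3 + C ≤ B ∧ ∀ x a r x', Bounded (k x a r x') C P
  | .feature _ _ _ k, B, P => ∃ C, d + C ≤ B ∧ ∀ y, Bounded (k y) C P
  | .argmax _ _ _ k, B, P => ∃ C, 1 + C ≤ B ∧ ∀ a, Bounded (k a) C P
  | .tick c k, B, P => ∃ C, c + C ≤ B ∧ Bounded k C P

/-- The structural bound is a bound for every run in every environment. -/
theorem Bounded.total_run_le {Ξ : Type w} [MeasurableSpace X] [MeasurableSpace Ξ] (M : MDP X A Ξ)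
    (φ : ℕ → X → A → Vec d) (amax : ℕ → X → Vec d → A) {p : Prog X A d α} {B : ℕ} {P : α → Prop}
    (h : Bounded p B P) (ω : ℕ → Episode X Ξ) : (p.run M φ amax ω).2.total ≤ B := by
  induction p generalizing B ω with
  | done a => exact Nat.zero_le _
  | episode θ l k ih =>
    obtain ⟨C, hC, hk⟩ := h
    set x := M.state (greedy amax θ) (ω 0).1 l
    set a := greedy amax θ l x
    have := ih _ _ _ _ (hk x a (M.reward l x a ((ω 0).2 l)) (M.next l x a)) fun n => ω (n + 1)
    refine le_trans (le_of_eq (Cost.total_plus _ _)) (le_trans (Nat.add_le_add ?_ this) hC)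
    simp only [Cost.total]; omega
  | feature l x a k ih =>
    obtain ⟨C, hC, hk⟩ := h
    have := ih _ (hk (φ l x a)) ω
    refine le_trans (le_of_eq (Cost.total_plus _ _)) (le_trans (Nat.add_le_add ?_ this) hC)
    simp only [Cost.total]; omega
  | argmax l x θ k ih =>
    obtain ⟨C, hC, hk⟩ := h
    have := ih _ (hk (amax l x θ)) ω
    refine le_trans (le_of_eq (Cost.total_plus _ _)) (le_trans (Nat.add_le_add ?_ this) hC)
    simp only [Cost.total]; omega
  | tick c k ih =>
    obtain ⟨C, hC, hk⟩ := h
    have := ih hk ω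
    refine le_trans (le_of_eq (Cost.total_plus _ _)) (le_trans (Nat.add_le_add ?_ this) hC)
    simp only [Cost.total]; omega

theorem Bounded.mono {p : Prog X A d α} {B B' : ℕ} {P P' : α → Prop} (h : Bounded p B P)
    (hB : B ≤ B') (hP : ∀ a, P a → P' a) : Bounded p B' P' := by
  induction p generalizing B B' with
  | done a => exact hP _ h
  | episode θ l k ih =>
    obtain ⟨C, hC, hk⟩ := h
    exact ⟨C, hC.trans hB, fun x a r x' => ih _ _ _ _ (hk x a r x') le_rfl⟩
  | feature l x a k ih =>
    obtain ⟨C, hC, hk⟩ := h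
    exact ⟨C, hC.trans hB, fun y => ih _ (hk y) le_rfl⟩
  | argmax l x θ k ih =>
    obtain ⟨C, hC, hk⟩ := h
    exact ⟨C, hC.trans hB, fun y => ih _ (hk y) le_rfl⟩
  | tick c k ih =>
    obtain ⟨C, hC, hk⟩ := h
    exact ⟨C, hC.trans hB, ih hk le_rfl⟩

theorem Bounded.bind {p : Prog X A d α} {f : α → Prog X A d β} {B B' : ℕ} {P : α → Prop}
    {Q : β → Prop} (h : Bounded p B P) (hf : ∀ a, P a → Bounded (f a) B' Q) :
    Bounded (p.bind f) (B + B') Q := by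
  induction p generalizing B with
  | done a => exact (hf a h).mono (Nat.le_add_left _ _) fun _ h => h
  | episode θ l k ih =>
    obtain ⟨C, hC, hk⟩ := h
    exact ⟨C + B', by omega, fun x a r x' => ih _ _ _ _ (hk x a r x')⟩
  | feature l x a k ih =>
    obtain ⟨C, hC, hk⟩ := h
    exact ⟨C + B', by omega, fun y => ih _ (hk y)⟩
  | argmax l x θ k ih =>
    obtain ⟨C, hC, hk⟩ := h
    exact ⟨C + B', by omega, fun y => ih _ (hk y)⟩
  | tick c k ih =>
    obtain ⟨C, hC, hk⟩ := h
    exact ⟨C + B', by omega, ih hk⟩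

theorem Bounded.done {a : α} {B : ℕ} {P : α → Prop} (h : P a) :
    Bounded (Prog.done a : Prog X A d α) B P := h

theorem Bounded.compute {a : α} {c B : ℕ} {P : α → Prop} (hc : c ≤ B) (h : P a) :
    Bounded (LBC.compute c a : Prog X A d α) B P := ⟨0, hc, h⟩

theorem Bounded.repeatProg {p : Prog X A d α} {B : ℕ} {P : α → Prop} (h : Bounded p B P) (n : ℕ) :
    Bounded (LBC.repeatProg p n) (n * B) fun l => l.length = n := by
  induction n with
  | zero => exact Bounded.done rfl
  | succ n ih =>
    have h1 : Bounded (LBC.repeatProg p (n + 1)) (B + (n * B + 0)) fun l => l.length = n + 1 :=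
      Bounded.bind h fun a _ => Bounded.bind ih fun l hl => Bounded.done (by simp [hl])
    exact h1.mono (by rw [Nat.succ_mul]; omega) fun _ h => h

theorem Bounded.forProg {κ : Type} {f : κ → Prog X A d α} {l : List κ} {B : ℕ} {P : α → Prop}
    (h : ∀ k ∈ l, Bounded (f k) B P) :
    Bounded (LBC.forProg f l) (l.length * B) fun L => L.length = l.length ∧ ∀ a ∈ L, P a := by
  induction l with
  | nil => exact Bounded.done (by simp)
  | cons k l ih =>
    have h1 : Bounded (LBC.forProg f (k :: l)) (B + (l.length * B + 0))
        fun L => L.length = (k :: l).length ∧ ∀ a ∈ L, P a :=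
      Bounded.bind (h k (by simp)) fun a ha =>
        Bounded.bind (ih fun k hk => h k (by simp [hk])) fun L hL =>
          Bounded.done ⟨by simp [hL.1], by simpa using ⟨ha, hL.2⟩⟩
    exact h1.mono (by rw [List.length_cons, Nat.succ_mul]; omega) fun _ h => h

theorem length_flatten_of_length {n : ℕ} {L : List (List α)} (h : ∀ l ∈ L, l.length = n) :
    L.flatten.length = L.length * n := by
  rw [List.length_flatten, List.map_congr_left h]; simp

end Bounded

/-- All sizes on which the cost depends are at most `N`. -/
structure Sizes.AtMost (s : Sizes) (d H n N : ℕ) : Prop where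
  large : 20 ≤ N
  dim : d + 1 ≤ N
  horizon : H + 1 ≤ N
  nIter : s.nIter ≤ N
  nVec : s.nVec ≤ N
  nTest : s.nTest ≤ N
  nSamp : s.nSamp ≤ N
  mBoost : s.mBoost ≤ N
  nReject : s.nReject ≤ N
  nCover : s.nCover ≤ N
  data : n ≤ N

section Costs

variable {X : Type u} {A : Type v} {d H n N : ℕ} {s : Sizes}

theorem pow_add_pow_le {a b c : ℕ} (hN : 2 ≤ N) (ha : a < c := by omega)
    (hb : b < c := by omega) : N ^ a + N ^ b ≤ N ^ c := by
  obtain ⟨c, rfl⟩ : ∃ k, c = k + 1 := ⟨c - 1, by omega⟩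
  have h1 := Nat.pow_le_pow_right (by omega : 0 < N) (by omega : a ≤ c)
  have h2 := Nat.pow_le_pow_right (by omega : 0 < N) (by omega : b ≤ c)
  rw [pow_succ]
  nlinarith [Nat.zero_le (N ^ c)]

theorem bounded_drawFeature (hs : s.AtMost d H n N) {h : ℕ} (hh : h < H) (π : Param d) :
    Bounded (drawFeature π h : Prog X A d (Vec d)) (N ^ 2) fun _ => True := by
  have h1 := hs.large; have h2 := hs.dim; have h3 := hs.horizon
  refine ⟨d, by nlinarith, fun x a r x' => ⟨0, le_rfl, fun y => Bounded.done trivial⟩⟩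

theorem bounded_drawReward (hs : s.AtMost d H n N) {h : ℕ} (hh : h < H) (π : Param d) :
    Bounded (drawReward π h : Prog X A d (Vec d × ℝ)) (N ^ 2) fun _ => True := by
  have h1 := hs.large; have h2 := hs.dim; have h3 := hs.horizon
  refine ⟨d, by nlinarith, fun x a r x' => ⟨0, le_rfl, fun y => Bounded.done trivial⟩⟩

theorem bounded_drawTarget (hs : s.AtMost d H n N) {h : ℕ} (hh : h < H) (π : Param d) (w θ : Vec d) :
    Bounded (drawTarget π h w θ : Prog X A d (Vec d × ℝ)) (N ^ 2) fun _ => True := by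
  have h1 := hs.large; have h2 := hs.dim; have h3 := hs.horizon
  refine ⟨d + (1 + (d + 4 * d)), by nlinarith, fun x a r x' => ⟨_, le_rfl, fun y => ⟨_, le_rfl,
    fun a' => ⟨_, le_rfl, fun y' => Bounded.compute le_rfl trivial⟩⟩⟩⟩

/-- Cost of a regression on at most `N ^ 2` data points. -/
theorem regression_cost_le (hs : s.AtMost d H n N) {m : ℕ} (hm : m ≤ N ^ 2) :
    m * d ^ 2 + 2 * d ^ 3 ≤ N ^ 5 := by
  have h1 := hs.large
  have h2 : d ≤ N := by have := hs.dim; omega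
  calc m * d ^ 2 + 2 * d ^ 3 ≤ N ^ 2 * N ^ 2 + N * N ^ 3 := by gcongr; omega
    _ = N ^ 4 + N ^ 4 := by ring
    _ ≤ N ^ 5 := pow_add_pow_le (by omega)

theorem bounded_fqiLoop (hs : s.AtMost d H n N) {k : ℕ} (hk : k ≤ N) (ws : Param d)
    {Ψ : ℕ → List (Param d)} {h : ℕ} (hh : h ≤ H) (hΨ : ∀ l < h, (Ψ l).length ≤ N) (θ : Param d) :
    Bounded (fqiLoop ws Ψ k h θ : Prog X A d (Param d)) (h * N ^ 6) fun _ => True := by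
  induction h generalizing θ with
  | zero => exact Bounded.done trivial
  | succ h ih =>
    have hN := hs.large
    have h1 := Bounded.forProg (l := Ψ h) (f := fun π => repeatProg
      (drawTarget π h (ws h) (θ (h + 1)) : Prog X A d (Vec d × ℝ)) k)
      fun π _ => (bounded_drawTarget hs (by omega) π (ws h) (θ (h + 1))).repeatProg k
    have h2 : Bounded (fqiLoop ws Ψ k (h + 1) θ : Prog X A d (Param d))
        ((Ψ h).length * (k * N ^ 2) + (N ^ 5 + h * N ^ 6)) fun _ => True := by
      refine Bounded.bind h1 fun D hD => Bounded.bind (Bounded.compute (P := fun _ => True) ?_ trivial)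
        fun θh _ => ih (by omega) (fun l hl => hΨ l (by omega)) _
      refine regression_cost_le hs ?_
      rw [length_flatten_of_length hD.2, hD.1, sq]
      exact Nat.mul_le_mul (hΨ h (by omega)) hk
    refine h2.mono ?_ fun _ h => h
    have h3 : (Ψ h).length * (k * N ^ 2) ≤ N ^ 4 := by
      calc (Ψ h).length * (k * N ^ 2) ≤ N * (N * N ^ 2) := by gcongr; exact hΨ h (by omega)
        _ = N ^ 4 := by ring
    have h4 : N ^ 4 + N ^ 5 ≤ N ^ 6 := pow_add_pow_le (by omega)
    rw [Nat.succ_mul]; omega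

theorem bounded_fqi (hs : s.AtMost d H n N) {k : ℕ} (hk : k ≤ N) (ws : Param d)
    {Ψ : ℕ → List (Param d)} {h : ℕ} (hh : h < H) (hΨ : ∀ l < h, (Ψ l).length ≤ N) :
    Bounded (fqi h ws Ψ k : Prog X A d (Param d)) (N ^ 7) fun _ => True := by
  refine (bounded_fqiLoop hs hk ws hh.le hΨ _).mono ?_ fun _ h => h
  have : h ≤ N := by have := hs.horizon; omega
  calc h * N ^ 6 ≤ N * N ^ 6 := by gcongr
    _ = N ^ 7 := by ring

theorem resid_cost_le (hs : s.AtMost d H n N) {q : ℕ} (hq : q ≤ N) : 4 * (q + 1) * d ≤ N ^ 3 := by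
  have h1 := hs.large
  have h2 : d ≤ N := by have := hs.dim; omega
  calc 4 * (q + 1) * d ≤ N * N * N := Nat.mul_le_mul (by nlinarith) h2
    _ = N ^ 3 := by ring

theorem bounded_outlierTest (hs : s.AtMost d H n N) {h : ℕ} (hh : h < H) (π : Param d)
    {Q : List (Vec d)} (hQ : Q.length ≤ N) :
    Bounded (outlierTest π h Q : Prog X A d Bool) (N ^ 4) fun _ => True := by
  have hN := hs.large
  have h1 : Bounded (outlierTest π h Q : Prog X A d Bool) (N ^ 2 + N ^ 3) fun _ => True :=
    Bounded.bind (bounded_drawFeature hs hh π) fun y _ =>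
      Bounded.compute (resid_cost_le hs hQ) trivial
  exact h1.mono (pow_add_pow_le (by omega)) fun _ h => h

theorem bounded_rejection (hs : s.AtMost d H n N) {h : ℕ} (hh : h < H) (π : Param d)
    {Q : List (Vec d)} (hQ : Q.length ≤ N) (K : ℕ) :
    Bounded (rejection π h Q K : Prog X A d (Vec d)) (K * N ^ 4) fun _ => True := by
  have hN := hs.large
  induction K with
  | zero => exact Bounded.done trivial
  | succ K ih =>
    have h1 : Bounded (rejection π h Q (K + 1) : Prog X A d (Vec d)) (N ^ 2 + (N ^ 3 + K * N ^ 4))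
        fun _ => True := by
      refine Bounded.bind (bounded_drawFeature hs hh π) fun y _ =>
        Bounded.bind (Bounded.compute (P := fun _ => True) (resid_cost_le hs hQ) trivial) fun r _ => ?_
      split_ifs
      · exact Bounded.done trivial
      · exact ih
    refine h1.mono ?_ fun _ h => h
    have := pow_add_pow_le (N := N) (a := 2) (b := 3) (c := 4) (by omega)
    rw [Nat.succ_mul]; omega

theorem bounded_computeOutlierDirection (hs : s.AtMost d H n N) {draw : Prog X A d (Vec d)}
    (hd : Bounded draw (N ^ 5) fun _ => True) :
    Bounded (computeOutlierDirection draw s.nSamp s.mBoost) (N ^ 11) fun _ => True := by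
  have hN := hs.large
  have hdN : d ≤ N := by have := hs.dim; omega
  have h1 : Bounded (repeatProg draw s.nSamp) (N ^ 6) fun l => l.length = s.nSamp := by
    refine (hd.repeatProg s.nSamp).mono ?_ fun _ h => h
    calc s.nSamp * N ^ 5 ≤ N * N ^ 5 := by gcongr; exact hs.nSamp
      _ = N ^ 6 := by ring
  have hc : (s.nSamp + 1) * d ^ 2 ≤ N ^ 4 := by
    have := hs.nSamp
    calc (s.nSamp + 1) * d ^ 2 ≤ (N * N) * N ^ 2 := by gcongr; nlinarith
      _ = N ^ 4 := by ring
  have h2 : ∀ y : Vec d, Bounded ((repeatProg ((repeatProg draw s.nSamp).bind fun W =>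
      compute ((s.nSamp + 1) * d ^ 2) (spanTest y W)) s.mBoost).bind fun hits =>
      compute s.mBoost (y, hits.count true)) (N ^ 9) fun _ => True := by
    intro y
    have h3 : Bounded ((repeatProg draw s.nSamp).bind fun W =>
        compute ((s.nSamp + 1) * d ^ 2) (spanTest y W)) (N ^ 6 + N ^ 4) fun _ => True :=
      Bounded.bind h1 fun W _ => Bounded.compute hc trivial
    have h4 := Bounded.bind (h3.repeatProg s.mBoost) fun hits _ =>
      Bounded.compute (P := fun _ => True) (a := (y, hits.count true)) hs.mBoost trivial
    refine h4.mono ?_ fun _ h => h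
    calc s.mBoost * (N ^ 6 + N ^ 4) + N ≤ N * N ^ 7 + N ^ 1 := by
          rw [pow_one]
          gcongr
          · exact hs.mBoost
          · exact pow_add_pow_le (by omega)
      _ = N ^ 8 + N ^ 1 := by ring
      _ ≤ N ^ 9 := pow_add_pow_le (by omega)
  have h5 : Bounded (computeOutlierDirection draw s.nSamp s.mBoost) (N ^ 6 + (N * N ^ 9 + N))
      fun _ => True := by
    refine Bounded.bind h1 fun U hU => Bounded.bind (P := fun _ => True) ?_ fun S _ =>
      Bounded.compute hs.nSamp trivial
    refine (Bounded.forProg (l := U) fun y _ => h2 y).mono ?_ fun _ _ => trivial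
    gcongr
    rw [hU]; exact hs.nSamp
  refine h5.mono ?_ fun _ h => h
  have h6 : N ^ 6 ≤ N ^ 9 := Nat.pow_le_pow_right (by omega) (by omega)
  have h7 : N ≤ N ^ 9 := Nat.le_self_pow (by omega) _
  have h8 : N ^ 11 = N * (N * N ^ 9) := by ring
  have h9 : 20 * N ^ 9 ≤ N * N ^ 9 := Nat.mul_le_mul_right _ hN
  have h10 : 20 * (N * N ^ 9) ≤ N * (N * N ^ 9) := Nat.mul_le_mul_right _ hN
  omega

theorem bounded_searchDirections (hs : s.AtMost d H n N) {h : ℕ} (hh : h < H)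
    {Ψ : ℕ → List (Param d)} (hΨ : ∀ l < h, (Ψ l).length ≤ N) {Q : List (Vec d)}
    (hQ : Q.length ≤ N) (l : List (Vec d)) :
    Bounded (searchDirections H s h Ψ Q l : Prog X A d (Option (Param d × Vec d)))
      (l.length * N ^ 12) fun _ => True := by
  have hN := hs.large
  induction l with
  | nil => exact Bounded.done trivial
  | cons θ l ih =>
    have hout : ∀ πm πp : Param d, Bounded (repeatProg ((outlierTest πm h Q).bind fun bm =>
        (outlierTest πp h Q).bind fun bp => .done (bm, bp) : Prog X A d (Bool × Bool)) s.nTest)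
        (s.nTest * (N ^ 4 + (N ^ 4 + 0))) fun _ => True := by
      intro πm πp
      refine Bounded.mono (Bounded.repeatProg (P := fun _ => True) ?_ s.nTest) le_rfl
        fun _ _ => trivial
      exact Bounded.bind (bounded_outlierTest hs hh πm hQ) fun _ _ =>
        Bounded.bind (bounded_outlierTest hs hh πp hQ) fun _ _ => Bounded.done trivial
    have key : Bounded (searchDirections H s h Ψ Q (θ :: l) : Prog X A d (Option (Param d × Vec d)))
        (N ^ 7 + (N ^ 7 + (s.nTest * (N ^ 4 + (N ^ 4 + 0)) + (N + (N + (N ^ 11 + l.length * N ^ 12))))))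
        fun _ => True := by
      refine Bounded.bind (bounded_fqi hs hs.nCover _ hh hΨ) fun πm _ =>
        Bounded.bind (bounded_fqi hs hs.nCover _ hh hΨ) fun πp _ =>
        Bounded.bind (hout πm πp) fun out _ =>
        Bounded.bind (Bounded.compute (P := fun _ => True) hs.nTest trivial) fun km _ =>
        Bounded.bind (Bounded.compute (P := fun _ => True) hs.nTest trivial) fun kp _ => ?_
      simp only
      split_ifs
      -- the search ends here with an outlier direction, or it goes on
      all_goals
        first
        | exact ih.mono (Nat.le_add_left _ _) fun _ h => h
        | refine Bounded.mono (Bounded.bind (B' := 0) (bounded_computeOutlierDirection hs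
            ((bounded_rejection hs hh _ hQ _).mono ?_ fun _ h => h)) fun y _ =>
              Bounded.done trivial) (Nat.le_add_right _ _) fun _ h => h
          calc s.nReject * N ^ 4 ≤ N * N ^ 4 := by gcongr; exact hs.nReject
            _ = N ^ 5 := by ring
    refine key.mono ?_ fun _ h => h
    have h1 : s.nTest * (N ^ 4 + (N ^ 4 + 0)) ≤ N ^ 6 := by
      calc s.nTest * (N ^ 4 + (N ^ 4 + 0)) ≤ N * N ^ 5 := by
            rw [add_zero]
            gcongr
            · exact hs.nTest
            · exact pow_add_pow_le (by omega)
        _ = N ^ 6 := by ring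
    have h2 : N ^ 6 ≤ N ^ 11 := Nat.pow_le_pow_right (by omega) (by omega)
    have h3 : N ^ 7 ≤ N ^ 11 := Nat.pow_le_pow_right (by omega) (by omega)
    have h4 : N ≤ N ^ 11 := Nat.le_self_pow (by omega) _
    have h5 : N ^ 12 = N * N ^ 11 := by ring
    have h6 : 20 * N ^ 11 ≤ N * N ^ 11 := Nat.mul_le_mul_right _ hN
    rw [List.length_cons, Nat.succ_mul]; omega

theorem bounded_subspaceLoop (hs : s.AtMost d H n N) {h : ℕ} (hh : h < H)
    {Ψ : ℕ → List (Param d)} (hΨ : ∀ l < h, (Ψ l).length ≤ N) {t : ℕ} {Q : List (Vec d)}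
    {Ψh : List (Param d)} (hQ : Q.length + t ≤ N) (hΨh : Ψh.length + t ≤ N) :
    Bounded (subspaceLoop H s h Ψ t Q Ψh : Prog X A d (List (Vec d) × List (Param d)))
      (t * N ^ 14) fun r => r.2.length ≤ N := by
  have hN := hs.large
  induction t generalizing Q Ψh with
  | zero => exact Bounded.done (by simpa using hΨh)
  | succ t ih =>
    have hd := hs.dim
    have hc1 : 4 * (d + 1) ^ 3 ≤ N ^ 4 := by
      calc 4 * (d + 1) ^ 3 ≤ N * N ^ 3 := by gcongr; omega
        _ = N ^ 4 := by ring
    have hc2 : 4 * (d + 1) ^ 2 ≤ N ^ 3 := by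
      calc 4 * (d + 1) ^ 2 ≤ N * N ^ 2 := by gcongr; omega
        _ = N ^ 3 := by ring
    have key : Bounded (subspaceLoop H s h Ψ (t + 1) Q Ψh :
        Prog X A d (List (Vec d) × List (Param d))) (N ^ 4 + (N * N ^ 12 + (N ^ 3 + t * N ^ 14)))
        fun r => r.2.length ≤ N := by
      refine Bounded.bind (Bounded.compute (P := fun B => B.length ≤ N) hc1
        ((length_complBasis_le Q).trans (by omega))) fun B hB => ?_
      refine Bounded.bind ((bounded_searchDirections hs hh hΨ (Q := Q) (by omega) B).mono
        (Nat.mul_le_mul_right _ hB) fun _ h => h) fun o _ => ?_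
      rcases o with _ | ⟨π, y⟩
      · exact Bounded.done (by simp only; omega)
      · refine Bounded.bind (Bounded.compute (P := fun Q' => Q'.length ≤ Q.length + 1) hc2
          (length_gsStep_le Q y)) fun Q' hQ' => ?_
        exact ih (by omega) (by rw [List.length_append, List.length_singleton]; omega)
    refine key.mono ?_ fun _ h => h
    have h1 : N * N ^ 12 = N ^ 13 := by ring
    have h2 : N ^ 4 ≤ N ^ 13 := Nat.pow_le_pow_right (by omega) (by omega)
    have h3 : N ^ 3 ≤ N ^ 13 := Nat.pow_le_pow_right (by omega) (by omega)
    have h5 : N ^ 14 = N * N ^ 13 := by ring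
    have h6 : 20 * N ^ 13 ≤ N * N ^ 13 := Nat.mul_le_mul_right _ hN
    rw [Nat.succ_mul]; omega

theorem bounded_vecEval (hs : s.AtMost d H n N) {h : ℕ} (hh : h < H) (π : Param d) :
    Bounded (vecEval h s.nVec π : Prog X A d (Vec d)) (N ^ 4) fun _ => True := by
  have hN := hs.large
  have hd := hs.dim
  have hv := hs.nVec
  have h1 : Bounded (vecEval h s.nVec π : Prog X A d (Vec d)) (s.nVec * N ^ 2 + (s.nVec + 1) * d)
      fun _ => True :=
    Bounded.bind ((bounded_drawFeature hs hh π).repeatProg s.nVec) fun l _ =>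
      Bounded.compute le_rfl trivial
  refine h1.mono ?_ fun _ h => h
  calc s.nVec * N ^ 2 + (s.nVec + 1) * d ≤ N * N ^ 2 + (N * N) * N := by
        gcongr
        · nlinarith
        · omega
    _ = N ^ 3 + N ^ 3 := by ring
    _ ≤ N ^ 4 := pow_add_pow_le (by omega)

section Spanner

variable {linOpt : Vec d → Prog X A d (Param d)} {vec : Param d → Prog X A d (Vec d)}

theorem bounded_spanQuery (hs : s.AtMost d H n N) (hl : ∀ θ, Bounded (linOpt θ) (N ^ 7) fun _ => True)
    (hv : ∀ π, Bounded (vec π) (N ^ 4) fun _ => True) (st : SpanState d) (i : Fin d) :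
    Bounded (spanQuery linOpt vec st i) (N ^ 8) fun _ => True := by
  have hN := hs.large
  have hd : d ≤ N := by have := hs.dim; omega
  have key : Bounded (spanQuery linOpt vec st i)
      (N ^ 4 + (N ^ 7 + (N ^ 4 + (N ^ 7 + (N ^ 4 + 0))))) fun _ => True :=
    Bounded.bind (Bounded.compute (P := fun _ => True) (Nat.pow_le_pow_left hd 4) trivial) fun _ _ =>
      Bounded.bind (hl _) fun zp _ => Bounded.bind (hv zp) fun _ _ =>
      Bounded.bind (hl _) fun zm _ => Bounded.bind (hv zm) fun _ _ => Bounded.done trivial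
  refine key.mono ?_ fun _ h => h
  have h2 : N ^ 4 ≤ N ^ 7 := Nat.pow_le_pow_right (by omega) (by omega)
  have h5 : N ^ 8 = N * N ^ 7 := by ring
  have h6 : 20 * N ^ 7 ≤ N * N ^ 7 := Nat.mul_le_mul_right _ hN
  omega

theorem column_cost_le (hs : s.AtMost d H n N) : N ^ 8 + 20 * d ≤ N ^ 9 := by
  have hN := hs.large
  have hd : d ≤ N := by have := hs.dim; omega
  calc N ^ 8 + 20 * d ≤ N ^ 8 + N * N := by gcongr
    _ = N ^ 8 + N ^ 2 := by ring
    _ ≤ N ^ 9 := pow_add_pow_le (by omega)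

theorem bounded_spanInit (hs : s.AtMost d H n N) (hl : ∀ θ, Bounded (linOpt θ) (N ^ 7) fun _ => True)
    (hv : ∀ π, Bounded (vec π) (N ^ 4) fun _ => True) (ε : ℝ) (l : List (Fin d)) (st : SpanState d) :
    Bounded (spanInit linOpt vec ε l st) (l.length * N ^ 9) fun _ => True := by
  induction l generalizing st with
  | nil => exact Bounded.done trivial
  | cons i l ih =>
    have key : Bounded (spanInit linOpt vec ε (i :: l) st) (N ^ 8 + (20 * d + l.length * N ^ 9))
        fun _ => True :=
      Bounded.bind (bounded_spanQuery hs hl hv st i) fun _ _ =>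
        Bounded.bind (Bounded.compute (P := fun _ => True) le_rfl trivial) fun st' _ => ih st'
    refine key.mono ?_ fun _ h => h
    have := column_cost_le hs
    rw [List.length_cons, Nat.succ_mul l.length]; omega

theorem bounded_spanPass (hs : s.AtMost d H n N) (hl : ∀ θ, Bounded (linOpt θ) (N ^ 7) fun _ => True)
    (hv : ∀ π, Bounded (vec π) (N ^ 4) fun _ => True) (C ε : ℝ) (st : SpanState d)
    (l : List (Fin d)) :
    Bounded (spanPass linOpt vec C ε st l) (l.length * N ^ 9) fun _ => True := by
  induction l with
  | nil => exact Bounded.done trivial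
  | cons i l ih =>
    have key : Bounded (spanPass linOpt vec C ε st (i :: l)) (N ^ 8 + (20 * d + l.length * N ^ 9))
        fun _ => True := by
      refine Bounded.bind (bounded_spanQuery hs hl hv st i) fun q _ =>
        Bounded.bind (Bounded.compute (P := fun _ => True) le_rfl trivial) fun o _ => ?_
      cases o with
      | none => exact ih
      | some st' => exact Bounded.done trivial
    refine key.mono ?_ fun _ h => h
    have := column_cost_le hs
    rw [List.length_cons, Nat.succ_mul l.length]; omega

theorem bounded_spanLoop (hs : s.AtMost d H n N) (hl : ∀ θ, Bounded (linOpt θ) (N ^ 7) fun _ => True)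
    (hv : ∀ π, Bounded (vec π) (N ^ 4) fun _ => True) (C ε : ℝ) (k : ℕ) (st : SpanState d) :
    Bounded (spanLoop linOpt vec C ε k st) (k * N ^ 10) fun _ => True := by
  induction k generalizing st with
  | zero => exact Bounded.done trivial
  | succ k ih =>
    have hd : d ≤ N := by have := hs.dim; omega
    have h1 : Bounded (spanPass linOpt vec C ε st (List.finRange d)) (N ^ 10) fun _ => True := by
      refine (bounded_spanPass hs hl hv C ε st (List.finRange d)).mono ?_ fun _ h => h
      rw [List.length_finRange]
      calc d * N ^ 9 ≤ N * N ^ 9 := by gcongr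
        _ = N ^ 10 := by ring
    have key : Bounded (spanLoop linOpt vec C ε (k + 1) st) (N ^ 10 + k * N ^ 10) fun _ => True := by
      refine Bounded.bind h1 fun o _ => ?_
      cases o with
      | none => exact Bounded.done trivial
      | some st' => exact ih st'
    exact key.mono (by rw [Nat.succ_mul]; omega) fun _ h => h

theorem bounded_robustSpanner (hs : s.AtMost d H n N)
    (hl : ∀ θ, Bounded (linOpt θ) (N ^ 7) fun _ => True)
    (hv : ∀ π, Bounded (vec π) (N ^ 4) fun _ => True) (C ε : ℝ) :
    Bounded (robustSpanner linOpt vec C ε s.nIter) (N ^ 12) fun _ => True := by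
  have hN := hs.large
  have hd : d ≤ N := by have := hs.dim; omega
  have key := Bounded.bind (bounded_spanInit hs hl hv ε (List.finRange d)
    ⟨fun i => EuclideanSpace.single i (1 : ℝ), fun _ => 0⟩) fun st _ =>
      bounded_spanLoop hs hl hv C ε s.nIter st
  refine key.mono ?_ fun _ h => h
  rw [List.length_finRange]
  calc d * N ^ 9 + s.nIter * N ^ 10 ≤ N * N ^ 9 + N * N ^ 10 := by gcongr; exact hs.nIter
    _ = N ^ 10 + N ^ 11 := by ring
    _ ≤ N ^ 12 := pow_add_pow_le (by omega)

end Spanner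

theorem bounded_exploreUpTo (hs : s.AtMost d H n N) {h : ℕ} (hh : h ≤ H) :
    Bounded (exploreUpTo H s h : Prog X A d (Option (Exploration d))) (h * N ^ 16)
      fun o => ∀ R, o = some R → ∀ l, (R.Ψ l).length ≤ N := by
  have hN := hs.large
  have hd := hs.dim
  induction h with
  | zero =>
    refine Bounded.done ?_
    rintro R hR l
    rw [Option.some.injEq] at hR
    subst hR; simp
  | succ h ih =>
    have key : Bounded (exploreUpTo H s (h + 1) : Prog X A d (Option (Exploration d)))
        (h * N ^ 16 + ((d + 1) * N ^ 14 + (N ^ 12 + 0)))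
        fun o => ∀ R, o = some R → ∀ l, (R.Ψ l).length ≤ N := by
      refine Bounded.bind (ih (by omega)) fun o ho => ?_
      cases o with
      | none => exact Bounded.done (by simp)
      | some R =>
        have hR := ho R rfl
        refine Bounded.bind (bounded_subspaceLoop hs (by omega) (fun l _ => hR l)
          (by simpa using hd) (by simpa using hd)) fun r hr => ?_
        refine Bounded.bind (bounded_robustSpanner hs (fun θ => bounded_fqi hs hs.nCover _ (by omega)
          fun l _ => hR l) (fun π => bounded_vecEval hs (by omega) π) _ _) fun o _ => ?_
        cases o with
        | none => exact Bounded.done (by simp)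
        | some Γh =>
          refine Bounded.done ?_
          rintro R' hR' l
          rw [Option.some.injEq] at hR'
          subst hR'
          simp only [Function.update_apply]
          split_ifs
          · exact hr
          · exact hR l
    refine key.mono ?_ fun _ h => h
    have h1 : (d + 1) * N ^ 14 + N ^ 12 ≤ N ^ 16 := by
      calc (d + 1) * N ^ 14 + N ^ 12 ≤ N * N ^ 14 + N ^ 12 := by gcongr
        _ = N ^ 15 + N ^ 12 := by ring
        _ ≤ N ^ 16 := pow_add_pow_le (by omega)
    rw [Nat.succ_mul h]; omega

theorem bounded_policyOpt (hs : s.AtMost d H n N) (hH : 1 ≤ H) {Ψ : ℕ → List (Param d)}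
    (hΨ : ∀ l, (Ψ l).length ≤ N) (Γ : ℕ → Fin d → Param d) (lam : ℝ) :
    Bounded (policyOpt H Ψ Γ n lam : Prog X A d (Param d)) (N ^ 8) fun _ => True := by
  have hN := hs.large
  have hd : d ≤ N := by have := hs.dim; omega
  have hHN : H ≤ N := by have := hs.horizon; omega
  have key : Bounded (policyOpt H Ψ Γ n lam : Prog X A d (Param d)) (H * N ^ 6 + N ^ 7)
      fun _ => True := by
    refine Bounded.bind (P := fun _ => True) ?_ fun ws _ =>
      bounded_fqi hs hs.data _ (by omega) fun l _ => hΨ l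
    refine Bounded.mono (Bounded.forProg (B := N ^ 6) (P := fun _ => True) ?_) (by simp)
      fun _ _ => trivial
    intro h hh
    have h1 := Bounded.forProg (l := List.finRange d) (f := fun i => repeatProg
      (drawReward (Γ h i) h : Prog X A d (Vec d × ℝ)) n)
      fun i _ => (bounded_drawReward hs (List.mem_range.1 hh) (Γ h i)).repeatProg n
    refine Bounded.mono (Bounded.bind (B' := N ^ 5) h1 fun D hD => Bounded.compute
      (P := fun _ => True) ?_ trivial) ?_ fun _ h => h
    · refine regression_cost_le hs ?_
      rw [length_flatten_of_length hD.2, hD.1, List.length_finRange, sq]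
      exact Nat.mul_le_mul hd hs.data
    · rw [List.length_finRange]
      calc d * (n * N ^ 2) + N ^ 5 ≤ N * (N * N ^ 2) + N ^ 5 := by gcongr; exact hs.data
        _ = N ^ 4 + N ^ 5 := by ring
        _ ≤ N ^ 6 := pow_add_pow_le (by omega)
  refine key.mono ?_ fun _ h => h
  calc H * N ^ 6 + N ^ 7 ≤ N * N ^ 6 + N ^ 7 := by gcongr
    _ = N ^ 7 + N ^ 7 := by ring
    _ ≤ N ^ 8 := pow_add_pow_le (by omega)

theorem bounded_procedure {c₀ c₁ c₂ ε δ : ℝ} (hH : 1 ≤ H)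
    (hs : (sizes c₁ d H (exploreEps c₀ d H ε δ) (δ / 4)).AtMost d H
      (max (sizes c₁ d H (exploreEps c₀ d H ε δ) (δ / 4)).nCover
        ⌈c₂ * ((d : ℝ) ^ 4 * (H : ℝ) ^ 2 * logFactor d H ε δ ^ 2 / ε ^ 2)⌉₊) N) :
    Bounded (procedure c₀ c₁ c₂ H ε δ : Prog X A d (Option (Param d))) (N ^ 18) fun _ => True := by
  have hN := hs.large
  have hHN : H ≤ N := by have := hs.horizon; omega
  have key : Bounded (procedure c₀ c₁ c₂ H ε δ : Prog X A d (Option (Param d)))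
      (H * N ^ 16 + (N ^ 8 + 0)) fun _ => True := by
    refine Bounded.bind (bounded_exploreUpTo hs le_rfl) fun o ho => ?_
    cases o with
    | none => exact Bounded.done trivial
    | some R =>
      exact Bounded.bind (bounded_policyOpt hs hH (ho R rfl) R.Γ 1) fun θ _ => Bounded.done trivial
  refine key.mono ?_ fun _ h => h
  calc H * N ^ 16 + (N ^ 8 + 0) ≤ N * N ^ 16 + N ^ 8 := by rw [add_zero]; gcongr
    _ = N ^ 17 + N ^ 8 := by ring
    _ ≤ N ^ 18 := pow_add_pow_le (by omega)

end Costs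

/-! ### The sample sizes are polynomial -/

section Poly

variable {d H W : ℕ} {c₀ c₁ c₂ e ε δ : ℝ}

theorem logb_two_le {y : ℝ} (hy : 1 ≤ y) : logb 2 y ≤ 2 * y := by
  have h1 := Real.log_two_gt_d9
  rw [logb, div_le_iff₀ (by linarith)]
  have h2 := Real.log_le_self (by linarith : 0 ≤ y)
  nlinarith

theorem three_mul_pow_le (hW : (3000 : ℝ) ≤ W) {a b : ℕ} (h : a < b) :
    3 * (W : ℝ) ^ a ≤ (W : ℝ) ^ b := by
  calc 3 * (W : ℝ) ^ a ≤ W * (W : ℝ) ^ a := by gcongr; linarith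
    _ = (W : ℝ) ^ (a + 1) := by ring
    _ ≤ (W : ℝ) ^ b := pow_le_pow_right₀ (by linarith) h

theorem numIter_le (hW : (3000 : ℝ) ≤ W) (hd : 1 ≤ d) (hdW : (d : ℝ) ≤ W) (he : 0 < e) (he1 : e ≤ 1)
    (heW : 1 / e ≤ (W : ℝ) ^ 7) : numIter d e ≤ W ^ 18 := by
  have hd' : (1 : ℝ) ≤ d := by exact_mod_cast hd
  have hW1 : (1 : ℝ) ≤ W := by linarith
  have hy1 : 1 ≤ 100 * d / (4 * e) ^ 2 := by
    rw [one_le_div (by positivity)]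
    nlinarith [mul_le_mul he1 he1 he.le (by norm_num)]
  have hy2 : 100 * d / (4 * e) ^ 2 ≤ (W : ℝ) ^ 16 := by
    calc 100 * d / (4 * e) ^ 2 = 100 / 16 * d * (1 / e) ^ 2 := by field_simp; ring
      _ ≤ W * W * ((W : ℝ) ^ 7) ^ 2 := by gcongr; linarith
      _ = (W : ℝ) ^ 16 := by ring
  have h1 : ⌈(d : ℝ) / 2 * logb 2 (100 * d / (4 * e) ^ 2)⌉₊ ≤ W ^ 17 := by
    refine Nat.ceil_le.2 ?_
    push_cast
    calc (d : ℝ) / 2 * logb 2 (100 * d / (4 * e) ^ 2) ≤ W / 2 * (2 * W ^ 16) := by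
          have := Real.logb_nonneg (by norm_num : (1 : ℝ) < 2) hy1
          have h3 := logb_two_le hy1
          gcongr
          linarith
      _ = (W : ℝ) ^ 17 := by ring
  have h2 : d ≤ W := by exact_mod_cast hdW
  have h3 : 2 ≤ W := by exact_mod_cast (by linarith : (2 : ℝ) ≤ W)
  calc numIter d e ≤ W ^ 1 + W ^ 17 := by rw [pow_one]; exact Nat.add_le_add h2 h1
    _ ≤ W ^ 18 := pow_add_pow_le h3

theorem log_inv_conf_le (hW : (3000 : ℝ) ≤ W) (hd : 1 ≤ d) (hdW : (d : ℝ) ≤ W) (hH : 1 ≤ H)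
    (hHW : (H : ℝ) ≤ W) (he : 0 < e) (he1 : e ≤ 1) (heW : 1 / e ≤ (W : ℝ) ^ 7) (hδ : 0 < δ)
    (hδW : log (1 / δ) ≤ (W : ℝ) ^ 2) : log (1 / conf d H e δ) ≤ (W : ℝ) ^ 23 := by
  have hN2 := two_le_numIter hd he he1
  have hN : 0 < numIter d e := by omega
  have hNW : (numIter d e : ℝ) ≤ (W : ℝ) ^ 18 := by exact_mod_cast numIter_le hW hd hdW he he1 heW
  have e1 : 1 / conf d H e δ = 8 * H * d ^ 2 * numIter d e * (1 / δ) := by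
    unfold conf; field_simp
  rw [e1, Real.log_mul (by positivity) (by positivity)]
  have h1 : log (8 * H * d ^ 2 * numIter d e) ≤ (W : ℝ) ^ 22 := by
    refine (Real.log_le_self (by positivity)).trans ?_
    calc 8 * (H : ℝ) * d ^ 2 * numIter d e ≤ W * W * W ^ 2 * W ^ 18 := by gcongr; linarith
      _ = (W : ℝ) ^ 22 := by ring
  have h2 := three_mul_pow_le hW (show 22 < 23 by norm_num)
  have h3 : (W : ℝ) ^ 2 ≤ W ^ 22 := pow_le_pow_right₀ (by linarith) (by norm_num)
  have : 0 ≤ (W : ℝ) ^ 22 := by positivity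
  linarith

theorem log_div_le {η R y : ℝ} (hη : 0 < η) (hR : log (1 / η) ≤ R) (hy : 1 ≤ y) :
    log (y / η) ≤ y + R := by
  rw [← mul_one_div, Real.log_mul (by positivity) (by positivity)]
  exact add_le_add (Real.log_le_self (by linarith)) hR

theorem log_div_nonneg {η y : ℝ} (hη : 0 < η) (hη1 : η ≤ 1 / 64) (hy : 1 ≤ y) :
    0 ≤ log (y / η) :=
  Real.log_nonneg (by rw [one_le_div hη]; linarith)

theorem reject_size_le {η : ℝ} {m B : ℕ} (hW : (3000 : ℝ) ≤ W) (hd : 1 ≤ d) (hdW : (d : ℝ) ≤ W)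
    (hHW : (H : ℝ) ≤ W) (he : 0 < e) (heW : 1 / e ≤ (W : ℝ) ^ 7) (hη : 0 < η) (hη1 : η ≤ 1 / 64)
    (hlogη : log (1 / η) ≤ (W : ℝ) ^ 23) (hS1 : (1 : ℝ) ≤ m) (hSle' : (m : ℝ) ≤ (W : ℝ) ^ 27)
    (hBle' : (B : ℝ) ≤ (W : ℝ) ^ 27) :
    ⌈8 * H * d * log ((m + (m : ℝ) ^ 2 * B) / η) / e⌉₊ ≤ W ^ 93 := by
  have hW1 : (1 : ℝ) ≤ W := by linarith
  have hd' : (1 : ℝ) ≤ d := by exact_mod_cast hd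
  have hmono' : ∀ {a b : ℕ}, a ≤ b → (W : ℝ) ^ a ≤ (W : ℝ) ^ b := fun h => pow_le_pow_right₀ hW1 h
  refine Nat.ceil_le.2 ?_
  push_cast
  have h1 : 1 ≤ (m : ℝ) + (m : ℝ) ^ 2 * B := by
    have : 0 ≤ (m : ℝ) ^ 2 * B := by positivity
    linarith
  have h2 : log ((m + (m : ℝ) ^ 2 * B) / η) ≤ (W : ℝ) ^ 82 := by
    refine (log_div_le hη hlogη h1).trans ?_
    have h3 : (m : ℝ) ^ 2 * B ≤ W ^ 81 := by
      calc (m : ℝ) ^ 2 * B ≤ ((W : ℝ) ^ 27) ^ 2 * W ^ 27 := by gcongr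
        _ = (W : ℝ) ^ 81 := by ring
    have h4 : (W : ℝ) ^ 27 ≤ W ^ 81 := hmono' (by norm_num)
    have h5 : (W : ℝ) ^ 23 ≤ W ^ 81 := hmono' (by norm_num)
    have h6 := three_mul_pow_le hW (show 81 < 82 by norm_num)
    linarith
  have h7 := log_div_nonneg hη hη1 h1
  calc 8 * H * d * log ((m + (m : ℝ) ^ 2 * B) / η) / e
      = 8 * H * d * log ((m + (m : ℝ) ^ 2 * B) / η) * (1 / e) := by
        field_simp
    _ ≤ W * W * W * W ^ 82 * W ^ 7 := by gcongr; linarith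
    _ = (W : ℝ) ^ 92 := by ring
    _ ≤ W ^ 93 := hmono' (by norm_num)

theorem span_size_le {m : ℕ} (hW : (3000 : ℝ) ≤ W) (hd : 1 ≤ d) (hdW : (d : ℝ) ≤ W)
    (hHW : (H : ℝ) ≤ W) (he : 0 < e) (heW : 1 / e ≤ (W : ℝ) ^ 7) (hSle' : (m : ℝ) ≤ (W : ℝ) ^ 27) :
    ⌈16 * H * d * √(log (4 * d) * m) / e
      + 32 * H * d * log (4 * d) / e + 8 * H * d * m / e⌉₊ ≤ W ^ 41 := by
  have hW1 : (1 : ℝ) ≤ W := by linarith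
  have hd' : (1 : ℝ) ≤ d := by exact_mod_cast hd
  have hmono' : ∀ {a b : ℕ}, a ≤ b → (W : ℝ) ^ a ≤ (W : ℝ) ^ b := fun h => pow_le_pow_right₀ hW1 h
  have hl4d : log (4 * d) ≤ (W : ℝ) ^ 2 := by
    refine (Real.log_le_self (by positivity)).trans ?_
    calc 4 * (d : ℝ) ≤ W * W := by gcongr; linarith
      _ = (W : ℝ) ^ 2 := by ring
  have hl4d0 : 0 ≤ log (4 * d) := Real.log_nonneg (by linarith)
  refine Nat.ceil_le.2 ?_
  push_cast
  have h1 : √(log (4 * d) * m) ≤ (W : ℝ) ^ 30 := by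
    refine Real.sqrt_le_iff.2 ⟨by positivity, ?_⟩
    calc log (4 * d) * m ≤ W ^ 2 * W ^ 27 := by gcongr
      _ = (W : ℝ) ^ 29 := by ring
      _ ≤ (W : ℝ) ^ 60 := hmono' (by norm_num)
      _ = _ := by ring
  have t1 : 16 * H * d * √(log (4 * d) * m) / e ≤ (W : ℝ) ^ 40 := by
    calc 16 * H * d * √(log (4 * d) * m) / e
        = 16 * H * d * √(log (4 * d) * m) * (1 / e) := by field_simp
      _ ≤ W * W * W * W ^ 30 * W ^ 7 := by gcongr; linarith
      _ = (W : ℝ) ^ 40 := by ring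
  have t2 : 32 * H * d * log (4 * d) / e ≤ (W : ℝ) ^ 40 := by
    calc 32 * H * d * log (4 * d) / e = 32 * H * d * log (4 * d) * (1 / e) := by field_simp
      _ ≤ W * W * W * W ^ 2 * W ^ 7 := by gcongr; linarith
      _ = (W : ℝ) ^ 12 := by ring
      _ ≤ (W : ℝ) ^ 40 := hmono' (by norm_num)
  have t3 : 8 * H * d * m / e ≤ (W : ℝ) ^ 40 := by
    calc 8 * H * d * m / e = 8 * H * d * m * (1 / e) := by field_simp
      _ ≤ W * W * W * W ^ 27 * W ^ 7 := by gcongr; linarith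
      _ = (W : ℝ) ^ 37 := by ring
      _ ≤ (W : ℝ) ^ 40 := hmono' (by norm_num)
  have := three_mul_pow_le hW (show 40 < 41 by norm_num)
  linarith

theorem cover_blocks_le {η : ℝ} (hW : (3000 : ℝ) ≤ W) (hd : 1 ≤ d) (hdW : (d : ℝ) ≤ W) (hH : 1 ≤ H)
    (hHW : (H : ℝ) ≤ W) (hη : 0 < η) (hη1 : η ≤ 1 / 64)
    (hlogη : log (1 / η) ≤ (W : ℝ) ^ 23) :
    ⌈logb 2 ((H : ℝ) ^ 2 * d / η)⌉₊ ≤ W ^ 25 := by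
  have hW1 : (1 : ℝ) ≤ W := by linarith
  have hd' : (1 : ℝ) ≤ d := by exact_mod_cast hd
  have hmono' : ∀ {a b : ℕ}, a ≤ b → (W : ℝ) ^ a ≤ (W : ℝ) ^ b := fun h => pow_le_pow_right₀ hW1 h
  have hH' : (1 : ℝ) ≤ H := by exact_mod_cast hH
  refine Nat.ceil_le.2 ?_
  push_cast
  have h2 : 1 ≤ (H : ℝ) ^ 2 * d := one_le_mul_of_one_le_of_one_le (one_le_pow₀ hH') hd'
  have h3 : (H : ℝ) ^ 2 * d ≤ W ^ 23 := by
    calc (H : ℝ) ^ 2 * d ≤ W ^ 2 * W := by gcongr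
      _ = (W : ℝ) ^ 3 := by ring
      _ ≤ W ^ 23 := hmono' (by norm_num)
  have h4 := log_div_le hη hlogη h2
  have h5 := log_div_nonneg hη hη1 h2
  have h6 := Real.log_two_gt_d9
  have h7 := three_mul_pow_le hW (show 23 < 24 by norm_num)
  have h8 := three_mul_pow_le hW (show 24 < 25 by norm_num)
  rw [logb, div_le_iff₀ (by linarith)]
  have h9 := mul_le_mul_of_nonneg_left h6.le (by positivity : 0 ≤ (W : ℝ) ^ 25)
  have h10 : 0 ≤ (W : ℝ) ^ 24 := by positivity
  linarith

/-- All sample sizes are at most a power of a number `W` that bounds the basic quantities. -/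
theorem sizes_atMost (hW : (3000 : ℝ) ≤ W) (hc₁ : 1 ≤ c₁) (hc₁W : c₁ ≤ W) (hd : 1 ≤ d)
    (hdW : (d : ℝ) ≤ W) (hH : 1 ≤ H) (hHW : (H : ℝ) ≤ W) (he : 0 < e) (he1 : e ≤ 1)
    (heW : 1 / e ≤ (W : ℝ) ^ 7) (hδ : 0 < δ) (hδ4 : δ ≤ 1 / 4)
    (hδW : log (1 / δ) ≤ (W : ℝ) ^ 2) {n : ℕ} (hn : n ≤ W ^ 97) :
    (sizes c₁ d H e δ).AtMost d H (max (sizes c₁ d H e δ).nCover n) (W ^ 97) := by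
  have hW1 : (1 : ℝ) ≤ W := by linarith
  have hWN : 3000 ≤ W := by exact_mod_cast hW
  have hd' : (1 : ℝ) ≤ d := by exact_mod_cast hd
  have hH' : (1 : ℝ) ≤ H := by exact_mod_cast hH
  have hmono : ∀ {m k : ℕ}, k ≤ 97 → m ≤ W ^ k → m ≤ W ^ 97 := fun hk hm =>
    hm.trans (Nat.pow_le_pow_right (by omega) hk)
  have hmono' : ∀ {a b : ℕ}, a ≤ b → (W : ℝ) ^ a ≤ (W : ℝ) ^ b := fun h => pow_le_pow_right₀ hW1 h
  have hη := conf_pos hd hH he he1 hδ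
  have hη1 := conf_mul_le hd hH he he1 hδ hδ4
  have hlogη := log_inv_conf_le hW hd hdW hH hHW he he1 heW hδ hδW
  have hNle := numIter_le hW hd hdW he he1 heW
  obtain ⟨hN, hS, hB, hJ, hT, hV, hP, hC, -⟩ := sizes_spec c₁ d H e δ
  generalize sizes c₁ d H e δ = s at *
  generalize conf d H e δ = η at *
  have hηle : η ≤ 1 / 64 := by
    have : η ≤ d * η := le_mul_of_one_le_left hη.le hd'
    linarith
  have hlog : ∀ {y : ℝ}, 1 ≤ y → log (y / η) ≤ y + (W : ℝ) ^ 23 := log_div_le hη hlogη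
  have hlog0 : ∀ {y : ℝ}, 1 ≤ y → 0 ≤ log (y / η) := log_div_nonneg hη hηle
  have hlog4 : log (4 / η) ≤ (W : ℝ) ^ 24 := by
    have h1 := hlog (by norm_num : (1 : ℝ) ≤ 4)
    have h2 := three_mul_pow_le hW (show 23 < 24 by norm_num)
    have h3 : (W : ℝ) ≤ W ^ 23 := le_self_pow₀ hW1 (by norm_num)
    linarith
  have hlog256 : log (256 * d / η) ≤ (W : ℝ) ^ 24 := by
    have h1 := hlog (by linarith : (1 : ℝ) ≤ 256 * d)
    have h2 := three_mul_pow_le hW (show 23 < 24 by norm_num)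
    have h3 : 256 * (d : ℝ) ≤ W * W := by gcongr; linarith
    have h4 : (W : ℝ) ^ 2 ≤ W ^ 23 := hmono' (by norm_num)
    have h5 : 0 ≤ (W : ℝ) ^ 23 := by positivity
    rw [← sq] at h3; linarith
  have l4 := hlog0 (by norm_num : (1 : ℝ) ≤ 4)
  have l256 := hlog0 (by linarith : (1 : ℝ) ≤ 256 * d)
  have l1 := hlog0 (le_refl (1 : ℝ))
  have hSle : s.nSamp ≤ W ^ 27 := by
    rw [hS]
    refine Nat.ceil_le.2 ?_
    push_cast
    calc 512 * (d : ℝ) ^ 2 * log (256 * d / η) ≤ W * W ^ 2 * W ^ 24 := by gcongr; linarith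
      _ = (W : ℝ) ^ 27 := by ring
  have hBle : s.mBoost ≤ W ^ 27 := by
    rw [hB]
    refine Nat.ceil_le.2 ?_
    push_cast
    calc 2048 * (d : ℝ) ^ 2 * log (4 / η) ≤ W * W ^ 2 * W ^ 24 := by gcongr; linarith
      _ = (W : ℝ) ^ 27 := by ring
  have hSle' : (s.nSamp : ℝ) ≤ (W : ℝ) ^ 27 := by exact_mod_cast hSle
  have hBle' : (s.mBoost : ℝ) ≤ (W : ℝ) ^ 27 := by exact_mod_cast hBle
  have hS1 : (1 : ℝ) ≤ s.nSamp := by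
    have : 0 < s.nSamp := by
      rw [hS]
      refine Nat.ceil_pos.2 ?_
      have : 0 < log (256 * d / η) := Real.log_pos (by rw [one_lt_div hη]; linarith)
      positivity
    exact_mod_cast this
  have hTle : s.nTest ≤ W ^ 43 := by
    rw [hT]
    refine Nat.ceil_le.2 ?_
    push_cast
    calc 128 * (H : ℝ) ^ 2 * (d : ℝ) ^ 2 * log (4 / η) / e ^ 2
        = 128 * (H : ℝ) ^ 2 * (d : ℝ) ^ 2 * log (4 / η) * (1 / e) ^ 2 := by field_simp
      _ ≤ W * W ^ 2 * W ^ 2 * W ^ 24 * ((W : ℝ) ^ 7) ^ 2 := by gcongr; linarith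
      _ = (W : ℝ) ^ 43 := by ring
  have hVle : s.nVec ≤ W ^ 44 := by
    rw [hV]
    refine Nat.ceil_le.2 ?_
    push_cast
    calc c₁ * (H : ℝ) ^ 4 * (d : ℝ) ^ 2 / e ^ 2 * log (1 / η)
        = c₁ * (H : ℝ) ^ 4 * (d : ℝ) ^ 2 * (1 / e) ^ 2 * log (1 / η) := by field_simp
      _ ≤ W * W ^ 4 * W ^ 2 * ((W : ℝ) ^ 7) ^ 2 * W ^ 23 := by gcongr
      _ = (W : ℝ) ^ 44 := by ring
  have hJle : s.nReject ≤ W ^ 93 := hJ ▸ reject_size_le hW hd hdW hHW he heW hη hηle hlogη hS1 hSle' hBle'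
  have hPle : s.nSpan ≤ W ^ 41 := hP ▸ span_size_le hW hd hdW hHW he heW hSle'
  have hCle : s.nCover ≤ W ^ 97 := by
    rw [hC]
    have h1 := cover_blocks_le hW hd hdW hH hHW hη hηle hlogη
    calc _ ≤ W ^ 25 * W ^ 41 := Nat.mul_le_mul h1 hPle
      _ = W ^ 66 := by ring
      _ ≤ W ^ 97 := Nat.pow_le_pow_right (by omega) (by norm_num)
  have hdN : d ≤ W := by exact_mod_cast hdW
  have hHN : H ≤ W := by exact_mod_cast hHW
  have hW2 : W + 1 ≤ W ^ 2 := by rw [sq]; exact (by omega : W + 1 ≤ 2 * W).trans (Nat.mul_le_mul_right _ (by omega))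
  exact
    { large := hmono (k := 2) (by norm_num) (by omega)
      dim := hmono (k := 2) (by norm_num) (by omega)
      horizon := hmono (k := 2) (by norm_num) (by omega)
      nIter := hmono (by norm_num) (hN ▸ hNle)
      nVec := hmono (by norm_num) hVle
      nTest := hmono (by norm_num) hTle
      nSamp := hmono (by norm_num) hSle
      mBoost := hmono (by norm_num) hBle
      nReject := hmono (by norm_num) hJle
      nCover := hCle
      data := max_le hCle hn }

/-- The worst-case cost of the procedure is polynomial. -/
theorem procedure_cost_le {X : Type u} {A : Type v} {Ξ : Type w} [MeasurableSpace X]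
    [MeasurableSpace Ξ] (M : MDP X A Ξ) (φ : ℕ → X → A → Vec d) (amax : ℕ → X → Vec d → A)
    {C : ℕ} (hC : 3000 ≤ C) (hc₀ : 1 ≤ c₀) (hc₀C : c₀ ≤ C) (hc₁ : 1 ≤ c₁) (hc₁C : c₁ ≤ C)
    (hc₂ : 1 ≤ c₂) (hc₂C : c₂ ≤ C) (hd : 1 ≤ d) (hH : 1 ≤ H) (hε : 0 < ε) (hε1 : ε < 1) (hδ : 0 < δ)
    (hδ1 : δ < 1) (ω : ℕ → Episode X Ξ) :
    ((((procedure c₀ c₁ c₂ H ε δ : Prog X A d _).run M φ amax ω).2.total : ℕ) : ℝ) ≤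
      (((C + 1 : ℕ) : ℝ) * (d * H * (1 / ε) * (1 + log (1 / δ)))) ^ (97 * 18) := by
  have hd' : (1 : ℝ) ≤ d := by exact_mod_cast hd
  have hH' : (1 : ℝ) ≤ H := by exact_mod_cast hH
  have hε' : 1 ≤ 1 / ε := by rw [one_le_div hε]; exact hε1.le
  have hlδ : 0 ≤ log (1 / δ) := Real.log_nonneg (by rw [one_le_div hδ]; exact hδ1.le)
  set Z : ℝ := d * H * (1 / ε) * (1 + log (1 / δ)) with hZ
  have hdH : 1 ≤ (d : ℝ) * H := one_le_mul_of_one_le_of_one_le hd' hH'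
  have hdHe : 1 ≤ (d : ℝ) * H * (1 / ε) := one_le_mul_of_one_le_of_one_le hdH hε'
  have hZ1 : (d : ℝ) * H * (1 / ε) ≤ Z := le_mul_of_one_le_right (by linarith) (by linarith)
  have hZ2 : 1 + log (1 / δ) ≤ Z := le_mul_of_one_le_left (by linarith) hdHe
  have hZ3 : (d : ℝ) * H ≤ Z := (le_mul_of_one_le_right (by linarith) hε').trans hZ1
  have hZd : (d : ℝ) ≤ Z := (le_mul_of_one_le_right (by linarith) hH').trans hZ3
  have hZH : (H : ℝ) ≤ Z := (le_mul_of_one_le_left (by linarith) hd').trans hZ3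
  have hZε : 1 / ε ≤ Z := (le_mul_of_one_le_left (by linarith) hdH).trans hZ1
  have hZp : 1 ≤ Z := hdHe.trans hZ1
  have hL : logFactor d H ε δ ≤ 2 * Z := by
    refine max_le (by linarith) ?_
    have e1 : (d : ℝ) * H / (δ * ε) = d * H * (1 / ε) * (1 / δ) := by field_simp
    rw [e1, Real.log_mul (by positivity) (by positivity)]
    have := Real.log_le_self (by linarith : 0 ≤ (d : ℝ) * H * (1 / ε))
    linarith
  -- the natural number that bounds all basic quantities
  set W : ℕ := ⌈(C : ℝ) * Z⌉₊ with hW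
  have hC' : (3000 : ℝ) ≤ C := by exact_mod_cast hC
  have hWge : (C : ℝ) * Z ≤ W := Nat.le_ceil _
  have hWle : (W : ℝ) ≤ ((C + 1 : ℕ) : ℝ) * Z := by
    have := (Nat.ceil_lt_add_one (by positivity : 0 ≤ (C : ℝ) * Z)).le
    push_cast
    linarith
  have hZW : 3000 * Z ≤ W := (mul_le_mul_of_nonneg_right hC' (by linarith)).trans hWge
  have hCW : (C : ℝ) ≤ W := (le_mul_of_one_le_right (by positivity) hZp).trans hWge
  have hW3 : (3000 : ℝ) ≤ W := hC'.trans hCW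
  have he0 := exploreEps_pos (δ := δ) hc₀ hd hH hε
  have he1 := exploreEps_le_one (δ := δ) hc₀ hd hH hε1
  have hL1 := one_le_logFactor d H ε δ
  have hdW : (d : ℝ) ≤ W := by linarith
  have hHW : (H : ℝ) ≤ W := by linarith
  have hεW : 1 / ε ≤ (W : ℝ) := by linarith
  have hLW : logFactor d H ε δ ≤ W := by linarith
  have hc₀W := hc₀C.trans hCW
  have hc₂W := hc₂C.trans hCW
  have heW : 1 / exploreEps c₀ d H ε δ ≤ (W : ℝ) ^ 7 := by
    calc 1 / exploreEps c₀ d H ε δ = c₀ * d ^ 2 * H ^ 2 * logFactor d H ε δ * (1 / ε) := by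
          unfold exploreEps; field_simp
      _ ≤ W * (W : ℝ) ^ 2 * W ^ 2 * W * W := by gcongr
      _ = (W : ℝ) ^ 7 := by ring
  have hdata : ⌈c₂ * ((d : ℝ) ^ 4 * (H : ℝ) ^ 2 * logFactor d H ε δ ^ 2 / ε ^ 2)⌉₊ ≤ W ^ 97 := by
    refine Nat.ceil_le.2 ?_
    push_cast
    calc c₂ * ((d : ℝ) ^ 4 * (H : ℝ) ^ 2 * logFactor d H ε δ ^ 2 / ε ^ 2)
        = c₂ * d ^ 4 * H ^ 2 * logFactor d H ε δ ^ 2 * (1 / ε) ^ 2 := by field_simp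
      _ ≤ W * (W : ℝ) ^ 4 * W ^ 2 * W ^ 2 * W ^ 2 := by gcongr
      _ = (W : ℝ) ^ 11 := by ring
      _ ≤ (W : ℝ) ^ 97 := pow_le_pow_right₀ (by linarith) (by norm_num)
  have hδW : log (1 / (δ / 4)) ≤ (W : ℝ) ^ 2 := by
    have e1 : 1 / (δ / 4) = 4 * (1 / δ) := by field_simp
    rw [e1, Real.log_mul (by norm_num) (by positivity)]
    have := Real.log_le_self (by norm_num : (0 : ℝ) ≤ 4)
    have hWW := mul_le_mul_of_nonneg_right hW3 (by linarith : (0 : ℝ) ≤ W)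
    rw [sq]; linarith
  have hs := sizes_atMost hW3 hc₁ (hc₁C.trans hCW) hd hdW hH hHW he0 he1 heW (by positivity)
    (by linarith) hδW hdata
  have hb := (bounded_procedure (X := X) (A := A) hH hs).total_run_le M φ amax ω
  calc _ ≤ (((W ^ 97) ^ 18 : ℕ) : ℝ) := by exact_mod_cast hb
    _ = (W : ℝ) ^ (97 * 18) := by push_cast; rw [← pow_mul]
    _ ≤ _ := by gcongr

end Poly

end LBC

end

theorem mainTheorem1 :
    ∃ C : ℝ, 0 < C ∧ ∀ c₀ c₁ c₂ : ℝ, C ≤ c₀ → C ≤ c₁ → C ≤ c₂ → ∃ K : ℕ,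
      ∀ (X : Type u) (A : Type v) (Ξ : Type w)
        [MeasurableSpace X] [MeasurableSpace A] [MeasurableSpace Ξ]
        (M : LBC.MDP X A Ξ) (d H : ℕ) (φ : ℕ → X → A → LBC.Vec d)
        (amax : ℕ → X → LBC.Vec d → A) (ε δ : ℝ),
        1 ≤ d → 1 ≤ H → 0 < ε → ε < 1 → 0 < δ → δ < 1 →
        M.IsMeasurable φ amax H →
        LBC.IsArgmaxOracle φ amax H →
        M.LinearBellmanComplete φ H →
        (∀ h < H, ∀ x a, ‖φ h x a‖ ≤ 1) →
        (∀ h < H, ∀ x a ξ, M.reward h x a ξ ∈ Set.Icc (0 : ℝ) 1) →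
        M.LinearReward φ H →
        M.law {ω | ¬ ∃ θ : LBC.Param d,
            ((LBC.procedure c₀ c₁ c₂ H ε δ).run M φ amax ω).1 = some θ ∧
            MeasureTheory.Integrable
              (fun x => M.optValue H x - M.value H (LBC.greedy amax θ) x) M.start ∧
            ∫ x, (M.optValue H x - M.value H (LBC.greedy amax θ) x) ∂M.start ≤ ε}
          ≤ ENNReal.ofReal δ ∧
        ∀ ω : ℕ → LBC.Episode X Ξ, ∀ c : LBC.Cost,
          c = ((LBC.procedure c₀ c₁ c₂ H ε δ).run M φ amax ω).2 →
          ((c.episodes + c.oracleCalls + c.steps : ℕ) : ℝ)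
            ≤ K * (d * H * (1 / ε) * (1 + Real.log (1 / δ))) ^ K := by
  refine ⟨1000000, by norm_num, fun c₀ c₁ c₂ hc₀ hc₁ hc₂ => ?_⟩
  obtain ⟨C, hC⟩ := exists_nat_ge (max c₀ (max c₁ c₂))
  have hC₀ : c₀ ≤ C := (le_max_left _ _).trans hC
  have hC₁ : c₁ ≤ C := ((le_max_left _ _).trans (le_max_right _ _)).trans hC
  have hC₂ : c₂ ≤ C := ((le_max_right _ _).trans (le_max_right _ _)).trans hC
  have hC3 : 3000 ≤ C := by
    have : (1000000 : ℝ) ≤ C := hc₀.trans hC₀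
    exact_mod_cast (by linarith : (3000 : ℝ) ≤ C)
  refine ⟨(C + 1) ^ (97 * 18) + 97 * 18, ?_⟩
  intro X A Ξ _ _ _ M d H φ amax ε δ hd hH hε hε1 hδ hδ1 hmeas horacle hcomplete hφ hr hlin
  let E : LBC.Setting X A Ξ d := ⟨M, φ, amax, H, hd, hH, hmeas, horacle, hcomplete, hφ, hr, hlin⟩
  refine ⟨E.law_not_nearOptimal_le hc₀ hc₁ hc₂ hε hε1 hδ hδ1, ?_⟩
  rintro ω c rfl
  have hcost := LBC.procedure_cost_le M φ amax hC3 (by linarith) hC₀ (by linarith) hC₁ (by linarith)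
    hC₂ hd hH hε hε1 hδ hδ1 ω
  refine hcost.trans ?_
  set Z : ℝ := d * H * (1 / ε) * (1 + Real.log (1 / δ)) with hZ
  have hZ1 : 1 ≤ Z := by
    have hd' : (1 : ℝ) ≤ d := by exact_mod_cast hd
    have hH' : (1 : ℝ) ≤ H := by exact_mod_cast hH
    have hε' : 1 ≤ 1 / ε := by rw [one_le_div hε]; exact hε1.le
    have hlδ : 0 ≤ Real.log (1 / δ) := Real.log_nonneg (by rw [one_le_div hδ]; exact hδ1.le)
    exact one_le_mul_of_one_le_of_one_le (one_le_mul_of_one_le_of_one_le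
      (one_le_mul_of_one_le_of_one_le hd' hH') hε') (by linarith)
  generalize 97 * 18 = k
  rw [mul_pow]
  gcongr
  · push_cast
    linarith [(Nat.cast_nonneg k : (0 : ℝ) ≤ k)]
  · exact Nat.le_add_left _ _
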